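/- **Proposition 4.1.** Let $n\ge 3$ be odd, let $(N,g)$ be a smooth Riemannian manifold of (even) dimension $n+1$, with curvature tensor $Rm$, Ricci tensor $R_{ij}$, scalar curvature $S$ and Schouten tensor $P_{ij}=\frac1{n-1}\bigl(R_{ij}-\frac{S}{2n}g_{ij}\bigr)$. Near each point of $N$ there is a smooth one-parameter family of metrics $g_x$, $0\le x<\varepsilon$, with $g_0=g$, such that $g^+=x^{-2}(dx^2+g_x)$ satisfies $$E:=\mathrm{Ric}_{g^+}+(n+1)g^+=O(x^{n-1})\quad (x\to0),$$ and the ambient obstruction tensor of $g$, $$\mathcal O=c_n\,\mathrm{tf}_g\bigl(x^{1-n}E|_{TN}\bigr)\big|_{x=0},\qquad c_n=\frac{2^{n-1}\bigl(\bigl(\frac{n+1}2-1\bigr)!\bigr)^2}{n-1},$$ where $\mathrm{tf}_g$ is the trace-free part with respect to $g$, does not depend on the choice of $g_x$. It has the form $$\mathcal O_{ij}=\Delta^{\frac{n+1}2-2}\bigl(P_{ij,k}{}^k-P_k{}^k{}_{,ij}\bigr)+\mathcal Q(Rm)_{ij},\qquad \Delta=\nabla^k\nabla_k,$$ $$\mathcal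 Q(Rm)=\sum_{l=2}^{\frac{n+1}2}\ \sum_{i_1+\cdots+i_l=n+1-2l}\nabla^{i_1}Rm*\nabla^{i_2}Rm*\cdots*\nabla^{i_l}Rm .$$ Here $\nabla^{i_1}Rm*\cdots*\nabla^{i_l}Rm$ stands for a finite linear combination of tensors with two free indices $i,j$, each obtained from $\nabla^{i_1}Rm\otimes\cdots\otimes\nabla^{i_l}Rm$ by contracting pairs of indices with $g^{-1}$ until the two free indices $i,j$ remain, or by contracting all indices and multiplying with $g_{ij}$; the contractions and their coefficients depend only on $n$, not on $N$, $g$ or the point. In particular every $i_k$ that occurs satisfies $i_k\le n-3$, that is, $\mathcal Q(Rm)$ involves at most $n-3$ derivatives of curvature. -/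

import Mathlib

open Set Filter Topology Asymptotics Bundle Manifold
open scoped ContDiff

namespace AmbientObstruction

noncomputable section

/-! ### Tensor calculus in local coordinates -/

/-- The coordinate space `ℝ^m`. -/
abbrev Coords (m : ℕ) : Type := EuclideanSpace ℝ (Fin m)

/-- The components `g_{ij}` of a (Riemannian) metric in local coordinates. -/
abbrev CoordMetric (m : ℕ) : Type := Coords m → Matrix (Fin m) (Fin m) ℝ

/-- The components `T_{i_1 … i_r}` of a covariant tensor field of rank `r` in local coordinates. -/
abbrev CoordTensor (m r : ℕ) : Type := Coords m → (Fin r → Fin m) → ℝ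

/-- The partial derivative `∂_i f` at `y`. -/
def partialD {m : ℕ} (i : Fin m) (f : Coords m → ℝ) (y : Coords m) : ℝ :=
  fderiv ℝ f y (EuclideanSpace.single i 1)

/-- The Christoffel symbol `Γ^k_{ij}`. The matrix `(G y)⁻¹` is `(g^{ij})`. -/
def christoffel {m : ℕ} (G : CoordMetric m) (k i j : Fin m) (y : Coords m) : ℝ :=
  1 / 2 * ∑ l, (G y)⁻¹ k l *
    (partialD i (fun z => G z j l) y + partialD j (fun z => G z i l) y
      - partialD l (fun z => G z i j) y)

/-- The curvature tensor `R_{ijk}^l`, with `R(∂_i, ∂_j) ∂_k = R_{ijk}^l ∂_l`. -/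
def riemannUp {m : ℕ} (G : CoordMetric m) (i j k l : Fin m) (y : Coords m) : ℝ :=
  partialD i (christoffel G l j k) y - partialD j (christoffel G l i k) y
    + ∑ s, (christoffel G l i s y * christoffel G s j k y
      - christoffel G l j s y * christoffel G s i k y)

/-- The curvature tensor `Rm = (R_{ijkl})`, all indices lowered. -/
def riemann {m : ℕ} (G : CoordMetric m) : CoordTensor m 4 :=
  fun y I => ∑ s, G y (I 3) s * riemannUp G (I 0) (I 1) (I 2) s y

/-- The Ricci tensor `R_{jk} = R_{ijk}^i` (positive on round spheres). -/
def ricci {m : ℕ} (G : CoordMetric m) (y : Coords m) : Matrix (Fin m) (Fin m) ℝ :=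
  Matrix.of fun j k => ∑ i, riemannUp G i j k i y

/-- The scalar curvature `S = g^{ij} R_{ij}`. -/
def scalarCurv {m : ℕ} (G : CoordMetric m) (y : Coords m) : ℝ :=
  ∑ i, ∑ j, (G y)⁻¹ i j * ricci G y i j

/-- The covariant derivative `T_{i_1 … i_r, k}`; the index of differentiation is the last one. -/
def covDeriv {m r : ℕ} (G : CoordMetric m) (T : CoordTensor m r) : CoordTensor m (r + 1) :=
  fun y J =>
    partialD (J (Fin.last r)) (fun z => T z (Fin.init J)) y
      - ∑ t : Fin r, ∑ s : Fin m,
          christoffel G s (J (Fin.last r)) (Fin.init J t) y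
            * T y (Function.update (Fin.init J) t s)

/-- The iterated covariant derivative `∇^k T`. -/
def iterCovDeriv {m r : ℕ} (G : CoordMetric m) (T : CoordTensor m r) :
    (k : ℕ) → CoordTensor m (r + k)
  | 0 => T
  | k + 1 => covDeriv G (iterCovDeriv G T k)

/-- The Laplacian `Δ T = g^{kl} T_{… , kl}` on covariant tensor fields. -/
def tensorLaplacian {m r : ℕ} (G : CoordMetric m) (T : CoordTensor m r) : CoordTensor m r :=
  fun y I => ∑ k, ∑ l, (G y)⁻¹ k l *
    covDeriv G (covDeriv G T) y
      (Fin.snoc (α := fun _ => Fin m) (Fin.snoc (α := fun _ => Fin m) I k) l)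

/-- The Schouten tensor `P_{ij} = 1/(n-1) (R_{ij} - S/(2n) g_{ij})` in dimension `n + 1`. -/
def schouten (n : ℕ) (G : CoordMetric (n + 1)) : CoordTensor (n + 1) 2 :=
  fun y I => 1 / ((n : ℝ) - 1) *
    (ricci G y (I 0) (I 1) - scalarCurv G y / (2 * (n : ℝ)) * G y (I 0) (I 1))

/-- The tensor `P_{ij,k}^k - P_k^k_{,ij}`. -/
def principalTensor (n : ℕ) (G : CoordMetric (n + 1)) : CoordTensor (n + 1) 2 :=
  fun y I =>
    (∑ k, ∑ l, (G y)⁻¹ k l * covDeriv G (covDeriv G (schouten n G)) y ![I 0, I 1, k, l])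
      - ∑ k, ∑ l, (G y)⁻¹ k l * covDeriv G (covDeriv G (schouten n G)) y ![k, l, I 0, I 1]

/-! ### The obstruction tensor, through metrics `g⁺ = x⁻² (dx² + g_x)` -/

/-- The point `(x, y)` of `ℝ × ℝ^m`, as a point of `ℝ^{m+1}`. -/
def joinCoords {m : ℕ} (x : ℝ) (y : Coords m) : Coords (m + 1) :=
  WithLp.toLp 2 (Fin.cons x (fun i => y i))

/-- The `ℝ^m`-part `y` of a point `(x, y)` of `ℝ^{m+1}`. -/
def tailCoords {m : ℕ} (z : Coords (m + 1)) : Coords m :=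
  WithLp.toLp 2 (fun i => z i.succ)

/-- The metric `g⁺ = x⁻² (dx² + h_x)` in the coordinates `(x, y)`; `x` has index `0`. -/
def poincareMetric {m : ℕ} (h : ℝ → CoordMetric m) : CoordMetric (m + 1) :=
  fun z => Matrix.of fun a b =>
    (z 0 ^ 2)⁻¹ *
      (Fin.cases (Fin.cases 1 (fun _ => 0) b)
        (fun i => Fin.cases 0 (fun j => h (z 0) (tailCoords z) i j) b) a : ℝ)

/-- The components of `E = Ric(g⁺) + m g⁺`, where `m` is the dimension of the boundary `x = 0`. -/
def einsteinDefect {m : ℕ} (h : ℝ → CoordMetric m) (z : Coords (m + 1)) :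
    Matrix (Fin (m + 1)) (Fin (m + 1)) ℝ :=
  ricci (poincareMetric h) z + (m : ℝ) • poincareMetric h z

/-- `h` is a smooth one-parameter family of metrics `h_x` on `U`, for `0 ≤ x < ε`, with `h_0 = g`,
such that `g⁺ = x⁻² (dx² + h_x)` satisfies `Ric(g⁺) + (n+1) g⁺ = O(x^{n-1})` locally uniformly up
to `x = 0` (in the coordinates `(x, y)`, for all components). -/
structure IsPoincareFamily (n : ℕ) (G : CoordMetric (n + 1)) (U : Set (Coords (n + 1))) (ε : ℝ)
    (h : ℝ → CoordMetric (n + 1)) : Prop where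
  isOpen : IsOpen U
  pos : 0 < ε
  initial : ∀ y ∈ U, h 0 y = G y
  posDef : ∀ x ∈ Ico 0 ε, ∀ y ∈ U, (h x y).PosDef
  smooth : ∀ i j, ContDiffOn ℝ ∞ (fun q : ℝ × Coords (n + 1) => h q.1 q.2 i j) (Ico 0 ε ×ˢ U)
  einstein : ∀ a b, ∀ y ∈ U,
    (fun z => einsteinDefect h z a b)
      =O[𝓝[{z : Coords (n + 1 + 1) | 0 < z 0}] (joinCoords 0 y)] fun z => z 0 ^ (n - 1)

/-- The trace-free part `B_{ij} - (1/m) g^{kl} B_{kl} g_{ij}`. -/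
def traceFree {m : ℕ} (A B : Matrix (Fin m) (Fin m) ℝ) : Matrix (Fin m) (Fin m) ℝ :=
  B - ((1 / (m : ℝ)) * ∑ k, ∑ l, A⁻¹ k l * B k l) • A

/-- The normalizing constant `c_n = 2^{n-1} ((n+1)/2 - 1)!² / (n-1)` in dimension `n + 1`. -/
def obstructionConst (n : ℕ) : ℝ :=
  2 ^ (n - 1) * (Nat.factorial ((n + 1) / 2 - 1) : ℝ) ^ 2 / ((n : ℝ) - 1)

/-- `O` is the matrix of components at `y₀` of the ambient obstruction tensor of the metric `G` of
dimension `n + 1`: for a metric `g⁺ = x⁻² (dx² + h_x)` with `h_0 = G` near `y₀` and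
`E = Ric(g⁺) + (n+1) g⁺ = O(x^{n-1})`,
`O = c_n tf (x^{1-n} E |_{x = 0})`, with `E` restricted to vectors tangent to `x = const`. -/
def IsObstructionTensorAt (n : ℕ) (G : CoordMetric (n + 1)) (y₀ : Coords (n + 1))
    (O : Matrix (Fin (n + 1)) (Fin (n + 1)) ℝ) : Prop :=
  ∃ (U : Set (Coords (n + 1))) (ε : ℝ) (h : ℝ → CoordMetric (n + 1))
    (B : Matrix (Fin (n + 1)) (Fin (n + 1)) ℝ),
    y₀ ∈ U ∧ IsPoincareFamily n G U ε h ∧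
    (∀ i j, Tendsto
      (fun x : ℝ => (x ^ (n - 1))⁻¹ * einsteinDefect h (joinCoords x y₀) i.succ j.succ)
      (𝓝[>] 0) (𝓝 (B i j))) ∧
    O = obstructionConst n • traceFree (G y₀) B

/-! ### Contractions of covariant derivatives of curvature -/

/-- The combinatorial type of a contraction
`∇^{i_1} Rm ∗ ⋯ ∗ ∇^{i_l} Rm` with two free indices, where `2 ≤ l ≤ (n+1)/2` and
`i_1 + ⋯ + i_l = n + 1 - 2 l`. The slots are the indices of the `l` factors and two outer slots
(which carry the free indices); the slots are divided into pairs. Two factor slots that form a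
pair are contracted by `g^{ab}`; a factor slot that is paired with an outer slot carries that free
index; if the two outer slots form a pair, they contribute the factor `g_{ij}`. -/
structure CurvatureContraction (n : ℕ) where
  /-- the number `l` of factors -/
  numFactors : ℕ
  two_le : 2 ≤ numFactors
  le_half : numFactors ≤ (n + 1) / 2
  /-- the numbers `i_1, …, i_l` of derivatives -/
  order : Fin numFactors → ℕ
  sum_order : ∑ j, order j = n + 1 - 2 * numFactors
  /-- the number of pairs of slots -/
  numPairs : ℕ
  /-- the division of all slots into pairs -/
  pairing : Fin numPairs × Fin 2 ≃ (Σ j : Fin numFactors, Fin (4 + order j)) ⊕ Fin 2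

/-- The value of a contraction for the metric `G` at `y`, with free indices `I 0, I 1`. -/
def CurvatureContraction.eval {n : ℕ} (C : CurvatureContraction n) (G : CoordMetric (n + 1)) :
    CoordTensor (n + 1) 2 :=
  fun y I =>
    ∑ a : ((Σ j : Fin C.numFactors, Fin (4 + C.order j)) ⊕ Fin 2) → Fin (n + 1),
      (∏ j, iterCovDeriv G (riemann G) (C.order j) y (fun s => a (Sum.inl ⟨j, s⟩)))
        * (∏ e : Fin 2, G y (I e) (a (Sum.inr e)))
        * ∏ k, (G y)⁻¹ (a (C.pairing (k, 0))) (a (C.pairing (k, 1)))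

/-- A finite linear combination, with constant coefficients, of such contractions. -/
abbrev CurvaturePolynomial (n : ℕ) : Type := List (ℝ × CurvatureContraction n)

/-- The value of a linear combination of contractions. -/
def CurvaturePolynomial.eval {n : ℕ} (Q : CurvaturePolynomial n) (G : CoordMetric (n + 1)) :
    CoordTensor (n + 1) 2 :=
  fun y I => (Q.map fun t => t.1 * t.2.eval G y I).sum

/-! ### Riemannian manifolds -/

/-- The components `g_{ij} = g(∂_i, ∂_j)` of a Riemannian metric in the local coordinates given
by a chart `e`. -/
def metricInChart {m : ℕ} {M : Type*} [TopologicalSpace M]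
    [ChartedSpace (EuclideanSpace ℝ (Fin m)) M] [IsManifold (𝓡 m) ∞ M]
    (g : ContMDiffRiemannianMetric (𝓡 m) ∞ (EuclideanSpace ℝ (Fin m))
      (fun p : M => TangentSpace (𝓡 m) p))
    (e : OpenPartialHomeomorph M (EuclideanSpace ℝ (Fin m))) : CoordMetric m :=
  fun y => Matrix.of fun i j =>
    g.inner (e.symm y)
      (mfderiv (𝓡 m) (𝓡 m) e.symm y (EuclideanSpace.single i (1 : ℝ)))
      (mfderiv (𝓡 m) (𝓡 m) e.symm y (EuclideanSpace.single j (1 : ℝ)))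

end

end AmbientObstruction

open AmbientObstruction

set_option linter.unusedSimpArgs false
set_option linter.unusedSectionVars false
set_option linter.unusedVariables false

namespace AmbientObstruction

noncomputable section

section

/-! ### Riemannian geometry over a commutative algebra with commuting derivations -/

/-! Put m = n + 1 and F = x (Ric(g⁺) + m g⁺) for g⁺ = x⁻² (dx² + h_x). The singular terms of the
conformal change cancel (`Geom.conformal_defect`), so F is smooth up to x = 0, and E = O(x^(n-1))
means F = O(x^(m-1)).

Recursion. The tangential part of F = 0 is a second-order equation in x with a regular singular
point. Adding x^t w to h changes the coefficient of x^(t-1) in F by (t/2) ((m - t) w + tr(w) g)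
(`GeomPath.F_sub_dvd`, `SMetric.coeff_F_sub`). This map is invertible for 0 < t < m, so the
coefficients of h below order m exist and are determined by g (`exists_model`,
`SMetric.dvd_sub_of_dvd_F`). For t = m it takes values in multiples of g, so the trace-free part of
the coefficient of x^(m-1) in F does not depend on any choice (`SMetric.tf_coeff_eq`). The
components of F in the normal direction then vanish to the same order by the contracted Bianchi
identity (`GeomPath.dvd_F_zero`).

Shape of the obstruction. Every coefficient of h and F is a natural tensor: a contraction of
covariant derivatives of curvature with universal constants. Two numbers are tracked: the weight,
where ∇^k Rm counts k + 2, and a lower bound L for the number of curvature factors. Modulo terms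
with L ≥ 2, the equation for h is linear: the coefficient of x^s in F is the linearized Ricci tensor
of h_(s-1) (Ric itself for s = 1) plus the indicial term in h_(s+1) (`SMFam.Natural.F_sub`).
Exchanging covariant derivatives costs a curvature factor, so modulo L ≥ 2 they commute. Hence h_2
is -P; since div P = d tr P, the linearized Ricci tensor of P is -B/2 with B = ΔP - ∇² tr P; and
since Δ^k B has trace and divergence zero modulo L ≥ 2, its linearized Ricci tensor is -Δ^(k+1) B /
2. By induction the linear part of the obstruction is a multiple of Δ^K B with K = m/2 - 2
(`SMFam.Natural.ricPart_sub`), and c_n is the reciprocal of the factor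
(`obstructionConst_mul_recCoeff`). The remainder is natural of weight n + 1 with at least two
factors; putting it into normal form (`Natl.netComb`, `Net.exists_contraction`) gives the polynomial
Q (`exists_polynomial_of_dvd`).

Algebra and analysis. The tensor calculus is done for a metric over an arbitrary ℝ-algebra with
commuting derivations. It then applies to smooth functions on a coordinate domain, to smooth
functions on a collar [0, ε) × U, and to formal power series in x, and naturality is uniformity in
the algebra. Taylor expansion at x = 0 is a homomorphism from the second to the third that respects
all the structure (`CollarFamily.taylorBdry_F`). Under it, O(x^n) becomes divisibility by X^n
(`isBigO_iff_dvd`), and the limit of x^(-n) f becomes a coefficient (`tendsto_of_dvd`). For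
existence, the formal solution is taken polynomial in x and is realized on a small collar
(`exists_collarFamily`). -/

/-- A metric with coefficients in an `ℝ`-algebra that carries commuting derivations. -/
structure Geom (ι A : Type*) [Fintype ι] [DecidableEq ι] [CommRing A] [Algebra ℝ A] where
  D : ι → Derivation ℝ A A
  comm : ∀ i j a, D i (D j a) = D j (D i a)
  g : Matrix ι ι A
  gi : Matrix ι ι A
  symm : ∀ i j, g i j = g j i
  mul_inv : g * gi = 1

/-- The element `1/2` of an `ℝ`-algebra. -/
def half (A : Type*) [CommRing A] [Algebra ℝ A] : A := algebraMap ℝ A (1 / 2)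

section half
variable {A : Type*} [CommRing A] [Algebra ℝ A]

theorem two_mul_half : 2 * half A = 1 := by
  rw [half, ← map_ofNat (algebraMap ℝ A) 2, ← map_mul]; norm_num

theorem half_mul_add (a : A) : half A * (a + a) = a := by
  linear_combination a * two_mul_half (A := A)

theorem D_half (D : Derivation ℝ A A) : D (half A) = 0 := D.map_algebraMap _

theorem D_half_mul (D : Derivation ℝ A A) (a : A) : D (half A * a) = half A * D a := by
  rw [D.leibniz, D_half]; simp

theorem half_cancel {a b : A} (h : a + a = b + b) : a = b := by
  rw [← half_mul_add a, h, half_mul_add]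

end half

namespace Geom

variable {ι A : Type*} [Fintype ι] [DecidableEq ι] [CommRing A] [Algebra ℝ A] (𝔤 : Geom ι A)

theorem inv_mul : 𝔤.gi * 𝔤.g = 1 := mul_eq_one_comm.mp 𝔤.mul_inv

theorem g_transpose : 𝔤.g.transpose = 𝔤.g := by ext i j; exact 𝔤.symm j i

theorem gi_transpose : 𝔤.gi.transpose = 𝔤.gi := by
  have h : 𝔤.gi.transpose * 𝔤.g = 1 := by
    rw [← 𝔤.g_transpose, ← Matrix.transpose_mul, 𝔤.mul_inv, Matrix.transpose_one]
  calc 𝔤.gi.transpose = 𝔤.gi.transpose * (𝔤.g * 𝔤.gi) := by rw [𝔤.mul_inv, mul_one]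
    _ = 𝔤.gi := by rw [← mul_assoc, h, one_mul]

theorem gi_symm (i j : ι) : 𝔤.gi i j = 𝔤.gi j i := by
  conv_lhs => rw [← 𝔤.gi_transpose]
  rfl

theorem sum_g_gi (i j : ι) : ∑ k, 𝔤.g i k * 𝔤.gi k j = if i = j then 1 else 0 := by
  rw [← Matrix.mul_apply, 𝔤.mul_inv, Matrix.one_apply]

theorem sum_gi_g (i j : ι) : ∑ k, 𝔤.gi i k * 𝔤.g k j = if i = j then 1 else 0 := by
  rw [← Matrix.mul_apply, 𝔤.inv_mul, Matrix.one_apply]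

/-- The Christoffel symbol `Γ^k_{ij}`. -/
def Γ (k i j : ι) : A :=
  half A * ∑ l, 𝔤.gi k l * (𝔤.D i (𝔤.g j l) + 𝔤.D j (𝔤.g i l) - 𝔤.D l (𝔤.g i j))

theorem Γ_symm (k i j : ι) : 𝔤.Γ k i j = 𝔤.Γ k j i := by
  unfold Γ
  congr 1
  refine Finset.sum_congr rfl fun l _ => ?_
  rw [𝔤.symm i j]; ring

theorem lower_Γ (l i j : ι) :
    ∑ k, 𝔤.g l k * 𝔤.Γ k i j
      = half A * (𝔤.D i (𝔤.g j l) + 𝔤.D j (𝔤.g i l) - 𝔤.D l (𝔤.g i j)) := by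
  unfold Γ
  simp only [Finset.mul_sum]
  rw [Finset.sum_comm]
  have : ∀ m, ∑ k, 𝔤.g l k * (half A * (𝔤.gi k m *
      (𝔤.D i (𝔤.g j m) + 𝔤.D j (𝔤.g i m) - 𝔤.D m (𝔤.g i j))))
      = (if l = m then 1 else 0) * (half A * (𝔤.D i (𝔤.g j m) + 𝔤.D j (𝔤.g i m)
        - 𝔤.D m (𝔤.g i j))) := by
    intro m
    rw [← 𝔤.sum_g_gi, Finset.sum_mul]
    refine Finset.sum_congr rfl fun k _ => by ring
  simp only [this]
  simp

/-- The metric is parallel. -/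
theorem D_g (i j k : ι) :
    𝔤.D i (𝔤.g j k) = ∑ s, (𝔤.Γ s i j * 𝔤.g s k + 𝔤.Γ s i k * 𝔤.g j s) := by
  have h1 := 𝔤.lower_Γ k i j
  have h2 := 𝔤.lower_Γ j i k
  rw [Finset.sum_add_distrib]
  have e1 : ∑ s, 𝔤.Γ s i j * 𝔤.g s k = ∑ s, 𝔤.g k s * 𝔤.Γ s i j :=
    Finset.sum_congr rfl fun s _ => by rw [𝔤.symm s k, mul_comm]
  have e2 : ∑ s, 𝔤.Γ s i k * 𝔤.g j s = ∑ s, 𝔤.g j s * 𝔤.Γ s i k :=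
    Finset.sum_congr rfl fun s _ => mul_comm _ _
  rw [e1, e2, h1, h2, 𝔤.symm k j]
  linear_combination (-𝔤.D i (𝔤.g j k)) * two_mul_half (A := A)

/-- Entrywise derivative of a matrix. -/
def dm (i : ι) (M : Matrix ι ι A) : Matrix ι ι A := M.map (𝔤.D i)

theorem dm_mul (i : ι) (M N : Matrix ι ι A) :
    𝔤.dm i (M * N) = 𝔤.dm i M * N + M * 𝔤.dm i N := by
  ext a b
  simp only [dm, Matrix.map_apply, Matrix.mul_apply, Matrix.add_apply, map_sum,
    Derivation.leibniz, smul_eq_mul, ← Finset.sum_add_distrib]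
  refine Finset.sum_congr rfl fun k _ => by ring

theorem dm_add (i : ι) (M N : Matrix ι ι A) : 𝔤.dm i (M + N) = 𝔤.dm i M + 𝔤.dm i N := by
  ext a b; simp [dm]

theorem dm_sub (i : ι) (M N : Matrix ι ι A) : 𝔤.dm i (M - N) = 𝔤.dm i M - 𝔤.dm i N := by
  ext a b; simp [dm]

theorem dm_transpose (i : ι) (M : Matrix ι ι A) :
    𝔤.dm i M.transpose = (𝔤.dm i M).transpose := rfl

theorem dm_one (i : ι) : 𝔤.dm i (1 : Matrix ι ι A) = 0 := by
  ext a b; simp only [dm, Matrix.map_apply, Matrix.one_apply, Matrix.zero_apply]; split_ifs <;> simp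

theorem dm_comm (i j : ι) (M : Matrix ι ι A) : 𝔤.dm i (𝔤.dm j M) = 𝔤.dm j (𝔤.dm i M) := by
  ext a b; exact 𝔤.comm i j _

/-- The connection matrix `(Γ_i)^l_k`. -/
def cm (i : ι) : Matrix ι ι A := Matrix.of fun l k => 𝔤.Γ l i k

theorem dm_g (i : ι) : 𝔤.dm i 𝔤.g = (𝔤.cm i).transpose * 𝔤.g + 𝔤.g * 𝔤.cm i := by
  ext j k
  simp only [dm, cm, Matrix.map_apply, Matrix.add_apply, Matrix.mul_apply, Matrix.transpose_apply,
    Matrix.of_apply, D_g, Finset.sum_add_distrib]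
  congr 1
  exact Finset.sum_congr rfl fun s _ => mul_comm _ _

theorem dm_gi (i : ι) : 𝔤.dm i 𝔤.gi = -(𝔤.cm i * 𝔤.gi + 𝔤.gi * (𝔤.cm i).transpose) := by
  have h : 𝔤.dm i (𝔤.gi * 𝔤.g) = 0 := by rw [inv_mul, dm_one]
  rw [dm_mul, dm_g] at h
  have h2 := congrArg (· * 𝔤.gi) h
  simp only [add_mul, zero_mul, mul_add, mul_assoc, 𝔤.mul_inv, mul_one] at h2
  rw [← mul_assoc 𝔤.gi 𝔤.g, 𝔤.inv_mul, one_mul] at h2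
  rw [eq_neg_iff_add_eq_zero, ← h2]; abel

theorem D_gi (i j k : ι) :
    𝔤.D i (𝔤.gi j k) = -∑ s, (𝔤.Γ j i s * 𝔤.gi s k + 𝔤.Γ k i s * 𝔤.gi j s) := by
  have h := congrFun (congrFun (𝔤.dm_gi i) j) k
  simp only [dm, cm, Matrix.map_apply, Matrix.add_apply, Matrix.mul_apply, Matrix.transpose_apply,
    Matrix.of_apply, Matrix.neg_apply] at h
  rw [h, Finset.sum_add_distrib]
  congr 2
  exact Finset.sum_congr rfl fun s _ => mul_comm _ _

/-- The curvature `R_{ijk}^l`. -/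
def riem (i j k l : ι) : A :=
  𝔤.D i (𝔤.Γ l j k) - 𝔤.D j (𝔤.Γ l i k) + ∑ s, (𝔤.Γ l i s * 𝔤.Γ s j k - 𝔤.Γ l j s * 𝔤.Γ s i k)

/-- The curvature as a matrix-valued two-form. -/
def rm (i j : ι) : Matrix ι ι A :=
  𝔤.dm i (𝔤.cm j) - 𝔤.dm j (𝔤.cm i) + (𝔤.cm i * 𝔤.cm j - 𝔤.cm j * 𝔤.cm i)

theorem rm_apply (i j k l : ι) : 𝔤.rm i j l k = 𝔤.riem i j k l := by
  simp [rm, riem, dm, cm, Matrix.mul_apply, Finset.sum_sub_distrib]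

theorem riem_antisymm (i j k l : ι) : 𝔤.riem i j k l = -𝔤.riem j i k l := by
  unfold riem; simp only [Finset.sum_sub_distrib]; ring

theorem riem_cyclic (i j k l : ι) : 𝔤.riem i j k l + 𝔤.riem j k i l + 𝔤.riem k i j l = 0 := by
  unfold riem
  simp only [Finset.sum_sub_distrib]
  rw [𝔤.Γ_symm l k j, 𝔤.Γ_symm l i k, 𝔤.Γ_symm l j i]
  have : ∀ a b c, ∑ s, 𝔤.Γ l a s * 𝔤.Γ s b c = ∑ s, 𝔤.Γ l a s * 𝔤.Γ s c b := fun a b c =>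
    Finset.sum_congr rfl fun s _ => by rw [𝔤.Γ_symm s b c]
  rw [this i k j, this j k i, this k j i]; ring

/-- Differentiating ∂_j g = Γ_jᵀ g + g Γ_j once more and using that ∂_i and ∂_j commute on g leaves
exactly this identity. -/
theorem rm_skew (i j : ι) : (𝔤.rm i j).transpose * 𝔤.g + 𝔤.g * 𝔤.rm i j = 0 := by
  have h := 𝔤.dm_comm i j 𝔤.g
  rw [dm_g, dm_g] at h
  simp only [dm_add, dm_mul, dm_transpose, dm_g] at h
  rw [← sub_eq_zero] at h
  rw [← h]
  simp only [rm, Matrix.transpose_add, Matrix.transpose_sub, Matrix.transpose_mul]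
  noncomm_ring

/-- Writing the curvature as dΓ + Γ ∧ Γ, the second derivatives of Γ cancel because the derivations
commute, and the rest cancels by associativity of the matrix product. -/
theorem rm_bianchi (m i j : ι) :
    (𝔤.dm m (𝔤.rm i j) + 𝔤.cm m * 𝔤.rm i j - 𝔤.rm i j * 𝔤.cm m)
    + (𝔤.dm i (𝔤.rm j m) + 𝔤.cm i * 𝔤.rm j m - 𝔤.rm j m * 𝔤.cm i)
    + (𝔤.dm j (𝔤.rm m i) + 𝔤.cm j * 𝔤.rm m i - 𝔤.rm m i * 𝔤.cm j) = 0 := by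
  simp only [rm, dm_add, dm_sub, dm_mul]
  rw [𝔤.dm_comm j m, 𝔤.dm_comm i m, 𝔤.dm_comm j i]
  noncomm_ring

/-- The covariant derivative `∇_m R_{ijk}^l`. -/
def dRiem (m i j k l : ι) : A :=
  𝔤.D m (𝔤.riem i j k l)
    + ∑ s, (𝔤.Γ l m s * 𝔤.riem i j k s - 𝔤.Γ s m k * 𝔤.riem i j s l
      - 𝔤.Γ s m i * 𝔤.riem s j k l - 𝔤.Γ s m j * 𝔤.riem i s k l)

theorem dRiem_bianchi (m i j k l : ι) :
    𝔤.dRiem m i j k l + 𝔤.dRiem i j m k l + 𝔤.dRiem j m i k l = 0 := by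
  have h := congrFun (congrFun (𝔤.rm_bianchi m i j) l) k
  simp only [Matrix.add_apply, Matrix.sub_apply, Matrix.mul_apply, dm, Matrix.map_apply,
    rm_apply, cm, Matrix.of_apply, Matrix.zero_apply] at h
  have e : ∀ a b c d, ∑ s, 𝔤.riem a b s l * 𝔤.Γ s c d = ∑ s, 𝔤.Γ s c d * 𝔤.riem a b s l :=
    fun a b c d => Finset.sum_congr rfl fun s _ => mul_comm _ _
  have f : ∀ a b c, ∑ s, 𝔤.Γ s a b * 𝔤.riem s c k l + ∑ s, 𝔤.Γ s b a * 𝔤.riem c s k l = 0 := by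
    intro a b c
    rw [← Finset.sum_add_distrib]
    refine Finset.sum_eq_zero fun s _ => ?_
    rw [𝔤.Γ_symm s b a, 𝔤.riem_antisymm s c]; ring
  simp only [e] at h
  unfold dRiem
  simp only [Finset.sum_sub_distrib]
  linear_combination h - f m i j - f i j m - f j m i

/-- The Ricci tensor. -/
def ric (j k : ι) : A := ∑ i, 𝔤.riem i j k i

/-- The scalar curvature. -/
def scal : A := ∑ i, ∑ j, 𝔤.gi i j * 𝔤.ric i j

/-- The covariant derivative `∇_k T_{ij}`. -/
def cov2 (T : ι → ι → A) (i j k : ι) : A :=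
  𝔤.D k (T i j) - ∑ s, (𝔤.Γ s k i * T s j + 𝔤.Γ s k j * T i s)

theorem rm_gi_skew (i j : ι) : 𝔤.rm i j * 𝔤.gi + 𝔤.gi * (𝔤.rm i j).transpose = 0 := by
  have h := congrArg (fun M => 𝔤.gi * (M * 𝔤.gi)) (𝔤.rm_skew i j)
  simp only [add_mul, mul_assoc, 𝔤.mul_inv, mul_one, mul_add, zero_mul, mul_zero] at h
  rw [← mul_assoc 𝔤.gi 𝔤.g, 𝔤.inv_mul, one_mul] at h
  rw [← h]; abel

/-- The curvature with the last two indices raised. -/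
theorem riem_gi_skew (i j p l : ι) :
    ∑ k, 𝔤.gi p k * 𝔤.riem i j k l = -∑ k, 𝔤.gi l k * 𝔤.riem i j k p := by
  have h := congrFun (congrFun (𝔤.rm_gi_skew i j) p) l
  simp only [Matrix.add_apply, Matrix.mul_apply, Matrix.transpose_apply, rm_apply,
    Matrix.zero_apply] at h
  rw [eq_neg_iff_add_eq_zero, ← h, add_comm]
  congr 1
  exact Finset.sum_congr rfl fun s _ => by rw [𝔤.gi_symm l s, mul_comm]

theorem trace_riem (i j : ι) : ∑ k, 𝔤.riem i j k k = 0 := by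
  have h := 𝔤.rm_skew i j
  have h2 := congrArg (fun M => Matrix.trace (M * 𝔤.gi)) h
  simp only [add_mul, mul_assoc, 𝔤.mul_inv, mul_one, Matrix.trace_add, zero_mul,
    Matrix.trace_transpose, Matrix.trace_zero] at h2
  rw [Matrix.trace_mul_comm, mul_assoc, 𝔤.inv_mul, mul_one] at h2
  have h3 : Matrix.trace (𝔤.rm i j) = 0 := half_cancel (by rw [h2, add_zero])
  rw [← h3]
  exact Finset.sum_congr rfl fun k _ => (𝔤.rm_apply i j k k).symm

/-- Contract the first Bianchi identity; the term `R_{jki}^i` is a trace of a skew endomorphism and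
vanishes by `trace_riem`. -/
theorem ric_symm (j k : ι) : 𝔤.ric j k = 𝔤.ric k j := by
  rw [← sub_eq_zero]
  unfold ric
  rw [← Finset.sum_sub_distrib]
  rw [← neg_eq_zero, ← 𝔤.trace_riem j k, ← Finset.sum_neg_distrib]
  refine Finset.sum_congr rfl fun i _ => ?_
  have := 𝔤.riem_cyclic i j k i
  rw [𝔤.riem_antisymm k i j] at this
  linear_combination -this

theorem sum_dRiem_ric (m j k : ι) : ∑ i, 𝔤.dRiem m i j k i = 𝔤.cov2 𝔤.ric j k m := by
  unfold dRiem cov2 ric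
  simp only [Finset.sum_add_distrib, Finset.sum_sub_distrib, map_sum, Finset.mul_sum]
  have e1 : ∑ i, ∑ s, 𝔤.Γ i m s * 𝔤.riem i j k s = ∑ i, ∑ s, 𝔤.Γ s m i * 𝔤.riem s j k i :=
    Finset.sum_comm
  rw [e1, Finset.sum_comm (f := fun i s => 𝔤.Γ s m k * 𝔤.riem i j s i),
    Finset.sum_comm (f := fun i s => 𝔤.Γ s m j * 𝔤.riem i s k i)]
  ring

/-- `∇_m` commutes with raising the index `k` of `R_{ijk}^l`. -/
theorem sum_gi_dRiem (m i j p l : ι) :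
    ∑ k, 𝔤.gi p k * 𝔤.dRiem m i j k l
      = 𝔤.D m (∑ k, 𝔤.gi p k * 𝔤.riem i j k l)
        + ∑ s, (𝔤.Γ l m s * (∑ k, 𝔤.gi p k * 𝔤.riem i j k s)
          + 𝔤.Γ p m s * (∑ k, 𝔤.gi s k * 𝔤.riem i j k l)
          - 𝔤.Γ s m i * (∑ k, 𝔤.gi p k * 𝔤.riem s j k l)
          - 𝔤.Γ s m j * (∑ k, 𝔤.gi p k * 𝔤.riem i s k l)) := by
  unfold dRiem
  simp only [map_sum, Derivation.leibniz, smul_eq_mul, D_gi, Finset.sum_add_distrib,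
    Finset.sum_sub_distrib, mul_add, mul_sub, Finset.mul_sum, mul_neg, Finset.sum_neg_distrib]
  have e1 : ∑ k, ∑ s, 𝔤.gi p k * (𝔤.Γ l m s * 𝔤.riem i j k s)
      = ∑ s, ∑ k, 𝔤.Γ l m s * (𝔤.gi p k * 𝔤.riem i j k s) := by
    rw [Finset.sum_comm]; simp only [mul_left_comm]
  have e2 : ∑ k, ∑ s, 𝔤.gi p k * (𝔤.Γ s m i * 𝔤.riem s j k l)
      = ∑ s, ∑ k, 𝔤.Γ s m i * (𝔤.gi p k * 𝔤.riem s j k l) := by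
    rw [Finset.sum_comm]; simp only [mul_left_comm]
  have e3 : ∑ k, ∑ s, 𝔤.gi p k * (𝔤.Γ s m j * 𝔤.riem i s k l)
      = ∑ s, ∑ k, 𝔤.Γ s m j * (𝔤.gi p k * 𝔤.riem i s k l) := by
    rw [Finset.sum_comm]; simp only [mul_left_comm]
  have e4 : ∑ k, ∑ s, 𝔤.riem i j k l * (𝔤.Γ p m s * 𝔤.gi s k)
      = ∑ s, ∑ k, 𝔤.Γ p m s * (𝔤.gi s k * 𝔤.riem i j k l) := by
    rw [Finset.sum_comm]
    refine Finset.sum_congr rfl fun s _ => Finset.sum_congr rfl fun k _ => by ring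
  have e5 : ∑ k, ∑ s, 𝔤.riem i j k l * (𝔤.Γ k m s * 𝔤.gi p s)
      = ∑ k, ∑ s, 𝔤.gi p k * (𝔤.Γ s m k * 𝔤.riem i j s l) := by
    rw [Finset.sum_comm]
    refine Finset.sum_congr rfl fun s _ => Finset.sum_congr rfl fun k _ => by ring
  rw [e1, e2, e3, e4, e5]; ring

/-- The contracted second Bianchi identity. -/
theorem contracted_bianchi (m : ι) :
    ∑ a, ∑ c, 𝔤.gi a c * 𝔤.cov2 𝔤.ric m a c = half A * 𝔤.D m 𝔤.scal := by
  -- Raising an index commutes with ∇, so the skew-symmetry of the curvature in its last pair passes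
  -- to its derivative.
  have skew : ∀ i j p l, ∑ k, 𝔤.gi p k * 𝔤.dRiem i j m k l
      = -∑ k, 𝔤.gi l k * 𝔤.dRiem i j m k p := by
    intro i j p l
    rw [sum_gi_dRiem, sum_gi_dRiem, 𝔤.riem_gi_skew j m p l]
    simp only [Finset.sum_add_distrib, Finset.sum_sub_distrib]
    simp only [fun s => 𝔤.riem_gi_skew j m p s, fun s => 𝔤.riem_gi_skew j m s l,
      fun s => 𝔤.riem_gi_skew s m p l, fun s => 𝔤.riem_gi_skew j s p l, map_neg, mul_neg,
      Finset.sum_neg_distrib]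
    ring
  have hS : 𝔤.D m 𝔤.scal = ∑ j, ∑ k, 𝔤.gi j k * 𝔤.cov2 𝔤.ric j k m := by
    unfold scal cov2
    simp only [map_sum, Derivation.leibniz, smul_eq_mul, D_gi, Finset.sum_add_distrib,
      mul_add, mul_sub, Finset.mul_sum, mul_neg, Finset.sum_neg_distrib, Finset.sum_sub_distrib]
    have e1 : ∑ j, ∑ k, ∑ s, 𝔤.ric j k * (𝔤.Γ j m s * 𝔤.gi s k)
        = ∑ j, ∑ k, ∑ s, 𝔤.gi j k * (𝔤.Γ s m j * 𝔤.ric s k) := by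
      rw [Finset.sum_comm]
      conv_rhs => rw [Finset.sum_comm]
      refine Finset.sum_congr rfl fun k _ => ?_
      rw [Finset.sum_comm]
      refine Finset.sum_congr rfl fun s _ => Finset.sum_congr rfl fun j _ => by ring
    have e2 : ∑ j, ∑ k, ∑ s, 𝔤.ric j k * (𝔤.Γ k m s * 𝔤.gi j s)
        = ∑ j, ∑ k, ∑ s, 𝔤.gi j k * (𝔤.Γ s m k * 𝔤.ric j s) := by
      refine Finset.sum_congr rfl fun k _ => ?_
      rw [Finset.sum_comm]
      refine Finset.sum_congr rfl fun s _ => Finset.sum_congr rfl fun j _ => by ring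
    rw [e1, e2]; ring
  -- The second Bianchi identity contracted once, over the upper index.
  have b : ∀ j k, 𝔤.cov2 𝔤.ric j k m + ∑ i, 𝔤.dRiem i j m k i - 𝔤.cov2 𝔤.ric m k j = 0 := by
    intro j k
    rw [← sum_dRiem_ric, ← sum_dRiem_ric, ← Finset.sum_add_distrib, ← Finset.sum_sub_distrib]
    refine Finset.sum_eq_zero fun i _ => ?_
    have h := 𝔤.dRiem_bianchi m i j k i
    have a : 𝔤.dRiem j m i k i = -𝔤.dRiem j i m k i := by
      unfold dRiem
      simp only [fun k l => 𝔤.riem_antisymm m i k l, fun s k l => 𝔤.riem_antisymm s i k l,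
        fun s k l => 𝔤.riem_antisymm m s k l, map_neg, Finset.sum_sub_distrib, mul_neg,
        Finset.sum_neg_distrib]
      ring
    rw [a] at h; linear_combination h
  -- In the second contraction the skew-symmetry turns the remaining divergence of the curvature
  -- into minus a divergence of Ric, so half of dS appears.
  have hW : ∑ j, ∑ k, 𝔤.gi j k * ∑ i, 𝔤.dRiem i j m k i
      = -∑ a, ∑ c, 𝔤.gi a c * 𝔤.cov2 𝔤.ric m a c := by
    calc ∑ j, ∑ k, 𝔤.gi j k * ∑ i, 𝔤.dRiem i j m k i
        = ∑ j, ∑ i, ∑ k, 𝔤.gi j k * 𝔤.dRiem i j m k i := by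
          refine Finset.sum_congr rfl fun j _ => ?_
          simp only [Finset.mul_sum]
          exact Finset.sum_comm
      _ = -∑ j, ∑ i, ∑ k, 𝔤.gi i k * 𝔤.dRiem i j m k j := by
          simp only [← Finset.sum_neg_distrib]
          refine Finset.sum_congr rfl fun j _ => Finset.sum_congr rfl fun i _ => ?_
          rw [skew, Finset.sum_neg_distrib]
      _ = -∑ a, ∑ c, 𝔤.gi a c * 𝔤.cov2 𝔤.ric m a c := by
          congr 1
          rw [Finset.sum_comm]
          calc ∑ i, ∑ j, ∑ k, 𝔤.gi i k * 𝔤.dRiem i j m k j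
              = ∑ i, ∑ k, 𝔤.gi i k * 𝔤.cov2 𝔤.ric m k i := by
                refine Finset.sum_congr rfl fun i _ => ?_
                rw [Finset.sum_comm]
                refine Finset.sum_congr rfl fun k _ => ?_
                rw [← Finset.mul_sum, sum_dRiem_ric]
            _ = _ := by
                rw [Finset.sum_comm]
                refine Finset.sum_congr rfl fun a _ => Finset.sum_congr rfl fun c _ => ?_
                rw [𝔤.gi_symm]
  have hb : ∑ j, ∑ k, 𝔤.gi j k *
      (𝔤.cov2 𝔤.ric j k m + ∑ i, 𝔤.dRiem i j m k i - 𝔤.cov2 𝔤.ric m k j) = 0 := by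
    simp [b]
  have hV : ∑ j, ∑ k, 𝔤.gi j k * 𝔤.cov2 𝔤.ric m k j
      = ∑ a, ∑ c, 𝔤.gi a c * 𝔤.cov2 𝔤.ric m a c := by
    rw [Finset.sum_comm]
    refine Finset.sum_congr rfl fun a _ => Finset.sum_congr rfl fun c _ => ?_
    rw [𝔤.gi_symm]
  simp only [mul_add, mul_sub, Finset.sum_add_distrib, Finset.sum_sub_distrib] at hb
  rw [← hS, hW, hV] at hb
  linear_combination (-half A) * hb - (∑ a, ∑ c, 𝔤.gi a c * 𝔤.cov2 𝔤.ric m a c)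
    * two_mul_half (A := A)

end Geom

end

/-! ### Covariant derivatives and the difference of two connections -/

section

namespace Geom

variable {ι A : Type*} [Fintype ι] [DecidableEq ι] [CommRing A] [Algebra ℝ A] (𝔤 : Geom ι A)

/-- The covariant derivative `∇_j u_i`. -/
def cov1 (u : ι → A) (i j : ι) : A := 𝔤.D j (u i) - ∑ s, 𝔤.Γ s j i * u s

/-- The covariant derivative `∇_l T_{ijk}`. -/
def cov3 (T : ι → ι → ι → A) (i j k l : ι) : A :=
  𝔤.D l (T i j k)
    - ∑ s, (𝔤.Γ s l i * T s j k + 𝔤.Γ s l j * T i s k + 𝔤.Γ s l k * T i j s)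

/-- The covariant derivative `∇_l C^i_{jk}`. -/
def covC (C : ι → ι → ι → A) (l i j k : ι) : A :=
  𝔤.D l (C i j k) + ∑ s, (𝔤.Γ i l s * C s j k - 𝔤.Γ s l j * C i s k - 𝔤.Γ s l k * C i j s)

variable (𝔥 : Geom ι A)

/-- The Ricci tensor of the connection `Γ + C`. -/
theorem ric_of_Γ_add (C : ι → ι → ι → A) (hD : ∀ i a, 𝔥.D i a = 𝔤.D i a)
    (hC : ∀ k i j, 𝔥.Γ k i j = 𝔤.Γ k i j + C k i j) (j k : ι) :
    𝔥.ric j k = 𝔤.ric j k + ∑ i, 𝔤.covC C i i j k - 𝔤.cov1 (fun k => ∑ i, C i i k) k j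
      + ∑ i, ∑ s, (C i i s * C s j k - C i j s * C s i k) := by
  unfold ric riem covC cov1
  simp only [hD, hC, map_add, Finset.sum_add_distrib, Finset.sum_sub_distrib, add_mul, mul_add,
    map_sum, Finset.mul_sum]
  have c1 : ∑ i, ∑ s, 𝔤.Γ s i j * C i s k = ∑ i, ∑ s, 𝔤.Γ i j s * C s i k := by
    rw [Finset.sum_comm]
    refine Finset.sum_congr rfl fun i _ => Finset.sum_congr rfl fun s _ => by rw [𝔤.Γ_symm i s j]
  have c2 : ∑ i, ∑ s, C i j s * 𝔤.Γ s i k = ∑ i, ∑ s, 𝔤.Γ s i k * C i j s := by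
    simp only [mul_comm]
  have c3 : ∑ i, ∑ s, C i i s * 𝔤.Γ s j k = ∑ s, ∑ i, 𝔤.Γ s j k * C i i s := by
    rw [Finset.sum_comm]; simp only [mul_comm]
  rw [c1, c2, c3]
  ring

/-- The difference of the Levi-Civita connections of two metrics. -/
theorem Γ_sub (hD : ∀ i a, 𝔥.D i a = 𝔤.D i a) (k i j : ι) :
    𝔥.Γ k i j = 𝔤.Γ k i j + half A * ∑ l, 𝔥.gi k l *
      (𝔤.cov2 𝔥.g j l i + 𝔤.cov2 𝔥.g i l j - 𝔤.cov2 𝔥.g i j l) := by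
  have h1 : ∀ l, 𝔤.cov2 𝔥.g j l i + 𝔤.cov2 𝔥.g i l j - 𝔤.cov2 𝔥.g i j l
      = (𝔤.D i (𝔥.g j l) + 𝔤.D j (𝔥.g i l) - 𝔤.D l (𝔥.g i j))
        - 2 * ∑ s, 𝔤.Γ s i j * 𝔥.g l s := by
    intro l
    unfold cov2
    simp only [Finset.sum_add_distrib]
    have a1 : ∑ s, 𝔤.Γ s j i * 𝔥.g s l = ∑ s, 𝔤.Γ s i j * 𝔥.g l s :=
      Finset.sum_congr rfl fun s _ => by rw [𝔤.Γ_symm, 𝔥.symm]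
    have a2 : ∑ s, 𝔤.Γ s i j * 𝔥.g s l = ∑ s, 𝔤.Γ s i j * 𝔥.g l s :=
      Finset.sum_congr rfl fun s _ => by rw [𝔥.symm]
    have a3 : ∑ s, 𝔤.Γ s l j * 𝔥.g i s = ∑ s, 𝔤.Γ s j l * 𝔥.g i s :=
      Finset.sum_congr rfl fun s _ => by rw [𝔤.Γ_symm]
    have a4 : ∑ s, 𝔤.Γ s l i * 𝔥.g s j = ∑ s, 𝔤.Γ s i l * 𝔥.g j s :=
      Finset.sum_congr rfl fun s _ => by rw [𝔤.Γ_symm, 𝔥.symm]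
    rw [a1, a2, a3, a4]; ring
  have h2 : ∑ l, 𝔥.gi k l * (2 * ∑ s, 𝔤.Γ s i j * 𝔥.g l s) = 2 * 𝔤.Γ k i j := by
    simp only [Finset.mul_sum]
    rw [Finset.sum_comm]
    have : ∀ s, ∑ l, 𝔥.gi k l * (2 * (𝔤.Γ s i j * 𝔥.g l s))
        = (if k = s then 1 else 0) * (2 * 𝔤.Γ s i j) := by
      intro s
      rw [← 𝔥.sum_gi_g, Finset.sum_mul]
      exact Finset.sum_congr rfl fun l _ => by ring
    simp [this]
  simp only [h1, mul_sub (𝔥.gi _ _) _ (2 * _), Finset.sum_sub_distrib, h2]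
  conv_lhs => rw [Γ]
  simp only [hD]
  linear_combination (𝔤.Γ k i j) * two_mul_half (A := A)

/-! ### A metric with a unit-length gradient coordinate, and its conformal rescaling -/

/-- The trace of a two-tensor. -/
def tr (T : ι → ι → A) : A := ∑ i, ∑ j, 𝔤.gi i j * T i j

variable (o : ι) (x : A)

/-- The Hessian of the coordinate with index `o`. -/
def hess (a b : ι) : A := -𝔤.Γ o a b

/-- The rescaled Einstein defect `x (Ric (x⁻² g) + (m - 1) x⁻² g)` where `m` is the dimension and
`x` the coordinate with index `o`. -/
def defect (a b : ι) : A :=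
  x * 𝔤.ric a b + ((Fintype.card ι : A) - 2) * 𝔤.hess o a b + 𝔤.tr (𝔤.hess o) * 𝔤.g a b

theorem hess_symm (a b : ι) : 𝔤.hess o a b = 𝔤.hess o b a := by
  unfold hess; rw [𝔤.Γ_symm]

theorem defect_symm (a b : ι) : 𝔤.defect o x a b = 𝔤.defect o x b a := by
  unfold defect; rw [𝔤.ric_symm, 𝔤.hess_symm, 𝔤.symm]

theorem tr_g : 𝔤.tr 𝔤.g = Fintype.card ι := by
  unfold tr
  have : ∀ i, ∑ j, 𝔤.gi i j * 𝔤.g i j = 1 := by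
    intro i
    rw [← (𝔤.sum_gi_g i i).trans (if_pos rfl)]
    exact Finset.sum_congr rfl fun j _ => by rw [𝔤.symm]
  simp [this]

theorem tr_add (S T : ι → ι → A) : 𝔤.tr (fun a b => S a b + T a b) = 𝔤.tr S + 𝔤.tr T := by
  simp only [tr, mul_add, Finset.sum_add_distrib]

theorem tr_mul (f : A) (T : ι → ι → A) : 𝔤.tr (fun a b => f * T a b) = f * 𝔤.tr T := by
  simp only [tr, mul_left_comm _ f, ← Finset.mul_sum]

theorem cov2_add (S T : ι → ι → A) (i j k : ι) :
    𝔤.cov2 (fun a b => S a b + T a b) i j k = 𝔤.cov2 S i j k + 𝔤.cov2 T i j k := by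
  unfold cov2
  simp only [map_add, mul_add, Finset.sum_add_distrib]; ring

theorem cov2_mul (f : A) (T : ι → ι → A) (i j k : ι) :
    𝔤.cov2 (fun a b => f * T a b) i j k = 𝔤.D k f * T i j + f * 𝔤.cov2 T i j k := by
  unfold cov2
  simp only [Derivation.leibniz, smul_eq_mul, Finset.sum_add_distrib, mul_left_comm _ f,
    ← Finset.mul_sum]
  ring

theorem cov2_g (i j k : ι) : 𝔤.cov2 𝔤.g i j k = 0 := by
  unfold cov2
  rw [D_g, sub_self]

theorem D_tr (T : ι → ι → A) (m : ι) :
    𝔤.D m (𝔤.tr T) = ∑ j, ∑ k, 𝔤.gi j k * 𝔤.cov2 T j k m := by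
  unfold tr cov2
  simp only [map_sum, Derivation.leibniz, smul_eq_mul, D_gi, Finset.sum_add_distrib,
    mul_add, mul_sub, Finset.mul_sum, mul_neg, Finset.sum_neg_distrib, Finset.sum_sub_distrib]
  have e1 : ∑ j, ∑ k, ∑ s, T j k * (𝔤.Γ j m s * 𝔤.gi s k)
      = ∑ j, ∑ k, ∑ s, 𝔤.gi j k * (𝔤.Γ s m j * T s k) := by
    rw [Finset.sum_comm]
    conv_rhs => rw [Finset.sum_comm]
    refine Finset.sum_congr rfl fun k _ => ?_
    rw [Finset.sum_comm]
    refine Finset.sum_congr rfl fun s _ => Finset.sum_congr rfl fun j _ => by ring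
  have e2 : ∑ j, ∑ k, ∑ s, T j k * (𝔤.Γ k m s * 𝔤.gi j s)
      = ∑ j, ∑ k, ∑ s, 𝔤.gi j k * (𝔤.Γ s m k * T j s) := by
    refine Finset.sum_congr rfl fun k _ => ?_
    rw [Finset.sum_comm]
    refine Finset.sum_congr rfl fun s _ => Finset.sum_congr rfl fun j _ => by ring
  rw [e1, e2]; ring

/-- `R_{jm}{}^{ji} = - R_m{}^i`. -/
theorem sum_gi_riem (m i : ι) :
    ∑ j, ∑ k, 𝔤.gi j k * 𝔤.riem j m k i = -∑ k, 𝔤.gi i k * 𝔤.ric m k := by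
  simp only [fun j => 𝔤.riem_gi_skew j m j i, Finset.sum_neg_distrib, ric, Finset.mul_sum]
  rw [Finset.sum_comm]

section unit
variable {o}
theorem gi_of_unit (hg : ∀ b, 𝔤.g o b = if o = b then 1 else 0) (b : ι) : 𝔤.gi o b = if o = b then 1 else 0 := by
  have := 𝔤.sum_g_gi o b
  simpa [hg] using this

/-- The entries of `g` in row `o` are constants, so only the derivative in the direction `o`
survives in the lowered Christoffel symbol. -/
theorem Γ_of_unit (hg : ∀ b, 𝔤.g o b = if o = b then 1 else 0) (a c : ι) : 𝔤.Γ o a c = -(half A * 𝔤.D o (𝔤.g a c)) := by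
  have h := 𝔤.lower_Γ o a c
  have hg' : ∀ b, 𝔤.g b o = if o = b then 1 else 0 := fun b => by rw [𝔤.symm, hg]
  simp only [hg, hg', ite_mul, one_mul, zero_mul, Finset.sum_ite_eq, Finset.mem_univ, if_true]
    at h
  rw [h]
  split_ifs <;> simp

theorem hess_of_unit (hg : ∀ b, 𝔤.g o b = if o = b then 1 else 0) (a : ι) : 𝔤.hess o o a = 0 := by
  rw [hess, 𝔤.Γ_of_unit hg, hg]
  split_ifs <;> simp

/-- Bochner's formula for the coordinate with index `o`: commuting two of the three derivatives
produces one curvature term, whose contraction is Ric applied to the gradient. By `hg` the gradient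
is the coordinate field itself. -/
theorem bochner (hg : ∀ b, 𝔤.g o b = if o = b then 1 else 0) (b : ι) :
    ∑ a, ∑ c, 𝔤.gi a c * 𝔤.cov2 (𝔤.hess o) b a c = 𝔤.D b (𝔤.tr (𝔤.hess o)) + 𝔤.ric b o := by
  have h1 : ∀ a c, 𝔤.cov2 (𝔤.hess o) b a c = 𝔤.cov2 (𝔤.hess o) c a b - 𝔤.riem c b a o := by
    intro a c
    unfold cov2 hess riem
    simp only [map_neg, mul_neg, Finset.sum_sub_distrib, Finset.sum_add_distrib,
      Finset.sum_neg_distrib]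
    have c1 : ∑ s, 𝔤.Γ s c b * 𝔤.Γ o s a = ∑ s, 𝔤.Γ s b c * 𝔤.Γ o s a := by
      simp only [𝔤.Γ_symm _ c b]
    have c2 : ∀ c b, ∑ s, 𝔤.Γ s c a * 𝔤.Γ o b s = ∑ s, 𝔤.Γ o b s * 𝔤.Γ s c a := by
      intro c b; simp only [mul_comm]
    rw [c1, c2, c2]; ring
  simp only [h1, mul_sub, Finset.sum_sub_distrib]
  rw [D_tr]
  have h2 : ∑ a, ∑ c, 𝔤.gi a c * 𝔤.cov2 (𝔤.hess o) c a b
      = ∑ j, ∑ k, 𝔤.gi j k * 𝔤.cov2 (𝔤.hess o) j k b := by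
    rw [Finset.sum_comm]
    exact Finset.sum_congr rfl fun _ _ => Finset.sum_congr rfl fun _ _ => by rw [𝔤.gi_symm]
  have h3 : ∑ a, ∑ c, 𝔤.gi a c * 𝔤.riem c b a o = -𝔤.ric b o := by
    rw [Finset.sum_comm]
    have := 𝔤.sum_gi_riem b o
    simp only [𝔤.gi_of_unit hg, ite_mul, one_mul, zero_mul, Finset.sum_ite_eq, Finset.mem_univ,
      if_true] at this
    rw [← this]
    exact Finset.sum_congr rfl fun _ _ => Finset.sum_congr rfl fun _ _ => by rw [𝔤.gi_symm]
  rw [h2, h3]; ring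

variable {x}

/-- The contracted Bianchi identity in terms of the Einstein defect. -/
theorem defect_bianchi (hg : ∀ b, 𝔤.g o b = if o = b then 1 else 0)
    (hx : ∀ c, 𝔤.D c x = if o = c then 1 else 0) (b : ι) :
    x * (∑ a, ∑ c, 𝔤.gi a c * 𝔤.cov2 (𝔤.defect o x) b a c
        - half A * 𝔤.D b (𝔤.tr (𝔤.defect o x)))
      = ((Fintype.card ι : A) - 1) * 𝔤.defect o x o b
        - half A * (if o = b then 𝔤.tr (𝔤.defect o x) else 0) := by
  set N : A := (Fintype.card ι : A) with hN
  have hDN : ∀ c, 𝔤.D c (N - 2) = 0 := by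
    intro c
    have : N - 2 = algebraMap ℝ A ((Fintype.card ι : ℝ) - 2) := by
      rw [map_sub, map_natCast, map_ofNat]
    rw [this]; exact Derivation.map_algebraMap _ _
  have htr : 𝔤.tr (𝔤.defect o x) = x * 𝔤.scal + 2 * (N - 1) * 𝔤.tr (𝔤.hess o) := by
    have : 𝔤.tr (𝔤.defect o x) = x * 𝔤.scal + (N - 2) * 𝔤.tr (𝔤.hess o)
        + 𝔤.tr (𝔤.hess o) * 𝔤.tr 𝔤.g := by
      have e : 𝔤.defect o x = fun a b => (x * 𝔤.ric a b + (N - 2) * 𝔤.hess o a b)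
        + 𝔤.tr (𝔤.hess o) * 𝔤.g a b := rfl
      rw [e, tr_add, tr_add 𝔤 (fun a b => x * 𝔤.ric a b), tr_mul, tr_mul,
        show 𝔤.tr (fun a b => 𝔤.tr (𝔤.hess o) * 𝔤.g a b) = _ from 𝔤.tr_mul _ 𝔤.g]
      rfl
    rw [this, tr_g]; ring
  have hcov : ∀ a c, 𝔤.cov2 (𝔤.defect o x) b a c
      = (if o = c then 1 else 0) * 𝔤.ric b a + x * 𝔤.cov2 𝔤.ric b a c
        + (N - 2) * 𝔤.cov2 (𝔤.hess o) b a c + 𝔤.D c (𝔤.tr (𝔤.hess o)) * 𝔤.g b a := by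
    intro a c
    have : 𝔤.defect o x = fun a b => (x * 𝔤.ric a b + (N - 2) * 𝔤.hess o a b)
        + 𝔤.tr (𝔤.hess o) * 𝔤.g a b := rfl
    rw [this, cov2_add, cov2_add (S := fun a b => x * 𝔤.ric a b), cov2_mul, cov2_mul,
      show 𝔤.cov2 (fun a b => 𝔤.tr (𝔤.hess o) * 𝔤.g a b) b a c = _ from 𝔤.cov2_mul _ 𝔤.g b a c,
      cov2_g, hx, hDN]
    ring
  -- The divergence of x Ric is Ric(∇x) plus x times half of dS; the divergence of the Hessian comes
  -- from `bochner`; the metric is parallel.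
  have hsum : ∑ a, ∑ c, 𝔤.gi a c * 𝔤.cov2 (𝔤.defect o x) b a c
      = 𝔤.ric b o + x * (half A * 𝔤.D b 𝔤.scal)
        + (N - 2) * (𝔤.D b (𝔤.tr (𝔤.hess o)) + 𝔤.ric b o) + 𝔤.D b (𝔤.tr (𝔤.hess o)) := by
    rw [← contracted_bianchi, ← 𝔤.bochner hg b]
    have e1 : ∑ a, ∑ c, 𝔤.gi a c * ((if o = c then 1 else 0) * 𝔤.ric b a) = 𝔤.ric b o := by
      rw [Finset.sum_comm]
      simp only [ite_mul, one_mul, zero_mul, mul_ite, mul_zero]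
      simp only [Finset.sum_comm (s := Finset.univ), fun a => 𝔤.gi_symm a o, 𝔤.gi_of_unit hg,
        Finset.sum_ite_eq, Finset.mem_univ, if_true, ite_mul, one_mul, zero_mul]
    have e2 : ∑ a, ∑ c, 𝔤.gi a c * (𝔤.D c (𝔤.tr (𝔤.hess o)) * 𝔤.g b a)
        = 𝔤.D b (𝔤.tr (𝔤.hess o)) := by
      rw [Finset.sum_comm]
      have : ∀ c, ∑ a, 𝔤.gi a c * (𝔤.D c (𝔤.tr (𝔤.hess o)) * 𝔤.g b a)
          = (if b = c then 1 else 0) * 𝔤.D c (𝔤.tr (𝔤.hess o)) := by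
        intro c
        rw [← 𝔤.sum_g_gi, Finset.sum_mul]
        exact Finset.sum_congr rfl fun a _ => by ring
      simp [this]
    simp only [hcov, mul_add, Finset.sum_add_distrib, e1, e2, mul_left_comm _ x,
      mul_left_comm _ (N - 2), ← Finset.mul_sum]
  have hDtr : 𝔤.D b (𝔤.tr (𝔤.defect o x)) = (if o = b then 1 else 0) * 𝔤.scal
      + x * 𝔤.D b 𝔤.scal + 2 * (N - 1) * 𝔤.D b (𝔤.tr (𝔤.hess o)) := by
    have e : 2 * (N - 1) = 2 * (N - 2) + 1 + 1 := by ring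
    rw [htr, map_add, Derivation.leibniz, Derivation.leibniz, hx]
    have : 𝔤.D b (2 * (N - 1)) = 0 := by
      rw [e, map_add, map_add, two_mul, map_add, hDN]; simp
    rw [this]; simp only [smul_eq_mul]; ring
  rw [hsum, hDtr, htr]
  have hF : 𝔤.defect o x o b = x * 𝔤.ric b o
      + 𝔤.tr (𝔤.hess o) * (if o = b then 1 else 0) := by
    rw [defect, 𝔤.hess_of_unit hg, hg, 𝔤.ric_symm]; ring
  rw [hF]
  split_ifs with hob
  · linear_combination (-x * (N - 1) * 𝔤.D b (𝔤.tr (𝔤.hess o))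
      + (N - 1) * 𝔤.tr (𝔤.hess o)) * two_mul_half (A := A)
  · linear_combination (-x * (N - 1) * 𝔤.D b (𝔤.tr (𝔤.hess o))) * two_mul_half (A := A)

/-- The Einstein defect of the rescaled metric `x⁻² g`. -/
theorem conformal_defect (hg : ∀ b, 𝔤.g o b = if o = b then 1 else 0)
    (hx : ∀ c, 𝔤.D c x = if o = c then 1 else 0)
    (xi : A) (hxi : x * xi = 1) (hD : ∀ i a, 𝔥.D i a = 𝔤.D i a)
    (hh : ∀ i j, 𝔥.g i j = xi ^ 2 * 𝔤.g i j) (j k : ι) :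
    x * (𝔥.ric j k + ((Fintype.card ι : A) - 1) * 𝔥.g j k) = 𝔤.defect o x j k := by
  set u : ι → A := fun i => if o = i then 1 else 0 with hu
  have hgo : ∀ b, 𝔤.g b o = u b := fun b => by rw [𝔤.symm, hg]
  have hgio : ∀ b, 𝔤.gi b o = u b := fun b => by rw [𝔤.gi_symm, 𝔤.gi_of_unit hg]
  have hDxi : ∀ c, 𝔤.D c xi = -(xi ^ 2 * u c) := by
    intro c
    have h := congrArg (𝔤.D c) hxi
    rw [Derivation.leibniz, hx, Derivation.map_one_eq_zero, smul_eq_mul, smul_eq_mul] at h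
    linear_combination xi * h - 𝔤.D c xi * hxi
  have hgi : ∀ i j, 𝔥.gi i j = x ^ 2 * 𝔤.gi i j := by
    have h1 : 𝔥.g = xi ^ 2 • 𝔤.g := by ext i j; simp [hh]
    have h2 : 𝔥.g * (x ^ 2 • 𝔤.gi) = 1 := by
      rw [h1, Matrix.smul_mul, Matrix.mul_smul, 𝔤.mul_inv, smul_smul, ← mul_pow, mul_comm xi, hxi,
        one_pow, one_smul]
    have h3 : 𝔥.gi = x ^ 2 • 𝔤.gi := by
      calc 𝔥.gi = 𝔥.gi * (𝔥.g * (x ^ 2 • 𝔤.gi)) := by rw [h2, mul_one]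
        _ = _ := by rw [← mul_assoc, 𝔥.inv_mul, one_mul]
    intro i j; rw [h3]; rfl
  -- The change of the Levi-Civita connection under rescaling by x⁻²; `u` stands both for dx and for
  -- the gradient of x, which have the same components by `hg`.
  set C : ι → ι → ι → A := fun k i j => -(xi * ((if k = i then 1 else 0) * u j
    + (if k = j then 1 else 0) * u i - u k * 𝔤.g i j)) with hCdef
  have hC : ∀ k i j, 𝔥.Γ k i j = 𝔤.Γ k i j + C k i j := by
    intro k i j
    have h1 : ∀ c a b, 𝔤.D c (𝔥.g a b) = xi ^ 2 * 𝔤.D c (𝔤.g a b)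
        - 2 * xi ^ 3 * (u c * 𝔤.g a b) := by
      intro c a b
      rw [hh, Derivation.leibniz, Derivation.leibniz_pow, hDxi]
      simp only [smul_eq_mul, nsmul_eq_mul]; push_cast; ring
    have h2 : ∀ l, 𝔥.gi k l * (𝔤.D i (𝔥.g j l) + 𝔤.D j (𝔥.g i l) - 𝔤.D l (𝔥.g i j))
        = 𝔤.gi k l * (𝔤.D i (𝔤.g j l) + 𝔤.D j (𝔤.g i l) - 𝔤.D l (𝔤.g i j))
          - 2 * xi * (u i * (𝔤.gi k l * 𝔤.g l j) + u j * (𝔤.gi k l * 𝔤.g l i)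
            - 𝔤.gi k l * u l * 𝔤.g i j) := by
      intro l
      rw [hgi, h1, h1, h1, 𝔤.symm l j, 𝔤.symm l i]
      have e : x ^ 2 * xi ^ 2 = 1 := by rw [← mul_pow, hxi, one_pow]
      linear_combination (𝔤.gi k l * (𝔤.D i (𝔤.g j l) + 𝔤.D j (𝔤.g i l) - 𝔤.D l (𝔤.g i j))
        - 2 * xi * 𝔤.gi k l * (u i * 𝔤.g j l + u j * 𝔤.g i l - u l * 𝔤.g i j)) * e
    have h3 : ∑ l, 𝔤.gi k l * u l * 𝔤.g i j = u k * 𝔤.g i j := by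
      rw [← Finset.sum_mul]; simp [hu, hgio]
    rw [Γ, Γ]
    simp only [hD, h2, Finset.sum_sub_distrib, ← Finset.mul_sum, Finset.sum_add_distrib,
      𝔤.sum_gi_g, h3, hCdef]
    linear_combination (-xi * (u i * (if k = j then 1 else 0) + u j * (if k = i then 1 else 0)
      - u k * 𝔤.g i j)) * two_mul_half (A := A)
  have hDu : ∀ c i, 𝔤.D c (u i) = 0 := by
    intro c i; simp only [hu]; split_ifs <;> simp
  have hDδ : ∀ (c i j : ι), 𝔤.D c (if i = j then (1 : A) else 0) = 0 := by
    intro c i j; split_ifs <;> simp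
  have htrC : (fun k => ∑ i, C i i k) = fun k => -((Fintype.card ι : A) * (xi * u k)) := by
    funext k
    have e : ∀ i, C i i k = -(xi * u k) - xi * ((if i = k then 1 else 0) * u i)
        + xi * (u i * 𝔤.g i k) := by
      intro i; simp only [hCdef, if_true]; ring
    simp only [e, Finset.sum_add_distrib, Finset.sum_sub_distrib, ← Finset.mul_sum]
    simp [hu, hg]
  -- The Laplacian of x is the divergence of its gradient, the coordinate field with index `o`.
  have htrX : ∑ i, 𝔤.Γ i i o = 𝔤.tr (𝔤.hess o) := by
    unfold tr hess
    simp only [𝔤.Γ_of_unit hg, neg_neg]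
    simp only [Γ]
    have e : ∀ i, ∑ l, 𝔤.gi i l * (𝔤.D i (𝔤.g o l) + 𝔤.D o (𝔤.g i l) - 𝔤.D l (𝔤.g i o))
        = ∑ l, 𝔤.gi i l * 𝔤.D o (𝔤.g i l) := by
      intro i
      refine Finset.sum_congr rfl fun l _ => ?_
      rw [hg, hDδ, hgo, hDu]; ring
    simp only [e, Finset.mul_sum, mul_left_comm _ (half A)]
  have hdC : ∀ l i j k, 𝔤.covC C l i j k = xi ^ 2 * u l * ((if i = j then 1 else 0) * u k
      + (if i = k then 1 else 0) * u j - u i * 𝔤.g j k)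
      - xi * ((if i = j then 1 else 0) * 𝔤.hess o l k + (if i = k then 1 else 0) * 𝔤.hess o l j
        - 𝔤.Γ i l o * 𝔤.g j k) := by
    intro l i j k
    have e1 : 𝔤.D l (C i j k) = xi ^ 2 * u l * ((if i = j then 1 else 0) * u k
      + (if i = k then 1 else 0) * u j - u i * 𝔤.g j k) + xi * (u i * 𝔤.D l (𝔤.g j k)) := by
      simp only [hCdef, map_neg, map_sub, map_add, Derivation.leibniz, hDxi, hDu, hDδ, smul_eq_mul]
      ring
    have e2 : ∑ s, 𝔤.Γ i l s * C s j k = -(xi * (𝔤.Γ i l j * u k + 𝔤.Γ i l k * u j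
        - 𝔤.Γ i l o * 𝔤.g j k)) := by
      have : ∀ s, 𝔤.Γ i l s * C s j k = -(xi * ((if s = j then 1 else 0) * 𝔤.Γ i l s * u k
        + (if s = k then 1 else 0) * 𝔤.Γ i l s * u j - (u s * 𝔤.Γ i l s) * 𝔤.g j k)) := by
        intro s; simp only [hCdef]; ring
      simp only [this, Finset.sum_neg_distrib, ← Finset.mul_sum, Finset.sum_sub_distrib,
        Finset.sum_add_distrib, ← Finset.sum_mul]
      simp [hu]
    have e3 : ∀ j k, ∑ s, 𝔤.Γ s l j * C i s k = -(xi * (𝔤.Γ i l j * u k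
        - (if i = k then 1 else 0) * 𝔤.hess o l j - u i * ∑ s, 𝔤.Γ s l j * 𝔤.g s k)) := by
      intro j k
      have : ∀ s, 𝔤.Γ s l j * C i s k = -(xi * ((if i = s then 1 else 0) * 𝔤.Γ s l j * u k
        + (if i = k then 1 else 0) * (u s * 𝔤.Γ s l j) - u i * (𝔤.Γ s l j * 𝔤.g s k))) := by
        intro s; simp only [hCdef]; ring
      simp only [this, Finset.sum_neg_distrib, ← Finset.mul_sum, Finset.sum_sub_distrib,
        Finset.sum_add_distrib, ← Finset.sum_mul]
      simp [hu, hess]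
    have hCs : ∀ i j k, C i j k = C i k j := by
      intro i j k; simp only [hCdef]; rw [𝔤.symm j k]; ring
    have e4 : ∑ s, 𝔤.Γ s l k * C i j s = ∑ s, 𝔤.Γ s l k * C i s j :=
      Finset.sum_congr rfl fun s _ => by rw [hCs]
    rw [covC, Finset.sum_sub_distrib, Finset.sum_sub_distrib, e1, e2, e3, e4, e3, 𝔤.D_g,
      Finset.sum_add_distrib]
    have e5 : ∑ s, 𝔤.Γ s l k * 𝔤.g j s = ∑ s, 𝔤.Γ s l k * 𝔤.g s j :=
      Finset.sum_congr rfl fun s _ => by rw [𝔤.symm]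
    rw [e5]; ring
  have huu : ∑ s, u s * u s = 1 := by simp [hu]
  have hquad1 : ∑ i, ∑ s, C i i s * C s j k = (Fintype.card ι : A) * xi ^ 2
      * (2 * (u j * u k) - 𝔤.g j k) := by
    rw [Finset.sum_comm]
    simp only [← Finset.sum_mul]
    have : ∀ s, (∑ i, C i i s) * C s j k = (Fintype.card ι : A) * xi ^ 2 *
        ((if s = j then 1 else 0) * u s * u k + (if s = k then 1 else 0) * u s * u j
          - u s * u s * 𝔤.g j k) := by
      intro s; rw [congrFun htrC s]; simp only [hCdef]; ring
    simp only [this, ← Finset.mul_sum, Finset.sum_sub_distrib, Finset.sum_add_distrib,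
      ← Finset.sum_mul, huu]
    simp; ring
  have hug : ∀ k, ∑ s, u s * 𝔤.g s k = u k := by intro k; simp [hu, hg]
  have hquad2 : ∑ i, ∑ s, C i j s * C s i k = xi ^ 2 * (((Fintype.card ι : A) + 2) * (u j * u k)
      - 2 * 𝔤.g j k) := by
    have e : ∀ i, ∑ s, C i j s * C s i k = xi ^ 2 * ((if i = j then 1 else 0) * u i * u k
        + (if i = j then 1 else 0) * (u i * u k) - (if i = j then 1 else 0) * 𝔤.g i k
        + (u j * u k + (if i = k then 1 else 0) * (u i * u j) - u j * (u i * 𝔤.g i k))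
        - (u i * 𝔤.g i j * u k + u i * u i * 𝔤.g j k - u j * (u i * 𝔤.g i k))) := by
      intro i
      have : ∀ s, C i j s * C s i k = xi ^ 2 * ((if i = j then 1 else 0)
            * ((if s = i then 1 else 0) * u s * u k)
          + (if i = j then 1 else 0) * ((if s = k then 1 else 0) * u s * u i)
          - (if i = j then 1 else 0) * (u s * u s * 𝔤.g i k)
          + ((if s = i then 1 else 0) * ((if i = s then 1 else 0) * u j * u k)
            + (if s = k then 1 else 0) * ((if i = s then 1 else 0) * (u j * u i))
            - (if i = s then 1 else 0) * (u s * (u j * 𝔤.g i k)))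
          - ((if s = i then 1 else 0) * (𝔤.g s j * (u i * u k))
            + (if s = k then 1 else 0) * (𝔤.g s j * (u i * u i))
            - (u s * 𝔤.g s j) * (u i * 𝔤.g i k))) := by
        intro s; simp only [hCdef]; rw [𝔤.symm j s]; ring
      simp only [this, ← Finset.mul_sum, Finset.sum_sub_distrib, Finset.sum_add_distrib,
        ← Finset.sum_mul, huu, hug]
      simp only [ite_mul, one_mul, zero_mul, Finset.sum_ite_eq', Finset.sum_ite_eq,
        Finset.mem_univ, if_true]
      rw [𝔤.symm k j]
      split_ifs <;> ring
    simp only [e, ← Finset.mul_sum, Finset.sum_sub_distrib, Finset.sum_add_distrib,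
        ← Finset.sum_mul, huu, hug]
    simp only [ite_mul, one_mul, zero_mul, Finset.sum_ite_eq',
        Finset.mem_univ, if_true, Finset.sum_const, Finset.card_univ, nsmul_eq_mul]
    ring
  have hlin1 : ∑ i, 𝔤.covC C i i j k = xi ^ 2 * (2 * (u j * u k) - 𝔤.g j k)
      - xi * (2 * 𝔤.hess o j k - 𝔤.tr (𝔤.hess o) * 𝔤.g j k) := by
    have : ∀ i, 𝔤.covC C i i j k = xi ^ 2 * ((if i = j then 1 else 0) * u i * u k
        + (if i = k then 1 else 0) * u i * u j - u i * u i * 𝔤.g j k)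
      - xi * ((if i = j then 1 else 0) * 𝔤.hess o i k + (if i = k then 1 else 0) * 𝔤.hess o i j
        - 𝔤.Γ i i o * 𝔤.g j k) := by
      intro i; rw [hdC]; ring
    simp only [this, ← Finset.mul_sum, Finset.sum_sub_distrib, Finset.sum_add_distrib,
        ← Finset.sum_mul, huu, htrX]
    simp only [ite_mul, one_mul, zero_mul, Finset.sum_ite_eq',
        Finset.mem_univ, if_true]
    rw [𝔤.hess_symm o k j]; ring
  have hlin2 : 𝔤.cov1 (fun k => ∑ i, C i i k) k j
      = (Fintype.card ι : A) * (xi ^ 2 * (u j * u k) - xi * 𝔤.hess o j k) := by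
    rw [htrC, cov1]
    have e : ∑ s, 𝔤.Γ s j k * -((Fintype.card ι : A) * (xi * u s))
        = (Fintype.card ι : A) * (xi * 𝔤.hess o j k) := by
      have : ∀ s, 𝔤.Γ s j k * -((Fintype.card ι : A) * (xi * u s))
        = (Fintype.card ι : A) * (xi * -(u s * 𝔤.Γ s j k)) := fun s => by ring
      simp only [this, ← Finset.mul_sum, Finset.sum_neg_distrib]
      simp [hu, hess]
    rw [e, map_neg, Derivation.leibniz, Derivation.leibniz, hDu, hDxi, Derivation.map_natCast]
    simp only [smul_eq_mul]; ring
  -- The terms with `xi ^ 2` add up to minus (card ι - 1) `xi ^ 2` times `g`, which the Einstein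
  -- constant cancels. What remains is linear in `xi`, so one factor x clears the denominator.
  have h := 𝔤.ric_of_Γ_add 𝔥 C hD hC j k
  rw [Finset.sum_congr rfl fun i _ => Finset.sum_sub_distrib _ _, Finset.sum_sub_distrib,
    hquad1, hquad2, hlin1, hlin2] at h
  rw [h, hh, defect]
  linear_combination ((((Fintype.card ι : A) - 2) * 𝔤.hess o j k)
    + 𝔤.tr (𝔤.hess o) * 𝔤.g j k) * hxi

end unit

end Geom

end

section

/-! ### The metric `dx² + h_x` -/

/-- A one-parameter family `h_x` of metrics: a metric over an algebra with an additional derivation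
`∂_x` and an element `x`. -/
structure GeomPath (m : ℕ) (A : Type*) [CommRing A] [Algebra ℝ A] extends Geom (Fin m) A where
  D₀ : Derivation ℝ A A
  comm₀ : ∀ i a, D₀ (D i a) = D i (D₀ a)
  x : A
  D₀_x : D₀ x = 1
  D_x : ∀ i, D i x = 0

namespace GeomPath

variable {m : ℕ} {A : Type*} [CommRing A] [Algebra ℝ A] (𝔥 : GeomPath m A)

/-- The matrix `1 ⊕ M`. -/
def border (M : Matrix (Fin m) (Fin m) A) : Matrix (Fin (m + 1)) (Fin (m + 1)) A :=
  Matrix.of fun a b => Fin.cases (Fin.cases 1 (fun _ => 0) b)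
    (fun i => Fin.cases 0 (fun j => M i j) b) a

section border
variable (M : Matrix (Fin m) (Fin m) A)
@[simp] theorem border_zero_zero : border M 0 0 = 1 := rfl
@[simp] theorem border_zero_succ (j : Fin m) : border M 0 j.succ = 0 := rfl
@[simp] theorem border_succ_zero (i : Fin m) : border M i.succ 0 = 0 := rfl
@[simp] theorem border_succ_succ (i j : Fin m) : border M i.succ j.succ = M i j := rfl

theorem border_mul (N : Matrix (Fin m) (Fin m) A) :
    border M * border N = border (M * N) := by
  ext a b
  refine Fin.cases ?_ (fun i => ?_) a <;> refine Fin.cases ?_ (fun j => ?_) b <;>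
    simp [Matrix.mul_apply, Fin.sum_univ_succ]

theorem border_one : border (1 : Matrix (Fin m) (Fin m) A) = 1 := by
  ext a b
  refine Fin.cases ?_ (fun i => ?_) a <;> refine Fin.cases ?_ (fun j => ?_) b <;>
    simp [Matrix.one_apply, Fin.succ_inj, (Fin.succ_ne_zero _).symm]
end border

/-- The metric `dx² + h_x`. -/
def cyl : Geom (Fin (m + 1)) A where
  D := Fin.cons 𝔥.D₀ 𝔥.D
  comm i j a := by
    refine Fin.cases ?_ (fun i => ?_) i <;> refine Fin.cases ?_ (fun j => ?_) j
    · rfl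
    · exact 𝔥.comm₀ j a
    · exact (𝔥.comm₀ i a).symm
    · exact 𝔥.comm i j a
  g := border 𝔥.g
  gi := border 𝔥.gi
  symm i j := by
    refine Fin.cases ?_ (fun i => ?_) i <;> refine Fin.cases ?_ (fun j => ?_) j
    · rfl
    · rfl
    · rfl
    · exact 𝔥.symm i j
  mul_inv := by rw [border_mul, 𝔥.mul_inv, border_one]

@[simp] theorem cyl_D_zero : 𝔥.cyl.D 0 = 𝔥.D₀ := rfl
@[simp] theorem cyl_D_succ (i : Fin m) : 𝔥.cyl.D i.succ = 𝔥.D i := rfl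
@[simp] theorem cyl_g : 𝔥.cyl.g = border 𝔥.g := rfl
@[simp] theorem cyl_gi : 𝔥.cyl.gi = border 𝔥.gi := rfl

/-- The endomorphism `½ h⁻¹ ∂_x h`. -/
def K (i j : Fin m) : A := half A * ∑ k, 𝔥.gi i k * 𝔥.D₀ (𝔥.g k j)

/-- The trace of `½ h⁻¹ ∂_x h`. -/
def trK : A := ∑ i, 𝔥.K i i

theorem cyl_unit (b : Fin (m + 1)) : 𝔥.cyl.g 0 b = if 0 = b then 1 else 0 := by
  refine Fin.cases ?_ (fun j => ?_) b
  · rfl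
  · simp [(Fin.succ_ne_zero j).symm]

theorem cyl_D_x (c : Fin (m + 1)) : 𝔥.cyl.D c 𝔥.x = if 0 = c then 1 else 0 := by
  refine Fin.cases ?_ (fun j => ?_) c
  · simp [𝔥.D₀_x]
  · simp [(Fin.succ_ne_zero j).symm, 𝔥.D_x]

@[simp] theorem cyl_Γ_zero (a : Fin (m + 1)) : 𝔥.cyl.Γ 0 0 a = 0 := by
  have := 𝔥.cyl.hess_of_unit 𝔥.cyl_unit a
  rwa [Geom.hess, neg_eq_zero] at this

@[simp] theorem cyl_Γ_zero' (a : Fin (m + 1)) : 𝔥.cyl.Γ 0 a 0 = 0 := by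
  rw [Geom.Γ_symm, cyl_Γ_zero]

@[simp] theorem cyl_Γ_zero_succ (i j : Fin m) :
    𝔥.cyl.Γ 0 i.succ j.succ = -(half A * 𝔥.D₀ (𝔥.g i j)) :=
  𝔥.cyl.Γ_of_unit 𝔥.cyl_unit _ _

@[simp] theorem cyl_Γ_succ_zero_succ (k j : Fin m) : 𝔥.cyl.Γ k.succ 0 j.succ = 𝔥.K k j := by
  simp [Geom.Γ, Fin.sum_univ_succ, K, 𝔥.symm j]

@[simp] theorem cyl_Γ_succ_succ_zero (k j : Fin m) : 𝔥.cyl.Γ k.succ j.succ 0 = 𝔥.K k j := by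
  rw [Geom.Γ_symm, cyl_Γ_succ_zero_succ]

@[simp] theorem cyl_Γ_succ_succ_succ (k i j : Fin m) :
    𝔥.cyl.Γ k.succ i.succ j.succ = 𝔥.Γ k i j := by
  simp [Geom.Γ, Fin.sum_univ_succ]

/-- The rescaled Einstein defect `x (Ric (g⁺) + m g⁺)` of `g⁺ = x⁻² (dx² + h_x)`. -/
def F (a b : Fin (m + 1)) : A := 𝔥.cyl.defect 0 𝔥.x a b

theorem tr_hess : 𝔥.cyl.tr (𝔥.cyl.hess 0) = 𝔥.trK := by
  simp [Geom.tr, Geom.hess, Fin.sum_univ_succ, trK, K, Finset.mul_sum, 𝔥.symm,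
    mul_left_comm (half A)]

/-- The Gauss equation for the slices x = const combined with the Riccati equation for their second
fundamental form, which up to sign is half of ∂_x h. -/
theorem ric_succ_succ (i j : Fin m) :
    𝔥.cyl.ric i.succ j.succ = 𝔥.ric i j - half A * 𝔥.D₀ (𝔥.D₀ (𝔥.g i j))
      + ∑ k, 𝔥.D₀ (𝔥.g i k) * 𝔥.K k j - half A * (𝔥.trK * 𝔥.D₀ (𝔥.g i j)) := by
  have e : ∑ k, 𝔥.K k i * 𝔥.D₀ (𝔥.g k j) = ∑ k, 𝔥.D₀ (𝔥.g i k) * 𝔥.K k j := by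
    simp only [K, Finset.mul_sum, Finset.sum_mul]
    rw [Finset.sum_comm]
    refine Finset.sum_congr rfl fun a _ => Finset.sum_congr rfl fun b _ => ?_
    rw [𝔥.gi_symm, 𝔥.symm i a]; ring
  have e1 : ∑ k, 𝔥.K k i * (half A * 𝔥.D₀ (𝔥.g k j)) = half A * ∑ k, 𝔥.D₀ (𝔥.g i k) * 𝔥.K k j := by
    rw [← e, Finset.mul_sum]; exact Finset.sum_congr rfl fun k _ => by ring
  have e2 : ∑ k, half A * 𝔥.D₀ (𝔥.g i k) * 𝔥.K k j = half A * ∑ k, 𝔥.D₀ (𝔥.g i k) * 𝔥.K k j := by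
    rw [Finset.mul_sum]; exact Finset.sum_congr rfl fun k _ => by ring
  have e3 : ∑ k, 𝔥.K k k * (half A * 𝔥.D₀ (𝔥.g i j)) = half A * (𝔥.trK * 𝔥.D₀ (𝔥.g i j)) := by
    rw [← Finset.sum_mul, trK]; ring
  simp only [Geom.ric, Geom.riem, Fin.sum_univ_succ, cyl_D_zero, cyl_D_succ, cyl_Γ_zero,
    cyl_Γ_zero', cyl_Γ_zero_succ, cyl_Γ_succ_zero_succ, cyl_Γ_succ_succ_zero,
    cyl_Γ_succ_succ_succ, map_zero, map_neg, D_half_mul, zero_mul, mul_zero, sub_zero, zero_sub,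
    neg_neg, neg_mul, mul_neg, Finset.sum_add_distrib, Finset.sum_sub_distrib,
    Finset.sum_neg_distrib, zero_add, sub_neg_eq_add, e1, e2, e3, Finset.sum_const_zero]
  linear_combination (∑ k, 𝔥.D₀ (𝔥.g i k) * 𝔥.K k j) * two_mul_half (A := A)

/-- The equation to be solved for h: every second x-derivative comes with a factor x, so x = 0 is a
regular singular point. -/
theorem F_succ_succ (i j : Fin m) :
    𝔥.F i.succ j.succ = 𝔥.x * (𝔥.ric i j - half A * 𝔥.D₀ (𝔥.D₀ (𝔥.g i j))
      + ∑ k, 𝔥.D₀ (𝔥.g i k) * 𝔥.K k j - half A * (𝔥.trK * 𝔥.D₀ (𝔥.g i j)))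
      + ((m : A) - 1) * (half A * 𝔥.D₀ (𝔥.g i j)) + 𝔥.trK * 𝔥.g i j := by
  rw [F, Geom.defect, ric_succ_succ, tr_hess, Geom.hess, cyl_Γ_zero_succ, cyl_g,
    border_succ_succ, Fintype.card_fin]
  push_cast
  ring

theorem F_symm (a b : Fin (m + 1)) : 𝔥.F a b = 𝔥.F b a := 𝔥.cyl.defect_symm _ _ _ _

/-- The contracted Bianchi identity for the rescaled Einstein defect. -/
theorem F_bianchi (b : Fin (m + 1)) :
    𝔥.x * (∑ a, ∑ c, 𝔥.cyl.gi a c * 𝔥.cyl.cov2 𝔥.F b a c - half A * 𝔥.cyl.D b (𝔥.cyl.tr 𝔥.F))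
      = (m : A) * 𝔥.F 0 b - half A * (if 0 = b then 𝔥.cyl.tr 𝔥.F else 0) := by
  have := 𝔥.cyl.defect_bianchi 𝔥.cyl_unit 𝔥.cyl_D_x b
  rw [Fintype.card_fin] at this
  push_cast at this
  rw [add_sub_cancel_right] at this
  exact this

end GeomPath

end

section

/-! ### Tensors with arbitrary index sets -/

/-- Extension of a family by a value at `none`. -/
def ocons {ρ α : Type*} (k : α) (I : ρ → α) : Option ρ → α := fun o => o.elim k I

@[simp] theorem ocons_none {ρ α : Type*} (k : α) (I : ρ → α) : ocons k I none = k := rfl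
@[simp] theorem ocons_some {ρ α : Type*} (k : α) (I : ρ → α) (t : ρ) : ocons k I (some t) = I t :=
  rfl

namespace Geom

variable {ι A : Type*} [Fintype ι] [DecidableEq ι] [CommRing A] [Algebra ℝ A] (𝔤 : Geom ι A)
variable {ρ ρ' : Type*} [Fintype ρ] [DecidableEq ρ] [Fintype ρ'] [DecidableEq ρ']

/-- The connection coefficient that acts on an upper (`true`) or lower (`false`) index. -/
def conn (b : Bool) (i a s : ι) : A := if b then 𝔤.Γ a i s else -𝔤.Γ s i a

/-- The covariant derivative in the coordinate direction `i`; `v` tells which indices are upper. -/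
def nabla (v : ρ → Bool) (T : (ρ → ι) → A) (i : ι) (I : ρ → ι) : A :=
  𝔤.D i (T I) + ∑ t, ∑ s, 𝔤.conn (v t) i (I t) s * T (Function.update I t s)

/-- The iterated covariant derivatives of the curvature tensor. -/
def covRm : (k : ℕ) → (Fin (4 + k) → ι) → A
  | 0 => fun I => ∑ s, 𝔤.g (I 3) s * 𝔤.riem (I 0) (I 1) (I 2) s
  | k + 1 => fun J => 𝔤.nabla (fun _ => false) (covRm k) (J (Fin.last (4 + k))) (Fin.init J)

end Geom

/-- A tensor field that is assigned to every metric on an `m`-dimensional space. -/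
abbrev Fam (m : ℕ) (ρ : Type) : Type 1 :=
  ∀ (A : Type) [CommRing A] [Algebra ℝ A], Geom (Fin m) A → (ρ → Fin m) → A

/-- Natural tensors: obtained from covariant derivatives of curvature by products, contractions
and linear combinations. `v` marks the upper indices, `w` is the weight (each factor `∇^k Rm` counts
`k + 2`), and each term has at least `L` curvature factors. -/
inductive Natl (m : ℕ) : {ρ : Type} → [Fintype ρ] → [DecidableEq ρ] → (ρ → Bool) → ℕ → ℕ →
    Fam m ρ → Prop
  | curv (k : ℕ) : Natl m (fun _ : Fin (4 + k) => false) (k + 2) 1 (fun _ _ _ 𝔤 => 𝔤.covRm k)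
  | metric : Natl m (fun _ : Fin 2 => false) 0 0 (fun _ _ _ 𝔤 I => 𝔤.g (I 0) (I 1))
  | inv : Natl m (fun _ : Fin 2 => true) 0 0 (fun _ _ _ 𝔤 I => 𝔤.gi (I 0) (I 1))
  | zero {ρ : Type} [Fintype ρ] [DecidableEq ρ] (v : ρ → Bool) (w L : ℕ) :
      Natl m v w L (fun _ _ _ _ _ => 0)
  | add {ρ : Type} [Fintype ρ] [DecidableEq ρ] {v : ρ → Bool} {w L : ℕ} {S T : Fam m ρ} :
      Natl m v w L S → Natl m v w L T → Natl m v w L (fun A _ _ 𝔤 I => S A 𝔤 I + T A 𝔤 I)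
  | smul {ρ : Type} [Fintype ρ] [DecidableEq ρ] {v : ρ → Bool} {w L : ℕ} (c : ℝ) {T : Fam m ρ} :
      Natl m v w L T → Natl m v w L (fun A _ _ 𝔤 I => c • T A 𝔤 I)
  | mul {ρ ρ' : Type} [Fintype ρ] [DecidableEq ρ] [Fintype ρ'] [DecidableEq ρ'] {v : ρ → Bool}
      {v' : ρ' → Bool} {w w' L L' : ℕ} {S : Fam m ρ} {T : Fam m ρ'} :
      Natl m v w L S → Natl m v' w' L' T → Natl m (Sum.elim v v') (w + w') (L + L')
        (fun A _ _ 𝔤 I => S A 𝔤 (I ∘ Sum.inl) * T A 𝔤 (I ∘ Sum.inr))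
  | trace {ρ : Type} [Fintype ρ] [DecidableEq ρ] {v : ρ → Bool} {w L : ℕ}
      {T : Fam m (Option (Option ρ))} :
      Natl m (ocons true (ocons false v)) w L T →
      Natl m v w L (fun A _ _ 𝔤 I => ∑ k, T A 𝔤 (ocons k (ocons k I)))
  | reindex {ρ ρ' : Type} [Fintype ρ] [DecidableEq ρ] [Fintype ρ'] [DecidableEq ρ']
      (v' : ρ' → Bool) {w L : ℕ} {T : Fam m ρ} (σ : ρ ≃ ρ') :
      Natl m (v' ∘ σ) w L T → Natl m v' w L (fun A _ _ 𝔤 I => T A 𝔤 (I ∘ σ))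
  | mono {ρ : Type} [Fintype ρ] [DecidableEq ρ] {v : ρ → Bool} {w L L' : ℕ} {T : Fam m ρ} :
      L' ≤ L → Natl m v w L T → Natl m v w L' T

/-! ### Normal form of natural tensors -/

section network

variable {m : ℕ} {A : Type*} [CommRing A] [Algebra ℝ A] (𝔤 : Geom (Fin m) A)

/-- All entries of a multiset of pairs. -/
def ends {Y : Type*} (P : Multiset (Y × Y)) : Multiset Y := P.map Prod.fst + P.map Prod.snd

theorem ends_cons {Y : Type*} (p : Y × Y) (P : Multiset (Y × Y)) :
    ends (p ::ₘ P) = p.1 ::ₘ p.2 ::ₘ ends P := by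
  simp only [ends, Multiset.map_cons, Multiset.cons_add, Multiset.add_cons]
  exact Multiset.cons_swap _ _ _

theorem ends_map {Y Z : Type*} (f : Y → Z) (P : Multiset (Y × Y)) :
    ends (P.map (Prod.map f f)) = (ends P).map f := by
  simp [ends, Multiset.map_map, Function.comp_def]

theorem ends_add {Y : Type*} (P Q : Multiset (Y × Y)) : ends (P + Q) = ends P + ends Q := by
  simp only [ends, Multiset.map_add]; abel

/-- The product of the contractions along a multiset of pairs. -/
def pairW {Y : Type*} (P : Multiset (Y × Y)) (a : Y → Fin m) : A :=
  (P.map fun p => 𝔤.gi (a p.1) (a p.2)).prod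

theorem pairW_cons {Y : Type*} (p : Y × Y) (P : Multiset (Y × Y)) (a : Y → Fin m) :
    pairW 𝔤 (p ::ₘ P) a = 𝔤.gi (a p.1) (a p.2) * pairW 𝔤 P a := by
  simp [pairW]

theorem pairW_map {Y Z : Type*} (f : Y → Z) (P : Multiset (Y × Y)) (a : Z → Fin m) :
    pairW 𝔤 (P.map (Prod.map f f)) a = pairW 𝔤 P (a ∘ f) := by
  simp [pairW, Multiset.map_map, Function.comp_def]

theorem pairW_add {Y : Type*} (P Q : Multiset (Y × Y)) (a : Y → Fin m) :
    pairW 𝔤 (P + Q) a = pairW 𝔤 P a * pairW 𝔤 Q a := by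
  simp [pairW]

/-- Since g⁻¹ is symmetric, a pair may be read in either direction, and any slot may be taken as the
first entry of its pair. -/
theorem exists_partner {Y : Type*} {P : Multiset (Y × Y)} {x : Y} (hx : x ∈ ends P) :
    ∃ (y : Y) (P' : Multiset (Y × Y)), ends P = x ::ₘ y ::ₘ ends P' ∧
      ∀ {A : Type} [CommRing A] [Algebra ℝ A] (𝔤 : Geom (Fin m) A) (a : Y → Fin m),
        pairW 𝔤 P a = 𝔤.gi (a x) (a y) * pairW 𝔤 P' a := by
  rw [ends, Multiset.mem_add, Multiset.mem_map, Multiset.mem_map] at hx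
  obtain ⟨p, hp, rfl⟩ | ⟨p, hp, rfl⟩ := hx
  · obtain ⟨P', rfl⟩ := Multiset.exists_cons_of_mem hp
    exact ⟨p.2, P', ends_cons _ _, fun 𝔤 a => pairW_cons 𝔤 _ _ _⟩
  · obtain ⟨P', rfl⟩ := Multiset.exists_cons_of_mem hp
    refine ⟨p.1, P', ?_, fun 𝔤 a => ?_⟩
    · rw [ends_cons, Multiset.cons_swap]
    · rw [pairW_cons, 𝔤.gi_symm]

theorem exists_map_eq {Y Z : Type*} (f : Z → Y) (P : Multiset (Y × Y))
    (h : ∀ y ∈ ends P, ∃ z, f z = y) : ∃ P', Multiset.map (Prod.map f f) P' = P := by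
  induction P using Multiset.induction with
  | empty => exact ⟨0, rfl⟩
  | cons p P ih =>
    rw [ends_cons] at h
    obtain ⟨P', rfl⟩ := ih fun y hy => h y (by simp [hy])
    obtain ⟨z₁, h₁⟩ := h p.1 (by simp)
    obtain ⟨z₂, h₂⟩ := h p.2 (by simp)
    exact ⟨(z₁, z₂) ::ₘ P', by rw [Multiset.map_cons]; congr 1; exact Prod.ext h₁ h₂⟩

theorem univ_option_option (Z : Type*) [Fintype Z] :
    (Finset.univ : Finset (Option (Option Z))).val
      = none ::ₘ some none ::ₘ (Finset.univ : Finset Z).val.map (fun z => some (some z)) := by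
  have hinj : Function.Injective (fun z : Z => some (some z)) := fun a b h => by simpa using h
  refine (Multiset.Nodup.ext Finset.univ.nodup ?_).mpr ?_
  · simp only [Multiset.nodup_cons, Multiset.mem_cons, Multiset.mem_map, not_or]
    refine ⟨⟨by simp, by simp⟩, by simp, Finset.univ.nodup.map hinj⟩
  · intro y
    rcases y with _ | _ | z <;> simp

theorem sum_g_mul_gi (𝔤 : Geom (Fin m) A) (p q : Fin m) :
    ∑ i, ∑ j, 𝔤.g i j * (𝔤.gi i p * 𝔤.gi j q) = 𝔤.gi p q := by
  have : ∀ i, ∑ j, 𝔤.g i j * (𝔤.gi i p * 𝔤.gi j q) = 𝔤.gi i p * (if i = q then 1 else 0) := by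
    intro i
    rw [← 𝔤.sum_g_gi, Finset.mul_sum]
    exact Finset.sum_congr rfl fun j _ => by ring
  simp [this, 𝔤.gi_symm q p]

theorem sum_g_gi_dim (𝔤 : Geom (Fin m) A) : ∑ i, ∑ j, 𝔤.g i j * 𝔤.gi i j = m := by
  have h := 𝔤.tr_g
  rw [Fintype.card_fin] at h
  rw [← h]
  simp only [Geom.tr, mul_comm]

/-- Contracting two free slots of a perfect pairing gives a perfect pairing. -/
theorem exists_merge {Z : Type} [Fintype Z] [DecidableEq Z]
    {P : Multiset (Option (Option Z) × Option (Option Z))} (hP : ends P = Finset.univ.val) :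
    ∃ (c : ℝ) (P' : Multiset (Z × Z)), ends P' = Finset.univ.val ∧
      ∀ {A : Type} [CommRing A] [Algebra ℝ A] (𝔤 : Geom (Fin m) A) (f : Z → Fin m),
        ∑ i, ∑ j, 𝔤.g i j * pairW 𝔤 P (ocons i (ocons j f)) = c • pairW 𝔤 P' f := by
  have hinj : Function.Injective (fun z : Z => some (some z)) := fun a b h => by simpa using h
  obtain ⟨y, P₁, h₁, e₁⟩ := exists_partner (m := m) (P := P) (x := none) (by rw [hP]; simp)
  have h₁' := h₁
  rw [hP, univ_option_option, Multiset.cons_inj_right] at h₁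
  have nd : (none ::ₘ y ::ₘ ends P₁).Nodup := by rw [← h₁', hP]; exact Finset.univ.nodup
  have hn : none ∉ y ::ₘ ends P₁ := (Multiset.nodup_cons.mp nd).1
  -- The partner of the first contracted slot cannot be that slot itself. If it is the other
  -- contracted slot, a closed loop splits off, with value g_ij g^ij = m. If it is a slot of `Z`,
  -- two edges have to be joined.
  rcases y with _ | _ | z
  · simp at hn
  · rw [Multiset.cons_inj_right] at h₁
    obtain ⟨P', rfl⟩ := exists_map_eq (fun z : Z => some (some z)) P₁ (by
      intro y hy; rw [← h₁, Multiset.mem_map] at hy; obtain ⟨z, -, rfl⟩ := hy; exact ⟨z, rfl⟩)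
    rw [ends_map] at h₁
    refine ⟨m, P', (Multiset.map_injective hinj h₁).symm, fun 𝔤 f => ?_⟩
    have : ∀ i j, ocons i (ocons j f) ∘ (fun z : Z => some (some z)) = f := fun i j => rfl
    simp only [e₁, pairW_map, this, ocons_none, ocons_some, ← mul_assoc, ← Finset.sum_mul,
      sum_g_gi_dim]
    rw [Algebra.smul_def, map_natCast]
  · have hs : some none ∈ ends P₁ := by
      have : some none ∈ some (some z) ::ₘ ends P₁ := by rw [← h₁]; simp
      simpa using this
    obtain ⟨t, P₂, h₂, e₂⟩ := exists_partner (m := m) hs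
    rw [h₂] at h₁ nd
    have hsn : some none ∉ t ::ₘ ends P₂ := by
      have h3 := (Multiset.nodup_cons.mp (Multiset.nodup_cons.mp nd).2).2
      exact (Multiset.nodup_cons.mp h3).1
    have hnn : none ∉ t ::ₘ ends P₂ := fun h => hn (by rw [h₂]; simp at h ⊢; tauto)
    rw [Multiset.cons_swap, Multiset.cons_inj_right] at h₁
    have hr : ∀ y ∈ t ::ₘ ends P₂, ∃ z : Z, some (some z) = y := by
      intro y hy
      rcases y with _ | _ | z
      · exact absurd hy hnn
      · exact absurd hy hsn
      · exact ⟨z, rfl⟩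
    obtain ⟨z', rfl⟩ := hr t (by simp)
    obtain ⟨P', rfl⟩ := exists_map_eq (fun z : Z => some (some z)) P₂
      fun y hy => hr y (by simp [hy])
    -- The metric between the two contracted slots joins the edges that end there into one edge,
    -- since g_ij g^ip g^jq = g^pq.
    refine ⟨1, (z, z') ::ₘ P', ?_, fun 𝔤 f => ?_⟩
    · rw [ends_map] at h₁
      apply Multiset.map_injective hinj
      rw [h₁, ends_cons]; simp
    · have : ∀ i j, ocons i (ocons j f) ∘ (fun z : Z => some (some z)) = f := fun i j => rfl
      simp only [e₁, e₂, pairW_map, this, ocons_none, ocons_some, pairW_cons, ← mul_assoc,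
        ← Finset.sum_mul, one_smul]
      congr 1
      rw [← sum_g_mul_gi]
      simp only [mul_assoc]

/-- The factor that attaches a free index to a slot. -/
def outerW (b : Bool) (i a : Fin m) : A := if b then (if i = a then 1 else 0) else 𝔤.g i a

/-- Contraction of `Φ` along a pairing of its slots and of free slots with values `b`. -/
def netKer {X ρ : Type*} [Fintype X] [DecidableEq X] (Φ : (X → Fin m) → A)
    (P : Multiset ((X ⊕ ρ) × (X ⊕ ρ))) (b : ρ → Fin m) : A :=
  ∑ a : X → Fin m, Φ a * pairW 𝔤 P (Sum.elim a b)

/-- Contraction of `Φ` along a pairing, as a tensor with index set `ρ`. -/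
def netEval {X ρ : Type*} [Fintype X] [DecidableEq X] [Fintype ρ] [DecidableEq ρ] (v : ρ → Bool)
    (Φ : (X → Fin m) → A) (P : Multiset ((X ⊕ ρ) × (X ⊕ ρ))) (I : ρ → Fin m) : A :=
  ∑ b : ρ → Fin m, (∏ e, outerW 𝔤 (v e) (I e) (b e)) * netKer 𝔤 Φ P b

end network

/-- A contraction of a product of covariant derivatives of curvature. -/
structure Net (ρ : Type) [Fintype ρ] [DecidableEq ρ] where
  κ : Type
  [fin : Fintype κ]
  [dec : DecidableEq κ]
  order : κ → ℕ
  pairs : Multiset (((Σ j : κ, Fin (4 + order j)) ⊕ ρ) × ((Σ j : κ, Fin (4 + order j)) ⊕ ρ))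
  perfect : ends pairs = Finset.univ.val

attribute [instance] Net.fin Net.dec

namespace Net

variable {ρ ρ' : Type} [Fintype ρ] [DecidableEq ρ] [Fintype ρ'] [DecidableEq ρ'] {m : ℕ}

/-- The slots of the curvature factors. -/
abbrev Slot (N : Net ρ) : Type := Σ j : N.κ, Fin (4 + N.order j)

/-- The product of the curvature factors. -/
def factors (N : Net ρ) {A : Type*} [CommRing A] [Algebra ℝ A] (𝔤 : Geom (Fin m) A)
    (a : N.Slot → Fin m) : A := ∏ j, 𝔤.covRm (N.order j) fun s => a ⟨j, s⟩

/-- The weight of a contraction. -/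
def weight (N : Net ρ) : ℕ := ∑ j, (N.order j + 2)

/-- The tensor defined by a contraction. -/
def eval (N : Net ρ) (v : ρ → Bool) : Fam m ρ :=
  fun _ _ _ 𝔤 => netEval 𝔤 v (N.factors 𝔤) N.pairs

end Net

/-- Linear combinations of contractions. -/
inductive NetComb (m : ℕ) {ρ : Type} [Fintype ρ] [DecidableEq ρ] (v : ρ → Bool) (w L : ℕ) :
    Fam m ρ → Prop
  | zero : NetComb m v w L (fun _ _ _ _ _ => 0)
  | cons (c : ℝ) (N : Net ρ) (hw : N.weight = w) (hL : L ≤ Fintype.card N.κ) {T : Fam m ρ} :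
      NetComb m v w L T →
      NetComb m v w L (fun A _ _ 𝔤 I => c • N.eval v A 𝔤 I + T A 𝔤 I)

end

/-! ### Closure properties of linear combinations of contractions -/

section

namespace NetComb

variable {m : ℕ} {ρ ρ' : Type} [Fintype ρ] [DecidableEq ρ] [Fintype ρ'] [DecidableEq ρ']
variable {v : ρ → Bool} {v' : ρ' → Bool} {w w' L L' : ℕ} {S T : Fam m ρ} {S' T' : Fam m ρ'}

theorem congr (h : NetComb m v w L S)
    (e : ∀ (A : Type) [CommRing A] [Algebra ℝ A] (𝔤 : Geom (Fin m) A) I, S A 𝔤 I = T A 𝔤 I) :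
    NetComb m v w L T := by
  have : S = T := by funext A _ _ 𝔤 I; exact e A 𝔤 I
  rwa [← this]

theorem of_net (N : Net ρ) (hw : N.weight = w) (hL : L ≤ Fintype.card N.κ) :
    NetComb m v w L (N.eval v) :=
  (NetComb.cons 1 N hw hL .zero).congr fun A _ _ 𝔤 I => by simp

theorem add (hS : NetComb m v w L S) (hT : NetComb m v w L T) :
    NetComb m v w L (fun A _ _ 𝔤 I => S A 𝔤 I + T A 𝔤 I) := by
  induction hS with
  | zero => exact hT.congr fun A _ _ 𝔤 I => by simp
  | cons c N hw hL _ ih =>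
    refine (NetComb.cons c N hw hL ih).congr (fun A _ _ 𝔤 I => ?_)
    exact (add_assoc _ _ _).symm

theorem smul (c : ℝ) (hT : NetComb m v w L T) :
    NetComb m v w L (fun A _ _ 𝔤 I => c • T A 𝔤 I) := by
  induction hT with
  | zero => exact NetComb.zero.congr fun A _ _ 𝔤 I => by simp
  | cons c' N hw hL _ ih =>
    refine (NetComb.cons (c * c') N hw hL ih).congr (fun A _ _ 𝔤 I => ?_)
    simp only [smul_add, mul_smul]

theorem mono (h : L' ≤ L) (hT : NetComb m v w L T) : NetComb m v w L' T := by
  induction hT with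
  | zero => exact .zero
  | cons c N hw hL _ ih => exact .cons c N hw (h.trans hL) ih

/-- An additive operation preserves linear combinations of contractions if it maps contractions to
such combinations. -/
theorem map (Op : Fam m ρ → Fam m ρ')
    (h0 : ∀ (A : Type) [CommRing A] [Algebra ℝ A] (𝔤 : Geom (Fin m) A) I,
      Op (fun _ _ _ _ _ => 0) A 𝔤 I = 0)
    (hadd : ∀ (c : ℝ) (S T : Fam m ρ) (A : Type) [CommRing A] [Algebra ℝ A] (𝔤 : Geom (Fin m) A) I,
      Op (fun A _ _ 𝔤 I => c • S A 𝔤 I + T A 𝔤 I) A 𝔤 I = c • Op S A 𝔤 I + Op T A 𝔤 I)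
    (hN : ∀ N : Net ρ, N.weight = w → L ≤ Fintype.card N.κ → NetComb m v' w' L' (Op (N.eval v)))
    (hT : NetComb m v w L T) : NetComb m v' w' L' (Op T) := by
  induction hT with
  | zero => exact NetComb.zero.congr fun A _ _ 𝔤 I => (h0 A 𝔤 I).symm
  | cons c N hw hL _ ih =>
    exact (((hN N hw hL).smul c).add ih).congr fun A _ _ 𝔤 I => (hadd c _ _ A 𝔤 I).symm

end NetComb

section generators

variable {m : ℕ} {A : Type*} [CommRing A] [Algebra ℝ A] (𝔤 : Geom (Fin m) A)

theorem sum_outerW_lower (i a : Fin m) : ∑ b, outerW 𝔤 false i b * 𝔤.gi a b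
    = if i = a then 1 else 0 := by
  rw [← 𝔤.sum_g_gi]
  exact Finset.sum_congr rfl fun b _ => by rw [𝔤.gi_symm]; rfl

theorem sum_fin_two (f : (Fin 2 → Fin m) → A) : ∑ b, f b = ∑ i, ∑ j, f ![i, j] := by
  rw [← Fintype.sum_prod_type' (f := fun i j => f ![i, j])]
  refine Fintype.sum_equiv (finTwoArrowEquiv (Fin m)) _ _ fun b => ?_
  congr 1
  ext e; fin_cases e <;> rfl

end generators

variable {m : ℕ} {ρ ρ' : Type} [Fintype ρ] [DecidableEq ρ] [Fintype ρ'] [DecidableEq ρ']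

theorem ends_univ_inl_inr (X : Type*) [Fintype X] :
    ends ((Finset.univ : Finset X).val.map fun s => ((Sum.inl s : X ⊕ X), (Sum.inr s : X ⊕ X)))
      = (Finset.univ : Finset (X ⊕ X)).val := by
  rw [ends, Multiset.map_map, Multiset.map_map]
  rfl

/-- The contraction that consists of one factor. -/
def Net.single (k : ℕ) : Net (Fin (4 + k)) where
  κ := Unit
  order := fun _ => k
  pairs := (Finset.univ : Finset (Fin (4 + k))).val.map fun s => (Sum.inl ⟨(), s⟩, Sum.inr s)
  perfect := by
    have e := ends_univ_inl_inr (Fin (4 + k))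
    let φ : (Fin (4 + k) ⊕ Fin (4 + k)) ≃ (Σ _ : Unit, Fin (4 + k)) ⊕ Fin (4 + k) :=
      Equiv.sumCongr ⟨fun s => ⟨(), s⟩, fun p => p.2, fun _ => rfl, fun _ => rfl⟩ (Equiv.refl _)
    have e2 := congrArg (Multiset.map φ) e
    rw [← ends_map, Multiset.map_map] at e2
    refine Eq.trans ?_ (e2.trans ?_)
    · rfl
    · have := Finset.map_univ_equiv φ
      rw [← this]; rfl

/-- Each free lower index is attached by a metric, which cancels the inverse metric on the edge
leading to it. -/
theorem Net.single_eval (k : ℕ) {A : Type} [CommRing A] [Algebra ℝ A] (𝔤 : Geom (Fin m) A)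
    (I : Fin (4 + k) → Fin m) : (Net.single k).eval (fun _ => false) A 𝔤 I = 𝔤.covRm k I := by
  let ψ : (Fin (4 + k) → Fin m) ≃ ((Net.single k).Slot → Fin m) :=
    ⟨fun a p => a p.2, fun a s => a ⟨(), s⟩, fun _ => rfl, fun _ => rfl⟩
  have h1 : ∀ b : Fin (4 + k) → Fin m, netKer 𝔤 ((Net.single k).factors 𝔤) (Net.single k).pairs b
      = ∑ a : Fin (4 + k) → Fin m, 𝔤.covRm k a * ∏ s, 𝔤.gi (a s) (b s) := by
    intro b
    refine (Fintype.sum_equiv ψ _ _ fun a => ?_).symm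
    congr 1
    · change 𝔤.covRm k a = ∏ _j : Unit, 𝔤.covRm k fun s => a s
      simp
    · simp only [pairW, Net.single, Multiset.map_map]
      rfl
  simp only [Net.eval, netEval, h1, Finset.mul_sum]
  rw [Finset.sum_comm]
  have h2 : ∀ a : Fin (4 + k) → Fin m,
      ∑ b : Fin (4 + k) → Fin m, (∏ e, outerW 𝔤 false (I e) (b e)) *
        (𝔤.covRm k a * ∏ s, 𝔤.gi (a s) (b s)) = if I = a then 𝔤.covRm k a else 0 := by
    intro a
    have : ∀ b : Fin (4 + k) → Fin m, (∏ e, outerW 𝔤 false (I e) (b e)) *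
        (𝔤.covRm k a * ∏ s, 𝔤.gi (a s) (b s))
        = 𝔤.covRm k a * ∏ s, outerW 𝔤 false (I s) (b s) * 𝔤.gi (a s) (b s) := by
      intro b; rw [Finset.prod_mul_distrib]; ring
    simp only [this, ← Finset.mul_sum]
    have hp : ∑ b : Fin (4 + k) → Fin m, ∏ s, outerW 𝔤 false (I s) (b s) * 𝔤.gi (a s) (b s)
        = ∏ s, if I s = a s then 1 else 0 := by
      simp only [← sum_outerW_lower 𝔤]
      rw [Finset.prod_univ_sum, Fintype.piFinset_univ]
    rw [hp]
    split_ifs with h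
    · subst h; simp
    · obtain ⟨s, hs⟩ := Function.ne_iff.mp h
      rw [Finset.prod_eq_zero (Finset.mem_univ s) (if_neg hs), mul_zero]
  simp only [h2]
  simp

/-- The contraction without factors that pairs two free slots. -/
def Net.edge : Net (Fin 2) where
  κ := Empty
  order := fun j => j.elim
  pairs := {(Sum.inr 0, Sum.inr 1)}
  perfect := by
    refine (Multiset.Nodup.ext (by simp [ends]) Finset.univ.nodup).mpr ?_
    rintro (⟨j, -⟩ | e)
    · exact j.elim
    · fin_cases e <;> simp [ends]

/-- The same net represents the metric, with both free slots lower, and its inverse, with both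
upper. -/
theorem Net.edge_eval (v : Fin 2 → Bool) {A : Type} [CommRing A] [Algebra ℝ A]
    (𝔤 : Geom (Fin m) A) (I : Fin 2 → Fin m) : Net.edge.eval v A 𝔤 I
      = ∑ i, ∑ j, outerW 𝔤 (v 0) (I 0) i * outerW 𝔤 (v 1) (I 1) j * 𝔤.gi i j := by
  have h1 : ∀ b : Fin 2 → Fin m, netKer 𝔤 (Net.edge.factors 𝔤) Net.edge.pairs b
      = 𝔤.gi (b 0) (b 1) := by
    intro b
    have : IsEmpty Net.edge.Slot := ⟨fun p => p.1.elim⟩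
    rw [netKer, Fintype.sum_unique]
    have : Net.edge.factors 𝔤 default = 1 := Fintype.prod_empty (ι := Empty) _
    rw [this]
    simp [pairW, Net.edge]
  simp only [Net.eval, netEval, h1, sum_fin_two, Fin.prod_univ_two]
  rfl

theorem NetComb.curv (k : ℕ) : NetComb m (fun _ : Fin (4 + k) => false) (k + 2) 1
    (fun _ _ _ 𝔤 => 𝔤.covRm k) :=
  (NetComb.of_net (Net.single k) (Fintype.sum_unique (ι := Unit) fun _ => k + 2)
    (le_of_eq (Fintype.card_unit).symm)).congr
    fun _ _ _ 𝔤 I => Net.single_eval k 𝔤 I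

theorem NetComb.metric : NetComb m (fun _ : Fin 2 => false) 0 0
    (fun _ _ _ 𝔤 I => 𝔤.g (I 0) (I 1)) :=
  (NetComb.of_net Net.edge (by simp [Net.weight, Net.edge]) (by simp [Net.edge])).congr
    fun A _ _ 𝔤 I => by
      rw [Net.edge_eval]
      simp only [mul_assoc, ← Finset.mul_sum, sum_outerW_lower]
      simp [outerW, 𝔤.symm]

theorem NetComb.inv : NetComb m (fun _ : Fin 2 => true) 0 0
    (fun _ _ _ 𝔤 I => 𝔤.gi (I 0) (I 1)) :=
  (NetComb.of_net Net.edge (by simp [Net.weight, Net.edge]) (by simp [Net.edge])).congr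
    fun A _ _ 𝔤 I => by
      rw [Net.edge_eval]
      simp [outerW]

/-- Renaming the free indices of a contraction. -/
def Net.rename (N : Net ρ) (σ : ρ ≃ ρ') : Net ρ' where
  κ := N.κ
  order := N.order
  pairs := N.pairs.map (Prod.map (Sum.map id σ) (Sum.map id σ))
  perfect := by
    rw [ends_map, N.perfect]
    have := Finset.map_univ_equiv (Equiv.sumCongr (Equiv.refl N.Slot) σ)
    rw [← this]; rfl

theorem Net.rename_eval (N : Net ρ) (σ : ρ ≃ ρ') (v' : ρ' → Bool) {A : Type} [CommRing A]
    [Algebra ℝ A] (𝔤 : Geom (Fin m) A) (I : ρ' → Fin m) :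
    (N.rename σ).eval v' A 𝔤 I = N.eval (v' ∘ σ) A 𝔤 (I ∘ σ) := by
  refine Fintype.sum_equiv (σ.symm.arrowCongr (Equiv.refl (Fin m))) _ _ fun b => ?_
  congr 1
  · refine (Fintype.prod_equiv σ _ _ fun e => ?_).symm
    simp
  · refine Finset.sum_congr rfl fun a _ => ?_
    congr 1
    refine (pairW_map 𝔤 _ _ _).trans (congrArg _ ?_)
    funext y
    rcases y with y | y <;> rfl

theorem NetComb.reindex (v' : ρ' → Bool) {w L : ℕ} {T : Fam m ρ} (σ : ρ ≃ ρ')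
    (hT : NetComb m (v' ∘ σ) w L T) :
    NetComb m v' w L (fun A _ _ 𝔤 I => T A 𝔤 (I ∘ σ)) :=
  hT.map (fun T A _ _ 𝔤 I => T A 𝔤 (I ∘ σ)) (fun _ _ _ _ _ => rfl) (fun _ _ _ _ _ _ _ _ => rfl)
    fun N hw hL => (NetComb.of_net (N.rename σ) hw hL).congr fun _ _ _ 𝔤 I =>
      N.rename_eval σ v' 𝔤 I

/-- The product of two contractions. -/
def Net.prod (N : Net ρ) (N' : Net ρ') : Net (ρ ⊕ ρ') where
  κ := N.κ ⊕ N'.κ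
  order := Sum.elim N.order N'.order
  pairs := N.pairs.map (Prod.map (Sum.map (fun p => ⟨Sum.inl p.1, p.2⟩) Sum.inl)
      (Sum.map (fun p => ⟨Sum.inl p.1, p.2⟩) Sum.inl))
    + N'.pairs.map (Prod.map (Sum.map (fun p => ⟨Sum.inr p.1, p.2⟩) Sum.inr)
      (Sum.map (fun p => ⟨Sum.inr p.1, p.2⟩) Sum.inr))
  perfect := by
    rw [ends_add, ends_map, ends_map, N.perfect, N'.perfect]
    refine (Multiset.Nodup.ext ?_ Finset.univ.nodup).mpr ?_
    · refine Multiset.nodup_add.mpr ⟨Finset.univ.nodup.map ?_, Finset.univ.nodup.map ?_, ?_⟩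
      · rintro (⟨p, s⟩ | e) (⟨p', s'⟩ | e') h
        · have h' := Sigma.mk.inj_iff.mp (Sum.inl.inj h)
          obtain rfl : p = p' := Sum.inl.inj h'.1
          obtain rfl : s = s' := eq_of_heq h'.2
          rfl
        · exact (Sum.inl_ne_inr h).elim
        · exact (Sum.inr_ne_inl h).elim
        · rw [Sum.inl.inj (Sum.inr.inj h)]
      · rintro (⟨p, s⟩ | e) (⟨p', s'⟩ | e') h
        · have h' := Sigma.mk.inj_iff.mp (Sum.inl.inj h)
          obtain rfl : p = p' := Sum.inr.inj h'.1
          obtain rfl : s = s' := eq_of_heq h'.2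
          rfl
        · exact (Sum.inl_ne_inr h).elim
        · exact (Sum.inr_ne_inl h).elim
        · rw [Sum.inr.inj (Sum.inr.inj h)]
      · rw [Multiset.disjoint_left]
        intro y h1 h2
        rw [Multiset.mem_map] at h1 h2
        obtain ⟨y1, -, rfl⟩ := h1
        obtain ⟨y2, -, h⟩ := h2
        rcases y1 with ⟨p, s⟩ | e <;> rcases y2 with ⟨p', s'⟩ | e'
        · exact Sum.inr_ne_inl (congrArg Sigma.fst (Sum.inl.inj h))
        · exact Sum.inr_ne_inl h
        · exact Sum.inl_ne_inr h
        · exact Sum.inr_ne_inl (Sum.inr.inj h)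
    · rintro (⟨p | p, s⟩ | e | e) <;>
        simp only [Multiset.mem_add, Multiset.mem_map, Finset.mem_val, Finset.mem_univ, true_and,
          iff_true]
      · exact Or.inl ⟨Sum.inl ⟨p, s⟩, rfl⟩
      · exact Or.inr ⟨Sum.inl ⟨p, s⟩, rfl⟩
      · exact Or.inl ⟨Sum.inr e, rfl⟩
      · exact Or.inr ⟨Sum.inr e, rfl⟩

theorem sum_arrow_sum {X Y : Type*} [Fintype X] [DecidableEq X] [Fintype Y] [DecidableEq Y]
    {A : Type*} [CommRing A] (f : (X → Fin m) → A) (g : (Y → Fin m) → A) :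
    ∑ b : X ⊕ Y → Fin m, f (b ∘ Sum.inl) * g (b ∘ Sum.inr) = (∑ b, f b) * ∑ b, g b := by
  rw [Finset.sum_mul_sum, ← Fintype.sum_prod_type' (f := fun i j => f i * g j)]
  exact Fintype.sum_equiv (Equiv.sumArrowEquivProdArrow X Y (Fin m)) _ _ fun b => rfl

theorem Net.prod_eval (N : Net ρ) (N' : Net ρ') (v : ρ → Bool) (v' : ρ' → Bool) {A : Type}
    [CommRing A] [Algebra ℝ A] (𝔤 : Geom (Fin m) A) (I : ρ ⊕ ρ' → Fin m) :
    (N.prod N').eval (Sum.elim v v') A 𝔤 I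
      = N.eval v A 𝔤 (I ∘ Sum.inl) * N'.eval v' A 𝔤 (I ∘ Sum.inr) := by
  have hk : ∀ b : ρ ⊕ ρ' → Fin m,
      netKer 𝔤 ((N.prod N').factors 𝔤) (N.prod N').pairs b
        = netKer 𝔤 (N.factors 𝔤) N.pairs (b ∘ Sum.inl)
          * netKer 𝔤 (N'.factors 𝔤) N'.pairs (b ∘ Sum.inr) := by
    intro b
    unfold netKer
    rw [← sum_arrow_sum]
    let θ : (N.prod N').Slot ≃ N.Slot ⊕ N'.Slot :=
      Equiv.sumSigmaDistrib (fun j : N.κ ⊕ N'.κ => Fin (4 + Sum.elim N.order N'.order j))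
    refine Fintype.sum_equiv (θ.arrowCongr (Equiv.refl (Fin m))) _ _ fun a => ?_
    have hf : (N.prod N').factors 𝔤 a
        = N.factors 𝔤 ((θ.arrowCongr (Equiv.refl (Fin m))) a ∘ Sum.inl)
          * N'.factors 𝔤 ((θ.arrowCongr (Equiv.refl (Fin m))) a ∘ Sum.inr) :=
      Fintype.prod_sum_type _
    have hp : pairW 𝔤 (N.prod N').pairs (Sum.elim a b)
        = pairW 𝔤 N.pairs (Sum.elim ((θ.arrowCongr (Equiv.refl (Fin m))) a ∘ Sum.inl)
            (b ∘ Sum.inl))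
          * pairW 𝔤 N'.pairs (Sum.elim ((θ.arrowCongr (Equiv.refl (Fin m))) a ∘ Sum.inr)
            (b ∘ Sum.inr)) := by
      refine (pairW_add 𝔤 _ _ _).trans (congrArg₂ (· * ·) ((pairW_map 𝔤 _ _ _).trans ?_)
        ((pairW_map 𝔤 _ _ _).trans ?_)) <;>
      · congr 1
        funext y
        rcases y with y | y <;> rfl
    rw [hf, hp]; ring
  simp only [Net.eval, netEval]
  rw [← sum_arrow_sum]
  refine Finset.sum_congr rfl fun b _ => ?_
  rw [hk, Fintype.prod_sum_type]
  simp only [Function.comp_apply, Sum.elim_inl, Sum.elim_inr]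
  ring

theorem NetComb.mul {v : ρ → Bool} {v' : ρ' → Bool} {w w' L L' : ℕ} {S : Fam m ρ} {T : Fam m ρ'}
    (hS : NetComb m v w L S) (hT : NetComb m v' w' L' T) :
    NetComb m (Sum.elim v v') (w + w') (L + L')
      (fun A _ _ 𝔤 I => S A 𝔤 (I ∘ Sum.inl) * T A 𝔤 (I ∘ Sum.inr)) := by
  refine hS.map (fun S A _ _ 𝔤 I => S A 𝔤 (I ∘ Sum.inl) * T A 𝔤 (I ∘ Sum.inr))
    (fun _ _ _ _ _ => by simp) (fun _ _ _ _ _ _ _ _ => by simp [add_mul]) fun N hw hL => ?_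
  refine hT.map (fun T A _ _ 𝔤 I => N.eval v A 𝔤 (I ∘ Sum.inl) * T A 𝔤 (I ∘ Sum.inr))
    (fun _ _ _ _ _ => by simp) (fun _ _ _ _ _ _ _ _ => by simp [mul_add]) fun N' hw' hL' => ?_
  refine (NetComb.of_net (N.prod N') ?_ ?_).congr fun _ _ _ 𝔤 I => N.prod_eval N' v v' 𝔤 I
  · rw [← hw, ← hw']; exact Fintype.sum_sum_type _
  · exact (add_le_add hL hL').trans_eq Fintype.card_sum.symm

theorem sum_ocons {A : Type*} [CommRing A] (f : (Option ρ → Fin m) → A) :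
    ∑ b, f b = ∑ k, ∑ b, f (ocons k b) := by
  rw [← Fintype.sum_prod_type' (f := fun k b => f (ocons k b))]
  refine Fintype.sum_equiv (Equiv.piOptionEquivProd (β := fun _ => Fin m)) _ _ fun b => ?_
  congr 1
  funext o; cases o <;> rfl

theorem sum_rotate {A β : Type*} [CommRing A] [Fintype β] (f : β → Fin m → Fin m → Fin m → A) :
    ∑ b, ∑ i, ∑ j, ∑ k, f b i j k = ∑ k, ∑ i, ∑ j, ∑ b, f b i j k := by
  rw [Finset.sum_comm]
  conv_rhs => rw [Finset.sum_comm]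
  refine Finset.sum_congr rfl fun i _ => ?_
  rw [Finset.sum_comm]
  conv_rhs => rw [Finset.sum_comm]
  exact Finset.sum_congr rfl fun j _ => Finset.sum_comm

/-- Summing over an upper and a lower free index inserts a metric between the two free slots.
`exists_merge` absorbs it without touching the curvature factors, so weight and number of factors
persist. -/
theorem NetComb.trace {v : ρ → Bool} {w L : ℕ} {T : Fam m (Option (Option ρ))}
    (hT : NetComb m (ocons true (ocons false v)) w L T) :
    NetComb m v w L (fun A _ _ 𝔤 I => ∑ k, T A 𝔤 (ocons k (ocons k I))) := by
  refine hT.map (fun T A _ _ 𝔤 I => ∑ k, T A 𝔤 (ocons k (ocons k I)))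
    (fun _ _ _ _ _ => by simp)
    (fun _ _ _ _ _ _ _ _ => by simp [Finset.sum_add_distrib, Finset.smul_sum]) fun N hw hL => ?_
  -- Moves the two contracted slots to the outermost positions, the form that `exists_merge`
  -- expects.
  let θ : N.Slot ⊕ Option (Option ρ) ≃ Option (Option (N.Slot ⊕ ρ)) :=
    { toFun := Sum.elim (fun x => some (some (Sum.inl x)))
        (fun o => o.elim none (fun o => o.elim (some none) (fun e => some (some (Sum.inr e)))))
      invFun := fun o => o.elim (Sum.inr none) (fun o => o.elim (Sum.inr (some none))
        (fun y => Sum.map id (fun e => some (some e)) y))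
      left_inv := by rintro (x | _ | _ | e) <;> rfl
      right_inv := by rintro (_ | _ | x | e) <;> rfl }
  obtain ⟨c, P', hP', hc⟩ := exists_merge (m := m) (Z := N.Slot ⊕ ρ)
    (P := N.pairs.map (Prod.map θ θ)) (by
      rw [ends_map, N.perfect, ← Finset.map_univ_equiv θ]; rfl)
  refine ((NetComb.of_net ⟨N.κ, N.order, P', hP'⟩ hw hL).smul c).congr fun A _ _ 𝔤 I => ?_
  have hk : ∀ b : ρ → Fin m, ∑ i, ∑ j, 𝔤.g i j *
      netKer 𝔤 (N.factors 𝔤) N.pairs (ocons i (ocons j b)) = c • netKer 𝔤 (N.factors 𝔤) P' b := by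
    intro b
    simp only [netKer, Finset.mul_sum, Finset.smul_sum]
    have : ∀ i, ∑ j, ∑ a : N.Slot → Fin m, 𝔤.g i j * (N.factors 𝔤 a *
        pairW 𝔤 N.pairs (Sum.elim a (ocons i (ocons j b))))
        = ∑ a : N.Slot → Fin m, ∑ j, 𝔤.g i j * (N.factors 𝔤 a *
        pairW 𝔤 N.pairs (Sum.elim a (ocons i (ocons j b)))) := fun i => Finset.sum_comm
    simp only [this]
    rw [Finset.sum_comm]
    refine Finset.sum_congr rfl fun a _ => ?_
    rw [← mul_smul_comm, ← hc, Finset.mul_sum]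
    refine Finset.sum_congr rfl fun i _ => ?_
    rw [Finset.mul_sum]
    refine Finset.sum_congr rfl fun j _ => ?_
    rw [pairW_map, mul_left_comm]
    congr 3
    funext y
    rcases y with x | _ | _ | e <;> rfl
  have hδ : ∀ i j : Fin m, ∑ k, outerW 𝔤 true k i * outerW 𝔤 false k j = 𝔤.g i j := by
    intro i j; simp [outerW]
  calc c • Net.eval ⟨N.κ, N.order, P', hP'⟩ v A 𝔤 I
      = ∑ b : ρ → Fin m, (∏ e, outerW 𝔤 (v e) (I e) (b e)) *
          (c • netKer 𝔤 (N.factors 𝔤) P' b) := by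
        simp only [mul_smul_comm, ← Finset.smul_sum]; rfl
    _ = ∑ b : ρ → Fin m, ∑ i, ∑ j, ∑ k, (∏ e, outerW 𝔤 (v e) (I e) (b e)) *
          (outerW 𝔤 true k i * outerW 𝔤 false k j *
            netKer 𝔤 (N.factors 𝔤) N.pairs (ocons i (ocons j b))) := by
        refine Finset.sum_congr rfl fun b _ => ?_
        simp only [← hk, ← hδ, Finset.mul_sum, Finset.sum_mul]
    _ = ∑ k, ∑ i, ∑ j, ∑ b : ρ → Fin m, (∏ e, outerW 𝔤 (v e) (I e) (b e)) *
          (outerW 𝔤 true k i * outerW 𝔤 false k j *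
            netKer 𝔤 (N.factors 𝔤) N.pairs (ocons i (ocons j b))) := by
        exact sum_rotate _
    _ = ∑ k, N.eval (ocons true (ocons false v)) A 𝔤 (ocons k (ocons k I)) := by
        refine Finset.sum_congr rfl fun k _ => ?_
        rw [Net.eval, netEval, sum_ocons]
        refine Finset.sum_congr rfl fun i _ => ?_
        rw [sum_ocons]
        refine Finset.sum_congr rfl fun j _ => Finset.sum_congr rfl fun b _ => ?_
        rw [Fintype.prod_option, Fintype.prod_option]
        simp only [ocons_none, ocons_some]
        ring

/-- Every natural tensor is a linear combination of contractions. -/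
theorem Natl.netComb {v : ρ → Bool} {w L : ℕ} {T : Fam m ρ} (h : Natl m v w L T) :
    NetComb m v w L T := by
  induction h with
  | curv k => exact .curv k
  | metric => exact .metric
  | inv => exact .inv
  | zero => exact .zero
  | add _ _ h₁ h₂ => exact h₁.add h₂
  | smul c _ h => exact h.smul c
  | mul _ _ h₁ h₂ => exact h₁.mul h₂
  | trace _ h => exact h.trace
  | reindex v' σ _ h => exact h.reindex v' σ
  | mono hL _ h => exact h.mono hL

end

/-! ### From nets with two lower indices to curvature polynomials -/

section

/-- The value of a curvature contraction over an algebra. -/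
def CurvatureContraction.aeval {n : ℕ} (C : CurvatureContraction n) {A : Type*} [CommRing A]
    [Algebra ℝ A] (𝔤 : Geom (Fin (n + 1)) A) (I : Fin 2 → Fin (n + 1)) : A :=
  ∑ a : ((Σ j : Fin C.numFactors, Fin (4 + C.order j)) ⊕ Fin 2) → Fin (n + 1),
    (∏ j, 𝔤.covRm (C.order j) (fun s => a (Sum.inl ⟨j, s⟩)))
      * (∏ e : Fin 2, 𝔤.g (I e) (a (Sum.inr e)))
      * ∏ k, 𝔤.gi (a (C.pairing (k, 0))) (a (C.pairing (k, 1)))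

/-- Enumerating the factors and the pairs is all that is needed. Weight n + 1 says that the orders
plus twice the number l of factors add up to n + 1, which gives both the required sum of orders and
the bound l ≤ (n + 1)/2. -/
theorem Net.exists_contraction {n : ℕ} (N : Net (Fin 2)) (hw : N.weight = n + 1)
    (hL : 2 ≤ Fintype.card N.κ) :
    ∃ C : CurvatureContraction n, ∀ (A : Type) [CommRing A] [Algebra ℝ A]
      (𝔤 : Geom (Fin (n + 1)) A) (I : Fin 2 → Fin (n + 1)),
      N.eval (fun _ => false) A 𝔤 I = C.aeval 𝔤 I := by
  let e : Fin (Fintype.card N.κ) ≃ N.κ := (Fintype.equivFin N.κ).symm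
  let φ : (Σ j, Fin (4 + N.order (e j))) ≃ N.Slot :=
    Equiv.sigmaCongrLeft (β := fun j => Fin (4 + N.order j)) e
  let ψ : (Σ j, Fin (4 + N.order (e j))) ⊕ Fin 2 ≃ N.Slot ⊕ Fin 2 :=
    Equiv.sumCongr φ (Equiv.refl _)
  let ls := N.pairs.toList
  have hls : (ls : Multiset _) = N.pairs := N.pairs.coe_toList
  let p : Fin ls.length × Fin 2 → N.Slot ⊕ Fin 2 := fun q => ![ls[q.1].1, ls[q.1].2] q.2
  -- Every slot is the end of some pair, and there are exactly twice as many slots as pairs, so no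
  -- slot occurs twice.
  have hp : Function.Bijective p := by
    rw [Fintype.bijective_iff_surjective_and_card]
    constructor
    · intro y
      have hy : y ∈ ends N.pairs := by rw [N.perfect]; exact Finset.mem_univ y
      rw [← hls, ends, Multiset.mem_add, Multiset.mem_map, Multiset.mem_map] at hy
      obtain ⟨q, hq, rfl⟩ | ⟨q, hq, rfl⟩ := hy
      · obtain ⟨i, hi, rfl⟩ := List.getElem_of_mem (Multiset.mem_coe.mp hq)
        exact ⟨(⟨i, hi⟩, 0), rfl⟩
      · obtain ⟨i, hi, rfl⟩ := List.getElem_of_mem (Multiset.mem_coe.mp hq)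
        exact ⟨(⟨i, hi⟩, 1), rfl⟩
    · have h := congrArg Multiset.card N.perfect
      rw [← hls, ends, Multiset.card_add, Multiset.card_map, Multiset.card_map,
        Multiset.coe_card] at h
      rw [Fintype.card_prod, Fintype.card_fin, Fintype.card_fin, mul_two, h]
      rfl
  have hsum : ∑ j, N.order (e j) + 2 * Fintype.card N.κ = n + 1 := by
    have h1 : ∑ j, N.order (e j) = ∑ j, N.order j := Equiv.sum_comp e _
    rw [h1, ← hw, Net.weight, Finset.sum_add_distrib, Finset.sum_const, Finset.card_univ,
      smul_eq_mul, mul_comm]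
  refine ⟨⟨Fintype.card N.κ, hL, by omega, fun j => N.order (e j), by omega, ls.length,
    (Equiv.ofBijective p hp).trans ψ.symm⟩, fun A _ _ 𝔤 I => ?_⟩
  have h1 : N.eval (fun _ => false) A 𝔤 I = ∑ a : N.Slot ⊕ Fin 2 → Fin (n + 1),
      N.factors 𝔤 (a ∘ Sum.inl) * (∏ e : Fin 2, 𝔤.g (I e) (a (Sum.inr e)))
        * pairW 𝔤 N.pairs a := by
    have : ∀ b : Fin 2 → Fin (n + 1), (∏ e, outerW 𝔤 false (I e) (b e)) *
        netKer 𝔤 (N.factors 𝔤) N.pairs b = ∑ a : N.Slot → Fin (n + 1),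
          N.factors 𝔤 a * (∏ e : Fin 2, 𝔤.g (I e) (b e)) * pairW 𝔤 N.pairs (Sum.elim a b) := by
      intro b
      rw [netKer, Finset.mul_sum]
      refine Finset.sum_congr rfl fun a _ => ?_
      simp only [outerW]; simp only [Bool.false_eq_true, if_false]; ring
    simp only [Net.eval, netEval, this]
    rw [Finset.sum_comm, ← Fintype.sum_prod_type' (f := fun a b => N.factors 𝔤 a *
      (∏ e : Fin 2, 𝔤.g (I e) (b e)) * pairW 𝔤 N.pairs (Sum.elim a b))]
    refine (Fintype.sum_equiv (Equiv.sumArrowEquivProdArrow _ _ _) _ _ fun a => ?_).symm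
    congr 2
    funext y; rcases y with y | y <;> rfl
  rw [h1]
  refine (Fintype.sum_equiv (ψ.arrowCongr (Equiv.refl (Fin (n + 1)))) _ _ fun a => ?_).symm
  have hψ : ∀ y, (ψ.arrowCongr (Equiv.refl (Fin (n + 1)))) a y = a (ψ.symm y) := fun y => rfl
  congr 1
  · congr 1
    refine (Fintype.prod_equiv e _ _ fun j => ?_)
    congr 1
    funext s
    have : ψ.symm (Sum.inl ⟨e j, s⟩) = Sum.inl ⟨j, s⟩ := by
      rw [Equiv.symm_apply_eq]; rfl
    rw [Function.comp_apply, hψ, this]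
  · rw [pairW, ← hls, Multiset.map_coe, Multiset.prod_coe, ← Fin.prod_univ_fun_getElem]
    rfl

/-- The coefficients are read off from the derivation of `NetComb`, hence are independent of the
algebra and of the metric. -/
theorem NetComb.exists_polynomial {n : ℕ} {T : Fam (n + 1) (Fin 2)}
    (h : NetComb (n + 1) (fun _ => false) (n + 1) 2 T) :
    ∃ Q : CurvaturePolynomial n, ∀ (A : Type) [CommRing A] [Algebra ℝ A]
      (𝔤 : Geom (Fin (n + 1)) A) (I : Fin 2 → Fin (n + 1)),
      T A 𝔤 I = (Q.map fun t => t.1 • t.2.aeval 𝔤 I).sum := by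
  induction h with
  | zero => exact ⟨[], fun _ _ _ _ _ => rfl⟩
  | cons c N hw hL _ ih =>
    obtain ⟨Q, hQ⟩ := ih
    obtain ⟨C, hC⟩ := N.exists_contraction hw hL
    refine ⟨(c, C) :: Q, fun A _ _ 𝔤 I => ?_⟩
    beta_reduce
    rw [List.map_cons, List.sum_cons, hQ, hC]

/-! ### Covariant derivatives of natural tensors -/

namespace Geom

variable {ι A : Type*} [Fintype ι] [DecidableEq ι] [CommRing A] [Algebra ℝ A] (𝔤 : Geom ι A)
variable {ρ ρ' : Type*} [Fintype ρ] [DecidableEq ρ] [Fintype ρ'] [DecidableEq ρ']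

theorem nabla_zero (v : ρ → Bool) (i : ι) (I : ρ → ι) : 𝔤.nabla v (fun _ => 0) i I = 0 := by
  simp [nabla]

theorem nabla_add (v : ρ → Bool) (S T : (ρ → ι) → A) (i : ι) (I : ρ → ι) :
    𝔤.nabla v (fun I => S I + T I) i I = 𝔤.nabla v S i I + 𝔤.nabla v T i I := by
  simp only [nabla, map_add, mul_add, Finset.sum_add_distrib]; ring

theorem nabla_smul (v : ρ → Bool) (c : ℝ) (T : (ρ → ι) → A) (i : ι) (I : ρ → ι) :
    𝔤.nabla v (fun I => c • T I) i I = c • 𝔤.nabla v T i I := by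
  simp only [nabla, Derivation.map_smul, mul_smul_comm, ← Finset.smul_sum, smul_add]

theorem nabla_mul (v : ρ → Bool) (v' : ρ' → Bool) (S : (ρ → ι) → A) (T : (ρ' → ι) → A) (i : ι)
    (I : ρ ⊕ ρ' → ι) :
    𝔤.nabla (Sum.elim v v') (fun I => S (I ∘ Sum.inl) * T (I ∘ Sum.inr)) i I
      = 𝔤.nabla v S i (I ∘ Sum.inl) * T (I ∘ Sum.inr)
        + S (I ∘ Sum.inl) * 𝔤.nabla v' T i (I ∘ Sum.inr) := by
  have h1 : ∀ t s, Function.update I (Sum.inl t) s ∘ Sum.inl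
      = Function.update (I ∘ Sum.inl) t s :=
    fun t s => Function.update_comp_eq_of_injective _ Sum.inl_injective _ _
  have h2 : ∀ t s, Function.update I (Sum.inr t) s ∘ Sum.inr
      = Function.update (I ∘ Sum.inr) t s :=
    fun t s => Function.update_comp_eq_of_injective _ Sum.inr_injective _ _
  have h3 : ∀ t s, Function.update I (Sum.inl t) s ∘ Sum.inr = I ∘ Sum.inr := fun t s => by
    funext y; simp
  have h4 : ∀ t s, Function.update I (Sum.inr t) s ∘ Sum.inl = I ∘ Sum.inl := fun t s => by
    funext y; simp
  simp only [nabla, Fintype.sum_sum_type, Sum.elim_inl, Sum.elim_inr, h1, h2, h3, h4,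
    Derivation.leibniz, smul_eq_mul, add_mul, mul_add, Finset.sum_mul, Finset.mul_sum,
    Function.comp_apply, mul_left_comm (𝔤.conn _ _ _ _) (S (I ∘ Sum.inl)), mul_assoc]
  ring

/-- The connection terms on the contracted upper slot and on the contracted lower slot are opposite.
-/
theorem nabla_trace (v : ρ → Bool) (T : (Option (Option ρ) → ι) → A) (i : ι) (I : ρ → ι) :
    𝔤.nabla v (fun I => ∑ k, T (ocons k (ocons k I))) i I
      = ∑ k, 𝔤.nabla (ocons true (ocons false v)) T i (ocons k (ocons k I)) := by
  have u1 : ∀ (k l s : ι) (I : ρ → ι), Function.update (ocons k (ocons l I)) none s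
      = ocons s (ocons l I) := fun k l s I => by
    funext y; rcases y with _ | _ | y <;> simp [Function.update]
  have u2 : ∀ (k l s : ι) (I : ρ → ι), Function.update (ocons k (ocons l I)) (some none) s
      = ocons k (ocons s I) := fun k l s I => by
    funext y; rcases y with _ | _ | y <;> simp [Function.update]
  have u3 : ∀ (k l s : ι) (t : ρ) (I : ρ → ι),
      Function.update (ocons k (ocons l I)) (some (some t)) s
        = ocons k (ocons l (Function.update I t s)) := fun k l s t I => by
    funext y; rcases y with _ | _ | y <;> simp [Function.update]
  simp only [nabla, Fintype.sum_option, ocons_none, ocons_some, u1, u2, u3, map_sum,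
    Finset.sum_add_distrib, Finset.mul_sum]
  have hz : ∑ k, ∑ s, 𝔤.conn true i k s * T (ocons s (ocons k I))
      + ∑ k, ∑ s, 𝔤.conn false i k s * T (ocons k (ocons s I)) = 0 := by
    rw [Finset.sum_comm, ← Finset.sum_add_distrib]
    refine Finset.sum_eq_zero fun s _ => ?_
    rw [← Finset.sum_add_distrib]
    refine Finset.sum_eq_zero fun k _ => ?_
    simp [conn]
  have hc : ∑ t, ∑ s, ∑ k, 𝔤.conn (v t) i (I t) s * T (ocons k (ocons k (Function.update I t s)))
      = ∑ k, ∑ t, ∑ s,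
        𝔤.conn (v t) i (I t) s * T (ocons k (ocons k (Function.update I t s))) := by
    conv_rhs => rw [Finset.sum_comm]
    exact Finset.sum_congr rfl fun t _ => Finset.sum_comm
  rw [hc]
  linear_combination -hz

theorem nabla_reindex (v' : ρ' → Bool) (σ : ρ ≃ ρ') (T : (ρ → ι) → A) (i : ι) (I : ρ' → ι) :
    𝔤.nabla v' (fun I => T (I ∘ σ)) i I = 𝔤.nabla (v' ∘ σ) T i (I ∘ σ) := by
  simp only [nabla]
  congr 1
  refine (Fintype.sum_equiv σ _ _ fun t => ?_).symm
  refine Finset.sum_congr rfl fun s _ => ?_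
  rw [Function.update_comp_eq_of_injective _ σ.injective]
  rfl

theorem nabla_metric (i : ι) (I : Fin 2 → ι) :
    𝔤.nabla (fun _ => false) (fun I => 𝔤.g (I 0) (I 1)) i I = 0 := by
  simp only [nabla, Fin.sum_univ_two, conn, Bool.false_eq_true, if_false, D_g,
    Finset.sum_add_distrib, neg_mul, Finset.sum_neg_distrib, Function.update_self, ne_eq,
    one_ne_zero, not_false_eq_true, Function.update_of_ne, zero_ne_one]
  ring

theorem nabla_inv (i : ι) (I : Fin 2 → ι) :
    𝔤.nabla (fun _ => true) (fun I => 𝔤.gi (I 0) (I 1)) i I = 0 := by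
  simp only [nabla, Fin.sum_univ_two, conn, if_true, D_gi,
    Finset.sum_add_distrib, Function.update_self, ne_eq,
    one_ne_zero, not_false_eq_true, Function.update_of_ne, zero_ne_one]
  ring

end Geom

namespace Natl

variable {m : ℕ} {ρ ρ' : Type} [Fintype ρ] [DecidableEq ρ] [Fintype ρ'] [DecidableEq ρ']
variable {v : ρ → Bool} {v' : ρ' → Bool} {w w' L L' : ℕ} {S T : Fam m ρ} {S' T' : Fam m ρ'}

theorem congr (h : Natl m v w L S)
    (e : ∀ (A : Type) [CommRing A] [Algebra ℝ A] (𝔤 : Geom (Fin m) A) I, S A 𝔤 I = T A 𝔤 I) :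
    Natl m v w L T := by
  have : S = T := by funext A _ _ 𝔤 I; exact e A 𝔤 I
  rwa [← this]

theorem cast (h : Natl m v w L T) {u : ρ → Bool} (hv : v = u) (hw : w = w') :
    Natl m u w' L T := by
  subst hv hw; exact h

/-- Natural tensors are closed under covariant differentiation. -/
theorem nabla (h : Natl m v w L T) : Natl m (ocons false v) (w + 1) L
    (fun A _ _ 𝔤 J => 𝔤.nabla v (T A 𝔤) (J none) (J ∘ some)) := by
  induction h with
  | curv k =>
    -- `covRm` stores the index of differentiation last, while `ocons` stores it at `none`.
    refine ((Natl.curv (k + 1)).cast ?_ rfl).reindex (T := fun A _ _ 𝔤 => 𝔤.covRm (k + 1))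
      (ρ := Fin (4 + k + 1)) _ finSuccEquivLast |>.congr fun A _ _ 𝔤 I => ?_
    · funext t
      refine Fin.lastCases ?_ (fun t => ?_) t <;> simp
    · simp only [Geom.covRm]
      congr 1
      · simp
      · funext t; simp [Fin.init]
  | metric => exact (Natl.zero _ _ _).congr fun A _ _ 𝔤 I => (𝔤.nabla_metric _ _).symm
  | inv => exact (Natl.zero _ _ _).congr fun A _ _ 𝔤 I => (𝔤.nabla_inv _ _).symm
  | zero v => exact (Natl.zero _ _ _).congr fun A _ _ 𝔤 I => (𝔤.nabla_zero _ _ _).symm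
  | add _ _ h₁ h₂ => exact (h₁.add h₂).congr fun A _ _ 𝔤 I => (𝔤.nabla_add _ _ _ _ _).symm
  | smul c _ h => exact (h.smul c).congr fun A _ _ 𝔤 I => (𝔤.nabla_smul _ _ _ _ _).symm
  | @mul ρ ρ' _ _ _ _ v v' w w' L L' S T hS hT h₁ h₂ =>
    let σ₁ : Option ρ ⊕ ρ' ≃ Option (ρ ⊕ ρ') :=
      { toFun := Sum.elim (fun o => o.elim none (fun t => some (Sum.inl t)))
          (fun t => some (Sum.inr t))
        invFun := fun o => o.elim (Sum.inl none) (Sum.map some id)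
        left_inv := by rintro ((_ | t) | t) <;> rfl
        right_inv := by rintro (_ | t | t) <;> rfl }
    let σ₂ : ρ ⊕ Option ρ' ≃ Option (ρ ⊕ ρ') :=
      { toFun := Sum.elim (fun t => some (Sum.inl t))
          (fun o => o.elim none (fun t => some (Sum.inr t)))
        invFun := fun o => o.elim (Sum.inr none) (Sum.map id some)
        left_inv := by rintro (t | (_ | t)) <;> rfl
        right_inv := by rintro (_ | t | t) <;> rfl }
    have k₁ := ((h₁.mul hT).cast (w' := w + w' + 1)
      (u := ocons false (Sum.elim v v') ∘ σ₁) (by funext t; rcases t with (_ | t) | t <;> rfl)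
      (by ring)).reindex _ σ₁
    have k₂ := ((hS.mul h₂).cast (w' := w + w' + 1)
      (u := ocons false (Sum.elim v v') ∘ σ₂) (by funext t; rcases t with t | (_ | t) <;> rfl)
      (by ring)).reindex _ σ₂
    exact (k₁.add k₂).congr fun A _ _ 𝔤 I => 
      (𝔤.nabla_mul v v' (S A 𝔤) (T A 𝔤) (I none) (I ∘ some)).symm
  | @trace ρ _ _ v w L T _ h =>
    let σ : Option (Option (Option ρ)) ≃ Option (Option (Option ρ)) :=
      { toFun := fun o => o.elim (some (some none)) (fun o => o.elim none (fun o => o.elim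
          (some none) (fun t => some (some (some t)))))
        invFun := fun o => o.elim (some none) (fun o => o.elim (some (some none)) (fun o => o.elim
          none (fun t => some (some (some t)))))
        left_inv := by rintro (_ | _ | _ | t) <;> rfl
        right_inv := by rintro (_ | _ | _ | t) <;> rfl }
    have k := (h.cast (u := ocons true (ocons false (ocons false v)) ∘ σ)
      (by funext t; rcases t with _ | _ | _ | t <;> rfl) rfl).reindex _ σ
    refine k.trace.congr fun A _ _ 𝔤 I => ?_
    rw [Geom.nabla_trace]
    refine Finset.sum_congr rfl fun a _ => ?_
    congr 1
    funext t; rcases t with _ | _ | t <;> rfl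
  | @reindex ρ ρ' _ _ _ _ v' w L T σ _ h =>
    have k := (h.cast (u := ocons false v' ∘ σ.optionCongr)
      (by funext t; rcases t with _ | t <;> rfl) rfl).reindex _ σ.optionCongr
    exact k.congr fun A _ _ 𝔤 I => 
      (𝔤.nabla_reindex v' σ (T A 𝔤) (I none) (I ∘ some)).symm
  | mono hL _ h => exact h.mono hL

end Natl

end

section

/-! ### Orders of vanishing in `x` -/

section dvd

variable {A : Type*} [CommRing A]

theorem dvd_mul_sub_mul {p a b c d : A} (h₁ : p ∣ a - b) (h₂ : p ∣ c - d) :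
    p ∣ a * c - b * d := by
  have : a * c - b * d = (a - b) * c + b * (c - d) := by ring
  rw [this]
  exact dvd_add (h₁.mul_right _) (h₂.mul_left _)

theorem dvd_sum_sub_sum {ι : Type*} {s : Finset ι} {p : A} {f g : ι → A}
    (h : ∀ i, p ∣ f i - g i) : p ∣ ∑ i ∈ s, f i - ∑ i ∈ s, g i := by
  rw [← Finset.sum_sub_distrib]
  exact Finset.dvd_sum fun i _ => h i

theorem dvd_add_sub_add {p a b c d : A} (h₁ : p ∣ a - b) (h₂ : p ∣ c - d) :
    p ∣ (a + c) - (b + d) := by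
  rw [add_sub_add_comm]; exact dvd_add h₁ h₂

theorem dvd_sub_sub_sub {p a b c d : A} (h₁ : p ∣ a - b) (h₂ : p ∣ c - d) :
    p ∣ (a - c) - (b - d) := by
  rw [sub_sub_sub_comm]; exact dvd_sub h₁ h₂

theorem dvd_of_real_mul [Algebra ℝ A] {p a : A} {r : ℝ} (hr : r ≠ 0)
    (h : p ∣ algebraMap ℝ A r * a) : p ∣ a := by
  have : a = algebraMap ℝ A r⁻¹ * (algebraMap ℝ A r * a) := by
    rw [← mul_assoc, ← map_mul, inv_mul_cancel₀ hr, map_one, one_mul]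
  rw [this]
  exact h.mul_left _

theorem D_pow_dvd [Algebra ℝ A] {D : Derivation ℝ A A} {x : A} (hx : D x = 0) {s : ℕ}
    {a : A} (h : x ^ s ∣ a) : x ^ s ∣ D a := by
  obtain ⟨w, rfl⟩ := h
  rw [D.leibniz, D.leibniz_pow, hx]
  simp

/-- Modulo x^(s+1), the Euler operator x ∂_x acts on multiples of x^s as the scalar s. All indicial
factors below arise in this way. -/
theorem D_mul_pow_mul [Algebra ℝ A] {D : Derivation ℝ A A} {x : A} (hx : D x = 1) (s : ℕ)
    (a : A) : x * D (x ^ s * a) = s * (x ^ s * a) + x ^ (s + 1) * D a := by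
  rw [D.leibniz, D.leibniz_pow, hx]
  cases s with
  | zero => simp
  | succ s => simp only [smul_eq_mul, nsmul_eq_mul, Nat.add_sub_cancel]; ring

end dvd

namespace GeomPath

variable {m : ℕ} {A : Type*} [CommRing A] [Algebra ℝ A] (𝔥 : GeomPath m A)

theorem cov2_F_sub {s : ℕ} (h : ∀ a b, 𝔥.x ^ s ∣ 𝔥.F a b) (b a c : Fin (m + 1)) :
    𝔥.x ^ s ∣ 𝔥.cyl.cov2 𝔥.F b a c - 𝔥.cyl.D c (𝔥.F b a) := by
  rw [Geom.cov2, sub_sub_cancel_left, dvd_neg]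
  exact Finset.dvd_sum fun t _ => dvd_add ((h _ _).mul_left _) ((h _ _).mul_left _)

/-- Christoffel terms and tangential derivatives do not lower the order of vanishing; only the
normal derivative does. -/
theorem div_F_sub {s : ℕ} (h : ∀ a b, 𝔥.x ^ s ∣ 𝔥.F a b) (b : Fin (m + 1)) :
    𝔥.x ^ s ∣ ∑ a, ∑ c, 𝔥.cyl.gi a c * 𝔥.cyl.cov2 𝔥.F b a c - 𝔥.D₀ (𝔥.F b 0) := by
  have e : ∑ a, ∑ c, 𝔥.cyl.gi a c * 𝔥.cyl.cov2 𝔥.F b a c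
      = 𝔥.cyl.cov2 𝔥.F b 0 0
        + ∑ i, ∑ j, 𝔥.gi i j * 𝔥.cyl.cov2 𝔥.F b (Fin.succ i) (Fin.succ j) := by
    simp [Fin.sum_univ_succ]
  rw [e, add_sub_right_comm]
  refine dvd_add (𝔥.cov2_F_sub h b 0 0) (Finset.dvd_sum fun i _ => Finset.dvd_sum fun j _ => ?_)
  refine Dvd.dvd.mul_left ?_ _
  rw [← sub_add_cancel (𝔥.cyl.cov2 𝔥.F b i.succ j.succ) (𝔥.D j (𝔥.F b i.succ))]
  exact dvd_add (𝔥.cov2_F_sub h b _ _) (D_pow_dvd (𝔥.D_x j) (h _ _))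

/-- If the tangential components of the Einstein defect vanish to order `m - 1`, then so do the
other components. -/
theorem dvd_F_zero (h : ∀ i j : Fin m, 𝔥.x ^ (m - 1) ∣ 𝔥.F i.succ j.succ) (b : Fin (m + 1)) :
    𝔥.x ^ (m - 1) ∣ 𝔥.F 0 b := by
  -- Bootstrapping in the order s. Modulo x^(s+1) the Bianchi identity becomes (s - m) F_0i = 0 and
  -- (s + 1 - 2m) F_00 = 0, with scalars that are nonzero in this range.
  have key : ∀ s ≤ m - 1, ∀ b, 𝔥.x ^ s ∣ 𝔥.F 0 b := by
    intro s
    induction s with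
    | zero => intro _ b; simp
    | succ s ih =>
      intro hs
      have ih := ih (by omega)
      have hall : ∀ a b, 𝔥.x ^ s ∣ 𝔥.F a b := by
        intro a b
        refine Fin.cases (ih b) (fun i => ?_) a
        refine Fin.cases ?_ (fun j => ?_) b
        · rw [F_symm]; exact ih _
        · exact (pow_dvd_pow _ (by omega)).trans (h i j)
      have htr : 𝔥.cyl.tr 𝔥.F = 𝔥.F 0 0 + ∑ i, ∑ j, 𝔥.gi i j * 𝔥.F (Fin.succ i) (Fin.succ j) := by
        simp [Geom.tr, Fin.sum_univ_succ]
      set R := ∑ i, ∑ j, 𝔥.gi i j * 𝔥.F (Fin.succ i) (Fin.succ j) with hR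
      have hRd : 𝔥.x ^ (s + 1) ∣ R :=
        Finset.dvd_sum fun i _ => Finset.dvd_sum fun j _ =>
          Dvd.dvd.mul_left ((pow_dvd_pow _ hs).trans (h i j)) _
      intro b
      have hb := 𝔥.F_bianchi b
      have hd := mul_dvd_mul_left 𝔥.x (𝔥.div_F_sub hall b)
      rw [← pow_succ'] at hd
      obtain ⟨f, hf⟩ := ih b
      have hx := D_mul_pow_mul 𝔥.D₀_x s f
      rw [← hf] at hx
      rw [𝔥.F_symm b 0] at hd
      obtain rfl | ⟨i, rfl⟩ := b.eq_zero_or_eq_succ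
      · rw [if_pos rfl, htr, cyl_D_zero, map_add] at hb
        obtain ⟨r, hr⟩ := hRd
        have hxR := D_mul_pow_mul 𝔥.D₀_x (s + 1) r
        rw [← hr] at hxR
        have hne : ((s : ℝ) + 1 - 2 * m) ≠ 0 := by
          have : s + 1 + 1 ≤ 2 * m := by omega
          have h2 : (s : ℝ) + 1 + 1 ≤ 2 * m := by exact_mod_cast this
          intro h0; linarith
        refine dvd_of_real_mul hne ?_
        have e : algebraMap ℝ A ((s : ℝ) + 1 - 2 * m) * 𝔥.F 0 0
            = -(2 * (𝔥.x * (∑ a, ∑ c, 𝔥.cyl.gi a c * 𝔥.cyl.cov2 𝔥.F 0 a c - 𝔥.D₀ (𝔥.F 0 0))))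
              + (𝔥.x ^ (s + 1) * (𝔥.x * 𝔥.D₀ r - 𝔥.D₀ f + s * r)) := by
          simp only [map_sub, map_add, map_mul, map_natCast, map_one, map_ofNat]
          push_cast at hxR
          linear_combination 2 * hb - hx + hxR + (s : A) * hr
            + (𝔥.x * 𝔥.D₀ (𝔥.F 0 0) + 𝔥.x * 𝔥.D₀ R - 𝔥.F 0 0 - R) * two_mul_half (A := A)
        rw [e]
        exact dvd_add ((hd.mul_left _).neg_right) (dvd_mul_right _ _)
      · rw [if_neg (Fin.succ_ne_zero i).symm, cyl_D_succ] at hb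
        have hne : ((s : ℝ) - m) ≠ 0 := by
          have : s + 1 ≤ m := by omega
          have h2 : (s : ℝ) + 1 ≤ m := by exact_mod_cast this
          intro h0; linarith
        refine dvd_of_real_mul hne ?_
        have htrd : 𝔥.x ^ s ∣ 𝔥.D i (𝔥.cyl.tr 𝔥.F) := by
          refine D_pow_dvd (𝔥.D_x i) ?_
          rw [htr]
          exact dvd_add (ih 0) ((pow_dvd_pow _ s.le_succ).trans hRd)
        have htrd' := mul_dvd_mul_left 𝔥.x htrd
        rw [← pow_succ'] at htrd'
        have e : algebraMap ℝ A ((s : ℝ) - m) * 𝔥.F 0 i.succ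
            = -(𝔥.x * (∑ a, ∑ c, 𝔥.cyl.gi a c * 𝔥.cyl.cov2 𝔥.F i.succ a c
                - 𝔥.D₀ (𝔥.F 0 i.succ)))
              + half A * (𝔥.x * 𝔥.D i (𝔥.cyl.tr 𝔥.F)) - 𝔥.x ^ (s + 1) * 𝔥.D₀ f := by
          simp only [map_sub, map_natCast]
          linear_combination hb - hx
        rw [e]
        exact dvd_sub (dvd_add hd.neg_right (htrd'.mul_left _)) (dvd_mul_right _ _)
  exact key _ le_rfl b

/-! ### Dependence of the Einstein defect on the metric -/

variable {𝔥 𝔥' : GeomPath m A}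

/-- Two paths of metrics over the same algebra with derivations. -/
structure SameBase (𝔥 𝔥' : GeomPath m A) : Prop where
  D : 𝔥.D = 𝔥'.D
  D₀ : 𝔥.D₀ = 𝔥'.D₀
  x : 𝔥.x = 𝔥'.x

theorem gi_sub {s : ℕ} (hg : ∀ i j, 𝔥.x ^ s ∣ 𝔥.g i j - 𝔥'.g i j) (i j : Fin m) :
    𝔥.x ^ s ∣ 𝔥.gi i j - 𝔥'.gi i j := by
  have e : 𝔥.gi - 𝔥'.gi = -(𝔥.gi * (𝔥.g - 𝔥'.g) * 𝔥'.gi) := by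
    rw [mul_sub, sub_mul, 𝔥.inv_mul, one_mul, mul_assoc, 𝔥'.mul_inv, mul_one, neg_sub]
  have e2 : 𝔥.gi i j - 𝔥'.gi i j = -(𝔥.gi * (𝔥.g - 𝔥'.g) * 𝔥'.gi) i j := by rw [← Matrix.neg_apply, ← e]; rfl
  rw [e2, dvd_neg]
  simp only [Matrix.mul_apply]
  exact Finset.dvd_sum fun k _ => Dvd.dvd.mul_right (Finset.dvd_sum fun l _ => (hg l k).mul_left _) _

theorem Γ_sub_dvd {s : ℕ} (hb : SameBase 𝔥 𝔥') (hg : ∀ i j, 𝔥.x ^ s ∣ 𝔥.g i j - 𝔥'.g i j)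
    (k i j : Fin m) : 𝔥.x ^ s ∣ 𝔥.Γ k i j - 𝔥'.Γ k i j := by
  have hD : ∀ a b c, 𝔥.x ^ s ∣ 𝔥.D a (𝔥.g b c) - 𝔥'.D a (𝔥'.g b c) := by
    intro a b c
    rw [← hb.D, ← map_sub]
    exact D_pow_dvd (𝔥.D_x a) (hg b c)
  unfold Geom.Γ
  rw [← mul_sub]
  refine Dvd.dvd.mul_left (dvd_sum_sub_sum fun l => dvd_mul_sub_mul (gi_sub hg _ _) ?_) _
  exact dvd_sub_sub_sub (dvd_add_sub_add (hD _ _ _) (hD _ _ _)) (hD _ _ _)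

theorem ric_sub_dvd {s : ℕ} (hb : SameBase 𝔥 𝔥') (hg : ∀ i j, 𝔥.x ^ s ∣ 𝔥.g i j - 𝔥'.g i j)
    (i j : Fin m) : 𝔥.x ^ s ∣ 𝔥.ric i j - 𝔥'.ric i j := by
  have hΓ := Γ_sub_dvd hb hg
  have hD : ∀ a k i j, 𝔥.x ^ s ∣ 𝔥.D a (𝔥.Γ k i j) - 𝔥'.D a (𝔥'.Γ k i j) := by
    intro a k i j
    rw [← hb.D, ← map_sub]
    exact D_pow_dvd (𝔥.D_x a) (hΓ k i j)
  refine dvd_sum_sub_sum fun k => dvd_add_sub_add (dvd_sub_sub_sub (hD _ _ _ _) (hD _ _ _ _)) ?_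
  exact dvd_sum_sub_sum fun l => dvd_sub_sub_sub (dvd_mul_sub_mul (hΓ _ _ _) (hΓ _ _ _))
    (dvd_mul_sub_mul (hΓ _ _ _) (hΓ _ _ _))

/-- The leading part of the difference of the Einstein defects of two metrics that agree to
order `r`. -/
theorem F_sub_dvd {r : ℕ} (hb : SameBase 𝔥 𝔥') (w : Fin m → Fin m → A)
    (hw : ∀ i j, 𝔥.g i j - 𝔥'.g i j = 𝔥.x ^ (r + 1) * w i j) (i j : Fin m) :
    𝔥.x ^ (r + 1) ∣ 𝔥.F i.succ j.succ - 𝔥'.F i.succ j.succ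
      - half A * (r + 1) * (𝔥.x ^ r * (((m : A) - 1 - r) * w i j + 𝔥.tr w * 𝔥.g i j)) := by
  have hg : ∀ i j, 𝔥.x ^ (r + 1) ∣ 𝔥.g i j - 𝔥'.g i j := fun i j => ⟨_, hw i j⟩
  have hD₀ : ∀ i j, 𝔥.D₀ (𝔥.g i j) - 𝔥'.D₀ (𝔥'.g i j)
      = (r + 1) * (𝔥.x ^ r * w i j) + 𝔥.x ^ (r + 1) * 𝔥.D₀ (w i j) := by
    intro i j
    rw [← hb.D₀, ← map_sub, hw, 𝔥.D₀.leibniz, 𝔥.D₀.leibniz_pow, 𝔥.D₀_x, Nat.add_sub_cancel]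
    simp only [smul_eq_mul, nsmul_eq_mul]; push_cast; ring
  have hD₀d : ∀ i j, 𝔥.x ^ r ∣ 𝔥.D₀ (𝔥.g i j) - 𝔥'.D₀ (𝔥'.g i j) := by
    intro i j
    rw [hD₀]
    exact dvd_add (Dvd.dvd.mul_left (dvd_mul_right _ _) _)
      (Dvd.dvd.mul_right (pow_dvd_pow _ r.le_succ) _)
  have hgr : ∀ i j, 𝔥.x ^ r ∣ 𝔥.gi i j - 𝔥'.gi i j := fun i j =>
    (pow_dvd_pow _ r.le_succ).trans (gi_sub hg i j)
  have hK : ∀ i j, 𝔥.x ^ r ∣ 𝔥.K i j - 𝔥'.K i j := by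
    intro i j
    unfold K
    rw [← mul_sub]
    exact Dvd.dvd.mul_left (dvd_sum_sub_sum fun k => dvd_mul_sub_mul (hgr _ _) (hD₀d _ _)) _
  have htrK : 𝔥.x ^ r ∣ 𝔥.trK - 𝔥'.trK := dvd_sum_sub_sum fun k => hK k k
  have h1 : 𝔥.x ^ (r + 1) ∣ 𝔥.ric i j - 𝔥'.ric i j := ric_sub_dvd hb hg i j
  -- The terms x ∂_x² h and (m - 1) ∂_x h together produce the factor (r + 1)(m - 1 - r)/2 of x^r w.
  -- The trace term is computed in `h5`; all other differences vanish to order r + 1.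
  have h2 : 𝔥.x * (𝔥.D₀ (𝔥.D₀ (𝔥.g i j)) - 𝔥'.D₀ (𝔥'.D₀ (𝔥'.g i j)))
      = r * (r + 1) * (𝔥.x ^ r * w i j) + 𝔥.x ^ (r + 1) * ((2 * r + 1 + 1) * 𝔥.D₀ (w i j)
        + 𝔥.x * 𝔥.D₀ (𝔥.D₀ (w i j))) := by
    have e : 𝔥.D₀ (𝔥.g i j) - 𝔥'.D₀ (𝔥'.g i j)
        = 𝔥.x ^ r * ((r + 1 : ℕ) * w i j + 𝔥.x * 𝔥.D₀ (w i j)) := by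
      rw [hD₀]; push_cast; ring
    have e2 := D_mul_pow_mul 𝔥.D₀_x r ((r + 1 : ℕ) * w i j + 𝔥.x * 𝔥.D₀ (w i j))
    rw [← e, map_sub, map_add, 𝔥.D₀.leibniz, 𝔥.D₀.leibniz, 𝔥.D₀_x, Derivation.map_natCast, e] at e2
    rw [← hb.D₀] at e2 ⊢
    rw [e2]
    simp only [smul_eq_mul]; push_cast; ring
  have h3 : 𝔥.x ^ r ∣ ∑ k, 𝔥.D₀ (𝔥.g i k) * 𝔥.K k j - ∑ k, 𝔥'.D₀ (𝔥'.g i k) * 𝔥'.K k j :=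
    dvd_sum_sub_sum fun k => dvd_mul_sub_mul (hD₀d _ _) (hK _ _)
  have h4 : 𝔥.x ^ r ∣ 𝔥.trK * 𝔥.D₀ (𝔥.g i j) - 𝔥'.trK * 𝔥'.D₀ (𝔥'.g i j) :=
    dvd_mul_sub_mul htrK (hD₀d _ _)
  have h5 : 𝔥.x ^ (r + 1) ∣ 𝔥.trK - 𝔥'.trK - half A * ((r + 1) * (𝔥.x ^ r * 𝔥.tr w)) := by
    have e : 𝔥.trK - 𝔥'.trK - half A * ((r + 1) * (𝔥.x ^ r * 𝔥.tr w))
        = half A * ∑ i, ∑ k, ((𝔥.gi i k - 𝔥'.gi i k) * 𝔥'.D₀ (𝔥'.g k i)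
          + 𝔥.gi i k * (𝔥.D₀ (𝔥.g k i) - 𝔥'.D₀ (𝔥'.g k i) - (r + 1) * (𝔥.x ^ r * w k i))) := by
      have etr : 𝔥.tr w = ∑ i, ∑ k, 𝔥.gi i k * w k i := by
        rw [Geom.tr, Finset.sum_comm]
        exact Finset.sum_congr rfl fun _ _ => Finset.sum_congr rfl fun _ _ => by rw [𝔥.gi_symm]
      rw [etr]
      simp only [trK, K, Finset.mul_sum, ← Finset.sum_sub_distrib]
      exact Finset.sum_congr rfl fun _ _ => Finset.sum_congr rfl fun _ _ => by ring
    rw [e]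
    refine Dvd.dvd.mul_left (Finset.dvd_sum fun a _ => Finset.dvd_sum fun b _ => dvd_add
      ((gi_sub hg _ _).mul_right _) (Dvd.dvd.mul_left ?_ _)) _
    rw [hD₀, add_sub_cancel_left]
    exact dvd_mul_right _ _
  rw [F_succ_succ, F_succ_succ, ← hb.x]
  have e : 𝔥.x * (𝔥.ric i j - half A * 𝔥.D₀ (𝔥.D₀ (𝔥.g i j))
        + ∑ k, 𝔥.D₀ (𝔥.g i k) * 𝔥.K k j - half A * (𝔥.trK * 𝔥.D₀ (𝔥.g i j)))
        + ((m : A) - 1) * (half A * 𝔥.D₀ (𝔥.g i j)) + 𝔥.trK * 𝔥.g i j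
      - (𝔥.x * (𝔥'.ric i j - half A * 𝔥'.D₀ (𝔥'.D₀ (𝔥'.g i j))
        + ∑ k, 𝔥'.D₀ (𝔥'.g i k) * 𝔥'.K k j - half A * (𝔥'.trK * 𝔥'.D₀ (𝔥'.g i j)))
        + ((m : A) - 1) * (half A * 𝔥'.D₀ (𝔥'.g i j)) + 𝔥'.trK * 𝔥'.g i j)
      - half A * (r + 1) * (𝔥.x ^ r * (((m : A) - 1 - r) * w i j + 𝔥.tr w * 𝔥.g i j))
      = 𝔥.x * (𝔥.ric i j - 𝔥'.ric i j)
        + 𝔥.x * (∑ k, 𝔥.D₀ (𝔥.g i k) * 𝔥.K k j - ∑ k, 𝔥'.D₀ (𝔥'.g i k) * 𝔥'.K k j)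
        - half A * (𝔥.x * (𝔥.trK * 𝔥.D₀ (𝔥.g i j) - 𝔥'.trK * 𝔥'.D₀ (𝔥'.g i j)))
        + (𝔥.trK - 𝔥'.trK - half A * ((r + 1) * (𝔥.x ^ r * 𝔥.tr w))) * 𝔥.g i j
        + 𝔥'.trK * (𝔥.g i j - 𝔥'.g i j)
        + 𝔥.x ^ (r + 1) * (half A * (((m : A) - 1) * 𝔥.D₀ (w i j)
          - ((2 * r + 1 + 1) * 𝔥.D₀ (w i j) + 𝔥.x * 𝔥.D₀ (𝔥.D₀ (w i j))))) := by
    linear_combination (-half A) * h2 + ((m : A) - 1) * half A * hD₀ i j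
  rw [e]
  refine dvd_add (dvd_add (dvd_add (dvd_sub (dvd_add (h1.mul_left _) ?_) ?_) (h5.mul_right _))
    ((hg i j).mul_left _)) (dvd_mul_right _ _)
  · rw [pow_succ']; exact mul_dvd_mul_left _ h3
  · refine Dvd.dvd.mul_left ?_ _
    rw [pow_succ']; exact mul_dvd_mul_left _ h4

end GeomPath

end

section

/-! ### Further closure properties of natural tensors -/

namespace Natl

variable {m : ℕ} {ρ ρ' τ : Type} [Fintype ρ] [DecidableEq ρ] [Fintype ρ'] [DecidableEq ρ']
variable [Fintype τ] [DecidableEq τ]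
variable {v : ρ → Bool} {v' : ρ' → Bool} {w w' L L' : ℕ} {S T : Fam m ρ} {S' T' : Fam m ρ'}

theorem neg (h : Natl m v w L T) : Natl m v w L (fun A _ _ 𝔤 I => -T A 𝔤 I) :=
  (h.smul (-1)).congr fun A _ _ 𝔤 I => by simp

theorem sub (h₁ : Natl m v w L S) (h₂ : Natl m v w L T) :
    Natl m v w L (fun A _ _ 𝔤 I => S A 𝔤 I - T A 𝔤 I) :=
  (h₁.add h₂.neg).congr fun A _ _ 𝔤 I => (sub_eq_add_neg _ _).symm

theorem const_mul (c : ℝ) (h : Natl m v w L T) :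
    Natl m v w L (fun A _ _ 𝔤 I => algebraMap ℝ A c * T A 𝔤 I) :=
  (h.smul c).congr fun A _ _ 𝔤 I => Algebra.smul_def _ _

theorem sum {β : Type*} (s : Finset β) {T : β → Fam m ρ} (h : ∀ b ∈ s, Natl m v w L (T b)) :
    Natl m v w L (fun A _ _ 𝔤 I => ∑ b ∈ s, T b A 𝔤 I) := by
  classical
  induction s using Finset.induction with
  | empty => exact (Natl.zero v w L).congr fun A _ _ 𝔤 I => by simp
  | insert b s hb ih =>
    refine ((h b (by simp)).add (ih fun b hb => h b (by simp [hb]))).congr fun A _ _ 𝔤 I => ?_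
    rw [Finset.sum_insert hb]

/-- Renaming of the slots. -/
theorem rename (h : Natl m v w L T) (f : ρ → ρ') (hf : f.Bijective) (hv : v' ∘ f = v) :
    Natl m v' w L (fun A _ _ 𝔤 I => T A 𝔤 (I ∘ f)) := by
  subst hv
  exact h.reindex v' (Equiv.ofBijective f hf)

/-- Contraction of an upper slot with a lower slot. -/
theorem contract (h : Natl m v w L T) (u : τ → Bool) (f : ρ → Option (Option τ)) (hf : f.Bijective)
    (hv : ocons true (ocons false u) ∘ f = v) :
    Natl m u w L (fun A _ _ 𝔤 I => ∑ k, T A 𝔤 (ocons k (ocons k I) ∘ f)) :=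
  (h.rename f hf hv).trace

/-- The contraction of a product. -/
theorem mulContract (h : Natl m v w L S) (h' : Natl m v' w' L' T') (u : τ → Bool)
    (f : ρ → Option (Option τ)) (f' : ρ' → Option (Option τ)) (hf : (Sum.elim f f').Bijective)
    (hv : ocons true (ocons false u) ∘ Sum.elim f f' = Sum.elim v v') :
    Natl m u (w + w') (L + L') (fun A _ _ 𝔤 I => ∑ k,
      S A 𝔤 (ocons k (ocons k I) ∘ f) * T' A 𝔤 (ocons k (ocons k I) ∘ f')) :=
  (h.mul h').contract u _ hf hv

/-- The product of two tensors, with renamed slots. -/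
theorem mulRename (h : Natl m v w L S) (h' : Natl m v' w' L' T') (u : τ → Bool)
    (f : ρ → τ) (f' : ρ' → τ) (hf : (Sum.elim f f').Bijective)
    (hv : u ∘ Sum.elim f f' = Sum.elim v v') :
    Natl m u (w + w') (L + L') (fun A _ _ 𝔤 I => S A 𝔤 (I ∘ f) * T' A 𝔤 (I ∘ f')) :=
  (h.mul h').rename _ hf hv

end Natl

/-! ### Power series -/

section series

variable {A : Type*} [CommRing A] [Algebra ℝ A]

open PowerSeries

/-- The coefficientwise extension of a derivation to power series. -/
def mapD (D : Derivation ℝ A A) : Derivation ℝ A⟦X⟧ A⟦X⟧ :=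
  Derivation.mk'
    { toFun := fun f => PowerSeries.mk fun n => D (coeff n f)
      map_add' := fun f g => by ext n; simp
      map_smul' := fun c f => by
        ext n
        simp only [coeff_mk, RingHom.id_apply, PowerSeries.coeff_smul, Derivation.map_smul] }
    fun f g => by
      ext n
      simp only [LinearMap.coe_mk, AddHom.coe_mk, coeff_mk, coeff_mul, map_sum, map_add,
        Derivation.leibniz, smul_eq_mul, Finset.sum_add_distrib]
      congr 1
      exact (Finset.Nat.sum_antidiagonal_swap (n := n)
        (f := fun p : ℕ × ℕ => coeff p.1 g * D (coeff p.2 f)))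

@[simp] theorem coeff_mapD (D : Derivation ℝ A A) (n : ℕ) (f : A⟦X⟧) :
    coeff n (mapD D f) = D (coeff n f) := by
  change coeff n (PowerSeries.mk fun n => D (coeff n f)) = _
  rw [coeff_mk]

theorem mapD_C (D : Derivation ℝ A A) (a : A) : mapD D (C a) = C (D a) := by
  ext n
  rw [coeff_mapD, coeff_C, coeff_C]
  split_ifs <;> simp

/-- The derivative of power series, as a derivation over `ℝ`. -/
def ddX (A : Type*) [CommRing A] [Algebra ℝ A] : Derivation ℝ A⟦X⟧ A⟦X⟧ :=
  (PowerSeries.derivative A).restrictScalars ℝ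

theorem coeff_ddX (n : ℕ) (f : A⟦X⟧) : coeff n (ddX A f) = coeff (n + 1) f * (n + 1) :=
  coeff_derivative f n

theorem ddX_mapD (D : Derivation ℝ A A) (f : A⟦X⟧) : ddX A (mapD D f) = mapD D (ddX A f) := by
  ext n
  rw [coeff_ddX, coeff_mapD, coeff_mapD, coeff_ddX, D.leibniz]
  have : D ((n : A) + 1) = 0 := by rw [map_add, Derivation.map_natCast, Derivation.map_one_eq_zero, add_zero]
  rw [this, smul_zero, zero_add, smul_eq_mul, mul_comm]

theorem algebraMap_series (c : ℝ) : algebraMap ℝ A⟦X⟧ c = C (algebraMap ℝ A c) :=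
  PowerSeries.algebraMap_apply

theorem half_series : half A⟦X⟧ = C (half A) := algebraMap_series _

theorem coeff_half_mul (n : ℕ) (f : A⟦X⟧) : coeff n (half A⟦X⟧ * f) = half A * coeff n f := by
  rw [half_series, coeff_C_mul]

namespace Geom

variable {ι : Type*} [Fintype ι] [DecidableEq ι] (𝔤 : Geom ι A)

/-- A metric, as a metric over the algebra of power series. -/
def series : Geom ι A⟦X⟧ where
  D i := mapD (𝔤.D i)
  comm i j f := by ext n; simp only [coeff_mapD, 𝔤.comm]
  g := (C : A →+* A⟦X⟧).mapMatrix 𝔤.g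
  gi := (C : A →+* A⟦X⟧).mapMatrix 𝔤.gi
  symm i j := congrArg C (𝔤.symm i j)
  mul_inv := by rw [← map_mul, 𝔤.mul_inv, map_one]

theorem series_g (i j : ι) : 𝔤.series.g i j = C (𝔤.g i j) := rfl
theorem series_gi (i j : ι) : 𝔤.series.gi i j = C (𝔤.gi i j) := rfl
@[simp] theorem coeff_series_D (i : ι) (n : ℕ) (f : A⟦X⟧) :
    coeff n (𝔤.series.D i f) = 𝔤.D i (coeff n f) := coeff_mapD _ _ _

theorem series_D_C (i : ι) (a : A) : 𝔤.series.D i (C a) = C (𝔤.D i a) := mapD_C _ _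

theorem series_Γ (k i j : ι) : 𝔤.series.Γ k i j = C (𝔤.Γ k i j) := by
  simp only [Γ, series_g, series_gi, series_D_C, half_series, map_mul, map_sum, map_add, map_sub]

theorem series_riem (i j k l : ι) : 𝔤.series.riem i j k l = C (𝔤.riem i j k l) := by
  simp only [riem, series_Γ, series_D_C, map_mul, map_sum, map_add, map_sub]

theorem series_ric (j k : ι) : 𝔤.series.ric j k = C (𝔤.ric j k) := by
  simp only [ric, series_riem, map_sum]

variable {ρ : Type*} [Fintype ρ] [DecidableEq ρ]

theorem series_conn (b : Bool) (i a s : ι) : 𝔤.series.conn b i a s = C (𝔤.conn b i a s) := by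
  cases b <;> simp [conn, series_Γ]

theorem coeff_series_nabla (n : ℕ) (v : ρ → Bool) (T : (ρ → ι) → A⟦X⟧) (i : ι) (I : ρ → ι) :
    coeff n (𝔤.series.nabla v T i I) = 𝔤.nabla v (fun J => coeff n (T J)) i I := by
  simp only [nabla, map_add, coeff_series_D, map_sum, series_conn, coeff_C_mul]

theorem coeff_series_cov2 (n : ℕ) (T : ι → ι → A⟦X⟧) (i j k : ι) :
    coeff n (𝔤.series.cov2 T i j k) = 𝔤.cov2 (fun i j => coeff n (T i j)) i j k := by
  simp only [cov2, map_sub, map_add, coeff_series_D, map_sum, series_Γ, coeff_C_mul]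

end Geom

/-! ### Formal power series of metrics -/

/-- A metric `h_x`, as a formal power series in `x`, with `h_0 = g`. -/
structure SMetric {m : ℕ} (𝔤 : Geom (Fin m) A) where
  h : Fin m → Fin m → A⟦X⟧
  symm : ∀ i j, h i j = h j i
  coeff_zero : ∀ i j, coeff 0 (h i j) = 𝔤.g i j

namespace SMetric

variable {m : ℕ} {𝔤 : Geom (Fin m) A} (H : SMetric 𝔤)

/-- The constant coefficient of the determinant is det g, a unit because g has an inverse matrix,
and that suffices for power series. -/
theorem isUnit_det : IsUnit (Matrix.of H.h).det := by
  rw [PowerSeries.isUnit_iff_constantCoeff, RingHom.map_det]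
  have : (constantCoeff (R := A)).mapMatrix (Matrix.of H.h) = 𝔤.g := by
    ext i j
    exact (coeff_zero_eq_constantCoeff_apply _).symm.trans (H.coeff_zero i j)
  rw [this]
  exact IsUnit.of_mul_eq_one (𝔤.gi.det) (by rw [← Matrix.det_mul, 𝔤.mul_inv, Matrix.det_one])

/-- A formal power series of metrics, as a path of metrics. -/
def path : GeomPath m A⟦X⟧ where
  D i := mapD (𝔤.D i)
  comm i j f := by ext n; simp only [coeff_mapD, 𝔤.comm]
  g := Matrix.of H.h
  gi := (Matrix.of H.h)⁻¹
  symm i j := H.symm i j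
  mul_inv := Matrix.mul_nonsing_inv _ H.isUnit_det
  D₀ := ddX A
  comm₀ i f := ddX_mapD _ _
  x := X
  D₀_x := derivative_X
  D_x i := by
    ext n
    rw [coeff_mapD, coeff_X, map_zero]
    split_ifs <;> simp

theorem path_x : H.path.x = X := rfl

theorem sameBase (H' : SMetric 𝔤) : GeomPath.SameBase H.path H'.path := ⟨rfl, rfl, rfl⟩

theorem coeff_zero_gi (i j : Fin m) : coeff 0 (H.path.gi i j) = 𝔤.gi i j := by
  have h1 : (constantCoeff (R := A)).mapMatrix H.path.g = 𝔤.g := by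
    ext i j; exact (coeff_zero_eq_constantCoeff_apply _).symm.trans (H.coeff_zero i j)
  have h2 := congrArg (constantCoeff (R := A)).mapMatrix H.path.mul_inv
  rw [map_mul, map_one, h1] at h2
  have h3 : (constantCoeff (R := A)).mapMatrix H.path.gi = 𝔤.gi := by
    rw [← one_mul ((constantCoeff (R := A)).mapMatrix H.path.gi), ← 𝔤.inv_mul, mul_assoc, h2,
      mul_one]
  exact (coeff_zero_eq_constantCoeff_apply _).trans (congrFun (congrFun h3 i) j)

end SMetric

end series

/-! ### Natural power series -/

open PowerSeries in
/-- A power series of tensors that is assigned to every metric. -/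
abbrev SFam (m : ℕ) (ρ : Type) : Type 1 :=
  ∀ (A : Type) [CommRing A] [Algebra ℝ A], Geom (Fin m) A → (ρ → Fin m) → A⟦X⟧

/-- A power series of natural tensors; the `s`-th coefficient has weight `s + k`. -/
def NatS (m : ℕ) {ρ : Type} [Fintype ρ] [DecidableEq ρ] (v : ρ → Bool) (k L : ℕ)
    (T : SFam m ρ) : Prop :=
  ∀ s, Natl m v (s + k) L (fun A _ _ 𝔤 I => PowerSeries.coeff s (T A 𝔤 I))

namespace NatS

open PowerSeries

variable {m : ℕ} {ρ ρ' τ : Type} [Fintype ρ] [DecidableEq ρ] [Fintype ρ'] [DecidableEq ρ']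
variable [Fintype τ] [DecidableEq τ]
variable {v : ρ → Bool} {v' : ρ' → Bool} {k k' L L' : ℕ} {S T : SFam m ρ} {S' T' : SFam m ρ'}

theorem congr (h : NatS m v k L S)
    (e : ∀ (A : Type) [CommRing A] [Algebra ℝ A] (𝔤 : Geom (Fin m) A) I, S A 𝔤 I = T A 𝔤 I) :
    NatS m v k L T :=
  fun s => (h s).congr fun A _ _ 𝔤 I => by rw [e]

theorem add (h₁ : NatS m v k L S) (h₂ : NatS m v k L T) :
    NatS m v k L (fun A _ _ 𝔤 I => S A 𝔤 I + T A 𝔤 I) :=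
  fun s => ((h₁ s).add (h₂ s)).congr fun A _ _ 𝔤 I => (map_add _ _ _).symm

theorem neg (h : NatS m v k L T) : NatS m v k L (fun A _ _ 𝔤 I => -T A 𝔤 I) :=
  fun s => (h s).neg.congr fun A _ _ 𝔤 I => (map_neg _ _).symm

theorem sub (h₁ : NatS m v k L S) (h₂ : NatS m v k L T) :
    NatS m v k L (fun A _ _ 𝔤 I => S A 𝔤 I - T A 𝔤 I) :=
  fun s => ((h₁ s).sub (h₂ s)).congr fun A _ _ 𝔤 I => (map_sub _ _ _).symm

theorem const_mul (c : ℝ) (h : NatS m v k L T) :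
    NatS m v k L (fun A _ _ 𝔤 I => algebraMap ℝ A⟦X⟧ c * T A 𝔤 I) :=
  fun s => ((h s).const_mul c).congr fun A _ _ 𝔤 I => by
    beta_reduce; rw [algebraMap_series, coeff_C_mul]

theorem of_natl {w : ℕ} {T : Fam m ρ} (h : Natl m v w L T) :
    NatS m v w L (fun A _ _ 𝔤 I => C (T A 𝔤 I)) := by
  intro s
  cases s with
  | zero => exact (h.cast rfl (zero_add w).symm).congr fun A _ _ 𝔤 I => by simp
  | succ s => exact (Natl.zero _ _ _).congr fun A _ _ 𝔤 I => by rw [coeff_C, if_neg (by omega)]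

theorem rename (h : NatS m v k L T) (u : ρ' → Bool) (f : ρ → ρ') (hf : f.Bijective)
    (hv : u ∘ f = v) : NatS m u k L (fun A _ _ 𝔤 I => T A 𝔤 (I ∘ f)) :=
  fun s => (h s).rename f hf hv

theorem contract (h : NatS m v k L T) (u : τ → Bool) (f : ρ → Option (Option τ))
    (hf : f.Bijective) (hv : ocons true (ocons false u) ∘ f = v) :
    NatS m u k L (fun A _ _ 𝔤 I => ∑ k, T A 𝔤 (ocons k (ocons k I) ∘ f)) :=
  fun s => ((h s).contract u f hf hv).congr fun A _ _ 𝔤 I => (map_sum _ _ _).symm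

theorem mul (h : NatS m v k L S) (h' : NatS m v' k' L' T') :
    NatS m (Sum.elim v v') (k + k') (L + L')
      (fun A _ _ 𝔤 I => S A 𝔤 (I ∘ Sum.inl) * T' A 𝔤 (I ∘ Sum.inr)) := by
  intro s
  refine (Natl.sum (Finset.HasAntidiagonal.antidiagonal s) (T := fun (p : ℕ × ℕ) A _ _ 𝔤 I =>
    coeff p.1 (S A 𝔤 (I ∘ Sum.inl)) * coeff p.2 (T' A 𝔤 (I ∘ Sum.inr))) fun p hp => ?_).congr
      fun A _ _ 𝔤 I => (coeff_mul _ _ _).symm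
  refine ((h p.1).mul (h' p.2)).cast rfl ?_
  rw [Finset.HasAntidiagonal.mem_antidiagonal] at hp
  omega

theorem mulContract (h : NatS m v k L S) (h' : NatS m v' k' L' T') (u : τ → Bool)
    (f : ρ → Option (Option τ)) (f' : ρ' → Option (Option τ)) (hf : (Sum.elim f f').Bijective)
    (hv : ocons true (ocons false u) ∘ Sum.elim f f' = Sum.elim v v') :
    NatS m u (k + k') (L + L') (fun A _ _ 𝔤 I => ∑ k,
      S A 𝔤 (ocons k (ocons k I) ∘ f) * T' A 𝔤 (ocons k (ocons k I) ∘ f')) :=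
  ((h.mul h').contract u _ hf hv).congr fun A _ _ 𝔤 I => Finset.sum_congr rfl fun k _ =>
    congrArg₂ (fun I J => S A 𝔤 I * T' A 𝔤 J) rfl rfl

theorem mulRename (h : NatS m v k L S) (h' : NatS m v' k' L' T') (u : τ → Bool)
    (f : ρ → τ) (f' : ρ' → τ) (hf : (Sum.elim f f').Bijective)
    (hv : u ∘ Sum.elim f f' = Sum.elim v v') :
    NatS m u (k + k') (L + L') (fun A _ _ 𝔤 I => S A 𝔤 (I ∘ f) * T' A 𝔤 (I ∘ f')) :=
  ((h.mul h').rename u _ hf hv).congr fun A _ _ 𝔤 I =>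
    congrArg₂ (fun I J => S A 𝔤 I * T' A 𝔤 J) rfl rfl

theorem nabla (h : NatS m v k L T) : NatS m (ocons false v) (k + 1) L
    (fun A _ _ 𝔤 J => 𝔤.series.nabla v (T A 𝔤) (J none) (J ∘ some)) :=
  fun s => ((h s).nabla.cast rfl (add_assoc _ _ _)).congr
    fun A _ _ 𝔤 I => (𝔤.coeff_series_nabla _ _ _ _ _).symm

theorem ddX (h : NatS m v k L T) : NatS m v (k + 1) L (fun A _ _ 𝔤 I => ddX A (T A 𝔤 I)) :=
  fun s => (((h (s + 1)).smul ((s : ℝ) + 1)).cast rfl (by omega)).congr fun A _ _ 𝔤 I => by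
    rw [coeff_ddX, Algebra.smul_def, mul_comm]; simp

/-- The variable x carries weight -1: multiplication by it shifts the coefficients, just as `ddX`
shifts them the other way. -/
theorem X_mul (h : NatS m v (k + 1) L T) : NatS m v k L (fun A _ _ 𝔤 I => X * T A 𝔤 I) := by
  intro s
  cases s with
  | zero => exact (Natl.zero _ _ _).congr fun A _ _ 𝔤 I => by simp
  | succ s =>
    exact ((h s).cast rfl (by omega)).congr fun A _ _ 𝔤 I => (coeff_succ_X_mul _ _).symm

end NatS

end

section

/-! ### The Ricci identity -/

namespace Geom

variable {ι A : Type*} [Fintype ι] [DecidableEq ι] [CommRing A] [Algebra ℝ A] (𝔤 : Geom ι A)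
variable {ρ : Type*} [Fintype ρ] [DecidableEq ρ]

/-- The second covariant derivative of a tensor, in the directions `j` and then `i`. -/
def nabla₂ (v : ρ → Bool) (T : (ρ → ι) → A) (i j : ι) (I : ρ → ι) : A :=
  𝔤.nabla (ocons false v) (fun J => 𝔤.nabla v T (J none) (J ∘ some)) i (ocons j I)

theorem nabla₂_eq (v : ρ → Bool) (T : (ρ → ι) → A) (i j : ι) (I : ρ → ι) :
    𝔤.nabla₂ v T i j I = 𝔤.D i (𝔤.nabla v T j I) - ∑ s, 𝔤.Γ s i j * 𝔤.nabla v T s I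
      + ∑ t, ∑ s, 𝔤.conn (v t) i (I t) s * 𝔤.nabla v T j (Function.update I t s) := by
  have h1 : ∀ s, Function.update (ocons j I) none s ∘ some = I := fun s => by funext t; rfl
  have h2 : ∀ t s, Function.update (ocons j I) (some t) s ∘ some = Function.update I t s :=
    fun t s => by
      rw [Function.update_comp_eq_of_injective _ (Option.some_injective _)]; rfl
  have h3 : ocons j I ∘ some = I := rfl
  have h4 : ∀ t s, Function.update (ocons j I) (some t) s none = j := fun t s => rfl
  have h5 : ∀ s, 𝔤.conn false i j s = -𝔤.Γ s i j := fun s => rfl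
  rw [nabla₂, nabla, Fintype.sum_option]
  simp only [h1, h2, h3, h4, h5, ocons_none, ocons_some, Function.update_self, neg_mul,
    Finset.sum_neg_distrib]
  ring

/-- The Ricci identity for covariant tensors. -/
theorem nabla₂_comm (T : (ρ → ι) → A) (i j : ι) (I : ρ → ι) :
    𝔤.nabla₂ (fun _ => false) T i j I - 𝔤.nabla₂ (fun _ => false) T j i I
      = -∑ t, ∑ s, 𝔤.riem i j (I t) s * T (Function.update I t s) := by
  have hΓ : ∑ s, 𝔤.Γ s i j * 𝔤.nabla (fun _ => false) T s I
      = ∑ s, 𝔤.Γ s j i * 𝔤.nabla (fun _ => false) T s I := by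
    simp only [𝔤.Γ_symm _ i j]
  -- The products of two connection terms are split according to whether both act on the same slot,
  -- which yields the ΓΓ part of the curvature, or on different slots.
  have hcross : ∀ i j : ι, ∑ t, ∑ s, 𝔤.Γ s i (I t) *
        ∑ t', ∑ s', 𝔤.Γ s' j (Function.update I t s t') *
          T (Function.update (Function.update I t s) t' s')
      = ∑ t, ∑ s, (∑ r, 𝔤.Γ r i (I t) * 𝔤.Γ s j r) * T (Function.update I t s)
        + ∑ t, ∑ t', if t' = t then 0 else ∑ s, ∑ s', 𝔤.Γ s i (I t) * (𝔤.Γ s' j (I t') *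
          T (Function.update (Function.update I t s) t' s')) := by
    intro i j
    rw [← Finset.sum_add_distrib]
    refine Finset.sum_congr rfl fun t _ => ?_
    have e1 : ∑ s, 𝔤.Γ s i (I t) * ∑ t', ∑ s', 𝔤.Γ s' j (Function.update I t s t') *
          T (Function.update (Function.update I t s) t' s')
        = ∑ t', ∑ s, ∑ s', 𝔤.Γ s i (I t) * (𝔤.Γ s' j (Function.update I t s t') *
          T (Function.update (Function.update I t s) t' s')) := by
      rw [Finset.sum_comm]
      simp only [Finset.mul_sum]
    have e2 : ∀ t', ∑ s, ∑ s', 𝔤.Γ s i (I t) * (𝔤.Γ s' j (Function.update I t s t') *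
          T (Function.update (Function.update I t s) t' s'))
        = (if t' = t then ∑ s, (∑ r, 𝔤.Γ r i (I t) * 𝔤.Γ s j r) * T (Function.update I t s)
            else 0)
          + if t' = t then 0 else ∑ s, ∑ s', 𝔤.Γ s i (I t) * (𝔤.Γ s' j (I t') *
          T (Function.update (Function.update I t s) t' s')) := by
      intro t'
      split_ifs with h
      · subst h
        rw [add_zero, Finset.sum_comm]
        refine Finset.sum_congr rfl fun s _ => ?_
        rw [Finset.sum_mul]
        refine Finset.sum_congr rfl fun r _ => ?_
        rw [Function.update_self, Function.update_idem]
        ring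
      · rw [zero_add]
        refine Finset.sum_congr rfl fun s _ => Finset.sum_congr rfl fun s' _ => ?_
        rw [Function.update_of_ne h]
    rw [e1, Finset.sum_congr rfl fun t' _ => e2 t', Finset.sum_add_distrib]
    simp
  -- Terms on two different slots are symmetric in i and j, so they drop out of the commutator.
  have hsym : ∑ t, ∑ t', (if t' = t then 0 else ∑ s, ∑ s', 𝔤.Γ s i (I t) * (𝔤.Γ s' j (I t') *
          T (Function.update (Function.update I t s) t' s')))
      = ∑ t, ∑ t', if t' = t then 0 else ∑ s, ∑ s', 𝔤.Γ s j (I t) * (𝔤.Γ s' i (I t') *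
          T (Function.update (Function.update I t s) t' s')) := by
    rw [Finset.sum_comm]
    refine Finset.sum_congr rfl fun t _ => Finset.sum_congr rfl fun t' _ => ?_
    by_cases h : t = t'
    · rw [if_pos h, if_pos h.symm]
    · rw [if_neg h, if_neg (Ne.symm h), Finset.sum_comm]
      refine Finset.sum_congr rfl fun s _ => Finset.sum_congr rfl fun s' _ => ?_
      rw [Function.update_comm h]
      ring
  have h1 := hcross i j
  have h2 := hcross j i
  rw [hsym] at h1
  have hr : ∑ t, ∑ s, 𝔤.riem i j (I t) s * T (Function.update I t s)
      = ∑ t, ∑ s, 𝔤.D i (𝔤.Γ s j (I t)) * T (Function.update I t s)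
        - ∑ t, ∑ s, 𝔤.D j (𝔤.Γ s i (I t)) * T (Function.update I t s)
        + ∑ t, ∑ s, (∑ r, 𝔤.Γ r j (I t) * 𝔤.Γ s i r) * T (Function.update I t s)
        - ∑ t, ∑ s, (∑ r, 𝔤.Γ r i (I t) * 𝔤.Γ s j r) * T (Function.update I t s) := by
    simp only [← Finset.sum_sub_distrib, ← Finset.sum_add_distrib, ← sub_mul, ← add_mul]
    refine Finset.sum_congr rfl fun t _ => Finset.sum_congr rfl fun s _ => ?_
    simp only [riem, Finset.sum_sub_distrib, mul_comm (𝔤.Γ s _ _)]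
    ring
  rw [hr, nabla₂_eq, nabla₂_eq, hΓ]
  simp only [nabla, conn, Bool.false_eq_true, if_false, neg_mul, mul_neg, Finset.sum_neg_distrib,
    map_add, map_neg, map_sum, Derivation.leibniz, smul_eq_mul, mul_add, Finset.sum_add_distrib,
    𝔤.comm i j, mul_comm (T _) _] at h1 h2 ⊢
  linear_combination h1 - h2

end Geom

/-- Natural covariant tensors. -/
abbrev Low (m : ℕ) {ρ : Type} [Fintype ρ] [DecidableEq ρ] (w L : ℕ) (T : Fam m ρ) : Prop :=
  Natl m (fun _ => false) w L T

namespace Natl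

variable {m w L : ℕ} {ρ : Type} [Fintype ρ] [DecidableEq ρ]

/-- The generator `curv` has all its indices lowered, so the last one is raised again; the inverse
metric adds neither weight nor a factor. -/
theorem riem : Natl m (![false, false, false, true] : Fin 4 → Bool) 2 1
    (fun A _ _ 𝔤 I => 𝔤.riem (I 0) (I 1) (I 2) (I 3)) := by
  refine ((Natl.inv (m := m)).mulContract (Natl.curv 0) (![false, false, false, true] : Fin 4 → Bool)
    (![none, some (some 3)] : Fin 2 → Option (Option (Fin 4)))
    (![some (some 0), some (some 1), some (some 2), some none] : Fin 4 → Option (Option (Fin 4)))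
    (by decide) (by decide)).congr fun A _ _ 𝔤 I => ?_
  change ∑ k, 𝔤.gi k (I 3) * ∑ s, 𝔤.g k s * 𝔤.riem (I 0) (I 1) (I 2) s = _
  have : ∀ k, 𝔤.gi k (I 3) * ∑ s, 𝔤.g k s * 𝔤.riem (I 0) (I 1) (I 2) s
      = ∑ s, 𝔤.gi (I 3) k * 𝔤.g k s * 𝔤.riem (I 0) (I 1) (I 2) s := fun k => by
    rw [Finset.mul_sum, 𝔤.gi_symm]
    exact Finset.sum_congr rfl fun s _ => (mul_assoc _ _ _).symm
  rw [Finset.sum_congr rfl fun k _ => this k, Finset.sum_comm]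
  simp only [← Finset.sum_mul, 𝔤.sum_gi_g]
  simp

theorem ric : Low m 2 1 (fun A _ _ 𝔤 (I : Fin 2 → Fin m) => 𝔤.ric (I 0) (I 1)) :=
  (Natl.riem.contract (fun _ : Fin 2 => false)
    (![some none, some (some 0), some (some 1), none] : Fin 4 → Option (Option (Fin 2)))
    (by decide) (by decide))

/-- Covariant derivatives of natural tensors commute up to terms with more curvature factors. -/
theorem nabla₂_comm {T : Fam m ρ} (h : Low m w L T) :
    Low m (w + 2) (L + 1) (fun A _ _ 𝔤 (J : Option (Option ρ) → Fin m) =>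
      𝔤.nabla₂ (fun _ => false) (T A 𝔤) (J none) (J (some none)) (fun t => J (some (some t)))
      - 𝔤.nabla₂ (fun _ => false) (T A 𝔤) (J (some none)) (J none)
        (fun t => J (some (some t)))) := by
  have key : ∀ t₀ : ρ, Low m (w + 2) (L + 1) (fun A _ _ 𝔤 (J : Option (Option ρ) → Fin m) =>
      ∑ s, 𝔤.riem (J none) (J (some none)) (J (some (some t₀))) s *
        T A 𝔤 (Function.update (fun t => J (some (some t))) t₀ s)) := by
    intro t₀
    -- The wiring of one term of the Ricci identity: the upper index of the curvature is contracted
    -- with slot `t₀` of T, and the curvature takes over the free index of that slot.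
    let f : Fin 4 → Option (Option (Option (Option ρ))) :=
      ![some (some none), some (some (some none)), some (some (some (some t₀))), none]
    let f' : ρ → Option (Option (Option (Option ρ))) :=
      fun t => if t = t₀ then some none else some (some (some (some t)))
    have hf : (Sum.elim f f').Bijective := by
      constructor
      · have hf4 : Function.Injective f := by
          intro a b hab
          fin_cases a <;> fin_cases b <;> simp [f] at hab ⊢
        have hf' : Function.Injective f' := by
          intro a b hab
          simp only [f'] at hab
          split_ifs at hab with h1 h2 h2
          · rw [h1, h2]
          · simp at hab
          · simp at hab
          · simpa using hab
        refine hf4.sumElim hf' fun a b => ?_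
        simp only [f']
        split_ifs with hb
        · fin_cases a <;> simp [f]
        · fin_cases a <;> simp [f, Ne.symm hb]
      · rintro (_ | _ | _ | _ | t)
        · exact ⟨Sum.inl 3, rfl⟩
        · exact ⟨Sum.inr t₀, by simp [f']⟩
        · exact ⟨Sum.inl 0, rfl⟩
        · exact ⟨Sum.inl 1, rfl⟩
        · by_cases h : t = t₀
          · exact ⟨Sum.inl 2, by simp [f, h]⟩
          · exact ⟨Sum.inr t, by simp [f', h]⟩
    refine ((Natl.riem.mulContract h (fun _ => false) f f' hf ?_).cast rfl (add_comm _ _)).mono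
      (by omega) |>.congr fun A _ _ 𝔤 I => ?_
    · funext x
      rcases x with x | x
      · fin_cases x <;> rfl
      · by_cases h : x = t₀ <;> simp [f', h]
    · refine Finset.sum_congr rfl fun s _ => ?_
      congr 2
      funext t
      by_cases h : t = t₀ <;> simp [f', h, Function.update]
  refine (Natl.sum Finset.univ fun t _ => key t).neg.congr fun A _ _ 𝔤 J => ?_
  exact (𝔤.nabla₂_comm _ _ _ _).symm

end Natl

end

section

/-! ### Second-order operators on symmetric two-tensors -/

namespace Geom

variable {ι A : Type*} [Fintype ι] [DecidableEq ι] [CommRing A] [Algebra ℝ A] (𝔤 : Geom ι A)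

/-- The covariant derivative `∇_m T_{ijkl}`. -/
def cov4 (T : ι → ι → ι → ι → A) (i j k l m : ι) : A :=
  𝔤.D m (T i j k l)
    - ∑ s, (𝔤.Γ s m i * T s j k l + 𝔤.Γ s m j * T i s k l + 𝔤.Γ s m k * T i j s l
      + 𝔤.Γ s m l * T i j k s)

theorem nabla_one (T : ι → A) (l : ι) (I : Fin 1 → ι) :
    𝔤.nabla (fun _ => false) (fun I => T (I 0)) l I = 𝔤.cov1 T (I 0) l := by
  simp [nabla, cov1, conn, sub_eq_add_neg]

theorem nabla_two (T : ι → ι → A) (l : ι) (I : Fin 2 → ι) :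
    𝔤.nabla (fun _ => false) (fun I => T (I 0) (I 1)) l I = 𝔤.cov2 T (I 0) (I 1) l := by
  simp [nabla, cov2, conn, Fin.sum_univ_two, Finset.sum_add_distrib]; ring

theorem nabla_three (T : ι → ι → ι → A) (l : ι) (I : Fin 3 → ι) :
    𝔤.nabla (fun _ => false) (fun I => T (I 0) (I 1) (I 2)) l I
      = 𝔤.cov3 T (I 0) (I 1) (I 2) l := by
  simp [nabla, cov3, conn, Fin.sum_univ_three, Finset.sum_add_distrib, Function.update]; ring

theorem nabla_four (T : ι → ι → ι → ι → A) (l : ι) (I : Fin 4 → ι) :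
    𝔤.nabla (fun _ => false) (fun I => T (I 0) (I 1) (I 2) (I 3)) l I
      = 𝔤.cov4 T (I 0) (I 1) (I 2) (I 3) l := by
  simp [nabla, cov4, conn, Fin.sum_univ_four, Finset.sum_add_distrib, Function.update]; ring

theorem nabla_covC (T : ι → ι → ι → A) (l : ι) (I : Fin 3 → ι) :
    𝔤.nabla ![true, false, false] (fun I => T (I 0) (I 1) (I 2)) l I
      = 𝔤.covC T l (I 0) (I 1) (I 2) := by
  simp [nabla, covC, conn, Fin.sum_univ_three, Finset.sum_add_distrib, Finset.sum_sub_distrib,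
    Function.update]; ring

theorem nabla₂_two (T : ι → ι → A) (k l : ι) (I : Fin 2 → ι) :
    𝔤.nabla₂ (fun _ => false) (fun I => T (I 0) (I 1)) k l I
      = 𝔤.cov3 (𝔤.cov2 T) (I 0) (I 1) l k := by
  rw [nabla₂_eq]
  simp [nabla_two, cov3, conn, Fin.sum_univ_two, Finset.sum_add_distrib, Function.update]; ring

theorem nabla₂_three (T : ι → ι → ι → A) (k l : ι) (I : Fin 3 → ι) :
    𝔤.nabla₂ (fun _ => false) (fun I => T (I 0) (I 1) (I 2)) k l I
      = 𝔤.cov4 (𝔤.cov3 T) (I 0) (I 1) (I 2) l k := by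
  rw [nabla₂_eq]
  simp [nabla_three, cov4, conn, Fin.sum_univ_three, Finset.sum_add_distrib, Function.update]; ring

theorem cov4_sub (S T : ι → ι → ι → ι → A) (i j k l m : ι) :
    𝔤.cov4 (fun i j k l => S i j k l - T i j k l) i j k l m
      = 𝔤.cov4 S i j k l m - 𝔤.cov4 T i j k l m := by
  simp only [cov4, map_sub, mul_sub, Finset.sum_add_distrib, Finset.sum_sub_distrib]; ring

/-- The contraction of a two-tensor, with the derivative of the entries. -/
theorem D_contr (f : ι → ι → A) (l : ι) :
    𝔤.D l (∑ a, ∑ b, 𝔤.gi a b * f a b) = ∑ a, ∑ b, 𝔤.gi a b * 𝔤.cov2 f a b l :=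
  𝔤.D_tr f l

theorem cov1_contr (S : ι → ι → ι → A) (j l : ι) :
    𝔤.cov1 (fun j => ∑ a, ∑ b, 𝔤.gi a b * S j a b) j l
      = ∑ a, ∑ b, 𝔤.gi a b * 𝔤.cov3 S j a b l := by
  have h : ∀ a b, 𝔤.cov3 S j a b l
      = 𝔤.cov2 (fun a b => S j a b) a b l - ∑ s, 𝔤.Γ s l j * S s a b := fun a b => by
    simp only [cov3, cov2, Finset.sum_add_distrib]; ring
  simp only [cov1, D_contr, h, mul_sub, Finset.sum_sub_distrib, Finset.mul_sum]
  congr 1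
  rw [Finset.sum_comm]
  refine Finset.sum_congr rfl fun a _ => ?_
  rw [Finset.sum_comm]
  exact Finset.sum_congr rfl fun b _ => Finset.sum_congr rfl fun s _ => by ring

theorem cov2_contr (S : ι → ι → ι → ι → A) (i j l : ι) :
    𝔤.cov2 (fun i j => ∑ a, ∑ b, 𝔤.gi a b * S i j a b) i j l
      = ∑ a, ∑ b, 𝔤.gi a b * 𝔤.cov4 S i j a b l := by
  have h : ∀ a b, 𝔤.cov4 S i j a b l
      = 𝔤.cov2 (fun a b => S i j a b) a b l
        - ∑ s, (𝔤.Γ s l i * S s j a b + 𝔤.Γ s l j * S i s a b) := fun a b => by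
    simp only [cov4, cov2, Finset.sum_add_distrib]; ring
  simp only [cov2, Finset.mul_sum, ← Finset.sum_add_distrib]
  rw [D_contr]
  simp only [h, mul_sub, Finset.sum_sub_distrib, Finset.mul_sum]
  congr 1
  rw [Finset.sum_comm]
  refine Finset.sum_congr rfl fun a _ => ?_
  rw [Finset.sum_comm]
  exact Finset.sum_congr rfl fun b _ => Finset.sum_congr rfl fun s _ => by ring

theorem cov3_rotate (S : ι → ι → ι → A) (i j k l : ι) :
    𝔤.cov3 (fun i j k => S j k i) i j k l = 𝔤.cov3 S j k i l := by
  simp only [cov3]; congr 1; exact Finset.sum_congr rfl fun s _ => by ring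

theorem cov3_add (S T : ι → ι → ι → A) (i j k l : ι) :
    𝔤.cov3 (fun i j k => S i j k + T i j k) i j k l = 𝔤.cov3 S i j k l + 𝔤.cov3 T i j k l := by
  simp only [cov3, map_add, mul_add, Finset.sum_add_distrib]; ring

theorem cov3_sub (S T : ι → ι → ι → A) (i j k l : ι) :
    𝔤.cov3 (fun i j k => S i j k - T i j k) i j k l = 𝔤.cov3 S i j k l - 𝔤.cov3 T i j k l := by
  simp only [cov3, map_sub, mul_sub, Finset.sum_add_distrib, Finset.sum_sub_distrib]; ring

theorem cov4_rotate (S : ι → ι → ι → ι → A) (i j k l m : ι) :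
    𝔤.cov4 (fun i j k l => S i k l j) i j k l m = 𝔤.cov4 S i k l j m := by
  simp only [cov4]; congr 1; exact Finset.sum_congr rfl fun s _ => by ring

theorem cov2_sub (S T : ι → ι → A) (i j k : ι) :
    𝔤.cov2 (fun i j => S i j - T i j) i j k = 𝔤.cov2 S i j k - 𝔤.cov2 T i j k := by
  simp only [cov2, map_sub, mul_sub, Finset.sum_add_distrib, Finset.sum_sub_distrib]; ring

theorem cov2_symm {T : ι → ι → A} (h : ∀ i j, T i j = T j i) (i j k : ι) :
    𝔤.cov2 T i j k = 𝔤.cov2 T j i k := by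
  simp only [cov2, h i j]
  congr 1
  refine Finset.sum_congr rfl fun s _ => ?_
  rw [h i s, h s j]; ring

theorem cov1_sub (S T : ι → A) (i j : ι) :
    𝔤.cov1 (fun i => S i - T i) i j = 𝔤.cov1 S i j - 𝔤.cov1 T i j := by
  simp only [cov1, map_sub, mul_sub, Finset.sum_sub_distrib]; ring

theorem cov1_const_mul (c : ℝ) (S : ι → A) (i j : ι) :
    𝔤.cov1 (fun i => algebraMap ℝ A c * S i) i j = algebraMap ℝ A c * 𝔤.cov1 S i j := by
  simp only [cov1, mul_sub, Finset.mul_sum, Derivation.leibniz, Derivation.map_algebraMap,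
    smul_eq_mul]
  congr 1
  · simp
  exact Finset.sum_congr rfl fun s _ => by ring

theorem cov2_const_mul (c : ℝ) (S : ι → ι → A) (i j k : ι) :
    𝔤.cov2 (fun i j => algebraMap ℝ A c * S i j) i j k = algebraMap ℝ A c * 𝔤.cov2 S i j k := by
  rw [cov2_mul, Derivation.map_algebraMap]; ring

theorem cov3_const_mul (c : ℝ) (S : ι → ι → ι → A) (i j k l : ι) :
    𝔤.cov3 (fun i j k => algebraMap ℝ A c * S i j k) i j k l
      = algebraMap ℝ A c * 𝔤.cov3 S i j k l := by
  simp only [cov3, mul_sub, Finset.mul_sum, Derivation.leibniz, Derivation.map_algebraMap,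
    smul_eq_mul]
  congr 1
  · simp
  exact Finset.sum_congr rfl fun s _ => by ring

/-- The covariant derivative of a tensor with a raised index. -/
theorem covC_raise (S : ι → ι → ι → A) (l i j k : ι) :
    𝔤.covC (fun i j k => ∑ b, 𝔤.gi i b * S b j k) l i j k
      = ∑ b, 𝔤.gi i b * 𝔤.cov3 S b j k l := by
  simp only [covC, cov3, map_sum, Derivation.leibniz, smul_eq_mul, D_gi, Finset.sum_add_distrib,
    Finset.sum_sub_distrib, mul_sub, mul_add, mul_neg, Finset.mul_sum, Finset.sum_neg_distrib]
  have e1 : ∑ s, ∑ b, 𝔤.Γ i l s * (𝔤.gi s b * S b j k)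
      = ∑ b, ∑ s, S b j k * (𝔤.Γ i l s * 𝔤.gi s b) := by
    rw [Finset.sum_comm]
    exact Finset.sum_congr rfl fun b _ => Finset.sum_congr rfl fun s _ => by ring
  have e2 : ∑ b, ∑ s, S b j k * (𝔤.Γ b l s * 𝔤.gi i s)
      = ∑ b, ∑ s, 𝔤.gi i b * (𝔤.Γ s l b * S s j k) := by
    rw [Finset.sum_comm]
    exact Finset.sum_congr rfl fun b _ => Finset.sum_congr rfl fun s _ => by ring
  have e3 : ∑ s, ∑ b, 𝔤.Γ s l j * (𝔤.gi i b * S b s k)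
      = ∑ b, ∑ s, 𝔤.gi i b * (𝔤.Γ s l j * S b s k) := by
    rw [Finset.sum_comm]
    exact Finset.sum_congr rfl fun b _ => Finset.sum_congr rfl fun s _ => by ring
  have e4 : ∑ s, ∑ b, 𝔤.Γ s l k * (𝔤.gi i b * S b j s)
      = ∑ b, ∑ s, 𝔤.gi i b * (𝔤.Γ s l k * S b j s) := by
    rw [Finset.sum_comm]
    exact Finset.sum_congr rfl fun b _ => Finset.sum_congr rfl fun s _ => by ring
  rw [e1, e2, e3, e4]; ring

/-- The divergence `T_{jk,}{}^k`. -/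
def div (T : ι → ι → A) (j : ι) : A := ∑ a, ∑ b, 𝔤.gi a b * 𝔤.cov2 T j a b

/-- The Laplacian `T_{ij,k}{}^k`. -/
def lap (T : ι → ι → A) (i j : ι) : A := ∑ a, ∑ b, 𝔤.gi a b * 𝔤.cov3 (𝔤.cov2 T) i j a b

/-- The Hessian of the trace, `T_k{}^k{}_{,ij}`. -/
def hessTr (T : ι → ι → A) (i j : ι) : A := ∑ a, ∑ b, 𝔤.gi a b * 𝔤.cov3 (𝔤.cov2 T) a b i j

/-- The trace commutes with ∇, so only the function tr T enters. This gives the symmetry of `hessTr`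
and lets bounds for tr T be used in place of bounds for T. -/
theorem hessTr_eq (T : ι → ι → A) (i j : ι) :
    𝔤.hessTr T i j = 𝔤.cov1 (fun i => 𝔤.D i (𝔤.tr T)) i j := by
  simp only [D_tr]
  rw [cov1_contr (S := fun i a b => 𝔤.cov2 T a b i)]
  simp only [hessTr, cov3_rotate]

/-- Both sides are the same double contraction of ∇²T with the two pairs exchanged, so no commutator
of derivatives appears. -/
theorem tr_lap (T : ι → ι → A) : 𝔤.tr (𝔤.lap T) = 𝔤.tr (𝔤.hessTr T) := by
  simp only [tr, lap, hessTr, Finset.mul_sum]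
  have e : ∀ f : ι → ι → ι → ι → A, ∑ i, ∑ j, ∑ a, ∑ b, f i j a b = ∑ a, ∑ b, ∑ i, ∑ j, f i j a b := by
    intro f
    simp only [← Fintype.sum_prod_type' (f := f _ _)]
    simp only [← Fintype.sum_prod_type' (f := fun i j => ∑ x : ι × ι, f i j x.1 x.2)]
    rw [Finset.sum_comm]
    simp only [Fintype.sum_prod_type]
  rw [e]
  refine Finset.sum_congr rfl fun a _ => Finset.sum_congr rfl fun b _ =>
    Finset.sum_congr rfl fun i _ => Finset.sum_congr rfl fun j _ => by ring

/-- The linearization of the Christoffel symbols. -/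
def linΓ (T : ι → ι → A) (k i j : ι) : A :=
  half A * ∑ l, 𝔤.gi k l * (𝔤.cov2 T j l i + 𝔤.cov2 T i l j - 𝔤.cov2 T i j l)

/-- The linearization of the Ricci tensor. -/
def linRic (T : ι → ι → A) (j k : ι) : A :=
  ∑ i, 𝔤.covC (𝔤.linΓ T) i i j k - 𝔤.cov1 (fun k => ∑ i, 𝔤.linΓ T i i k) k j

/-- The divergence passes through the inverse metric by `covC_raise`, and the trace of the
linearized Christoffel symbol is half of d tr T. The derivatives in the mixed terms are not yet
commuted, so the identity is exact. -/
theorem linRic_eq {T : ι → ι → A} (h : ∀ i j, T i j = T j i) (j k : ι) :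
    𝔤.linRic T j k = half A * (∑ a, ∑ b, 𝔤.gi a b * 𝔤.cov3 (𝔤.cov2 T) k a j b
      + ∑ a, ∑ b, 𝔤.gi a b * 𝔤.cov3 (𝔤.cov2 T) j a k b - 𝔤.lap T j k - 𝔤.hessTr T k j) := by
  have h1 : 𝔤.linΓ T = fun i j k => ∑ b, 𝔤.gi i b *
      (algebraMap ℝ A (1 / 2) * (𝔤.cov2 T k b j + 𝔤.cov2 T j b k - 𝔤.cov2 T j k b)) := by
    funext i j k
    rw [linΓ, Finset.mul_sum]
    exact Finset.sum_congr rfl fun b _ => by rw [half]; ring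
  have h2 : (fun k => ∑ i, 𝔤.linΓ T i i k)
      = fun k => algebraMap ℝ A (1 / 2) * 𝔤.D k (𝔤.tr T) := by
    funext k
    simp only [linΓ, ← Finset.mul_sum, D_tr]
    rw [half]
    congr 1
    have : ∑ a, ∑ b, 𝔤.gi a b * 𝔤.cov2 T k b a = ∑ a, ∑ b, 𝔤.gi a b * 𝔤.cov2 T a k b := by
      rw [Finset.sum_comm]
      refine Finset.sum_congr rfl fun a _ => Finset.sum_congr rfl fun b _ => ?_
      rw [𝔤.gi_symm, 𝔤.cov2_symm h]
    simp only [mul_sub, mul_add, Finset.sum_add_distrib, Finset.sum_sub_distrib, this]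
    ring
  rw [linRic, h2, cov1_const_mul, ← hessTr_eq, h1]
  simp only [covC_raise]
  have h3 : ∀ b j k l, 𝔤.cov3 (fun b j k => algebraMap ℝ A (1 / 2) *
      (𝔤.cov2 T k b j + 𝔤.cov2 T j b k - 𝔤.cov2 T j k b)) b j k l
      = algebraMap ℝ A (1 / 2) * (𝔤.cov3 (𝔤.cov2 T) k b j l + 𝔤.cov3 (𝔤.cov2 T) j b k l
        - 𝔤.cov3 (𝔤.cov2 T) j k b l) := by
    intro b j k l
    rw [cov3_const_mul, cov3_sub, cov3_add, cov3_rotate (S := 𝔤.cov2 T)]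
    congr 3
    · simp only [cov3]; congr 1; exact Finset.sum_congr rfl fun s _ => by ring
    · simp only [cov3]; congr 1; exact Finset.sum_congr rfl fun s _ => by ring
  simp only [h3]
  have h4 : ∀ S : ι → ι → A, ∑ i, ∑ b, 𝔤.gi i b * S b i = ∑ a, ∑ b, 𝔤.gi a b * S a b := by
    intro S
    rw [Finset.sum_comm]
    exact Finset.sum_congr rfl fun a _ => Finset.sum_congr rfl fun b _ => by rw [𝔤.gi_symm]
  have h5 := h4 fun b i => algebraMap ℝ A (1 / 2) * (𝔤.cov3 (𝔤.cov2 T) k b j i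
    + 𝔤.cov3 (𝔤.cov2 T) j b k i - 𝔤.cov3 (𝔤.cov2 T) j k b i)
  rw [h5, lap, half]
  simp only [mul_add, mul_sub, Finset.sum_add_distrib, Finset.sum_sub_distrib, Finset.mul_sum]
  simp only [mul_left_comm (𝔤.gi _ _)]

end Geom

/-! ### Natural tensors with few indices -/

namespace Natl

variable {m w L : ℕ} {ρ τ : Type} [Fintype ρ] [DecidableEq ρ] [Fintype τ] [DecidableEq τ]

/-- A contraction of two lower slots is two traces against g⁻¹, which has weight zero and no
curvature factor. -/
theorem ctr {T : Fam m ρ} (h : Low m w L T) (f : ρ → Option (Option τ)) (hf : f.Bijective) :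
    Low m w L (fun A _ _ 𝔤 (I : τ → Fin m) =>
      ∑ k, ∑ l, 𝔤.gi k l * T A 𝔤 (ocons k (ocons l I) ∘ f)) := by
  have h' : Low m w L _ := h.rename f hf (v' := fun _ => false) rfl
  let e : Option (Option τ) → Option (Option (Option (Option τ))) :=
    fun o => o.elim (some none) fun o => o.elim (some (some (some none)))
      fun t => some (some (some (some t)))
  have key := (((Natl.inv (m := m)).mulRename h'
    (ocons true (ocons false (ocons true (ocons false (fun _ : τ => false)))))
    (![none, some (some none)] : Fin 2 → Option (Option (Option (Option τ)))) e (by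
      constructor
      · rintro (a | (_ | _ | a)) (b | (_ | _ | b)) <;>
          first
          | (fin_cases a <;> fin_cases b <;> simp)
          | (fin_cases a <;> simp [e])
          | (fin_cases b <;> simp [e])
          | simp [e]
      · rintro (_ | _ | _ | _ | t)
        · exact ⟨Sum.inl 0, rfl⟩
        · exact ⟨Sum.inr none, rfl⟩
        · exact ⟨Sum.inl 1, rfl⟩
        · exact ⟨Sum.inr (some none), rfl⟩
        · exact ⟨Sum.inr (some (some t)), rfl⟩) (by
      funext x
      rcases x with x | (_ | _ | x)
      · fin_cases x <;> rfl
      all_goals rfl)).trace.trace).cast rfl (zero_add w)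
  refine (key.mono (zero_add L).ge).congr fun A _ _ 𝔤 I => ?_
  rw [Finset.sum_comm]
  refine Finset.sum_congr rfl fun k _ => Finset.sum_congr rfl fun l _ => ?_
  refine congrArg₂ (· * ·) rfl (congrArg (T A 𝔤) ?_)
  funext t
  simp only [Function.comp_apply]
  rcases f t with _ | _ | t <;> rfl

theorem cov0 {T : ∀ (A : Type) [CommRing A] [Algebra ℝ A], Geom (Fin m) A → A}
    (h : Low m w L (fun A _ _ 𝔤 (_ : Fin 0 → Fin m) => T A 𝔤)) :
    Low m (w + 1) L (fun A _ _ 𝔤 (I : Fin 1 → Fin m) => 𝔤.D (I 0) (T A 𝔤)) :=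
  (h.nabla.rename (v' := fun _ : Fin 1 => false) (fun o => o.elim 0 Fin.castSucc) (by decide)
    (by decide)).congr fun A _ _ 𝔤 I => by simp [Geom.nabla]

theorem cov1 {T : ∀ (A : Type) [CommRing A] [Algebra ℝ A], Geom (Fin m) A → Fin m → A}
    (h : Low m w L (fun A _ _ 𝔤 (I : Fin 1 → Fin m) => T A 𝔤 (I 0))) :
    Low m (w + 1) L (fun A _ _ 𝔤 (I : Fin 2 → Fin m) => 𝔤.cov1 (T A 𝔤) (I 0) (I 1)) :=
  (h.nabla.rename (v' := fun _ : Fin 2 => false) (fun o => o.elim 1 Fin.castSucc) (by decide)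
    (by decide)).congr fun A _ _ 𝔤 I => 𝔤.nabla_one _ _ _

theorem cov2 {T : ∀ (A : Type) [CommRing A] [Algebra ℝ A], Geom (Fin m) A → Fin m → Fin m → A}
    (h : Low m w L (fun A _ _ 𝔤 (I : Fin 2 → Fin m) => T A 𝔤 (I 0) (I 1))) :
    Low m (w + 1) L
      (fun A _ _ 𝔤 (I : Fin 3 → Fin m) => 𝔤.cov2 (T A 𝔤) (I 0) (I 1) (I 2)) :=
  (h.nabla.rename (v' := fun _ : Fin 3 => false) (fun o => o.elim 2 Fin.castSucc) (by decide)
    (by decide)).congr fun A _ _ 𝔤 I => 𝔤.nabla_two _ _ _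

theorem cov3 {T : ∀ (A : Type) [CommRing A] [Algebra ℝ A],
      Geom (Fin m) A → Fin m → Fin m → Fin m → A}
    (h : Low m w L (fun A _ _ 𝔤 (I : Fin 3 → Fin m) => T A 𝔤 (I 0) (I 1) (I 2))) :
    Low m (w + 1) L
      (fun A _ _ 𝔤 (I : Fin 4 → Fin m) => 𝔤.cov3 (T A 𝔤) (I 0) (I 1) (I 2) (I 3)) :=
  (h.nabla.rename (v' := fun _ : Fin 4 => false) (fun o => o.elim 3 Fin.castSucc) (by decide)
    (by decide)).congr fun A _ _ 𝔤 I => 𝔤.nabla_three _ _ _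

theorem cov4 {T : ∀ (A : Type) [CommRing A] [Algebra ℝ A],
      Geom (Fin m) A → Fin m → Fin m → Fin m → Fin m → A}
    (h : Low m w L (fun A _ _ 𝔤 (I : Fin 4 → Fin m) => T A 𝔤 (I 0) (I 1) (I 2) (I 3))) :
    Low m (w + 1) L
      (fun A _ _ 𝔤 (I : Fin 5 → Fin m) => 𝔤.cov4 (T A 𝔤) (I 0) (I 1) (I 2) (I 3) (I 4)) :=
  (h.nabla.rename (v' := fun _ : Fin 5 => false) (fun o => o.elim 4 Fin.castSucc) (by decide)
    (by decide)).congr fun A _ _ 𝔤 I => 𝔤.nabla_four _ _ _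

theorem cov3_comm {T : ∀ (A : Type) [CommRing A] [Algebra ℝ A],
      Geom (Fin m) A → Fin m → Fin m → A}
    (h : Low m w L (fun A _ _ 𝔤 (I : Fin 2 → Fin m) => T A 𝔤 (I 0) (I 1))) :
    Low m (w + 2) (L + 1) (fun A _ _ 𝔤 (I : Fin 4 → Fin m) =>
      𝔤.cov3 (𝔤.cov2 (T A 𝔤)) (I 0) (I 1) (I 2) (I 3)
        - 𝔤.cov3 (𝔤.cov2 (T A 𝔤)) (I 0) (I 1) (I 3) (I 2)) :=
  (h.nabla₂_comm.rename (v' := fun _ : Fin 4 => false)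
    (fun o => o.elim 3 (fun o => o.elim 2 ![0, 1])) (by decide) rfl).congr fun A _ _ 𝔤 I =>
      congrArg₂ (· - ·) (𝔤.nabla₂_two (T A 𝔤) _ _ _) (𝔤.nabla₂_two (T A 𝔤) _ _ _)

theorem cov4_comm {T : ∀ (A : Type) [CommRing A] [Algebra ℝ A],
      Geom (Fin m) A → Fin m → Fin m → Fin m → A}
    (h : Low m w L (fun A _ _ 𝔤 (I : Fin 3 → Fin m) => T A 𝔤 (I 0) (I 1) (I 2))) :
    Low m (w + 2) (L + 1) (fun A _ _ 𝔤 (I : Fin 5 → Fin m) =>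
      𝔤.cov4 (𝔤.cov3 (T A 𝔤)) (I 0) (I 1) (I 2) (I 3) (I 4)
        - 𝔤.cov4 (𝔤.cov3 (T A 𝔤)) (I 0) (I 1) (I 2) (I 4) (I 3)) :=
  (h.nabla₂_comm.rename (v' := fun _ : Fin 5 => false)
    (fun o => o.elim 4 (fun o => o.elim 3 ![0, 1, 2])) (by decide) rfl).congr fun A _ _ 𝔤 I =>
      congrArg₂ (· - ·) (𝔤.nabla₂_three (T A 𝔤) _ _ _) (𝔤.nabla₂_three (T A 𝔤) _ _ _)

end Natl

end

/-! ### Natural two-tensors modulo terms with more curvature factors -/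

section

theorem sum_four_comm {ι A : Type*} [Fintype ι] [AddCommMonoid A] (f : ι → ι → ι → ι → A) :
    ∑ i, ∑ j, ∑ a, ∑ b, f i j a b = ∑ a, ∑ b, ∑ i, ∑ j, f i j a b := by
  simp only [← Fintype.sum_prod_type' (f := f _ _)]
  simp only [← Fintype.sum_prod_type' (f := fun i j => ∑ x : ι × ι, f i j x.1 x.2)]
  rw [Finset.sum_comm]
  simp only [Fintype.sum_prod_type]

/-- A two-tensor that is assigned to every metric. -/
abbrev Fam₂ (m : ℕ) : Type 1 :=
  ∀ (A : Type) [CommRing A] [Algebra ℝ A], Geom (Fin m) A → Fin m → Fin m → A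

/-- Natural covariant two-tensors. -/
abbrev Low₂ (m w L : ℕ) (T : Fam₂ m) : Prop :=
  Low m w L (fun A _ _ 𝔤 (I : Fin 2 → Fin m) => T A 𝔤 (I 0) (I 1))

/-- Natural covectors. -/
abbrev Low₁ (m w L : ℕ)
    (T : ∀ (A : Type) [CommRing A] [Algebra ℝ A], Geom (Fin m) A → Fin m → A) : Prop :=
  Low m w L (fun A _ _ 𝔤 (I : Fin 1 → Fin m) => T A 𝔤 (I 0))

/-- Natural scalars. -/
abbrev Low₀ (m w L : ℕ)
    (T : ∀ (A : Type) [CommRing A] [Algebra ℝ A], Geom (Fin m) A → A) : Prop :=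
  Low m w L (fun A _ _ 𝔤 (_ : Fin 0 → Fin m) => T A 𝔤)

namespace Low₂

variable {m w L : ℕ} {T : Fam₂ m}

theorem swap (h : Low₂ m w L T) : Low₂ m w L (fun A _ _ 𝔤 i j => T A 𝔤 j i) :=
  Natl.rename h (v' := fun _ : Fin 2 => false) (![1, 0] : Fin 2 → Fin 2) (by decide) rfl

theorem tr (h : Low₂ m w L T) : Low₀ m w L (fun A _ _ 𝔤 => 𝔤.tr (T A 𝔤)) :=
  Natl.ctr h (![none, some none] : Fin 2 → Option (Option (Fin 0))) (by decide)

theorem div (h : Low₂ m w L T) : Low₁ m (w + 1) L (fun A _ _ 𝔤 => 𝔤.div (T A 𝔤)) :=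
  Natl.ctr (Natl.cov2 h) (![some (some 0), none, some none] : Fin 3 → Option (Option (Fin 1)))
    (by decide)

theorem lap (h : Low₂ m w L T) : Low₂ m (w + 2) L (fun A _ _ 𝔤 => 𝔤.lap (T A 𝔤)) :=
  Natl.ctr (Natl.cov3 (Natl.cov2 h)) (![some (some 0), some (some 1), none, some none] :
    Fin 4 → Option (Option (Fin 2))) (by decide)

/-- The assumption concerns tr T only; for Δ^k B the trace has more curvature factors than the
tensor itself. -/
theorem hessTr (h : Low₀ m w L (fun A _ _ 𝔤 => 𝔤.tr (T A 𝔤))) :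
    Low₂ m (w + 2) L (fun A _ _ 𝔤 => 𝔤.hessTr (T A 𝔤)) :=
  (Natl.cov1 (Natl.cov0 h)).congr fun A _ _ 𝔤 I => (𝔤.hessTr_eq _ _ _).symm

/-- The contraction of `T_{ki,ja}` over `i` and `a` is the derivative of the divergence, up to
terms with more curvature factors. -/
theorem contr_comm (h : Low₂ m w L T) : Low₂ m (w + 2) (L + 1) (fun A _ _ 𝔤 j k =>
    ∑ a, ∑ b, 𝔤.gi a b * 𝔤.cov3 (𝔤.cov2 (T A 𝔤)) k a j b - 𝔤.cov1 (𝔤.div (T A 𝔤)) k j) := by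
  refine (Natl.ctr (Natl.cov3_comm h) (![some (some 1), none, some (some 0), some none] :
    Fin 4 → Option (Option (Fin 2))) (by decide)).congr fun A _ _ 𝔤 I => ?_
  have := 𝔤.cov1_contr (𝔤.cov2 (T A 𝔤)) (I 1) (I 0)
  refine Eq.trans ?_ (congrArg (fun z => _ - z) this.symm)
  simp only [← Finset.sum_sub_distrib, ← mul_sub]
  rfl

/-- The mixed terms of `linRic_eq` become derivatives of the divergence after one exchange of
derivatives each, at the cost of a curvature factor. -/
theorem linRic (h : Low₂ m w L T)
    (hs : ∀ (A : Type) [CommRing A] [Algebra ℝ A] (𝔤 : Geom (Fin m) A) i j,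
      T A 𝔤 i j = T A 𝔤 j i) :
    Low₂ m (w + 2) (L + 1) (fun A _ _ 𝔤 j k => 𝔤.linRic (T A 𝔤) j k
      - half A * (𝔤.cov1 (𝔤.div (T A 𝔤)) k j + 𝔤.cov1 (𝔤.div (T A 𝔤)) j k
        - 𝔤.lap (T A 𝔤) j k - 𝔤.hessTr (T A 𝔤) k j)) :=
  ((h.contr_comm.add (swap (T := fun A _ _ 𝔤 j k =>
      ∑ a, ∑ b, 𝔤.gi a b * 𝔤.cov3 (𝔤.cov2 (T A 𝔤)) k a j b - 𝔤.cov1 (𝔤.div (T A 𝔤)) k j)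
    h.contr_comm)).const_mul (1 / 2)).congr fun A _ _ 𝔤 I => by
    beta_reduce
    rw [𝔤.linRic_eq (hs A 𝔤), half]
    ring

/-- The divergence commutes with the Laplacian up to commutators of covariant derivatives, each of
which brings in a curvature factor. -/
theorem div_lap (h : Low₂ m w L T) : Low₁ m (w + 3) (L + 1) (fun A _ _ 𝔤 j =>
    𝔤.div (𝔤.lap (T A 𝔤)) j
      - ∑ a, ∑ b, 𝔤.gi a b * 𝔤.cov2 (𝔤.cov1 (𝔤.div (T A 𝔤))) j a b) := by
  -- The differentiation index of the divergence moves past the two indices of the Laplacian: `h1`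
  -- takes it past the second, and `h2`, the derivative of a lower commutator, past the first. The
  -- sum telescopes.
  have h1 := (Natl.cov4_comm (Natl.cov2 h)).cast rfl (w' := w + 3) (by omega)
  have h2 := Natl.rename (Natl.cov4 (T := fun A _ _ 𝔤 i j k l =>
      𝔤.cov3 (𝔤.cov2 (T A 𝔤)) i j k l - 𝔤.cov3 (𝔤.cov2 (T A 𝔤)) i j l k) (Natl.cov3_comm h))
    (v' := fun _ : Fin 5 => false) (![0, 1, 2, 4, 3] : Fin 5 → Fin 5) (by decide) rfl
  have h3 := Natl.ctr (h1.add h2) (![some (some (some (some 0))), some (some none), none,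
    some none, some (some (some none))] :
      Fin 5 → Option (Option (Option (Option (Fin 1))))) (by decide)
  have h4 := Natl.ctr h3 id Function.bijective_id
  refine h4.congr fun A _ _ 𝔤 I => ?_
  have e1 : ∀ j c d, 𝔤.cov2 (𝔤.lap (T A 𝔤)) j c d
      = ∑ a, ∑ b, 𝔤.gi a b * 𝔤.cov4 (𝔤.cov3 (𝔤.cov2 (T A 𝔤))) j c a b d := fun j c d =>
    𝔤.cov2_contr (𝔤.cov3 (𝔤.cov2 (T A 𝔤))) j c d
  have e2 : ∀ j a b, 𝔤.cov2 (𝔤.cov1 (𝔤.div (T A 𝔤))) j a b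
      = ∑ c, ∑ d, 𝔤.gi c d * 𝔤.cov4 (𝔤.cov3 (𝔤.cov2 (T A 𝔤))) j c d a b := by
    intro j a b
    have : 𝔤.cov1 (𝔤.div (T A 𝔤)) = fun j a => ∑ c, ∑ d, 𝔤.gi c d *
        𝔤.cov3 (𝔤.cov2 (T A 𝔤)) j c d a := by
      funext j a
      exact 𝔤.cov1_contr (𝔤.cov2 (T A 𝔤)) j a
    rw [this, 𝔤.cov2_contr (fun j a c d => 𝔤.cov3 (𝔤.cov2 (T A 𝔤)) j c d a)]
    exact Finset.sum_congr rfl fun c _ => Finset.sum_congr rfl fun d _ =>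
      congrArg (𝔤.gi c d * ·) (𝔤.cov4_rotate _ _ _ _ _ _)
  have e3 : ∀ j, 𝔤.div (𝔤.lap (T A 𝔤)) j = ∑ c, ∑ d, ∑ a, ∑ b, 𝔤.gi c d * (𝔤.gi a b *
      𝔤.cov4 (𝔤.cov3 (𝔤.cov2 (T A 𝔤))) j c a b d) := fun j => by
    simp only [Geom.div, e1, Finset.mul_sum]
  have e4 : ∀ j, ∑ a, ∑ b, 𝔤.gi a b * 𝔤.cov2 (𝔤.cov1 (𝔤.div (T A 𝔤))) j a b
      = ∑ c, ∑ d, ∑ a, ∑ b, 𝔤.gi c d * (𝔤.gi a b *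
      𝔤.cov4 (𝔤.cov3 (𝔤.cov2 (T A 𝔤))) j c d a b) := fun j => by
    simp only [e2, Finset.mul_sum]
    rw [sum_four_comm]
    refine Finset.sum_congr rfl fun a _ => Finset.sum_congr rfl fun b _ =>
      Finset.sum_congr rfl fun i _ => Finset.sum_congr rfl fun j _ => by ring
  refine Eq.trans ?_ (congrArg₂ (· - ·) (e3 (I 0)) (e4 (I 0))).symm
  simp only [← Finset.sum_sub_distrib, ← mul_sub, Finset.mul_sum]
  refine Finset.sum_congr rfl fun c _ => Finset.sum_congr rfl fun d _ =>
    Finset.sum_congr rfl fun a _ => Finset.sum_congr rfl fun b _ => ?_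
  refine congrArg (fun z => 𝔤.gi c d * (𝔤.gi a b * z)) ?_
  change _ + 𝔤.cov4 (fun i j k l => 𝔤.cov3 (𝔤.cov2 (T A 𝔤)) i j k l
    - 𝔤.cov3 (𝔤.cov2 (T A 𝔤)) i j l k) (I 0) c a d b = _
  rw [𝔤.cov4_sub]
  have : 𝔤.cov4 (fun i j k l => 𝔤.cov3 (𝔤.cov2 (T A 𝔤)) i j l k) (I 0) c a d b
      = 𝔤.cov4 (𝔤.cov3 (𝔤.cov2 (T A 𝔤))) (I 0) c d a b := by
    simp only [Geom.cov4]; congr 1; exact Finset.sum_congr rfl fun s _ => by ring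
  rw [this]
  exact sub_add_sub_cancel _ _ _

/-- The divergence of `Δ T` has more curvature factors if that of `T` has. -/
theorem div_lap_mono (h : Low₂ m w L T)
    (hd : Low₁ m (w + 1) (L + 1) (fun A _ _ 𝔤 => 𝔤.div (T A 𝔤))) :
    Low₁ m (w + 3) (L + 1) (fun A _ _ 𝔤 => 𝔤.div (𝔤.lap (T A 𝔤))) := by
  have h2 := Natl.ctr (Natl.cov2 (Natl.cov1 hd)) (![some (some 0), none, some none] :
    Fin 3 → Option (Option (Fin 1))) (by decide)
  exact (h.div_lap.add h2).congr fun A _ _ 𝔤 I => sub_add_cancel _ _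

theorem tr_lap_mono (hd : Low₀ m w L (fun A _ _ 𝔤 => 𝔤.tr (T A 𝔤))) :
    Low₀ m (w + 2) L (fun A _ _ 𝔤 => 𝔤.tr (𝔤.lap (T A 𝔤))) :=
  (tr (hessTr hd)).congr fun A _ _ 𝔤 I => (𝔤.tr_lap _).symm

end Low₂

/-! ### The Schouten tensor -/

namespace Geom

variable {m : ℕ} {A : Type*} [CommRing A] [Algebra ℝ A] (𝔤 : Geom (Fin m) A)

/-- The Schouten tensor. -/
def schouten (i j : Fin m) : A :=
  algebraMap ℝ A (1 / ((m : ℝ) - 2)) *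
    (𝔤.ric i j - algebraMap ℝ A (1 / (2 * ((m : ℝ) - 1))) * 𝔤.scal * 𝔤.g i j)

/-- The tensor `P_{ij,k}{}^k - P_k{}^k{}_{,ij}`. -/
def bach (i j : Fin m) : A := 𝔤.lap 𝔤.schouten i j - 𝔤.hessTr 𝔤.schouten i j

theorem schouten_symm (i j : Fin m) : 𝔤.schouten i j = 𝔤.schouten j i := by
  rw [schouten, schouten, 𝔤.ric_symm, 𝔤.symm]

theorem tr_schouten (hm : 3 ≤ m) :
    𝔤.tr 𝔤.schouten = algebraMap ℝ A (1 / (2 * ((m : ℝ) - 1))) * 𝔤.scal := by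
  have h3 : (3 : ℝ) ≤ m := by exact_mod_cast hm
  have h1 : (m : ℝ) - 1 ≠ 0 := by linarith
  have h2 : (m : ℝ) - 2 ≠ 0 := by linarith
  have e : 𝔤.tr 𝔤.schouten = algebraMap ℝ A (1 / ((m : ℝ) - 2)) *
      (𝔤.scal - algebraMap ℝ A (1 / (2 * ((m : ℝ) - 1))) * 𝔤.scal * m) := by
    have hg := 𝔤.tr_g
    rw [Fintype.card_fin] at hg
    rw [← hg]
    simp only [tr, schouten, scal, mul_sub, Finset.sum_sub_distrib, Finset.mul_sum, Finset.sum_mul]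
    congr 1
    · exact Finset.sum_congr rfl fun a _ => Finset.sum_congr rfl fun b _ => by ring
    · refine Finset.sum_congr rfl fun a _ => Finset.sum_congr rfl fun b _ => 
        Finset.sum_congr rfl fun i _ => Finset.sum_congr rfl fun j _ => by ring
  rw [e]
  have e2 : (1 / ((m : ℝ) - 2)) * (1 - 1 / (2 * ((m : ℝ) - 1)) * m) = 1 / (2 * ((m : ℝ) - 1)) := by
    field_simp; ring
  have e3 := congrArg (algebraMap ℝ A) e2
  simp only [map_mul, map_sub, map_one, map_natCast] at e3
  linear_combination 𝔤.scal * e3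

/-- The contracted Bianchi identity div Ric = dS/2; the normalization of P is exactly the one for
which the multiples of dS agree. -/
theorem div_schouten (hm : 3 ≤ m) (j : Fin m) :
    𝔤.div 𝔤.schouten j = 𝔤.D j (𝔤.tr 𝔤.schouten) := by
  have h3 : (3 : ℝ) ≤ m := by exact_mod_cast hm
  have h1 : (m : ℝ) - 1 ≠ 0 := by linarith
  have h2 : (m : ℝ) - 2 ≠ 0 := by linarith
  rw [tr_schouten _ hm]
  have hc : ∀ a b, 𝔤.cov2 𝔤.schouten j a b = algebraMap ℝ A (1 / ((m : ℝ) - 2)) *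
      (𝔤.cov2 𝔤.ric j a b - algebraMap ℝ A (1 / (2 * ((m : ℝ) - 1))) * 𝔤.D b 𝔤.scal * 𝔤.g j a) := by
    intro a b
    have : 𝔤.schouten = fun i j => algebraMap ℝ A (1 / ((m : ℝ) - 2)) *
        (𝔤.ric i j - algebraMap ℝ A (1 / (2 * ((m : ℝ) - 1))) * 𝔤.scal * 𝔤.g i j) := rfl
    have hg : 𝔤.cov2 (fun i j => algebraMap ℝ A (1 / (2 * ((m : ℝ) - 1))) * 𝔤.scal * 𝔤.g i j) j a b
        = algebraMap ℝ A (1 / (2 * ((m : ℝ) - 1))) * 𝔤.D b 𝔤.scal * 𝔤.g j a := by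
      refine (𝔤.cov2_mul _ 𝔤.g j a b).trans ?_
      rw [𝔤.cov2_g, Derivation.leibniz, Derivation.map_algebraMap]
      simp only [smul_eq_mul, mul_zero, add_zero, zero_add]
    rw [this, cov2_const_mul, cov2_sub, hg]
  have hb := 𝔤.contracted_bianchi j
  have ht : ∑ a, ∑ b, 𝔤.gi a b * (𝔤.D b 𝔤.scal * 𝔤.g j a) = 𝔤.D j 𝔤.scal := by
    rw [Finset.sum_comm]
    have : ∀ b, ∑ a, 𝔤.gi a b * (𝔤.D b 𝔤.scal * 𝔤.g j a)
        = (if j = b then 1 else 0) * 𝔤.D b 𝔤.scal := by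
      intro b
      rw [← 𝔤.sum_g_gi, Finset.sum_mul]
      exact Finset.sum_congr rfl fun a _ => by ring
    simp [this]
  have e : 𝔤.div 𝔤.schouten j = algebraMap ℝ A (1 / ((m : ℝ) - 2)) *
      (∑ a, ∑ b, 𝔤.gi a b * 𝔤.cov2 𝔤.ric j a b - algebraMap ℝ A (1 / (2 * ((m : ℝ) - 1))) *
        ∑ a, ∑ b, 𝔤.gi a b * (𝔤.D b 𝔤.scal * 𝔤.g j a)) := by
    simp only [div, hc, mul_sub, Finset.sum_sub_distrib, Finset.mul_sum]
    congr 1 <;>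
    exact Finset.sum_congr rfl fun a _ => Finset.sum_congr rfl fun b _ => by ring
  rw [e, hb, ht, half, Derivation.leibniz, Derivation.map_algebraMap]
  have e2 : (1 / ((m : ℝ) - 2)) * (1 / 2 - 1 / (2 * ((m : ℝ) - 1))) = 1 / (2 * ((m : ℝ) - 1)) := by
    field_simp; ring
  have e3 := congrArg (algebraMap ℝ A) e2
  simp only [map_mul, map_sub] at e3
  simp only [smul_eq_mul, mul_zero, add_zero]
  linear_combination 𝔤.D j 𝔤.scal * e3

theorem tr_sub (S T : Fin m → Fin m → A) :
    𝔤.tr (fun a b => S a b - T a b) = 𝔤.tr S - 𝔤.tr T := by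
  simp only [tr, mul_sub, Finset.sum_sub_distrib]

theorem tr_bach : 𝔤.tr 𝔤.bach = 0 := by
  have : 𝔤.bach = fun i j => 𝔤.lap 𝔤.schouten i j - 𝔤.hessTr 𝔤.schouten i j := rfl
  rw [this, tr_sub]
  exact sub_eq_zero.mpr (𝔤.tr_lap _)

end Geom

namespace Low₂

variable {m : ℕ}

theorem schouten : Low₂ m 2 1 (fun A _ _ 𝔤 => 𝔤.schouten) := by
  have hs : Low₀ m 2 1 (fun A _ _ 𝔤 => 𝔤.scal) := tr (T := fun A _ _ 𝔤 => 𝔤.ric) Natl.ric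
  have hg : Low₂ m 2 1 (fun A _ _ 𝔤 i j => 𝔤.scal * 𝔤.g i j) :=
    Natl.mulRename hs Natl.metric (fun _ : Fin 2 => false) (![] : Fin 0 → Fin 2) ![0, 1]
      (by decide) (by decide)
  refine ((Natl.ric.sub (hg.const_mul (1 / (2 * ((m : ℝ) - 1))))).const_mul
    (1 / ((m : ℝ) - 2))).congr fun A _ _ 𝔤 I => ?_
  change _ = algebraMap ℝ A _ * (_ - _ * _ * _)
  beta_reduce
  rw [mul_assoc]

theorem bach : Low₂ m 4 1 (fun A _ _ 𝔤 => 𝔤.bach) :=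
  schouten.lap.sub (hessTr schouten.tr)

/-- By `div_schouten`, ∇ div P is the Hessian of tr P. Hence Δ div P is the divergence of that
Hessian, and only the commutator of `div_lap` remains. -/
theorem div_bach (hm : 3 ≤ m) : Low₁ m 5 2 (fun A _ _ 𝔤 => 𝔤.div 𝔤.bach) := by
  refine (schouten (m := m)).div_lap.congr fun A _ _ 𝔤 I => ?_
  have h1 : 𝔤.cov1 (𝔤.div 𝔤.schouten) = 𝔤.hessTr 𝔤.schouten := by
    funext i j
    rw [𝔤.hessTr_eq]
    congr 1
    funext j
    exact 𝔤.div_schouten hm j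
  have h2 : 𝔤.bach = fun i j => 𝔤.lap 𝔤.schouten i j - 𝔤.hessTr 𝔤.schouten i j := rfl
  beta_reduce
  rw [h1, h2, Geom.div, Geom.div]
  simp only [Geom.cov2_sub, mul_sub, Finset.sum_sub_distrib]

end Low₂

end

/-! ### Natural formal metrics and their Einstein defect modulo quadratic terms -/

section

open PowerSeries (coeff coeff_mul coeff_C_mul C X)

namespace Geom

variable {ι A : Type*} [Fintype ι] [DecidableEq ι] [CommRing A] [Algebra ℝ A] (𝔤 : Geom ι A)

theorem covC_sub (S T : ι → ι → ι → A) (l i j k : ι) :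
    𝔤.covC (fun i j k => S i j k - T i j k) l i j k = 𝔤.covC S l i j k - 𝔤.covC T l i j k := by
  simp only [covC, map_sub, mul_sub, Finset.sum_add_distrib, Finset.sum_sub_distrib]; ring

open PowerSeries in
theorem coeff_series_linRic (n : ℕ) (T : ι → ι → A⟦X⟧) (j k : ι) :
    coeff n (𝔤.series.linRic T j k) = 𝔤.linRic (fun i j => coeff n (T i j)) j k := by
  have h : ∀ k i j, coeff n (𝔤.series.linΓ T k i j) = 𝔤.linΓ (fun i j => coeff n (T i j)) k i j := by
    intro k i j
    simp only [linΓ, coeff_half_mul, map_sum, series_gi, coeff_C_mul, map_add, map_sub,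
      coeff_series_cov2]
  simp only [linRic, covC, cov1, map_sub, map_sum, map_add, coeff_series_D, series_Γ, coeff_C_mul, h]

end Geom

namespace SMetric

open PowerSeries (coeff C)

variable {m : ℕ} {A : Type*} [CommRing A] [Algebra ℝ A] {𝔤 : Geom (Fin m) A} (H : SMetric 𝔤)

/-- The deviation `h_x - h_0`. -/
def dev (i j : Fin m) : PowerSeries A := H.h i j - C (𝔤.g i j)

/-- The deviation `h_x^{-1} - h_0^{-1}`. -/
def devInv (i j : Fin m) : PowerSeries A := H.path.gi i j - C (𝔤.gi i j)

theorem coeff_zero_dev (i j : Fin m) : coeff 0 (H.dev i j) = 0 := by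
  rw [dev, map_sub, H.coeff_zero]; simp

theorem coeff_succ_dev (s : ℕ) (i j : Fin m) : coeff (s + 1) (H.dev i j) = coeff (s + 1) (H.h i j) := by
  rw [dev, map_sub, PowerSeries.coeff_C, if_neg s.succ_ne_zero, sub_zero]

theorem ddX_dev (i j : Fin m) : ddX A (H.dev i j) = ddX A (H.h i j) := by
  ext n
  rw [coeff_ddX, coeff_ddX, coeff_succ_dev]

/-- The resolvent identity h⁻¹ = g⁻¹ - h⁻¹ (h - g) g⁻¹. As h - g has no constant term, it determines
the coefficients of h⁻¹ recursively. -/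
theorem gi_eq (i j : Fin m) : H.path.gi i j
    = C (𝔤.gi i j) - ∑ l, (∑ k, H.path.gi i k * H.dev k l) * C (𝔤.gi l j) := by
  have h1 : ∀ l, ∑ k, H.path.gi i k * H.dev k l
      = (if i = l then 1 else 0) - ∑ k, H.path.gi i k * C (𝔤.g k l) := by
    intro l
    rw [← H.path.sum_gi_g, ← Finset.sum_sub_distrib]
    exact Finset.sum_congr rfl fun k _ => by rw [dev, mul_sub]; rfl
  have h2 : ∑ l, (∑ k, H.path.gi i k * C (𝔤.g k l)) * C (𝔤.gi l j) = H.path.gi i j := by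
    simp only [Finset.sum_mul]
    rw [Finset.sum_comm]
    have : ∀ k, ∑ l, H.path.gi i k * C (𝔤.g k l) * C (𝔤.gi l j)
        = H.path.gi i k * (if k = j then 1 else 0) := by
      intro k
      have := congrArg (C (R := A)) (𝔤.sum_g_gi k j)
      rw [map_sum] at this
      simp only [map_mul] at this
      rw [show (if k = j then (1 : PowerSeries A) else 0) = C (if k = j then 1 else 0) by
        split_ifs <;> simp, ← this, Finset.mul_sum]
      exact Finset.sum_congr rfl fun l _ => mul_assoc _ _ _
    simp [this]
  simp only [h1, sub_mul, Finset.sum_sub_distrib, h2]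
  simp

theorem devInv_eq (i j : Fin m) : H.devInv i j
    = -∑ l, (∑ k, H.path.gi i k * H.dev k l) * C (𝔤.gi l j) := by
  rw [devInv, gi_eq]; ring

/-- The difference of the Christoffel symbols of `h_x` and `h_0`. -/
def devΓ (k i j : Fin m) : PowerSeries A := half (PowerSeries A) *
    ∑ l, H.path.gi k l * (𝔤.series.cov2 H.dev j l i + 𝔤.series.cov2 H.dev i l j
      - 𝔤.series.cov2 H.dev i j l)

theorem Γ_path (k i j : Fin m) : H.path.Γ k i j = 𝔤.series.Γ k i j + H.devΓ k i j := by
  rw [devΓ]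
  have h : 𝔤.series.cov2 H.dev = 𝔤.series.cov2 H.path.g := by
    funext i j k
    have : H.dev = fun i j => H.path.g i j - 𝔤.series.g i j := rfl
    rw [this]
    refine (𝔤.series.cov2_sub H.path.g 𝔤.series.g i j k).trans ?_
    rw [𝔤.series.cov2_g, sub_zero]
  rw [h]
  exact 𝔤.series.Γ_sub H.path.toGeom (fun _ _ => rfl) k i j

end SMetric

namespace NatS

variable {m k L : ℕ} {ρ τ : Type} [Fintype ρ] [DecidableEq ρ] [Fintype τ] [DecidableEq τ]

open PowerSeries in
theorem cov1 {T : ∀ (A : Type) [CommRing A] [Algebra ℝ A], Geom (Fin m) A → Fin m → A⟦X⟧}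
    (h : NatS m (fun _ : Fin 1 => false) k L (fun A _ _ 𝔤 I => T A 𝔤 (I 0))) :
    NatS m (fun _ : Fin 2 => false) (k + 1) L
      (fun A _ _ 𝔤 I => 𝔤.series.cov1 (T A 𝔤) (I 0) (I 1)) :=
  (h.nabla.rename (fun _ : Fin 2 => false) (fun o => o.elim 1 Fin.castSucc) (by decide)
    (by decide)).congr fun A _ _ 𝔤 I => 𝔤.series.nabla_one _ _ _

open PowerSeries in
theorem cov2 {T : ∀ (A : Type) [CommRing A] [Algebra ℝ A], Geom (Fin m) A → Fin m → Fin m → A⟦X⟧}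
    (h : NatS m (fun _ : Fin 2 => false) k L (fun A _ _ 𝔤 I => T A 𝔤 (I 0) (I 1))) :
    NatS m (fun _ : Fin 3 => false) (k + 1) L
      (fun A _ _ 𝔤 I => 𝔤.series.cov2 (T A 𝔤) (I 0) (I 1) (I 2)) :=
  (h.nabla.rename (fun _ : Fin 3 => false) (fun o => o.elim 2 Fin.castSucc) (by decide)
    (by decide)).congr fun A _ _ 𝔤 I => 𝔤.series.nabla_two _ _ _

open PowerSeries in
theorem covC {T : ∀ (A : Type) [CommRing A] [Algebra ℝ A],
      Geom (Fin m) A → Fin m → Fin m → Fin m → A⟦X⟧}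
    (h : NatS m (![true, false, false] : Fin 3 → Bool) k L
      (fun A _ _ 𝔤 I => T A 𝔤 (I 0) (I 1) (I 2))) :
    NatS m (![false, true, false, false] : Fin 4 → Bool) (k + 1) L
      (fun A _ _ 𝔤 I => 𝔤.series.covC (T A 𝔤) (I 0) (I 1) (I 2) (I 3)) :=
  (h.nabla.rename (![false, true, false, false] : Fin 4 → Bool)
    (fun o => o.elim 0 Fin.succ) (by decide)
    (by decide)).congr fun A _ _ 𝔤 I => 𝔤.series.nabla_covC _ _ _

end NatS

/-- A formal power series of metrics that is assigned to every metric. -/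
abbrev SMFam (m : ℕ) : Type 1 :=
  ∀ (A : Type) [CommRing A] [Algebra ℝ A] (𝔤 : Geom (Fin m) A), SMetric 𝔤

/-- The coefficient of `x^s` is natural of weight `s`, with at least one curvature factor
for `s > 0`. -/
def SMFam.Natural {m : ℕ} (H : SMFam m) : Prop :=
  NatS m (fun _ : Fin 2 => false) 0 1 (fun A _ _ 𝔤 I => (H A 𝔤).dev (I 0) (I 1))

namespace SMFam.Natural

variable {m : ℕ} {H : SMFam m}

theorem gi (hH : H.Natural) :
    NatS m (fun _ : Fin 2 => true) 0 0 (fun A _ _ 𝔤 I => (H A 𝔤).path.gi (I 0) (I 1)) := by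
  intro s
  induction s using Nat.strong_induction_on with
  | _ s ih =>
  have h1 : Natl m (fun _ : Fin 2 => true) (s + 0) 0
      (fun A _ _ 𝔤 I => coeff s (C (𝔤.gi (I 0) (I 1)))) := NatS.of_natl Natl.inv s
  have h2 : ∀ p ∈ Finset.HasAntidiagonal.antidiagonal s, Natl m (fun _ : Fin 2 => true) (s + 0) 0
      (fun A _ _ 𝔤 I => ∑ l, (∑ k, coeff p.1 ((H A 𝔤).path.gi (I 0) k) *
        coeff p.2 ((H A 𝔤).dev k l)) * 𝔤.gi l (I 1)) := by
    intro p hp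
    rw [Finset.HasAntidiagonal.mem_antidiagonal] at hp
    -- The term that would contain the coefficient under consideration itself has the factor `coeff
    -- 0` of h - g, which is zero; in all others the index of h⁻¹ is smaller.
    rcases Nat.eq_zero_or_pos p.2 with h0 | h0
    · refine (Natl.zero _ _ _).congr fun A _ _ 𝔤 I => ?_
      simp [h0, SMetric.coeff_zero_dev, -PowerSeries.coeff_zero_eq_constantCoeff]
    · have a1 := (ih p.1 (by omega)).mulContract (hH p.2) (![true, false] : Fin 2 → Bool)
        (![some (some 0), none] : Fin 2 → Option (Option (Fin 2)))
        (![some none, some (some 1)] : Fin 2 → Option (Option (Fin 2))) (by decide) (by decide)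
      have a2 := a1.mulContract Natl.inv (fun _ : Fin 2 => true)
        (![some (some 0), some none] : Fin 2 → Option (Option (Fin 2)))
        (![none, some (some 1)] : Fin 2 → Option (Option (Fin 2))) (by decide) (by decide)
      exact (a2.mono (Nat.zero_le _)).cast rfl (by omega)
  refine (h1.sub (Natl.sum _ h2)).congr fun A _ _ 𝔤 I => ?_
  refine Eq.trans ?_ (congrArg (coeff s) ((H A 𝔤).gi_eq (I 0) (I 1)).symm)
  rw [map_sub]
  congr 1
  rw [map_sum, Finset.sum_comm]
  refine Finset.sum_congr rfl fun l _ => ?_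
  rw [PowerSeries.coeff_mul_C, map_sum, ← Finset.sum_mul]
  congr 1
  rw [Finset.sum_comm]
  exact Finset.sum_congr rfl fun k _ => (coeff_mul _ _ _).symm

theorem devInv (hH : H.Natural) :
    NatS m (fun _ : Fin 2 => true) 0 1 (fun A _ _ 𝔤 I => (H A 𝔤).devInv (I 0) (I 1)) := by
  have a1 := hH.gi.mulContract hH (![true, false] : Fin 2 → Bool)
    (![some (some 0), none] : Fin 2 → Option (Option (Fin 2)))
    (![some none, some (some 1)] : Fin 2 → Option (Option (Fin 2))) (by decide) (by decide)
  have a2 := a1.mulContract (NatS.of_natl Natl.inv) (fun _ : Fin 2 => true)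
    (![some (some 0), some none] : Fin 2 → Option (Option (Fin 2)))
    (![none, some (some 1)] : Fin 2 → Option (Option (Fin 2))) (by decide) (by decide)
  exact a2.neg.congr fun A _ _ 𝔤 I => ((H A 𝔤).devInv_eq _ _).symm

theorem ddX_h (hH : H.Natural) : NatS m (fun _ : Fin 2 => false) 1 1
    (fun A _ _ 𝔤 I => ddX A ((H A 𝔤).h (I 0) (I 1))) :=
  (NatS.ddX hH).congr fun A _ _ 𝔤 I => (H A 𝔤).ddX_dev _ _

theorem K (hH : H.Natural) : NatS m (![true, false] : Fin 2 → Bool) 1 1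
    (fun A _ _ 𝔤 I => (H A 𝔤).path.K (I 0) (I 1)) :=
  (hH.gi.mulContract hH.ddX_h (![true, false] : Fin 2 → Bool)
    (![some (some 0), none] : Fin 2 → Option (Option (Fin 2)))
    (![some none, some (some 1)] : Fin 2 → Option (Option (Fin 2))) (by decide)
    (by decide)).const_mul (1 / 2)

theorem trK (hH : H.Natural) : NatS m (fun _ : Fin 0 => false) 1 1
    (fun A _ _ 𝔤 _ => (H A 𝔤).path.trK) :=
  hH.K.contract (fun _ : Fin 0 => false) (![none, some none] : Fin 2 → Option (Option (Fin 0)))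
    (by decide) (by decide)

/-- Replacing h⁻¹ by g⁻¹ in front of ∂_x h is an error of two curvature factors, one from h⁻¹ - g⁻¹
and one from ∂_x h. -/
theorem trK_sub (hH : H.Natural) : NatS m (fun _ : Fin 0 => false) 1 2 (fun A _ _ 𝔤 _ =>
    (H A 𝔤).path.trK - half (PowerSeries A) *
      ∑ i, ∑ k, C (𝔤.gi i k) * ddX A ((H A 𝔤).h k i)) := by
  have a1 := hH.devInv.mulContract hH.ddX_h (![true, false] : Fin 2 → Bool)
    (![some (some 0), none] : Fin 2 → Option (Option (Fin 2)))
    (![some none, some (some 1)] : Fin 2 → Option (Option (Fin 2))) (by decide) (by decide)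
  have a2 := a1.contract (fun _ : Fin 0 => false)
    (![none, some none] : Fin 2 → Option (Option (Fin 0))) (by decide) (by decide)
  refine (a2.const_mul (1 / 2)).congr fun A _ _ 𝔤 I => ?_
  change half _ * ∑ i, ∑ k, (H A 𝔤).devInv i k * ddX A ((H A 𝔤).h k i) = _
  simp only [GeomPath.trK, GeomPath.K, ← Finset.mul_sum, ← mul_sub, ← Finset.sum_sub_distrib]
  exact congrArg (half _ * ·) (Finset.sum_congr rfl fun i _ => Finset.sum_congr rfl fun k _ =>
    sub_mul _ _ _)

/-- Used twice: with U = h⁻¹ for the difference of the connections, and with U = h⁻¹ - g⁻¹, which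
has one more factor, for its deviation from the linearization. -/
theorem covGi (hH : H.Natural) {U : SFam m (Fin 2)} {L : ℕ}
    (hU : NatS m (fun _ : Fin 2 => true) 0 L U) : NatS m (![true, false, false] : Fin 3 → Bool) 1 (L + 1)
    (fun A _ _ 𝔤 I => half (PowerSeries A) * ∑ l, U A 𝔤 ![I 0, l] *
      (𝔤.series.cov2 (H A 𝔤).dev (I 2) l (I 1) + 𝔤.series.cov2 (H A 𝔤).dev (I 1) l (I 2)
      - 𝔤.series.cov2 (H A 𝔤).dev (I 1) (I 2) l)) := by
  have hc := NatS.cov2 (T := fun A _ _ 𝔤 => (H A 𝔤).dev) hH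
  have h1 := hc.rename (fun _ : Fin 3 => false) (![2, 0, 1] : Fin 3 → Fin 3) (by decide) rfl
  have h2 := hc.rename (fun _ : Fin 3 => false) (![1, 0, 2] : Fin 3 → Fin 3) (by decide) rfl
  have h3 := hc.rename (fun _ : Fin 3 => false) (![1, 2, 0] : Fin 3 → Fin 3) (by decide) rfl
  have h4 := hU.mulContract ((h1.add h2).sub h3) (![true, false, false] : Fin 3 → Bool)
    (![some (some 0), none] : Fin 2 → Option (Option (Fin 3)))
    (![some none, some (some 1), some (some 2)] : Fin 3 → Option (Option (Fin 3)))
    (by decide) (by decide)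
  refine (h4.const_mul (1 / 2)).congr fun A _ _ 𝔤 I => ?_
  refine congrArg (half (PowerSeries A) * ·) (Finset.sum_congr rfl fun l _ => ?_)
  refine congrArg₂ (· * ·) (congrArg (U A 𝔤) ?_) rfl
  funext t; fin_cases t <;> rfl

/-- The Ricci tensor of `h_x`, up to terms with two curvature factors. -/
theorem ric_sub (hH : H.Natural) : NatS m (fun _ : Fin 2 => false) 2 2 (fun A _ _ 𝔤 I =>
    (H A 𝔤).path.ric (I 0) (I 1) - C (𝔤.ric (I 0) (I 1))
      - 𝔤.series.linRic (H A 𝔤).dev (I 0) (I 1)) := by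
  have hU : NatS m (![true, false, false] : Fin 3 → Bool) 1 1
      (fun A _ _ 𝔤 I => (H A 𝔤).devΓ (I 0) (I 1) (I 2)) :=
    (hH.covGi hH.gi).congr fun A _ _ 𝔤 I => rfl
  have hV : NatS m (![true, false, false] : Fin 3 → Bool) 1 2
      (fun A _ _ 𝔤 I => (H A 𝔤).devΓ (I 0) (I 1) (I 2)
        - 𝔤.series.linΓ (H A 𝔤).dev (I 0) (I 1) (I 2)) := by
    refine (hH.covGi hH.devInv).congr fun A _ _ 𝔤 I => ?_
    simp only [SMetric.devΓ, Geom.linΓ]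
    rw [← mul_sub, ← Finset.sum_sub_distrib]
    refine congrArg (half (PowerSeries A) * ·) (Finset.sum_congr rfl fun l _ => ?_)
    rw [← sub_mul]; rfl
  -- `h1` and `h3` are the derivative terms of the nonlinear remainder of the connection; `h4` and
  -- `h5` are the products of two difference tensors. All have two curvature factors.
  have h1 := (NatS.covC (T := fun A _ _ 𝔤 i j k => (H A 𝔤).devΓ i j k
      - 𝔤.series.linΓ (H A 𝔤).dev i j k) hV).contract (fun _ : Fin 2 => false)
    (![some none, none, some (some 0), some (some 1)] : Fin 4 → Option (Option (Fin 2)))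
    (by decide) (by decide)
  have h2 := hV.contract (fun _ : Fin 1 => false)
    (![none, some none, some (some 0)] : Fin 3 → Option (Option (Fin 1)))
    (by decide) (by decide)
  have h3 := (NatS.cov1 (T := fun A _ _ 𝔤 k => ∑ i, ((H A 𝔤).devΓ i i k
      - 𝔤.series.linΓ (H A 𝔤).dev i i k)) h2).rename (fun _ : Fin 2 => false)
    (![1, 0] : Fin 2 → Fin 2) (by decide) rfl
  have h4 := ((hU.mulContract hU (![true, false, false, false] : Fin 4 → Bool)
    (![some (some 0), some (some 1), some none] : Fin 3 → Option (Option (Fin 4)))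
    (![none, some (some 2), some (some 3)] : Fin 3 → Option (Option (Fin 4)))
    (by decide) (by decide)).contract (fun _ : Fin 2 => false)
    (![none, some none, some (some 0), some (some 1)] : Fin 4 → Option (Option (Fin 2)))
    (by decide) (by decide))
  have h5 := ((hU.mulContract hU (![true, false, false, false] : Fin 4 → Bool)
    (![some (some 0), some (some 1), some none] : Fin 3 → Option (Option (Fin 4)))
    (![none, some (some 2), some (some 3)] : Fin 3 → Option (Option (Fin 4)))
    (by decide) (by decide)).contract (fun _ : Fin 2 => false)
    (![none, some (some 0), some none, some (some 1)] : Fin 4 → Option (Option (Fin 2)))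
    (by decide) (by decide))
  refine ((h1.sub h3).add (h4.sub h5)).congr fun A _ _ 𝔤 I => ?_
  have hr := 𝔤.series.ric_of_Γ_add (H A 𝔤).path.toGeom (H A 𝔤).devΓ (fun _ _ => rfl)
    (H A 𝔤).Γ_path (I 0) (I 1)
  rw [hr, Geom.series_ric, Geom.linRic]
  change (∑ i, 𝔤.series.covC (fun i j k => (H A 𝔤).devΓ i j k - 𝔤.series.linΓ (H A 𝔤).dev i j k) i i
      (I 0) (I 1) - 𝔤.series.cov1 (fun k => ∑ i, ((H A 𝔤).devΓ i i k
      - 𝔤.series.linΓ (H A 𝔤).dev i i k)) (I 1) (I 0)) +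
    (∑ i, ∑ s, (H A 𝔤).devΓ i i s * (H A 𝔤).devΓ s (I 0) (I 1) - ∑ i, ∑ s, (H A 𝔤).devΓ i (I 0) s * (H A 𝔤).devΓ s i (I 1)) = _
  simp only [Geom.covC_sub, Finset.sum_sub_distrib, Geom.cov1_sub]
  ring

/-- The Einstein defect of `h_x`, up to terms with two curvature factors. -/
theorem F_sub (hH : H.Natural) (s : ℕ) : Low₂ m (s + 1) 2 (fun A _ _ 𝔤 i j =>
    coeff s ((H A 𝔤).path.F i.succ j.succ)
      - coeff s (X * (C (𝔤.ric i j) + 𝔤.series.linRic (H A 𝔤).dev i j))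
      - algebraMap ℝ A ((s + 1) / 2) * (algebraMap ℝ A (m - (s + 1)) *
          coeff (s + 1) ((H A 𝔤).h i j)
        + 𝔤.tr (fun i j => coeff (s + 1) ((H A 𝔤).h i j)) * 𝔤.g i j)) := by
  have h1 := hH.ddX_h.mulContract hH.K (fun _ : Fin 2 => false)
    (![some (some 0), some none] : Fin 2 → Option (Option (Fin 2)))
    (![none, some (some 1)] : Fin 2 → Option (Option (Fin 2))) (by decide) (by decide)
  have h2 := (hH.trK.mulRename hH.ddX_h (fun _ : Fin 2 => false) (![] : Fin 0 → Fin 2)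
    ![0, 1] (by decide) (by decide)).const_mul (1 / 2)
  have h3 := hH.trK.mulRename hH (fun _ : Fin 2 => false) (![] : Fin 0 → Fin 2)
    ![0, 1] (by decide) (by decide)
  have h4 := hH.trK_sub.mulRename (NatS.of_natl Natl.metric) (fun _ : Fin 2 => false)
    (![] : Fin 0 → Fin 2) ![0, 1] (by decide) (by decide)
  -- The discarded terms: the nonlinear part of Ric, the products of two first derivatives, and the
  -- errors from replacing h and h⁻¹ by g and g⁻¹ in the term trK · h.
  have h5 := ((((hH.ric_sub.add h1).sub h2).X_mul).add h3).add h4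
  refine (h5 s).congr fun A _ _ 𝔤 I => ?_
  set i := I 0 with hi
  set j := I 1 with hj
  have hF := (H A 𝔤).path.F_succ_succ i j
  set P := (H A 𝔤).path with hP
  -- The linear part of the normal operator. At x^s the first two terms combine to -s(s + 1)/2 + (m
  -- - 1)(s + 1)/2 = (s + 1)(m - (s + 1))/2.
  have hlin : coeff s (X * (-(half (PowerSeries A) * ddX A (ddX A ((H A 𝔤).h i j))))
      + ((m : PowerSeries A) - 1) * (half (PowerSeries A) * ddX A ((H A 𝔤).h i j))
      + half (PowerSeries A) * (∑ i, ∑ k, C (𝔤.gi i k) * ddX A ((H A 𝔤).h k i)) * C (𝔤.g i j))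
      = algebraMap ℝ A ((s + 1) / 2) * (algebraMap ℝ A (m - (s + 1)) *
          coeff (s + 1) ((H A 𝔤).h i j)
        + 𝔤.tr (fun i j => coeff (s + 1) ((H A 𝔤).h i j)) * 𝔤.g i j) := by
    have e1 : coeff s (X * (-(half (PowerSeries A) * ddX A (ddX A ((H A 𝔤).h i j)))))
        = -(half A * (s * (s + 1) * coeff (s + 1) ((H A 𝔤).h i j))) := by
      cases s with
      | zero => simp
      | succ s =>
        rw [PowerSeries.coeff_succ_X_mul, map_neg, coeff_half_mul, coeff_ddX, coeff_ddX]
        push_cast; ring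
    have e2 : coeff s (((m : PowerSeries A) - 1) * (half (PowerSeries A) * ddX A ((H A 𝔤).h i j)))
        = ((m : A) - 1) * (half A * ((s + 1) * coeff (s + 1) ((H A 𝔤).h i j))) := by
      have : (m : PowerSeries A) - 1 = C ((m : A) - 1) := by simp
      rw [this, coeff_C_mul, coeff_half_mul, coeff_ddX]; ring
    have e3 : coeff s (half (PowerSeries A) * (∑ i, ∑ k, C (𝔤.gi i k) * ddX A ((H A 𝔤).h k i)) *
        C (𝔤.g i j)) = half A * ((s + 1) * 𝔤.tr (fun i j => coeff (s + 1) ((H A 𝔤).h i j))) * 𝔤.g i j := by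
      rw [PowerSeries.coeff_mul_C, coeff_half_mul, Geom.tr]
      simp only [map_sum, coeff_C_mul, coeff_ddX, Finset.mul_sum, (H A 𝔤).symm]
      congr 1
      refine Finset.sum_congr rfl fun a _ => Finset.sum_congr rfl fun b _ => ?_
      rw [(H A 𝔤).symm a b]; ring
    rw [map_add, map_add, e1, e2, e3]
    have e4 : algebraMap ℝ A ((s + 1) / 2) = half A * (s + 1) := by
      rw [half, div_eq_mul_one_div, map_mul, map_add, map_natCast, map_one]; ring
    rw [e4]
    simp only [map_sub, map_add, map_natCast, map_one]
    ring
  refine Eq.trans ?_ (congrArg (fun z => coeff s (P.F i.succ j.succ)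
    - coeff s (X * (C (𝔤.ric i j) + 𝔤.series.linRic (H A 𝔤).dev i j)) - z) hlin)
  beta_reduce
  rw [hF, ← map_sub, ← map_sub]
  refine congrArg (coeff s) ?_
  change X * (_ - _ - _ + ∑ k, ddX A ((H A 𝔤).h i k) * P.K k j
    - algebraMap ℝ _ (1 / 2) * (P.trK * ddX A ((H A 𝔤).h i j))) + P.trK * (H A 𝔤).dev i j
    + (P.trK - _) * C (𝔤.g i j) = _
  rw [SMetric.dev]
  change _ = X * (P.ric i j - half _ * ddX A (ddX A ((H A 𝔤).h i j))
    + ∑ k, ddX A ((H A 𝔤).h i k) * P.K k j - half _ * (P.trK * ddX A ((H A 𝔤).h i j)))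
    + _ * (half _ * ddX A ((H A 𝔤).h i j)) + P.trK * (H A 𝔤).h i j - _ - _
  rw [half]
  ring

end SMFam.Natural

end

section

open PowerSeries (coeff coeff_mul coeff_C_mul C X)

/-! ### The formal Poincaré metric -/

namespace Geom

variable {m : ℕ} {A : Type*} [CommRing A] [Algebra ℝ A] (𝔤 : Geom (Fin m) A)

/-- The left-hand side of the equation for the coefficient of `x^t`. -/
def indicial (t : ℝ) (w : Fin m → Fin m → A) (i j : Fin m) : A :=
  algebraMap ℝ A (t / 2) * (algebraMap ℝ A (m - t) * w i j + 𝔤.tr w * 𝔤.g i j)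

/-- The inverse of `indicial`. -/
def solve (t : ℝ) (z : Fin m → Fin m → A) (i j : Fin m) : A :=
  algebraMap ℝ A (2 / (t * (m - t))) *
    (z i j - algebraMap ℝ A (1 / (2 * m - t)) * (𝔤.tr z * 𝔤.g i j))

/-- The trace-free part. -/
def tf (z : Fin m → Fin m → A) (i j : Fin m) : A :=
  z i j - algebraMap ℝ A (1 / m) * (𝔤.tr z * 𝔤.g i j)

theorem tr_const_mul (c : ℝ) (z : Fin m → Fin m → A) :
    𝔤.tr (fun i j => algebraMap ℝ A c * z i j) = algebraMap ℝ A c * 𝔤.tr z := 𝔤.tr_mul _ _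

theorem tr_mul_g (f : A) : 𝔤.tr (fun i j => f * 𝔤.g i j) = f * m := by
  have := 𝔤.tr_g
  rw [Fintype.card_fin] at this
  rw [← this]
  exact 𝔤.tr_mul f 𝔤.g

theorem tr_indicial (t : ℝ) (w : Fin m → Fin m → A) :
    𝔤.tr (𝔤.indicial t w) = algebraMap ℝ A (t / 2 * (2 * m - t)) * 𝔤.tr w := by
  have e : 𝔤.tr (𝔤.indicial t w) = algebraMap ℝ A (t / 2) *
      (algebraMap ℝ A (m - t) * 𝔤.tr w + 𝔤.tr w * m) := by
    rw [← tr_mul_g, ← tr_const_mul, ← tr_add, ← tr_const_mul]; rfl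
  rw [e]
  simp only [map_mul, map_sub, map_natCast, map_ofNat]
  ring

/-- The indicial map has eigenvalue (t/2)(m - t) on trace-free tensors and (t/2)(2m - t) on
multiples of g. The three hypotheses exclude its zeros. -/
theorem solve_indicial {t : ℝ} (h0 : t ≠ 0) (h1 : (m : ℝ) - t ≠ 0) (h2 : 2 * (m : ℝ) - t ≠ 0)
    (w : Fin m → Fin m → A) (i j : Fin m) : 𝔤.solve t (𝔤.indicial t w) i j = w i j := by
  rw [solve, tr_indicial, indicial]
  have e1 : 2 / (t * (m - t)) * (t / 2 * (m - t)) = 1 := by field_simp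
  have e2 : 2 / (t * (m - t)) * (t / 2 - 1 / (2 * m - t) * (t / 2 * (2 * m - t))) = 0 := by
    field_simp; simp
  have e1 := congrArg (algebraMap ℝ A) e1
  have e2 := congrArg (algebraMap ℝ A) e2
  simp only [map_mul, map_sub, map_one, map_zero] at e1 e2 ⊢
  linear_combination w i j * e1 + 𝔤.tr w * 𝔤.g i j * e2

theorem indicial_solve {t : ℝ} (h0 : t ≠ 0) (h1 : (m : ℝ) - t ≠ 0) (h2 : 2 * (m : ℝ) - t ≠ 0)
    (z : Fin m → Fin m → A) (i j : Fin m) : 𝔤.indicial t (𝔤.solve t z) i j = z i j := by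
  have e : 𝔤.tr (𝔤.solve t z) = algebraMap ℝ A (2 / (t * (m - t))) *
      (𝔤.tr z - algebraMap ℝ A (1 / (2 * m - t)) * (𝔤.tr z * m)) := by
    rw [← 𝔤.tr_mul_g (𝔤.tr z), ← tr_const_mul, ← tr_sub, ← tr_const_mul]; rfl
  rw [indicial, e, solve]
  have e1 : t / 2 * ((m - t) * (2 / (t * (m - t)))) = 1 := by field_simp
  have e2 : t / 2 * (2 / (t * (m - t))) * (1 - 1 / (2 * m - t) * m - (m - t) * (1 / (2 * m - t)))
      = 0 := by
    field_simp; ring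
  have e1 := congrArg (algebraMap ℝ A) e1
  have e2 := congrArg (algebraMap ℝ A) e2
  simp only [map_mul, map_sub, map_one, map_zero, map_natCast] at e1 e2 ⊢
  linear_combination z i j * e1 + 𝔤.tr z * 𝔤.g i j * e2

theorem solve_symm {t : ℝ} {z : Fin m → Fin m → A} (h : ∀ i j, z i j = z j i) (i j : Fin m) :
    𝔤.solve t z i j = 𝔤.solve t z j i := by
  rw [solve, solve, h, 𝔤.symm]

theorem tf_add_trace {z z' : Fin m → Fin m → A} (hm : 0 < m) (c : A)
    (h : ∀ i j, z i j = z' i j + c * 𝔤.g i j) (i j : Fin m) : 𝔤.tf z i j = 𝔤.tf z' i j := by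
  have hz : z = fun i j => z' i j + c * 𝔤.g i j := by funext i j; exact h i j
  have e : 𝔤.tr z = 𝔤.tr z' + c * m := by
    rw [hz, 𝔤.tr_add (S := z'), tr_mul_g]
  have e1 : (1 / (m : ℝ)) * m = 1 := by
    have : (m : ℝ) ≠ 0 := by exact_mod_cast hm.ne'
    field_simp
  have e1 := congrArg (algebraMap ℝ A) e1
  simp only [map_mul, map_one, map_natCast] at e1
  rw [tf, tf, e, h]
  linear_combination (-c * 𝔤.g i j) * e1

theorem hessTr_symm (T : Fin m → Fin m → A) (i j : Fin m) : 𝔤.hessTr T i j = 𝔤.hessTr T j i := by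
  rw [hessTr_eq, hessTr_eq, cov1, cov1, 𝔤.comm]
  simp only [𝔤.Γ_symm _ i j]

theorem lap_symm {T : Fin m → Fin m → A} (h : ∀ i j, T i j = T j i) (i j : Fin m) :
    𝔤.lap T i j = 𝔤.lap T j i := by
  have h2 := 𝔤.cov2_symm h
  have h3 : ∀ a b, 𝔤.cov3 (𝔤.cov2 T) i j a b = 𝔤.cov3 (𝔤.cov2 T) j i a b := by
    intro a b
    simp only [cov3, fun s => h2 s j, h2 i j]
    congr 1
    refine Finset.sum_congr rfl fun s _ => ?_
    rw [h2 i s]; ring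
  simp only [lap, h3]

theorem bach_symm (i j : Fin m) : 𝔤.bach i j = 𝔤.bach j i := by
  rw [bach, bach, 𝔤.lap_symm 𝔤.schouten_symm, 𝔤.hessTr_symm]

theorem lap_iterate_bach_symm (k : ℕ) (i j : Fin m) :
    𝔤.lap^[k] 𝔤.bach i j = 𝔤.lap^[k] 𝔤.bach j i := by
  induction k generalizing i j with
  | zero => exact 𝔤.bach_symm i j
  | succ k ih =>
    rw [Function.iterate_succ_apply']
    exact 𝔤.lap_symm ih i j

theorem linRic_sub (S T : Fin m → Fin m → A) (j k : Fin m) :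
    𝔤.linRic (fun i j => S i j - T i j) j k = 𝔤.linRic S j k - 𝔤.linRic T j k := by
  have h : ∀ k i j, 𝔤.linΓ (fun i j => S i j - T i j) k i j = 𝔤.linΓ S k i j - 𝔤.linΓ T k i j := by
    intro k i j
    simp only [linΓ, cov2_sub]
    rw [← mul_sub, ← Finset.sum_sub_distrib]
    congr 1
    exact Finset.sum_congr rfl fun l _ => by ring
  have h' : 𝔤.linΓ (fun i j => S i j - T i j) = fun k i j => 𝔤.linΓ S k i j - 𝔤.linΓ T k i j := by
    funext k i j; exact h k i j
  simp only [linRic, h', covC_sub, Finset.sum_sub_distrib, cov1_sub]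
  ring

theorem linRic_const_mul (c : ℝ) (T : Fin m → Fin m → A) (j k : Fin m) :
    𝔤.linRic (fun i j => algebraMap ℝ A c * T i j) j k = algebraMap ℝ A c * 𝔤.linRic T j k := by
  have h' : 𝔤.linΓ (fun i j => algebraMap ℝ A c * T i j)
      = fun k i j => algebraMap ℝ A c * 𝔤.linΓ T k i j := by
    funext k i j
    simp only [linΓ, cov2_const_mul, Finset.mul_sum]
    exact Finset.sum_congr rfl fun l _ => by ring
  have h2 : ∀ (S : Fin m → Fin m → Fin m → A) l i j k, 𝔤.covC (fun i j k =>
      algebraMap ℝ A c * S i j k) l i j k = algebraMap ℝ A c * 𝔤.covC S l i j k := by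
    intro S l i j k
    simp only [covC, mul_add, Finset.mul_sum, Derivation.leibniz, Derivation.map_algebraMap,
      smul_eq_mul, mul_zero, add_zero]
    congr 1
    exact Finset.sum_congr rfl fun s _ => by ring
  rw [linRic, h']
  simp only [h2, ← Finset.mul_sum, cov1_const_mul, ← mul_sub]
  rfl

end Geom

namespace Low₂

variable {m w L : ℕ} {T S : Fam₂ m}

theorem mul_g {f : ∀ (A : Type) [CommRing A] [Algebra ℝ A], Geom (Fin m) A → A}
    (h : Low₀ m w L f) : Low₂ m w L (fun A _ _ 𝔤 i j => f A 𝔤 * 𝔤.g i j) :=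
  Natl.mulRename h Natl.metric (fun _ : Fin 2 => false) (![] : Fin 0 → Fin 2) ![0, 1]
      (by decide) (by decide)

theorem indicial (t : ℝ) (h : Low₂ m w L T) :
    Low₂ m w L (fun A _ _ 𝔤 => 𝔤.indicial t (T A 𝔤)) :=
  ((Natl.const_mul (m - t) h).add (mul_g h.tr)).const_mul (t / 2)

theorem solve (t : ℝ) (h : Low₂ m w L T) :
    Low₂ m w L (fun A _ _ 𝔤 => 𝔤.solve t (T A 𝔤)) :=
  (Natl.sub h ((mul_g h.tr).const_mul (1 / (2 * m - t)))).const_mul (2 / (t * (m - t)))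

theorem tf (h : Low₂ m w L T) : Low₂ m w L (fun A _ _ 𝔤 => 𝔤.tf (T A 𝔤)) :=
  Natl.sub h ((mul_g h.tr).const_mul (1 / m))

/-- Keeps track of error terms: `linRic` adds two derivatives and does not reduce the number of
curvature factors. -/
theorem linRic_natural (h : Low₂ m w L T)
    (hs : ∀ (A : Type) [CommRing A] [Algebra ℝ A] (𝔤 : Geom (Fin m) A) i j,
      T A 𝔤 i j = T A 𝔤 j i) :
    Low₂ m (w + 2) L (fun A _ _ 𝔤 => 𝔤.linRic (T A 𝔤)) := by
  have h1 : Low₂ m (w + 2) L (fun A _ _ 𝔤 => 𝔤.cov1 (𝔤.div (T A 𝔤))) := Natl.cov1 h.div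
  have h2 := (((h1.swap.add h1).sub h.lap).sub (hessTr h.tr).swap).const_mul (1 / 2)
  refine (((h.linRic hs).mono (Nat.le_succ L)).add h2).congr fun A _ _ 𝔤 I => ?_
  beta_reduce
  rw [half]; ring

theorem lap_iterate_bach (k : ℕ) : Low₂ m (2 * k + 4) 1 (fun A _ _ 𝔤 => 𝔤.lap^[k] 𝔤.bach) := by
  induction k with
  | zero => exact bach
  | succ k ih =>
    simp only [Function.iterate_succ_apply']
    exact ih.lap.cast rfl (by ring)

/-- The trace of B vanishes identically, and trace and Laplacian commute. -/
theorem tr_lap_iterate_bach (k : ℕ) :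
    Low₀ m (2 * k + 4) 2 (fun A _ _ 𝔤 => 𝔤.tr (𝔤.lap^[k] 𝔤.bach)) := by
  induction k with
  | zero => exact (Natl.zero _ _ _).congr fun A _ _ 𝔤 I => 𝔤.tr_bach.symm
  | succ k ih =>
    simp only [Function.iterate_succ_apply']
    exact (tr_lap_mono ih).cast rfl (by ring)

theorem div_lap_iterate_bach (hm : 3 ≤ m) (k : ℕ) :
    Low₁ m (2 * k + 5) 2 (fun A _ _ 𝔤 => 𝔤.div (𝔤.lap^[k] 𝔤.bach)) := by
  induction k with
  | zero => exact div_bach hm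
  | succ k ih =>
    simp only [Function.iterate_succ_apply']
    exact ((lap_iterate_bach k).div_lap_mono ih).cast rfl (by ring)

/-- The linearized Ricci tensor of the Schouten tensor. -/
theorem linRic_schouten (hm : 3 ≤ m) : Low₂ m 4 2 (fun A _ _ 𝔤 i j =>
    𝔤.linRic 𝔤.schouten i j + algebraMap ℝ A (1 / 2) * 𝔤.bach i j) := by
  refine (schouten.linRic fun A _ _ 𝔤 => 𝔤.schouten_symm).congr fun A _ _ 𝔤 I => ?_
  have h1 : 𝔤.cov1 (𝔤.div 𝔤.schouten) = 𝔤.hessTr 𝔤.schouten := by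
    funext i j
    rw [𝔤.hessTr_eq]
    congr 1
    funext j
    exact 𝔤.div_schouten hm j
  beta_reduce
  rw [h1, half, Geom.bach]; ring

/-- The linearized Ricci tensor of `Δ^k B`. -/
theorem linRic_lap_iterate_bach (hm : 3 ≤ m) (k : ℕ) : Low₂ m (2 * k + 6) 2 (fun A _ _ 𝔤 i j =>
    𝔤.linRic (𝔤.lap^[k] 𝔤.bach) i j
      + algebraMap ℝ A (1 / 2) * 𝔤.lap^[k + 1] 𝔤.bach i j) := by
  have h0 := (lap_iterate_bach (m := m) k).linRic fun A _ _ 𝔤 => 𝔤.lap_iterate_bach_symm k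
  have h1 : Low₂ m (2 * k + 6) 2 (fun A _ _ 𝔤 => 𝔤.cov1 (𝔤.div (𝔤.lap^[k] 𝔤.bach))) :=
    Natl.cov1 (div_lap_iterate_bach hm k)
  have h2 := hessTr (tr_lap_iterate_bach (m := m) k)
  have h3 := ((h1.swap.add h1).sub h2.swap).const_mul (1 / 2)
  refine (h0.add h3).congr fun A _ _ 𝔤 I => ?_
  beta_reduce
  rw [Function.iterate_succ_apply', half]; ring

end Low₂

theorem coeff_zero_mul {A : Type*} [CommRing A] (f g : PowerSeries A) :
    coeff 0 (f * g) = coeff 0 f * coeff 0 g := by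
  simp [PowerSeries.coeff_zero_eq_constantCoeff]

namespace SMetric

variable {m : ℕ} {A : Type*} [CommRing A] [Algebra ℝ A] {𝔤 : Geom (Fin m) A}

/-- The constant power series of metrics. -/
def const (𝔤 : Geom (Fin m) A) : SMetric 𝔤 where
  h i j := C (𝔤.g i j)
  symm i j := congrArg C (𝔤.symm i j)
  coeff_zero i j := by simp

/-- Addition of a term of order `x^(r+1)`. -/
def addTerm (H : SMetric 𝔤) (r : ℕ) (w : Fin m → Fin m → A) (hw : ∀ i j, w i j = w j i) :
    SMetric 𝔤 where
  h i j := H.h i j + X ^ (r + 1) * C (w i j)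
  symm i j := by rw [H.symm, hw]
  coeff_zero i j := by rw [map_add, H.coeff_zero]; simp

/-- The formal version of `GeomPath.F_sub_dvd`: since h_0 = g, only g and the constant term of `w`
matter at the leading order, with exponent t = r + 1. -/
theorem coeff_F_sub {H H' : SMetric 𝔤} {r : ℕ} {w : Fin m → Fin m → PowerSeries A}
    (hw : ∀ i j, H'.h i j - H.h i j = X ^ (r + 1) * w i j) (i j : Fin m) :
    X ^ r ∣ H'.path.F i.succ j.succ - H.path.F i.succ j.succ ∧
    coeff r (H'.path.F i.succ j.succ) = coeff r (H.path.F i.succ j.succ)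
      + 𝔤.indicial (r + 1) (fun i j => coeff 0 (w i j)) i j := by
  have key := GeomPath.F_sub_dvd (H'.sameBase H) w hw i j
  change X ^ (r + 1) ∣ _ - _ * (_ * _ : PowerSeries A) at key
  rw [path_x] at key
  constructor
  · have h1 := (pow_dvd_pow (X : PowerSeries A) r.le_succ).trans key
    have h2 := dvd_add h1 (Dvd.intro _ rfl |>.mul_left (half (PowerSeries A) * (r + 1)) :
      (X : PowerSeries A) ^ r ∣ half (PowerSeries A) * ((r : PowerSeries A) + 1) * (X ^ r *
        (((m : PowerSeries A) - 1 - (r : PowerSeries A)) * w i j + H'.path.tr w * H'.path.g i j)))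
    rwa [sub_add_cancel] at h2
  · rw [PowerSeries.X_pow_dvd_iff] at key
    have h1 := key r r.lt_succ_self
    have e : half (PowerSeries A) * ((r : PowerSeries A) + 1) * (X ^ r *
        (((m : PowerSeries A) - 1 - (r : PowerSeries A)) * w i j + H'.path.tr w * H'.path.g i j))
        = C (half A * ((r : A) + 1)) * (X ^ r * (C ((m : A) - 1 - r) * w i j
          + H'.path.tr w * H'.path.g i j)) := by
      rw [half_series]; simp
    rw [e, map_sub, map_sub, coeff_C_mul] at h1
    have h2 : coeff r (X ^ r * (C ((m : A) - 1 - r) * w i j + H'.path.tr w * H'.path.g i j))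
        = ((m : A) - 1 - r) * coeff 0 (w i j)
          + 𝔤.tr (fun i j => coeff 0 (w i j)) * 𝔤.g i j := by
      have := PowerSeries.coeff_X_pow_mul (C ((m : A) - 1 - r) * w i j
        + H'.path.tr w * H'.path.g i j) r 0
      rw [zero_add] at this
      rw [this, map_add, coeff_C_mul, coeff_zero_mul, Geom.tr, map_sum]
      simp only [map_sum, coeff_zero_mul, H'.coeff_zero_gi]
      rw [show coeff 0 (H'.path.g i j) = 𝔤.g i j from H'.coeff_zero i j]
      rfl
    rw [h2] at h1
    have h3 : 𝔤.indicial (r + 1) (fun i j => coeff 0 (w i j)) i j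
        = half A * (r + 1) * (((m : A) - 1 - r) * coeff 0 (w i j)
          + 𝔤.tr (fun i j => coeff 0 (w i j)) * 𝔤.g i j) := by
      have e4 : algebraMap ℝ A ((r + 1) / 2) = half A * (r + 1) := by
        rw [half, div_eq_mul_one_div, map_mul, map_add, map_natCast, map_one]; ring
      rw [Geom.indicial, e4]
      simp only [map_sub, map_add, map_natCast, map_one]
      ring
    rw [h3]
    linear_combination h1

/-- Formal Poincaré metrics are unique up to order `m`. -/
theorem dvd_sub_of_dvd_F {H H' : SMetric 𝔤} 
    (hF : ∀ i j : Fin m, X ^ (m - 1) ∣ H.path.F i.succ j.succ)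
    (hF' : ∀ i j : Fin m, X ^ (m - 1) ∣ H'.path.F i.succ j.succ) (r : ℕ) (hr : r ≤ m)
    (i j : Fin m) : X ^ r ∣ H'.h i j - H.h i j := by
  induction r generalizing i j with
  | zero => simp
  | succ r ih =>
    rcases r with _ | r
    · rw [zero_add, pow_one, PowerSeries.X_dvd_iff, ← PowerSeries.coeff_zero_eq_constantCoeff_apply,
        map_sub, H.coeff_zero, H'.coeff_zero, sub_self]
    · choose w hw using ih (by omega)
      have h1 := fun i j => (coeff_F_sub hw i j).2
      have h2 : ∀ i j, 𝔤.indicial (r + 1) (fun i j => coeff 0 (w i j)) i j = 0 := by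
        intro i j
        have h3 := h1 i j
        rw [PowerSeries.X_pow_dvd_iff.mp (hF i j) r (by omega),
          PowerSeries.X_pow_dvd_iff.mp (hF' i j) r (by omega), zero_add] at h3
        exact h3.symm
      -- The exponent t = r + 1 stays strictly below m, so the indicial map is injective and the
      -- next coefficient of the difference vanishes.
      have hr' : (r : ℝ) + 1 + 1 ≤ m := by exact_mod_cast hr
      have hr0 : (0 : ℝ) ≤ r := r.cast_nonneg
      have h4 := 𝔤.solve_indicial (t := r + 1) (by linarith) (by linarith) (by linarith)
        (fun i j => coeff 0 (w i j)) i j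
      have h5 : 𝔤.indicial (r + 1) (fun i j => coeff 0 (w i j)) = fun _ _ => 0 := by
        funext i j; exact h2 i j
      rw [h5] at h4
      have h6 : coeff 0 (w i j) = 0 := by rw [← h4]; simp [Geom.solve, Geom.tr]
      rw [hw, pow_succ]
      refine mul_dvd_mul_left _ ?_
      rwa [PowerSeries.X_dvd_iff, ← PowerSeries.coeff_zero_eq_constantCoeff_apply]

/-- The trace-free part of the leading coefficient does not depend on the choice of a formal
Poincaré metric. -/
theorem tf_coeff_eq {H H' : SMetric 𝔤} (hm : 2 ≤ m)
    (hF : ∀ i j : Fin m, X ^ (m - 1) ∣ H.path.F i.succ j.succ)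
    (hF' : ∀ i j : Fin m, X ^ (m - 1) ∣ H'.path.F i.succ j.succ) (i j : Fin m) :
    𝔤.tf (fun i j => coeff (m - 1) (H'.path.F i.succ j.succ)) i j
      = 𝔤.tf (fun i j => coeff (m - 1) (H.path.F i.succ j.succ)) i j := by
  have h := dvd_sub_of_dvd_F hF hF' m le_rfl
  choose w hw using h
  obtain ⟨r, rfl⟩ : ∃ r, m = r + 1 := ⟨m - 1, by omega⟩
  have h1 := fun i j => (coeff_F_sub hw i j).2
  refine 𝔤.tf_add_trace (by omega) (algebraMap ℝ A ((r + 1) / 2) *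
    𝔤.tr (fun i j => coeff 0 (w i j))) (fun i j => ?_) i j
  -- At the exponent t = m the factor m - t vanishes, so the two coefficients differ by a multiple
  -- of g only.
  have e : algebraMap ℝ A (((r + 1 : ℕ) : ℝ) - (r + 1)) = 0 := by push_cast; simp
  rw [Nat.add_sub_cancel, h1 i j, Geom.indicial]
  linear_combination algebraMap ℝ A ((r + 1) / 2) * coeff 0 (w i j) * e

end SMetric

end

/-! ### Coefficients of natural formal Poincaré metrics -/

section

open PowerSeries (coeff coeff_mul coeff_C_mul C X)

namespace SMetric

variable {m : ℕ} {A : Type*} [CommRing A] [Algebra ℝ A] {𝔤 : Geom (Fin m) A} (H : SMetric 𝔤)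

/-- The linear part of the contribution of the Ricci tensor to the Einstein defect. -/
def ricPart (s : ℕ) (i j : Fin m) : A :=
  coeff s (X * (C (𝔤.ric i j) + 𝔤.series.linRic H.dev i j))

theorem ricPart_one (i j : Fin m) : H.ricPart 1 i j = 𝔤.ric i j := by
  -- The zero tensor is written as 0 · g so that `linRic_const_mul` shows that its linearized Ricci
  -- tensor vanishes.
  have h0 : (fun i j => coeff 0 (H.dev i j)) = fun i j => algebraMap ℝ A 0 * 𝔤.g i j := by
    funext i j; rw [H.coeff_zero_dev, map_zero, zero_mul]
  have h1 : 𝔤.linRic (fun i j => algebraMap ℝ A 0 * 𝔤.g i j) i j = 0 := by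
    refine (𝔤.linRic_const_mul 0 𝔤.g i j).trans ?_
    rw [map_zero, zero_mul]
  rw [ricPart, show (1 : ℕ) = 0 + 1 from rfl, PowerSeries.coeff_succ_X_mul, map_add,
    𝔤.coeff_series_linRic, h0, h1]
  simp

theorem ricPart_add_two (s : ℕ) (i j : Fin m) :
    H.ricPart (s + 2) i j = 𝔤.linRic (fun i j => coeff (s + 1) (H.h i j)) i j := by
  rw [ricPart, PowerSeries.coeff_succ_X_mul, map_add, 𝔤.coeff_series_linRic,
    PowerSeries.coeff_C, if_neg s.succ_ne_zero, zero_add]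
  simp only [H.coeff_succ_dev]

end SMetric

namespace SMFam.Natural

variable {m : ℕ} {H : SMFam m}

theorem coeff_h (hH : H.Natural) (s : ℕ) :
    Low₂ m (s + 1) 1 (fun A _ _ 𝔤 i j => coeff (s + 1) ((H A 𝔤).h i j)) :=
  (hH (s + 1)).congr fun A _ _ 𝔤 I => (H A 𝔤).coeff_succ_dev _ _ _

theorem ricPart (hH : H.Natural) (s : ℕ) :
    Low₂ m (s + 1) 1 (fun A _ _ 𝔤 => (H A 𝔤).ricPart s) := by
  rcases s with _ | _ | s
  · exact (Natl.zero _ _ _).congr fun A _ _ 𝔤 I => by simp [SMetric.ricPart]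
  · exact Natl.ric.congr fun A _ _ 𝔤 I => ((H A 𝔤).ricPart_one _ _).symm
  · refine ((hH.coeff_h s).linRic_natural fun A _ _ 𝔤 i j => by rw [(H A 𝔤).symm]).congr
      fun A _ _ 𝔤 I => ((H A 𝔤).ricPart_add_two _ _ _).symm

theorem F_sub' (hH : H.Natural) (s : ℕ) : Low₂ m (s + 1) 2 (fun A _ _ 𝔤 i j =>
    coeff s ((H A 𝔤).path.F i.succ j.succ) - (H A 𝔤).ricPart s i j
      - 𝔤.indicial (s + 1) (fun i j => coeff (s + 1) ((H A 𝔤).h i j)) i j) :=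
  hH.F_sub s

theorem coeff_F (hH : H.Natural) (s : ℕ) : Low₂ m (s + 1) 1 (fun A _ _ 𝔤 i j =>
    coeff s ((H A 𝔤).path.F i.succ j.succ)) :=
  ((((hH.F_sub' s).mono one_le_two).add (hH.ricPart s)).add
    ((hH.coeff_h s).indicial (s + 1))).congr fun A _ _ 𝔤 I => by ring

theorem const : SMFam.Natural (fun A _ _ 𝔤 => SMetric.const 𝔤 : SMFam m) := by
  intro s
  refine (Natl.zero _ _ _).congr fun A _ _ 𝔤 I => ?_
  simp only [SMetric.dev, SMetric.const, sub_self, map_zero]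

theorem addTerm (hH : H.Natural) {r : ℕ} {w : Fam₂ m} (hw : Low₂ m (r + 1) 1 w)
    (hs : ∀ (A : Type) [CommRing A] [Algebra ℝ A] (𝔤 : Geom (Fin m) A) i j,
      w A 𝔤 i j = w A 𝔤 j i) :
    SMFam.Natural (fun A _ _ 𝔤 => (H A 𝔤).addTerm r (w A 𝔤) (hs A 𝔤) : SMFam m) := by
  intro s
  have h1 : Low₂ m s 1 (fun A _ _ 𝔤 i j => coeff s (X ^ (r + 1) * C (w A 𝔤 i j))) := by
    by_cases hsr : s = r + 1
    · subst hsr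
      refine hw.congr fun A _ _ 𝔤 I => ?_
      have := PowerSeries.coeff_X_pow_mul (C (w A 𝔤 (I 0) (I 1))) (r + 1) 0
      rw [zero_add] at this
      beta_reduce
      rw [this]; simp
    · refine (Natl.zero _ _ _).congr fun A _ _ 𝔤 I => ?_
      beta_reduce
      rw [PowerSeries.X_pow_mul, PowerSeries.coeff_C_mul_X_pow, if_neg hsr]
  refine ((hH s).add h1).congr fun A _ _ 𝔤 I => ?_
  rw [← map_add]
  refine congrArg (coeff s) ?_
  simp only [SMetric.dev, SMetric.addTerm]
  ring

end SMFam.Natural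

/-- Natural formal Poincaré metrics exist. -/
theorem exists_model (m s : ℕ) (hs : s ≤ m - 1) : ∃ H : SMFam m, H.Natural ∧
    ∀ (A : Type) [CommRing A] [Algebra ℝ A] (𝔤 : Geom (Fin m) A) (i j : Fin m),
      X ^ s ∣ (H A 𝔤).path.F i.succ j.succ ∧ ∀ k, s < k → coeff k ((H A 𝔤).h i j) = 0 := by
  induction s with
  | zero =>
    refine ⟨_, SMFam.Natural.const, fun A _ _ 𝔤 i j => ⟨by simp, fun k hk => ?_⟩⟩
    exact (PowerSeries.coeff_C _ _).trans (if_neg hk.ne')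
  | succ s ih =>
    obtain ⟨H, hH, hHF⟩ := ih (by omega)
    have hF := fun A [CommRing A] [Algebra ℝ A] 𝔤 i j => (hHF A 𝔤 i j).1
    have hm : (s : ℝ) + 1 + 1 ≤ m := by
      have : s + 1 + 1 ≤ m := by omega
      exact_mod_cast this
    have hs0 : (0 : ℝ) ≤ s := s.cast_nonneg
    -- The correction at order x^(s+1) is chosen to cancel the coefficient of x^s in F. The model
    -- stays polynomial in x, so that it can later be realized by actual smooth functions.
    let w : Fam₂ m := fun A _ _ 𝔤 i j =>
      𝔤.solve (s + 1) (fun i j => -coeff s ((H A 𝔤).path.F i.succ j.succ)) i j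
    have hw : Low₂ m (s + 1) 1 w := Low₂.solve (s + 1) (T := fun A _ _ 𝔤 i j =>
      -coeff s ((H A 𝔤).path.F i.succ j.succ)) (hH.coeff_F s).neg
    have hsymm : ∀ (A : Type) [CommRing A] [Algebra ℝ A] (𝔤 : Geom (Fin m) A) i j,
        w A 𝔤 i j = w A 𝔤 j i := fun A _ _ 𝔤 i j =>
      𝔤.solve_symm (fun i j => by rw [GeomPath.F_symm]) i j
    refine ⟨_, hH.addTerm hw hsymm, fun A _ _ 𝔤 i j => ⟨?_, fun k hk => ?_⟩⟩
    swap
    · change coeff k ((H A 𝔤).h i j + X ^ (s + 1) * C (w A 𝔤 i j)) = 0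
      rw [map_add, (hHF A 𝔤 i j).2 k (by omega), PowerSeries.X_pow_mul,
        PowerSeries.coeff_C_mul_X_pow, if_neg hk.ne', add_zero]
    have h1 := SMetric.coeff_F_sub (H := H A 𝔤) (H' := (H A 𝔤).addTerm s (w A 𝔤) (hsymm A 𝔤))
      (r := s) (w := fun i j => C (w A 𝔤 i j)) (fun i j => add_sub_cancel_left _ _) i j
    have h2 : 𝔤.indicial (s + 1) (fun i j => coeff 0 (C (w A 𝔤 i j))) i j
        = -coeff s ((H A 𝔤).path.F i.succ j.succ) := by
      have e : (fun i j => coeff 0 (C (w A 𝔤 i j))) = w A 𝔤 := by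
        funext i j; simp
      rw [e]
      exact 𝔤.indicial_solve (by linarith) (by linarith) (by linarith) _ i j
    rw [h2, add_neg_cancel] at h1
    rw [PowerSeries.X_pow_dvd_iff]
    intro k hk
    rcases Nat.lt_succ_iff_lt_or_eq.mp hk with hk | rfl
    · have h3 := dvd_add h1.1 (hF A 𝔤 i j)
      rw [sub_add_cancel] at h3
      exact PowerSeries.X_pow_dvd_iff.mp h3 k hk
    · exact h1.2

/-- The coefficient of `Δ^k B` in the equation for the coefficients of a Poincaré metric. -/
def recCoeff (m : ℕ) : ℕ → ℝ
  | 0 => 1 / 2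
  | k + 1 => recCoeff m k / ((2 * k + 4) * (m - (2 * k + 4)))

/-- In dimension m = 2K + 4 the denominator of the recursion is (2k + 4)(m - 2k - 4) = 4 (k + 2)(K -
k), so the recursion is solved by factorials. -/
theorem recCoeff_eq (K k : ℕ) (hk : k ≤ K) : recCoeff (2 * K + 4) k *
    (2 * 4 ^ k * ((k + 1).factorial * K.factorial)) = (K - k).factorial := by
  induction k with
  | zero => simp [recCoeff]
  | succ k ih =>
    have ih := ih (by omega)
    obtain ⟨j, rfl⟩ : ∃ j, K = k + 1 + j := ⟨K - (k + 1), by omega⟩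
    have e1 : k + 1 + j - k = j + 1 := by omega
    have e2 : k + 1 + j - (k + 1) = j := by omega
    rw [e1, Nat.factorial_succ j] at ih
    rw [e2, recCoeff, Nat.factorial_succ (k + 1)]
    push_cast at ih ⊢
    have h1 : (2 * (k : ℝ) + 4) ≠ 0 := by positivity
    have h2 : (2 * ((k : ℝ) + 1 + j) + 4 - (2 * k + 4)) ≠ 0 := by
      have : (2 * ((k : ℝ) + 1 + j) + 4 - (2 * k + 4)) = 2 * (j + 1) := by ring
      rw [this]; positivity
    rw [div_mul_eq_mul_div, div_eq_iff (mul_ne_zero h1 h2)]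
    linear_combination (4 * (k + 2) : ℝ) * ih

theorem obstructionConst_mul_recCoeff (K : ℕ) :
    obstructionConst (2 * K + 3) * recCoeff (2 * K + 4) K = 1 := by
  have h := recCoeff_eq K K le_rfl
  rw [Nat.sub_self, Nat.factorial_zero, Nat.cast_one] at h
  have e1 : (2 * K + 3 + 1) / 2 - 1 = K + 1 := by omega
  have e2 : 2 * K + 3 - 1 = 2 * (K + 1) := by omega
  rw [obstructionConst, e1, e2, pow_mul]
  have h3 : (((2 * K + 3 : ℕ) : ℝ) - 1) = 2 * (K + 1) := by push_cast; ring
  rw [h3, div_mul_eq_mul_div, div_eq_iff (by positivity)]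
  rw [Nat.factorial_succ] at h ⊢
  push_cast at h ⊢
  rw [show (2 : ℝ) ^ 2 = 4 by norm_num, pow_succ]
  linear_combination (2 * ((K : ℝ) + 1)) * h

namespace SMFam.Natural

variable {m : ℕ} {H : SMFam m}

/-- Below the critical order the coefficient of F is zero, so `F_sub'` says that the indicial map
sends h_(s+1) to -Y up to quadratic terms; its inverse preserves the number of curvature factors. -/
theorem solve_sub (hH : H.Natural) {s : ℕ} (hs : s + 1 < m) {Y : Fam₂ m}
    (hF : ∀ (A : Type) [CommRing A] [Algebra ℝ A] (𝔤 : Geom (Fin m) A) (i j : Fin m),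
      X ^ (m - 1) ∣ (H A 𝔤).path.F i.succ j.succ)
    (hY : Low₂ m (s + 1) 2 (fun A _ _ 𝔤 i j => (H A 𝔤).ricPart s i j - Y A 𝔤 i j)) :
    Low₂ m (s + 1) 2 (fun A _ _ 𝔤 i j => coeff (s + 1) ((H A 𝔤).h i j)
      + 𝔤.solve (s + 1) (Y A 𝔤) i j) := by
  have h1 : Low₂ m (s + 1) 2 (fun A _ _ 𝔤 i j => 𝔤.indicial (s + 1)
      (fun i j => coeff (s + 1) ((H A 𝔤).h i j)) i j + Y A 𝔤 i j) :=
    ((hH.F_sub' s).add hY).neg.congr fun A _ _ 𝔤 I => by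
      beta_reduce
      rw [PowerSeries.X_pow_dvd_iff.mp (hF A 𝔤 (I 0) (I 1)) s (by omega)]
      ring
  have hm : (s : ℝ) + 1 + 1 ≤ m := by exact_mod_cast hs
  have hs0 : (0 : ℝ) ≤ s := s.cast_nonneg
  refine (Low₂.solve (s + 1) h1).congr fun A _ _ 𝔤 I => ?_
  have h2 := 𝔤.solve_indicial (t := s + 1) (by linarith) (by linarith) (by linarith)
    (fun i j => coeff (s + 1) ((H A 𝔤).h i j)) (I 0) (I 1)
  beta_reduce
  rw [← h2]
  simp only [Geom.solve, 𝔤.tr_add]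
  ring

/-- The coefficients of a natural Poincaré metric, up to terms with two curvature factors. -/
theorem ricPart_sub (hH : H.Natural) (hm : 4 ≤ m)
    (hF : ∀ (A : Type) [CommRing A] [Algebra ℝ A] (𝔤 : Geom (Fin m) A) (i j : Fin m),
      X ^ (m - 1) ∣ (H A 𝔤).path.F i.succ j.succ) (k : ℕ) (hk : 2 * k + 4 ≤ m) :
    Low₂ m (2 * k + 4) 2 (fun A _ _ 𝔤 i j => (H A 𝔤).ricPart (2 * k + 3) i j
      - algebraMap ℝ A (recCoeff m k) * 𝔤.lap^[k] 𝔤.bach i j) := by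
  induction k with
  | zero =>
    -- Inverting the indicial map at t = 2 on Ric gives the constants 1/(m - 2) and 1/(2(m - 1)) of
    -- the Schouten tensor: to first order h is g - x² P.
    have h0 : Low₂ m 2 2 (fun A _ _ 𝔤 i j => coeff 2 ((H A 𝔤).h i j) + 𝔤.schouten i j) := by
      have h1 := hH.solve_sub (s := 1) (Y := fun A _ _ 𝔤 => 𝔤.ric) (by omega) hF
        ((Natl.zero _ _ _).congr fun A _ _ 𝔤 I => by
          beta_reduce; rw [(H A 𝔤).ricPart_one, sub_self])
      refine h1.congr fun A _ _ 𝔤 I => ?_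
      refine congrArg (_ + ·) ?_
      have e1 : (2 : ℝ) / ((((1 : ℕ) : ℝ) + 1) * (m - (((1 : ℕ) : ℝ) + 1))) = 1 / ((m : ℝ) - 2) := by
        have h4 : (4 : ℝ) ≤ m := by exact_mod_cast hm
        have : (m : ℝ) - 2 ≠ 0 := by linarith
        norm_num
        field_simp
      have e2 : 1 / (2 * (m : ℝ) - (((1 : ℕ) : ℝ) + 1)) = 1 / (2 * ((m : ℝ) - 1)) := by
        push_cast; ring_nf
      simp only [Geom.solve, e1, e2, Geom.schouten]
      change _ * (_ - _ * (𝔤.scal * _)) = _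
      ring
    have h2 := (h0.linRic_natural fun A _ _ 𝔤 i j => by
      rw [(H A 𝔤).symm, 𝔤.schouten_symm]).sub (Low₂.linRic_schouten (m := m) (by omega))
    refine h2.congr fun A _ _ 𝔤 I => ?_
    beta_reduce
    have e3 : (fun i j => coeff 2 ((H A 𝔤).h i j) + 𝔤.schouten i j)
        = fun i j => coeff 2 ((H A 𝔤).h i j) - algebraMap ℝ A (-1) * 𝔤.schouten i j := by
      funext i j
      rw [map_neg, map_one]; ring
    rw [e3, 𝔤.linRic_sub, 𝔤.linRic_const_mul, (H A 𝔤).ricPart_add_two]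
    simp only [recCoeff, Function.iterate_zero, id, map_neg, map_one]
    ring
  | succ k ih =>
    have h1 := hH.solve_sub (s := 2 * k + 3) (Y := fun A _ _ 𝔤 i j =>
      algebraMap ℝ A (recCoeff m k) * 𝔤.lap^[k] 𝔤.bach i j) (by omega) hF (ih (by omega))
    have hm2 : (2 * (k : ℝ) + 2 + 4) ≤ m := by
      have : ((2 * (k + 1) + 4 : ℕ) : ℝ) ≤ m := by exact_mod_cast hk
      push_cast at this; linarith
    -- The factor of -Δ^k B in the coefficient of order 2k + 4: the inverse trace-free eigenvalue at
    -- t = 2k + 4 times the factor from the previous step. Applying `linRic` halves it.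
    set c : ℝ := 2 / ((((2 * k + 3 : ℕ) : ℝ) + 1) * (m - (((2 * k + 3 : ℕ) : ℝ) + 1))) * recCoeff m k
      with hc
    have h2 : Low₂ m (2 * k + 4) 2 (fun A _ _ 𝔤 i j => coeff (2 * k + 4) ((H A 𝔤).h i j)
        + algebraMap ℝ A c * 𝔤.lap^[k] 𝔤.bach i j) := by
      -- `solve` also produces a multiple of tr(Δ^k B) g, which is moved into the quadratic
      -- remainder.
      have ht := (Low₂.mul_g (Low₂.tr_lap_iterate_bach (m := m) k)).const_mul
        (c * (1 / (2 * m - (((2 * k + 3 : ℕ) : ℝ) + 1))))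
      refine (h1.add ht).congr fun A _ _ 𝔤 I => ?_
      simp only [Geom.solve, 𝔤.tr_const_mul, hc, map_mul]
      ring
    have h3 := (h2.linRic_natural fun A _ _ 𝔤 i j => by
      rw [(H A 𝔤).symm, 𝔤.lap_iterate_bach_symm]).sub
        ((Low₂.linRic_lap_iterate_bach (m := m) (by omega) k).const_mul c)
    refine (h3.cast rfl (by ring)).congr fun A _ _ 𝔤 I => ?_
    beta_reduce
    have e3 : (fun i j => coeff (2 * k + 4) ((H A 𝔤).h i j)
          + algebraMap ℝ A c * 𝔤.lap^[k] 𝔤.bach i j)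
        = fun i j => coeff (2 * k + 4) ((H A 𝔤).h i j)
          - algebraMap ℝ A (-c) * 𝔤.lap^[k] 𝔤.bach i j := by
      funext i j
      rw [map_neg]; ring
    have e4 : recCoeff m (k + 1) = c * (1 / 2) := by
      have h5 : (2 * (k : ℝ) + 4) ≠ 0 := by positivity
      have h6 : (m : ℝ) - (2 * k + 4) ≠ 0 := by intro h; linarith
      have h7 : (m : ℝ) - (2 * k + 3 + 1) ≠ 0 := by intro h; linarith
      have h8 : (2 * (k : ℝ) + 3 + 1) ≠ 0 := by positivity
      rw [hc, recCoeff]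
      push_cast
      rw [show 2 * (k : ℝ) + 3 + 1 = 2 * k + 4 by ring]
      field_simp
    clear_value c
    rw [e3, 𝔤.linRic_sub, 𝔤.linRic_const_mul, e4, map_mul,
      show 2 * (k + 1) + 3 = (2 * k + 3) + 2 by ring, (H A 𝔤).ricPart_add_two, map_neg]
    ring

end SMFam.Natural

/-- The trace-free part of the leading coefficient of the Einstein defect of a formal Poincaré
metric. -/
theorem exists_polynomial_of_dvd (K : ℕ) : ∃ Q : CurvaturePolynomial (2 * K + 3),
    ∀ (A : Type) [CommRing A] [Algebra ℝ A] (𝔤 : Geom (Fin (2 * K + 4)) A) (H : SMetric 𝔤),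
      (∀ i j : Fin (2 * K + 4), X ^ (2 * K + 3) ∣ H.path.F i.succ j.succ) → ∀ i j,
      algebraMap ℝ A (obstructionConst (2 * K + 3)) *
        𝔤.tf (fun i j => coeff (2 * K + 3) (H.path.F i.succ j.succ)) i j
      = 𝔤.lap^[K] 𝔤.bach i j + (Q.map fun t => t.1 • t.2.aeval 𝔤 ![i, j]).sum := by
  obtain ⟨H, hH, hHF⟩ := exists_model (2 * K + 4) (2 * K + 3) le_rfl
  have hF := fun A [CommRing A] [Algebra ℝ A] 𝔤 i j => (hHF A 𝔤 i j).1
  have h1 := hH.F_sub' (2 * K + 3)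
  have h2 := hH.ricPart_sub (by omega) hF K le_rfl
  have h3 : Low₂ (2 * K + 4) (2 * K + 4) 2 (fun A _ _ 𝔤 i j =>
      algebraMap ℝ A (obstructionConst (2 * K + 3)) *
        𝔤.tf (fun i j => coeff (2 * K + 3) ((H A 𝔤).path.F i.succ j.succ)) i j
      - 𝔤.lap^[K] 𝔤.bach i j) := by
    have h4 := (Low₂.tf (T := fun A _ _ 𝔤 i j =>
        (coeff (2 * K + 3) ((H A 𝔤).path.F i.succ j.succ)
        - (H A 𝔤).ricPart (2 * K + 3) i j
        - 𝔤.indicial ((2 * K + 3 : ℕ) + 1) (fun i j => coeff (2 * K + 3 + 1) ((H A 𝔤).h i j)) i j)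
        + ((H A 𝔤).ricPart (2 * K + 3) i j
          - algebraMap ℝ A (recCoeff (2 * K + 4) K) * 𝔤.lap^[K] 𝔤.bach i j)) (h1.add h2)).const_mul (obstructionConst (2 * K + 3))
    -- Likewise Δ^K B and its trace-free part differ only by a quadratic term.
    have h5 := (Low₂.mul_g (Low₂.tr_lap_iterate_bach (m := 2 * K + 4) K)).const_mul
      (1 / ((2 * K + 4 : ℕ) : ℝ))
    refine (h4.sub h5).congr fun A _ _ 𝔤 I => ?_
    beta_reduce
    -- At the critical exponent t = m the indicial term is a multiple of g, so the undetermined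
    -- coefficient of x^m disappears under the trace-free part.
    have e1 := 𝔤.tf_add_trace (by omega)
      (z' := fun i j => (coeff (2 * K + 3) ((H A 𝔤).path.F i.succ j.succ)
        - (H A 𝔤).ricPart (2 * K + 3) i j
        - 𝔤.indicial ((2 * K + 3 : ℕ) + 1) (fun i j => coeff (2 * K + 3 + 1) ((H A 𝔤).h i j)) i j)
        + ((H A 𝔤).ricPart (2 * K + 3) i j
          - algebraMap ℝ A (recCoeff (2 * K + 4) K) * 𝔤.lap^[K] 𝔤.bach i j))
      (z := fun i j => coeff (2 * K + 3) ((H A 𝔤).path.F i.succ j.succ)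
        - algebraMap ℝ A (recCoeff (2 * K + 4) K) * 𝔤.lap^[K] 𝔤.bach i j)
      (algebraMap ℝ A ((((2 * K + 3 : ℕ) : ℝ) + 1) / 2) *
        𝔤.tr (fun i j => coeff (2 * K + 3 + 1) ((H A 𝔤).h i j))) (fun i j => by
          have e : algebraMap ℝ A (((2 * K + 4 : ℕ) : ℝ) - (((2 * K + 3 : ℕ) : ℝ) + 1)) = 0 := by
            rw [← map_zero (algebraMap ℝ A)]; congr 1; push_cast; ring
          rw [Geom.indicial, e]; ring) (I 0) (I 1)
    have e2 : 𝔤.tf (fun i j => coeff (2 * K + 3) ((H A 𝔤).path.F i.succ j.succ)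
        - algebraMap ℝ A (recCoeff (2 * K + 4) K) * 𝔤.lap^[K] 𝔤.bach i j) (I 0) (I 1)
        = 𝔤.tf (fun i j => coeff (2 * K + 3) ((H A 𝔤).path.F i.succ j.succ)) (I 0) (I 1)
          - algebraMap ℝ A (recCoeff (2 * K + 4) K) * 𝔤.tf (𝔤.lap^[K] 𝔤.bach) (I 0) (I 1) := by
      simp only [Geom.tf]
      rw [𝔤.tr_sub, 𝔤.tr_const_mul]
      ring
    have e3 := congrArg (algebraMap ℝ A) (obstructionConst_mul_recCoeff K)
    rw [map_mul, map_one] at e3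
    refine (congrArg (fun z => algebraMap ℝ A (obstructionConst (2 * K + 3)) * z - _)
      (e1.symm.trans e2)).trans ?_
    rw [show 𝔤.tf (𝔤.lap^[K] 𝔤.bach) (I 0) (I 1) = 𝔤.lap^[K] 𝔤.bach (I 0) (I 1)
      - algebraMap ℝ A (1 / ((2 * K + 4 : ℕ) : ℝ)) * (𝔤.tr (𝔤.lap^[K] 𝔤.bach) * 𝔤.g (I 0) (I 1))
      from rfl]
    linear_combination (-(𝔤.lap^[K] 𝔤.bach (I 0) (I 1)
      - algebraMap ℝ A (1 / ((2 * K + 4 : ℕ) : ℝ)) *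
        (𝔤.tr (𝔤.lap^[K] 𝔤.bach) * 𝔤.g (I 0) (I 1)))) * e3
  obtain ⟨Q, hQ⟩ := NetComb.exists_polynomial (Natl.netComb h3)
  refine ⟨Q, fun A _ _ 𝔤 H' hF' i j => ?_⟩
  -- Q was found for one natural model; any other formal Poincaré metric has the same trace-free
  -- leading coefficient.
  have h6 : 𝔤.tf (fun i j => coeff (2 * K + 3) (H'.path.F i.succ j.succ)) i j
      = 𝔤.tf (fun i j => coeff (2 * K + 3) ((H A 𝔤).path.F i.succ j.succ)) i j :=
    SMetric.tf_coeff_eq (H := H A 𝔤) (H' := H') (by omega) (fun i j => hF A 𝔤 i j) hF' i j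
  have h7 : algebraMap ℝ A (obstructionConst (2 * K + 3)) *
        𝔤.tf (fun i j => coeff (2 * K + 3) ((H A 𝔤).path.F i.succ j.succ)) i j
      - 𝔤.lap^[K] 𝔤.bach i j = (Q.map fun t => t.1 • t.2.aeval 𝔤 ![i, j]).sum := hQ A 𝔤 ![i, j]
  rw [h6, ← h7]
  exact (add_sub_cancel _ _).symm

end

section

/-! ### Algebras of smooth functions -/

/-- A domain on which smooth functions have well-defined and symmetric derivatives. -/
structure Domain (k : ℕ) where
  carrier : Set (Coords k)
  uniqueDiffOn : UniqueDiffOn ℝ carrier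
  subset_closure : carrier ⊆ closure (interior carrier)

/-- An open domain. -/
def Domain.ofOpen {k : ℕ} (U : Set (Coords k)) (hU : IsOpen U) : Domain k where
  carrier := U
  uniqueDiffOn := hU.uniqueDiffOn
  subset_closure := by rw [hU.interior_eq]; exact _root_.subset_closure

section

variable {k l : ℕ} {Ω : Domain k} {Ω' : Domain l}

open Classical in
/-- Extension by zero. -/
def zeroExt (f : Ω.carrier → ℝ) (z : Coords k) : ℝ :=
  if h : z ∈ Ω.carrier then f ⟨z, h⟩ else 0

theorem zeroExt_apply (f : Ω.carrier → ℝ) (z : Ω.carrier) : zeroExt f z = f z := by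
  rw [zeroExt, dif_pos z.2]

variable (Ω) in
/-- The smooth functions, as a subalgebra of all functions. -/
def smoothSubalgebra : Subalgebra ℝ (Ω.carrier → ℝ) where
  carrier := {f | ContDiffOn ℝ ∞ (zeroExt f) Ω.carrier}
  mul_mem' {f g} hf hg := (hf.mul hg).congr fun z hz => by
    lift z to Ω.carrier using hz
    simp only [zeroExt_apply, Pi.mul_apply]
  add_mem' {f g} hf hg := (hf.add hg).congr fun z hz => by
    lift z to Ω.carrier using hz
    simp only [zeroExt_apply, Pi.add_apply]
  algebraMap_mem' c := (contDiffOn_const (c := c)).congr fun z hz => by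
    lift z to Ω.carrier using hz
    rw [zeroExt_apply]; rfl

variable (Ω) in
/-- The algebra of smooth functions. -/
def Sm : Type := smoothSubalgebra Ω

instance : CommRing (Sm Ω) := inferInstanceAs (CommRing (smoothSubalgebra Ω))

instance : Algebra ℝ (Sm Ω) := inferInstanceAs (Algebra ℝ (smoothSubalgebra Ω))

namespace Sm

/-- The function on the whole space, extended by zero. -/
def ext (f : Sm Ω) : Coords k → ℝ := zeroExt f.1

theorem ext_apply (f : Sm Ω) (z : Ω.carrier) : f.ext z = f.1 z := zeroExt_apply _ _

theorem contDiffOn (f : Sm Ω) : ContDiffOn ℝ ∞ f.ext Ω.carrier := f.2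

/-- The element given by a function that is smooth on the domain. -/
def of (F : Coords k → ℝ) (hF : ContDiffOn ℝ ∞ F Ω.carrier) : Sm Ω :=
  ⟨fun z => F z, hF.congr fun z hz => by
    lift z to Ω.carrier using hz
    rw [zeroExt_apply]⟩

/-- Evaluation at a point. -/
def ev {z : Coords k} (hz : z ∈ Ω.carrier) : Sm Ω →ₐ[ℝ] ℝ :=
  (Pi.evalAlgHom ℝ (fun _ : Ω.carrier => ℝ) ⟨z, hz⟩).comp (smoothSubalgebra Ω).val

theorem ev_apply (f : Sm Ω) {z : Coords k} (hz : z ∈ Ω.carrier) : ev hz f = f.ext z :=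
  (ext_apply f ⟨z, hz⟩).symm

theorem hasFDerivWithinAt (f : Sm Ω) {z : Coords k} (hz : z ∈ Ω.carrier) :
    HasFDerivWithinAt f.ext (fderivWithin ℝ f.ext Ω.carrier z) Ω.carrier z :=
  ((f.contDiffOn.differentiableOn (by simp)) z hz).hasFDerivWithinAt

theorem contDiffOn_fderivWithin (f : Sm Ω) (v : Coords k) :
    ContDiffOn ℝ ∞ (fun z => fderivWithin ℝ f.ext Ω.carrier z v) Ω.carrier :=
  (f.contDiffOn.fderivWithin Ω.uniqueDiffOn (m := ∞) (by simp)).clm_apply contDiffOn_const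

theorem ev_of {F : Coords k → ℝ} (hF : ContDiffOn ℝ ∞ F Ω.carrier) {z : Coords k}
    (hz : z ∈ Ω.carrier) : ev hz (of F hF) = F z := rfl

theorem eq_of_ev {f g : Sm Ω} (h : ∀ z (hz : z ∈ Ω.carrier), ev hz f = ev hz g) : f = g :=
  Subtype.ext (funext fun z => h z z.2)

theorem ext_eqOn_of {f : Sm Ω} {F : Coords k → ℝ} (h : ∀ z (hz : z ∈ Ω.carrier), ev hz f = F z)
    {z : Coords k} (hz : z ∈ Ω.carrier) : f.ext z = F z := by rw [← ev_apply f hz, h]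

theorem hasFDerivWithinAt_eq {f : Sm Ω} {F : Coords k → ℝ}
    (h : ∀ z (hz : z ∈ Ω.carrier), ev hz f = F z) {F' : Coords k →L[ℝ] ℝ} {z : Coords k}
    (hz : z ∈ Ω.carrier) (hF : HasFDerivWithinAt F F' Ω.carrier z) :
    fderivWithin ℝ f.ext Ω.carrier z = F' :=
  (hF.congr (fun z hz => ext_eqOn_of h hz) (ext_eqOn_of h hz)).fderivWithin
    (Ω.uniqueDiffOn z hz)

variable (Ω) in
/-- The derivative in a constant direction. -/
def deriv (v : Coords k) : Derivation ℝ (Sm Ω) (Sm Ω) :=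
  Derivation.mk'
    { toFun := fun f => of _ (f.contDiffOn_fderivWithin v)
      map_add' := fun f g => eq_of_ev fun z hz => by
        rw [map_add, ev_of, ev_of, ev_of, hasFDerivWithinAt_eq (fun z hz => ?_) hz
          ((f.hasFDerivWithinAt hz).add (g.hasFDerivWithinAt hz))]
        · rfl
        · rw [map_add, ev_apply, ev_apply]; rfl
      map_smul' := fun c f => eq_of_ev fun z hz => by
        rw [RingHom.id_apply, map_smul, ev_of, ev_of, hasFDerivWithinAt_eq (fun z hz => ?_) hz
          ((f.hasFDerivWithinAt hz).const_smul c)]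
        · rfl
        · rw [map_smul, ev_apply]; rfl }
    fun f g => eq_of_ev fun z hz => by
      change ev hz (of _ _) = ev hz (f * of _ _ + g * of _ _)
      rw [map_add, map_mul, map_mul, ev_of, ev_of, ev_of, hasFDerivWithinAt_eq (fun z hz => ?_) hz
          ((f.hasFDerivWithinAt hz).mul (g.hasFDerivWithinAt hz))]
      · rw [ev_apply, ev_apply]; rfl
      · rw [map_mul, ev_apply, ev_apply]; rfl

theorem ev_deriv (v : Coords k) (f : Sm Ω) {z : Coords k} (hz : z ∈ Ω.carrier) :
    ev hz (deriv Ω v f) = fderivWithin ℝ f.ext Ω.carrier z v := rfl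

theorem ev_deriv_eq (v : Coords k) {f : Sm Ω} {F : Coords k → ℝ}
    (h : ∀ z (hz : z ∈ Ω.carrier), ev hz f = F z) {F' : Coords k →L[ℝ] ℝ} {z : Coords k}
    (hz : z ∈ Ω.carrier) (hF : HasFDerivWithinAt F F' Ω.carrier z) :
    ev hz (deriv Ω v f) = F' v := by rw [ev_deriv, hasFDerivWithinAt_eq h hz hF]

/-- Second derivatives within a set are symmetric at points in the closure of its interior, so the
derivations commute also at the boundary points of a collar. -/
theorem deriv_comm (v w : Coords k) (f : Sm Ω) :
    deriv Ω v (deriv Ω w f) = deriv Ω w (deriv Ω v f) := by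
  refine eq_of_ev fun z hz => ?_
  have hd : DifferentiableWithinAt ℝ (fderivWithin ℝ f.ext Ω.carrier) Ω.carrier z :=
    (f.contDiffOn.fderivWithin Ω.uniqueDiffOn (m := ∞) (by simp)).differentiableOn (by simp) z hz
  have h : ∀ u, HasFDerivWithinAt (fun z => fderivWithin ℝ f.ext Ω.carrier z u)
      ((fderivWithin ℝ (fderivWithin ℝ f.ext Ω.carrier) Ω.carrier z).flip u) Ω.carrier z :=
    fun u => by
      have := hd.hasFDerivWithinAt.clm_apply (hasFDerivWithinAt_const u z Ω.carrier)
      refine this.congr_fderiv ?_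
      ext x
      simp
  rw [ev_deriv_eq v (fun z hz => ev_deriv w f hz) hz (h w),
    ev_deriv_eq w (fun z hz => ev_deriv v f hz) hz (h v)]
  have hs := (f.contDiffOn z hz).isSymmSndFDerivWithinAt
    (by rw [minSmoothness_of_isRCLikeNormedField]; exact WithTop.coe_le_coe.mpr le_top) Ω.uniqueDiffOn
    (Ω.subset_closure hz) hz
  exact hs.eq v w

/-- Pullback by a linear map. -/
def pull (φ : Coords l →L[ℝ] Coords k) (hφ : MapsTo φ Ω'.carrier Ω.carrier) : Sm Ω →ₐ[ℝ] Sm Ω' where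
  toFun f := of (f.ext ∘ φ) (f.contDiffOn.comp φ.contDiff.contDiffOn hφ)
  map_one' := eq_of_ev fun z hz => by
    rw [ev_of, map_one, Function.comp, ← ev_apply _ (hφ hz), map_one]
  map_zero' := eq_of_ev fun z hz => by
    rw [ev_of, map_zero, Function.comp, ← ev_apply _ (hφ hz), map_zero]
  map_add' f g := eq_of_ev fun z hz => by
    simp only [ev_of, map_add, Function.comp, ← ev_apply _ (hφ hz)]
  map_mul' f g := eq_of_ev fun z hz => by
    simp only [ev_of, map_mul, Function.comp, ← ev_apply _ (hφ hz)]
  commutes' c := eq_of_ev fun z hz => by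
    simp only [ev_of, AlgHom.commutes, Function.comp, ← ev_apply _ (hφ hz)]

theorem ev_pull (φ : Coords l →L[ℝ] Coords k) (hφ : MapsTo φ Ω'.carrier Ω.carrier) (f : Sm Ω)
    {z : Coords l} (hz : z ∈ Ω'.carrier) : ev hz (pull φ hφ f) = ev (hφ hz) f := by
  rw [ev_apply f]; rfl

theorem deriv_pull (φ : Coords l →L[ℝ] Coords k) (hφ : MapsTo φ Ω'.carrier Ω.carrier) (f : Sm Ω)
    (v : Coords l) : deriv Ω' v (pull φ hφ f) = pull φ hφ (deriv Ω (φ v) f) := by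
  refine eq_of_ev fun z hz => ?_
  rw [ev_pull, ev_deriv_eq v (fun z hz => ?_) hz
    ((f.hasFDerivWithinAt (hφ hz)).comp z φ.hasFDerivWithinAt hφ)]
  · rfl
  · rw [ev_pull, ev_apply]; rfl

/-- A function without zeros is invertible. -/
theorem isUnit_of_ne_zero {f : Sm Ω} (hf : ∀ z (hz : z ∈ Ω.carrier), ev hz f ≠ 0) : IsUnit f := by
  have h : ContDiffOn ℝ ∞ (fun z => (f.ext z)⁻¹) Ω.carrier :=
    f.contDiffOn.inv fun z hz => by rw [← ev_apply f hz]; exact hf z hz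
  refine IsUnit.of_mul_eq_one (of _ h) (eq_of_ev fun z hz => ?_)
  rw [map_mul, ev_of, map_one, ← ev_apply f hz, mul_inv_cancel₀ (hf z hz)]

end Sm

end

end

section

/-! ### Functoriality -/

/-- A change of coefficients that takes a metric to a metric. -/
structure Geom.Hom {ι A B : Type*} [Fintype ι] [DecidableEq ι] [CommRing A] [Algebra ℝ A]
    [CommRing B] [Algebra ℝ B] (φ : A →ₐ[ℝ] B) (𝔤 : Geom ι A) (𝔥 : Geom ι B) : Prop where
  map_D : ∀ i a, φ (𝔤.D i a) = 𝔥.D i (φ a)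
  map_g : ∀ i j, φ (𝔤.g i j) = 𝔥.g i j

namespace Geom.Hom

variable {ι A B : Type*} [Fintype ι] [DecidableEq ι] [CommRing A] [Algebra ℝ A] [CommRing B]
  [Algebra ℝ B] {φ : A →ₐ[ℝ] B} {𝔤 : Geom ι A} {𝔥 : Geom ι B}

theorem map_half : φ (half A) = half B := φ.commutes _

theorem map_gi (h : Geom.Hom φ 𝔤 𝔥) (i j : ι) : φ (𝔤.gi i j) = 𝔥.gi i j := by
  have h1 : φ.mapMatrix 𝔤.g = 𝔥.g := by ext i j; exact h.map_g i j
  have h2 := congrArg φ.mapMatrix 𝔤.mul_inv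
  rw [map_mul, map_one, h1] at h2
  have h3 : φ.mapMatrix 𝔤.gi = 𝔥.gi := by
    rw [← one_mul (φ.mapMatrix 𝔤.gi), ← 𝔥.inv_mul, mul_assoc, h2, mul_one]
  exact congrFun (congrFun h3 i) j

theorem map_Γ (h : Geom.Hom φ 𝔤 𝔥) (k i j : ι) : φ (𝔤.Γ k i j) = 𝔥.Γ k i j := by
  simp only [Geom.Γ, map_mul, map_sum, map_sub, map_add, h.map_gi, h.map_D, h.map_g, map_half]

theorem map_riem (h : Geom.Hom φ 𝔤 𝔥) (i j k l : ι) : φ (𝔤.riem i j k l) = 𝔥.riem i j k l := by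
  simp only [Geom.riem, map_mul, map_sum, map_sub, map_add, h.map_D, h.map_Γ]

theorem map_ric (h : Geom.Hom φ 𝔤 𝔥) (j k : ι) : φ (𝔤.ric j k) = 𝔥.ric j k := by
  simp only [Geom.ric, map_sum, h.map_riem]

theorem map_defect (h : Geom.Hom φ 𝔤 𝔥) (o : ι) (x : A) (j k : ι) :
    φ (𝔤.defect o x j k) = 𝔥.defect o (φ x) j k := by
  simp only [Geom.defect, Geom.tr, Geom.hess, map_mul, map_sum, map_sub, map_add, map_neg,
    h.map_Γ, h.map_gi, h.map_g, h.map_ric, map_natCast, map_ofNat]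

end Geom.Hom

/-- A change of coefficients that takes a path of metrics to a path of metrics. -/
theorem GeomPath.map_F {m : ℕ} {A B : Type*} [CommRing A] [Algebra ℝ A] [CommRing B] [Algebra ℝ B]
    {φ : A →ₐ[ℝ] B} {𝔥 : GeomPath m A} {𝔥' : GeomPath m B} (h : Geom.Hom φ 𝔥.toGeom 𝔥'.toGeom)
    (hD : ∀ a, φ (𝔥.D₀ a) = 𝔥'.D₀ (φ a)) (hx : φ 𝔥.x = 𝔥'.x) (a b : Fin (m + 1)) :
    φ (𝔥.F a b) = 𝔥'.F a b := by
  have h1 : Geom.Hom φ 𝔥.cyl 𝔥'.cyl := by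
    constructor
    · intro i a
      refine Fin.cases (hD a) (fun i => h.map_D i a) i
    · intro i j
      refine Fin.cases ?_ (fun i => ?_) i <;> refine Fin.cases ?_ (fun j => ?_) j
      · exact map_one φ
      · exact map_zero φ
      · exact map_zero φ
      · exact h.map_g i j
  rw [GeomPath.F, h1.map_defect, hx, GeomPath.F]

/-! ### Taylor series -/

section taylor

variable {A B : Type*} [CommRing A] [Algebra ℝ A] [CommRing B] [Algebra ℝ B]

open PowerSeries (coeff)

/-- A formal Taylor series is multiplicative. -/
theorem coeff_taylor_mul {D : Derivation ℝ A A} {ρ : A →ₐ[ℝ] B} {T : A → PowerSeries B}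
    (h0 : ∀ a, coeff 0 (T a) = ρ a) (hT : ∀ a b, T (a + b) = T a + T b)
    (hD : ∀ a, T (D a) = ddX B (T a)) (n : ℕ) :
    ∀ a b, coeff n (T (a * b)) = coeff n (T a * T b) := by
  induction n with
  | zero =>
    intro a b
    rw [h0, map_mul, coeff_zero_mul, h0, h0]
  | succ n ih =>
    intro a b
    -- Both sides obey the Leibniz rule, so the induction hypothesis identifies coefficient n of the
    -- derivatives; division by n + 1 gives coefficient n + 1.
    have h1 : coeff n (ddX B (T (a * b))) = coeff n (ddX B (T a * T b)) := by
      rw [← hD, D.leibniz, (ddX B).leibniz, hT, map_add, map_add, smul_eq_mul, smul_eq_mul,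
        smul_eq_mul, smul_eq_mul, ih, ih, hD, hD]
    rw [coeff_ddX, coeff_ddX] at h1
    have h2 : IsUnit ((n : B) + 1) := by
      refine IsUnit.of_mul_eq_one (algebraMap ℝ B (1 / ((n : ℝ) + 1))) ?_
      rw [show (n : B) + 1 = algebraMap ℝ B ((n : ℝ) + 1) by rw [map_add, map_natCast, map_one],
        ← map_mul, mul_one_div_cancel (by positivity), map_one]
    exact h2.mul_right_cancel h1

theorem algebraMap_inv_factorial (n : ℕ) : algebraMap ℝ B (1 / (n.factorial : ℝ))
    = algebraMap ℝ B (1 / ((n + 1).factorial : ℝ)) * (n + 1) := by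
  rw [show (n : B) + 1 = algebraMap ℝ B ((n : ℝ) + 1) by rw [map_add, map_natCast, map_one],
    ← map_mul, Nat.factorial_succ]
  congr 1
  have := n.factorial_ne_zero
  push_cast
  field_simp

/-- The formal Taylor series along a derivation. -/
def taylor (D : Derivation ℝ A A) (ρ : A →ₐ[ℝ] B) : A →ₐ[ℝ] PowerSeries B := by
  let T : A → PowerSeries B := fun a => PowerSeries.mk fun n =>
    algebraMap ℝ B (1 / (n.factorial : ℝ)) * ρ (D^[n] a)
  have hDadd : ∀ n a b, D^[n] (a + b) = D^[n] a + D^[n] b := fun n a b => by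
    rw [← iterate_map_add]
  have h0 : ∀ a, coeff 0 (T a) = ρ a := fun a => by simp [T]
  have hadd : ∀ a b, T (a + b) = T a + T b := fun a b => by
    ext n
    simp only [T, PowerSeries.coeff_mk, map_add, hDadd, mul_add]
  have hD : ∀ a, T (D a) = ddX B (T a) := fun a => by
    ext n
    simp only [T, PowerSeries.coeff_mk, coeff_ddX]
    rw [Function.iterate_succ_apply]
    rw [algebraMap_inv_factorial]; ring
  have hC : ∀ c : ℝ, T (algebraMap ℝ A c) = algebraMap ℝ _ c := fun c => by
    ext n
    rcases n with _ | n
    · rw [h0, AlgHom.commutes, algebraMap_series]; simp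
    · simp only [T, PowerSeries.coeff_mk]
      have : D^[n] 0 = 0 := iterate_map_zero D n
      rw [Function.iterate_succ_apply, D.map_algebraMap, this, map_zero, mul_zero,
        algebraMap_series, PowerSeries.coeff_C, if_neg n.succ_ne_zero]
  exact
    { toFun := T
      map_one' := by have := hC 1; rwa [map_one, map_one] at this
      map_zero' := by have := hC 0; rwa [map_zero, map_zero] at this
      map_add' := hadd
      map_mul' := fun a b => PowerSeries.ext fun n => coeff_taylor_mul h0 hadd hD n a b
      commutes' := hC }

theorem coeff_taylor (D : Derivation ℝ A A) (ρ : A →ₐ[ℝ] B) (a : A) (n : ℕ) :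
    coeff n (taylor D ρ a) = algebraMap ℝ B (1 / (n.factorial : ℝ)) * ρ (D^[n] a) := by
  change coeff n (PowerSeries.mk fun n => algebraMap ℝ B (1 / (n.factorial : ℝ)) * ρ (D^[n] a)) = _
  rw [PowerSeries.coeff_mk]

theorem coeff_zero_taylor (D : Derivation ℝ A A) (ρ : A →ₐ[ℝ] B) (a : A) :
    coeff 0 (taylor D ρ a) = ρ a := by rw [coeff_taylor]; simp

theorem taylor_D (D : Derivation ℝ A A) (ρ : A →ₐ[ℝ] B) (a : A) :
    taylor D ρ (D a) = ddX B (taylor D ρ a) := by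
  ext n
  rw [coeff_taylor, coeff_ddX, coeff_taylor, Function.iterate_succ_apply]
  rw [algebraMap_inv_factorial]; ring

theorem taylor_comm {D E : Derivation ℝ A A} {E' : Derivation ℝ B B} {ρ : A →ₐ[ℝ] B}
    (hc : ∀ a, D (E a) = E (D a)) (hE : ∀ a, ρ (E a) = E' (ρ a)) (a : A) :
    taylor D ρ (E a) = mapD E' (taylor D ρ a) := by
  ext n
  have h : ∀ n, D^[n] (E a) = E (D^[n] a) := fun n => by
    induction n with
    | zero => rfl
    | succ n ih => rw [Function.iterate_succ_apply', Function.iterate_succ_apply', ih, hc]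
  rw [coeff_mapD, coeff_taylor, coeff_taylor, h, hE, E'.leibniz, E'.map_algebraMap, smul_zero,
    add_zero, smul_eq_mul]

theorem taylor_of_D_eq_one {D : Derivation ℝ A A} {ρ : A →ₐ[ℝ] B} {x : A} (hx : D x = 1)
    (h0 : ρ x = 0) : taylor D ρ x = PowerSeries.X := by
  ext n
  rcases n with _ | _ | n
  · rw [coeff_zero_taylor, h0]; simp
  · rw [coeff_taylor]; simp [hx]
  · have : D^[n] 0 = 0 := iterate_map_zero D n
    rw [coeff_taylor, Function.iterate_succ_apply, Function.iterate_succ_apply, hx,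
      D.map_one_eq_zero, this, map_zero, mul_zero, PowerSeries.coeff_X, if_neg (by omega)]

theorem taylor_of_D_eq_zero {D : Derivation ℝ A A} {ρ : A →ₐ[ℝ] B} {x : A} (hx : D x = 0) :
    taylor D ρ x = PowerSeries.C (ρ x) := by
  ext n
  rcases n with _ | n
  · rw [coeff_zero_taylor]; simp
  · have : D^[n] 0 = 0 := iterate_map_zero D n
    rw [coeff_taylor, Function.iterate_succ_apply, hx, this, map_zero, mul_zero,
      PowerSeries.coeff_C, if_neg n.succ_ne_zero]

end taylor

end

section

open PowerSeries (coeff)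

/-! ### Smooth functions on a collar -/

section coords

variable {m : ℕ}

/-- The `ℝ^m`-part, as a linear map. -/
def tailL (m : ℕ) : Coords (m + 1) →L[ℝ] Coords m :=
  LinearMap.toContinuousLinearMap
    { toFun := tailCoords
      map_add' := fun _ _ => rfl
      map_smul' := fun _ _ => rfl }

/-- The inclusion of the boundary, as a linear map. -/
def zeroL (m : ℕ) : Coords m →L[ℝ] Coords (m + 1) :=
  LinearMap.toContinuousLinearMap
    { toFun := joinCoords 0
      map_add' := fun y y' => by
        ext i
        refine Fin.cases ?_ (fun i => ?_) i
        · exact (add_zero (0 : ℝ)).symm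
        · rfl
      map_smul' := fun c y => by
        ext i
        refine Fin.cases ?_ (fun i => ?_) i
        · exact (mul_zero c).symm
        · rfl }

/-- The first coordinate, as a linear map. -/
def headL (m : ℕ) : Coords (m + 1) →L[ℝ] ℝ := EuclideanSpace.proj 0

theorem tailL_apply (z : Coords (m + 1)) : tailL m z = tailCoords z := rfl
theorem zeroL_apply (y : Coords m) : zeroL m y = joinCoords 0 y := rfl

theorem joinCoords_zero_apply (x : ℝ) (y : Coords m) : joinCoords x y 0 = x := rfl
theorem joinCoords_succ_apply (x : ℝ) (y : Coords m) (i : Fin m) : joinCoords x y i.succ = y i := rfl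

theorem joinCoords_tailCoords (z : Coords (m + 1)) : joinCoords (z 0) (tailCoords z) = z := by
  ext i
  refine Fin.cases rfl (fun i => rfl) i

theorem joinCoords_eq (x : ℝ) (y : Coords m) :
    joinCoords x y = x • EuclideanSpace.single 0 1 + zeroL m y := by
  ext i
  refine Fin.cases ?_ (fun i => ?_) i
  · simp [zeroL_apply, joinCoords_zero_apply]
  · simp [zeroL_apply, joinCoords_succ_apply, (Fin.succ_ne_zero i)]

theorem hasDerivAt_joinCoords (x : ℝ) (y : Coords m) :
    HasDerivAt (fun x => joinCoords x y) (EuclideanSpace.single 0 1) x := by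
  have h : (fun x => joinCoords x y) = fun x => x • EuclideanSpace.single 0 (1 : ℝ) + zeroL m y :=
    funext fun x => joinCoords_eq x y
  rw [h]
  simpa using ((hasDerivAt_id x).smul_const (EuclideanSpace.single (0 : Fin (m + 1)) (1 : ℝ))).add_const
    (zeroL m y)

theorem tailL_single_zero : tailL m (EuclideanSpace.single 0 1) = 0 := by
  ext i
  simp [tailL_apply, tailCoords, Fin.succ_ne_zero]

theorem zeroL_single (i : Fin m) :
    zeroL m (EuclideanSpace.single i 1) = EuclideanSpace.single i.succ 1 := by
  ext j
  refine Fin.cases ?_ (fun j => ?_) j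
  · simp [zeroL_apply, joinCoords_zero_apply, Pi.single_apply, (Fin.succ_ne_zero _).symm]
  · simp [zeroL_apply, joinCoords_succ_apply, Pi.single_apply]

/-- A normal segment from the boundary to a point of a ball centred on the boundary stays in the
ball, so bounds on the ball can be integrated along it. -/
theorem dist_joinCoords_le {s t : ℝ} (hs : 0 ≤ s) (hst : s ≤ t) (y y₀ : Coords m) :
    dist (joinCoords s y) (joinCoords 0 y₀) ≤ dist (joinCoords t y) (joinCoords 0 y₀) := by
  rw [EuclideanSpace.dist_eq, EuclideanSpace.dist_eq]
  refine Real.sqrt_le_sqrt ?_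
  rw [Fin.sum_univ_succ, Fin.sum_univ_succ]
  simp only [joinCoords_zero_apply, joinCoords_succ_apply]
  gcongr
  rw [Real.dist_eq, Real.dist_eq, sub_zero, sub_zero, abs_of_nonneg hs, abs_of_nonneg (hs.trans hst)]
  exact hst

/-- The splitting of the coordinates. -/
def splitL (m : ℕ) : Coords (m + 1) ≃L[ℝ] ℝ × Coords m :=
  ContinuousLinearEquiv.equivOfInverse ((headL m).prod (tailL m))
    (((ContinuousLinearMap.id ℝ ℝ).smulRight (EuclideanSpace.single 0 1)).coprod (zeroL m))
    (fun z => by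
      change z 0 • EuclideanSpace.single 0 1 + zeroL m (tailCoords z) = z
      rw [← joinCoords_eq, joinCoords_tailCoords])
    (fun q => by
      change (headL m (q.1 • EuclideanSpace.single 0 1 + zeroL m q.2),
        tailCoords (q.1 • EuclideanSpace.single 0 1 + zeroL m q.2)) = q
      rw [← joinCoords_eq]
      rfl)

end coords

variable {m : ℕ} {U : Set (Coords m)} {hU : IsOpen U} {ε : ℝ} {hε : 0 < ε}

/-- The collar `[0, ε) × U`. -/
def collar (U : Set (Coords m)) (hU : IsOpen U) (ε : ℝ) (hε : 0 < ε) : Domain (m + 1) where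
  carrier := splitL m ⁻¹' (Ico 0 ε ×ˢ U)
  uniqueDiffOn := by
    rw [(splitL m).uniqueDiffOn_preimage_iff]
    exact (uniqueDiffOn_Ico 0 ε).prod hU.uniqueDiffOn
  subset_closure := by
    have h1 := (splitL m).toHomeomorph.preimage_interior (Ico 0 ε ×ˢ U)
    have h2 := (splitL m).toHomeomorph.preimage_closure (interior (Ico 0 ε ×ˢ U))
    change _ ⊆ closure (interior ((splitL m).toHomeomorph ⁻¹' _))
    rw [← h1, ← h2, interior_prod_eq, closure_prod_eq, interior_Ico, hU.interior_eq,
      closure_Ioo hε.ne]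
    exact preimage_mono (prod_mono Ico_subset_Icc_self subset_closure)

/-- The open collar `(0, ε) × U`. -/
def openCollar (U : Set (Coords m)) (hU : IsOpen U) (ε : ℝ) : Domain (m + 1) :=
  Domain.ofOpen (splitL m ⁻¹' (Ioo 0 ε ×ˢ U))
    ((isOpen_Ioo.prod hU).preimage (splitL m).continuous)

theorem eventually_openCollar (hU : IsOpen U) (hε : 0 < ε) {y : Coords m} (hy : y ∈ U) :
    ∀ᶠ z in 𝓝[{z : Coords (m + 1) | 0 < z 0}] (joinCoords 0 y),
      z ∈ (openCollar U hU ε).carrier := by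
  have h1 : ∀ᶠ z in 𝓝 (joinCoords 0 y), headL m z < ε :=
    (headL m).continuous.continuousAt.eventually_lt continuousAt_const
      (show headL m (joinCoords 0 y) < ε from hε)
  have h2 : ∀ᶠ z in 𝓝 (joinCoords 0 y), tailL m z ∈ U :=
    (tailL m).continuous.continuousAt.eventually_mem (hU.mem_nhds hy)
  filter_upwards [self_mem_nhdsWithin, nhdsWithin_le_nhds h1, nhdsWithin_le_nhds h2]
    with z h h1 h2
  exact ⟨⟨h, h1⟩, h2⟩

theorem openCollar_subset : (openCollar U hU ε).carrier ⊆ (collar U hU ε hε).carrier :=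
  fun z hz => ⟨⟨hz.1.1.le, hz.1.2⟩, hz.2⟩

theorem tendsto_joinCoords (y : Coords m) : Tendsto (fun x => joinCoords x y) (𝓝[>] 0)
    (𝓝[{z : Coords (m + 1) | 0 < z 0}] (joinCoords 0 y)) :=
  tendsto_nhdsWithin_iff.mpr
    ⟨((hasDerivAt_joinCoords 0 y).continuousAt.tendsto).mono_left nhdsWithin_le_nhds,
      self_mem_nhdsWithin⟩

theorem mapsTo_zeroL : MapsTo (zeroL m) (Domain.ofOpen U hU).carrier (collar U hU ε hε).carrier :=
  fun y hy => ⟨⟨le_rfl, hε⟩, hy⟩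

theorem mapsTo_tailL : MapsTo (tailL m) (collar U hU ε hε).carrier (Domain.ofOpen U hU).carrier :=
  fun z hz => hz.2

variable (hU hε) in
/-- The derivative in the normal direction. -/
def normalD : Derivation ℝ (Sm (collar U hU ε hε)) (Sm (collar U hU ε hε)) :=
  Sm.deriv _ (EuclideanSpace.single 0 1)

variable (hU hε) in
/-- The restriction to the boundary. -/
def bdry : Sm (collar U hU ε hε) →ₐ[ℝ] Sm (Domain.ofOpen U hU) := Sm.pull (zeroL m) mapsTo_zeroL

variable (hU hε) in
/-- The extension that is constant in the normal direction. -/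
def lift : Sm (Domain.ofOpen U hU) →ₐ[ℝ] Sm (collar U hU ε hε) := Sm.pull (tailL m) mapsTo_tailL

variable (hU hε) in
/-- The normal coordinate. -/
def normalX : Sm (collar U hU ε hε) := Sm.of (fun z => z 0) (headL m).contDiff.contDiffOn

variable (hU hε) in
/-- The Taylor series at the boundary. -/
def taylorBdry : Sm (collar U hU ε hε) →ₐ[ℝ] PowerSeries (Sm (Domain.ofOpen U hU)) :=
  taylor (normalD hU hε) (bdry hU hε)

theorem deriv_normalX (v : Coords (m + 1)) :
    Sm.deriv _ v (normalX hU hε) = algebraMap ℝ _ (v 0) := by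
  refine Sm.eq_of_ev fun z hz => ?_
  rw [Sm.ev_deriv_eq v (fun z hz => rfl) hz (headL m).hasFDerivWithinAt, AlgHom.commutes]
  rfl

theorem normalD_normalX : normalD hU hε (normalX hU hε) = 1 := by
  rw [normalD, deriv_normalX]; simp

theorem ev_bdry (f : Sm (collar U hU ε hε)) {y : Coords m} (hy : y ∈ U) :
    Sm.ev (Ω := Domain.ofOpen U hU) hy (bdry hU hε f) = f.ext (joinCoords 0 y) :=
  (Sm.ev_pull _ _ _ hy).trans (Sm.ev_apply _ _)

theorem bdry_normalX : bdry hU hε (normalX hU hε) = 0 :=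
  Sm.eq_of_ev fun y hy => (Sm.ev_pull _ _ _ hy).trans rfl

theorem bdry_lift (c : Sm (Domain.ofOpen U hU)) : bdry hU hε (lift hU hε c) = c := by
  refine Sm.eq_of_ev fun y hy => ?_
  rw [bdry, Sm.ev_pull, lift, Sm.ev_pull, Sm.ev_apply, Sm.ev_apply]
  rfl

theorem normalD_lift (c : Sm (Domain.ofOpen U hU)) : normalD hU hε (lift hU hε c) = 0 := by
  rw [normalD, lift, Sm.deriv_pull, tailL_single_zero]
  refine (congrArg (Sm.pull _ _) (Sm.eq_of_ev fun y hy => ?_)).trans (map_zero _)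
  rw [Sm.ev_deriv, map_zero, map_zero]

theorem taylorBdry_normalX : taylorBdry hU hε (normalX hU hε) = PowerSeries.X :=
  taylor_of_D_eq_one normalD_normalX bdry_normalX

theorem taylorBdry_lift (c : Sm (Domain.ofOpen U hU)) :
    taylorBdry hU hε (lift hU hε c) = PowerSeries.C c := by
  rw [taylorBdry, taylor_of_D_eq_zero (normalD_lift c), bdry_lift]

/-- The mean value inequality, iterated. -/
theorem abs_le_pow_of_iterate {y₀ : Coords m} {δ C : ℝ} (n : ℕ) :
    ∀ f : Sm (collar U hU ε hε), (∀ k < n, bdry hU hε ((normalD hU hε)^[k] f) = 0) →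
      (∀ z ∈ (collar U hU ε hε).carrier, dist z (joinCoords 0 y₀) < δ →
        |((normalD hU hε)^[n] f).ext z| ≤ C) →
      ∀ z ∈ (collar U hU ε hε).carrier, dist z (joinCoords 0 y₀) < δ →
        |f.ext z| ≤ C * z 0 ^ n := by
  induction n with
  | zero => intro f _ h z hz hd; simpa using h z hz hd
  | succ n ih =>
    intro f hf hb z hz hd
    -- Applied to ∂_x f, whose first n boundary derivatives vanish too; the mean value inequality
    -- along the normal segment then gains one power of x.
    have h1 := ih (normalD hU hε f) (fun k hk => hf (k + 1) (by omega)) hb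
    set y := tailCoords z with hy
    have hz0 : 0 ≤ z 0 := hz.1.1
    have hmem : ∀ t ∈ Icc 0 (z 0), joinCoords t y ∈ (collar U hU ε hε).carrier := fun t ht =>
      ⟨⟨ht.1, ht.2.trans_lt hz.1.2⟩, hz.2⟩
    have hder : ∀ t ∈ Icc 0 (z 0), HasDerivWithinAt (fun t => f.ext (joinCoords t y))
        ((normalD hU hε f).ext (joinCoords t y)) (Icc 0 (z 0)) t := fun t ht => by
      have := (f.hasFDerivWithinAt (hmem t ht)).comp_hasDerivWithinAt t
        (hasDerivAt_joinCoords t y).hasDerivWithinAt hmem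
      refine this.congr_deriv ?_
      rw [← Sm.ev_apply _ (hmem t ht), normalD, Sm.ev_deriv]
    have hC : 0 ≤ C := by
      refine le_trans (abs_nonneg _) (hb z hz hd)
    have hbd : ∀ t ∈ Icc 0 (z 0), ‖(normalD hU hε f).ext (joinCoords t y)‖ ≤ C * z 0 ^ n := by
      intro t ht
      have hdt : dist (joinCoords t y) (joinCoords 0 y₀) < δ := by
        refine (dist_joinCoords_le ht.1 ht.2 y y₀).trans_lt ?_
        rwa [hy, joinCoords_tailCoords]
      refine (h1 _ (hmem t ht) hdt).trans ?_
      rw [joinCoords_zero_apply]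
      gcongr
      · exact ht.1
      · exact ht.2
    have h2 := Convex.norm_image_sub_le_of_norm_hasDerivWithin_le hder hbd (convex_Icc 0 (z 0))
      (left_mem_Icc.mpr hz0) (right_mem_Icc.mpr hz0)
    have h3 : f.ext (joinCoords 0 y) = 0 := by
      have := congrArg (Sm.ev (Ω := Domain.ofOpen U hU) hz.2) (hf 0 n.succ_pos)
      rw [map_zero] at this
      exact (ev_bdry f hz.2).symm.trans this
    rw [h3, sub_zero, sub_zero, hy, joinCoords_tailCoords, Real.norm_eq_abs, Real.norm_eq_abs,
      abs_of_nonneg hz0] at h2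
    rw [pow_succ, ← mul_assoc]
    exact h2

theorem bdry_iterate_eq_zero {f : Sm (collar U hU ε hε)} {n : ℕ}
    (h : PowerSeries.X ^ n ∣ taylorBdry hU hε f) (k : ℕ) (hk : k < n) :
    bdry hU hε ((normalD hU hε)^[k] f) = 0 := by
  have h1 := PowerSeries.X_pow_dvd_iff.mp h k hk
  rw [taylorBdry, coeff_taylor] at h1
  have h2 : algebraMap ℝ (Sm (Domain.ofOpen U hU)) (k.factorial : ℝ)
      * algebraMap ℝ (Sm (Domain.ofOpen U hU)) (1 / (k.factorial : ℝ)) = 1 := by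
    rw [← map_mul, mul_one_div_cancel (by exact_mod_cast k.factorial_ne_zero), map_one]
  rw [← one_mul (bdry hU hε _), ← h2, mul_assoc, h1, mul_zero]

/-- The bound given by a Taylor series of order at least `n`. -/
theorem exists_bound_of_dvd {f : Sm (collar U hU ε hε)} {n : ℕ}
    (h : PowerSeries.X ^ n ∣ taylorBdry hU hε f) {y₀ : Coords m} (hy : y₀ ∈ U) :
    ∃ C, ∀ᶠ z in 𝓝[{z : Coords (m + 1) | 0 < z 0}] (joinCoords 0 y₀), |f.ext z| ≤ C * z 0 ^ n := by
  set q := (normalD hU hε)^[n] f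
  have hp : joinCoords 0 y₀ ∈ (collar U hU ε hε).carrier := ⟨⟨le_rfl, hε⟩, hy⟩
  have hq : ContinuousWithinAt q.ext (collar U hU ε hε).carrier (joinCoords 0 y₀) :=
    q.contDiffOn.continuousOn _ hp
  -- Continuity up to the boundary bounds the n-th normal derivative near the given boundary point.
  obtain ⟨δ, hδ, hb⟩ := Metric.continuousWithinAt_iff.mp hq 1 one_pos
  refine ⟨|q.ext (joinCoords 0 y₀)| + 1, ?_⟩
  filter_upwards [eventually_openCollar hU hε hy, nhdsWithin_le_nhds (Metric.ball_mem_nhds _ hδ)]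
    with z hz hd
  refine abs_le_pow_of_iterate n f (bdry_iterate_eq_zero h) (fun z hz hd => ?_) z
    (openCollar_subset hz) hd
  have h1 := hb hz hd
  rw [Real.dist_eq] at h1
  have h2 := abs_sub_abs_le_abs_sub (q.ext z) (q.ext (joinCoords 0 y₀))
  linarith

/-- Subtracting x^n c, with the leading coefficient c extended constantly in x, leaves a function
whose Taylor series is divisible by X^(n+1). That function is O(x^(n+1)). -/
theorem tendsto_of_dvd {f : Sm (collar U hU ε hε)} {n : ℕ}
    (h : PowerSeries.X ^ n ∣ taylorBdry hU hε f) {y₀ : Coords m} (hy : y₀ ∈ U) :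
    Tendsto (fun x : ℝ => (x ^ n)⁻¹ * f.ext (joinCoords x y₀)) (𝓝[>] 0)
      (𝓝 (Sm.ext (coeff n (taylorBdry hU hε f)) y₀)) := by
  set c := coeff n (taylorBdry hU hε f) with hc
  set g := f - normalX hU hε ^ n * lift hU hε c with hg
  have hT : taylorBdry hU hε g = taylorBdry hU hε f - PowerSeries.X ^ n * PowerSeries.C c := by
    rw [hg, map_sub, map_mul, map_pow, taylorBdry_normalX, taylorBdry_lift]
  have hd : PowerSeries.X ^ (n + 1) ∣ taylorBdry hU hε g := by
    rw [PowerSeries.X_pow_dvd_iff]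
    intro k hk
    rw [hT, map_sub, PowerSeries.X_pow_mul, PowerSeries.coeff_C_mul_X_pow]
    rcases Nat.lt_succ_iff_lt_or_eq.mp hk with hk | rfl
    · rw [if_neg hk.ne, sub_zero, PowerSeries.X_pow_dvd_iff.mp h k hk]
    · rw [if_pos rfl, sub_self]
  obtain ⟨C, hC⟩ := exists_bound_of_dvd hd hy
  have h1 := (tendsto_joinCoords y₀).eventually hC
  have h2 := (tendsto_joinCoords y₀).eventually (eventually_openCollar hU hε hy)
  rw [tendsto_iff_norm_sub_tendsto_zero]
  have h3 : Tendsto (fun x : ℝ => C * x) (𝓝[>] 0) (𝓝 0) := by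
    have : Tendsto (fun x : ℝ => C * x) (𝓝 0) (𝓝 (C * 0)) := (continuous_const_mul C).tendsto 0
    rw [mul_zero] at this
    exact this.mono_left nhdsWithin_le_nhds
  refine squeeze_zero' (Eventually.of_forall fun _ => norm_nonneg _) ?_ h3
  filter_upwards [h1, h2, self_mem_nhdsWithin] with x h1 h2 (hx : 0 < x)
  rw [joinCoords_zero_apply] at h1
  have h4 : g.ext (joinCoords x y₀) = f.ext (joinCoords x y₀) - x ^ n * c.ext y₀ := by
    have hm := openCollar_subset (hε := hε) h2
    rw [← Sm.ev_apply g hm, hg, map_sub, map_mul, map_pow, Sm.ev_apply f hm, lift, Sm.ev_pull,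
      Sm.ev_apply c]
    rfl
  have h5 : (x ^ n)⁻¹ * f.ext (joinCoords x y₀) - c.ext y₀
      = (x ^ n)⁻¹ * g.ext (joinCoords x y₀) := by
    rw [h4]
    have := pow_ne_zero n hx.ne'
    field_simp
  have h6 : 0 < x ^ n := pow_pos hx n
  rw [h5, norm_mul, norm_inv, Real.norm_eq_abs, Real.norm_eq_abs, abs_of_pos h6, inv_mul_le_iff₀ h6]
  refine h1.trans (le_of_eq ?_)
  ring

/-- One direction is the iterated mean value bound. In the other, if X^j divides the series with j <
n, then x^(-j) f tends to the j-th coefficient, while the bound O(x^n) forces the limit 0; so the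
order goes up one step at a time. -/
theorem isBigO_iff_dvd {f : Sm (collar U hU ε hε)} {n : ℕ} :
    (∀ y ∈ U, f.ext =O[𝓝[{z : Coords (m + 1) | 0 < z 0}] (joinCoords 0 y)] fun z => z 0 ^ n)
      ↔ PowerSeries.X ^ n ∣ taylorBdry hU hε f := by
  constructor
  · intro h
    suffices hs : ∀ k ≤ n, PowerSeries.X ^ k ∣ taylorBdry hU hε f from hs n le_rfl
    intro k
    induction k with
    | zero => intro _; simp
    | succ k ih =>
      intro hk
      have hd := ih (by omega)
      rw [PowerSeries.X_pow_dvd_iff]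
      intro j hj
      rcases Nat.lt_succ_iff_lt_or_eq.mp hj with hj | rfl
      · exact PowerSeries.X_pow_dvd_iff.mp hd j hj
      refine Sm.eq_of_ev fun y hy => ?_
      rw [map_zero, Sm.ev_apply]
      refine tendsto_nhds_unique (tendsto_of_dvd hd hy) ?_
      obtain ⟨C, hC⟩ := ((h y hy).comp_tendsto (tendsto_joinCoords y)).bound
      have h3 : Tendsto (fun x : ℝ => C * x ^ (n - j)) (𝓝[>] 0) (𝓝 0) := by
        have : Tendsto (fun x : ℝ => C * x ^ (n - j)) (𝓝 0) (𝓝 (C * 0 ^ (n - j))) :=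
          (by fun_prop : Continuous fun x : ℝ => C * x ^ (n - j)).tendsto 0
        rw [zero_pow (by omega), mul_zero] at this
        exact this.mono_left nhdsWithin_le_nhds
      refine squeeze_zero_norm' ?_ h3
      filter_upwards [hC, self_mem_nhdsWithin] with x h1 (hx : 0 < x)
      simp only [Function.comp, joinCoords_zero_apply] at h1
      have h6 : 0 < x ^ j := pow_pos hx j
      rw [norm_mul, norm_inv, Real.norm_eq_abs, abs_of_pos h6, inv_mul_le_iff₀ h6]
      refine h1.trans (le_of_eq ?_)
      rw [Real.norm_eq_abs, abs_of_pos (pow_pos hx n)]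
      obtain ⟨r, rfl⟩ : ∃ r, n = j + r := ⟨n - j, by omega⟩
      rw [Nat.add_sub_cancel_left, pow_add]; ring
  · intro h y hy
    obtain ⟨C, hC⟩ := exists_bound_of_dvd h hy
    refine IsBigO.of_bound C ?_
    filter_upwards [hC, self_mem_nhdsWithin] with z h1 (hz : 0 < z 0)
    rwa [Real.norm_eq_abs, Real.norm_eq_abs, abs_of_pos (pow_pos hz n)]

end

section

/-! ### Local coordinate expressions as evaluations -/

section rep

variable {k : ℕ} {Ω : Domain k}

/-- The metric with the given components. -/
def smGeom (g gi : Matrix (Fin k) (Fin k) (Sm Ω)) (hs : ∀ i j, g i j = g j i) (hi : g * gi = 1) :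
    Geom (Fin k) (Sm Ω) where
  D i := Sm.deriv Ω (EuclideanSpace.single i 1)
  comm i j a := Sm.deriv_comm _ _ a
  g := g
  gi := gi
  symm := hs
  mul_inv := hi

/-- The metric `𝔤` has the components `G`. -/
structure Represents (𝔤 : Geom (Fin k) (Sm Ω)) (G : CoordMetric k) : Prop where
  isOpen : IsOpen Ω.carrier
  D : ∀ i, 𝔤.D i = Sm.deriv Ω (EuclideanSpace.single i 1)
  g : ∀ i j z (hz : z ∈ Ω.carrier), Sm.ev hz (𝔤.g i j) = G z i j

namespace Represents

variable {𝔤 : Geom (Fin k) (Sm Ω)} {G : CoordMetric k}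


/-- Openness enters here: `partialD` is an unrestricted derivative, while the derivations of `Sm`
differentiate within the domain. -/
theorem partialD_eq (h : Represents 𝔤 G) {f : Sm Ω} {F : Coords k → ℝ} (hF : ∀ z (hz : z ∈ Ω.carrier), F z = Sm.ev hz f)
    (i : Fin k) {z : Coords k} (hz : z ∈ Ω.carrier) :
    partialD i F z = Sm.ev hz (𝔤.D i f) := by
  rw [h.D, Sm.ev_deriv, partialD, ← fderivWithin_of_isOpen h.isOpen hz]
  refine congrArg (fun L : Coords k →L[ℝ] ℝ => L _) (fderivWithin_congr (fun z hz => ?_) ?_)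
  · rw [hF z hz, Sm.ev_apply]
  · rw [hF z hz, Sm.ev_apply]

theorem inv_eq (h : Represents 𝔤 G) {z : Coords k} (hz : z ∈ Ω.carrier) (i j : Fin k) :
    (G z)⁻¹ i j = Sm.ev hz (𝔤.gi i j) := by
  have h1 : (Sm.ev hz).mapMatrix 𝔤.g = G z := by ext i j; exact h.g i j z hz
  have h2 := congrArg (Sm.ev hz).mapMatrix 𝔤.mul_inv
  rw [map_mul, map_one, h1] at h2
  rw [Matrix.inv_eq_right_inv h2]
  rfl

theorem christoffel_eq (h : Represents 𝔤 G) {z : Coords k} (hz : z ∈ Ω.carrier) (a i j : Fin k) :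
    christoffel G a i j z = Sm.ev hz (𝔤.Γ a i j) := by
  have hg := fun i j => h.partialD_eq (f := 𝔤.g i j) (F := fun z => G z i j)
    (fun z hz => (h.g i j z hz).symm)
  rw [christoffel, Geom.Γ, map_mul, half, AlgHom.commutes, map_sum]
  simp only [hg _ _ _ hz, h.inv_eq hz, map_mul, map_add, map_sub]
  rfl

theorem riemannUp_eq (h : Represents 𝔤 G) {z : Coords k} (hz : z ∈ Ω.carrier) (i j a l : Fin k) :
    riemannUp G i j a l z = Sm.ev hz (𝔤.riem i j a l) := by
  have hΓ := fun l j a => h.partialD_eq (f := 𝔤.Γ l j a) (F := christoffel G l j a)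
    (fun z hz => h.christoffel_eq hz l j a)
  rw [riemannUp, Geom.riem]
  simp only [hΓ _ _ _ _ hz, h.christoffel_eq hz, map_mul, map_add, map_sub, map_sum]

theorem riemann_eq (h : Represents 𝔤 G) {z : Coords k} (hz : z ∈ Ω.carrier) (I : Fin 4 → Fin k) :
    riemann G z I = Sm.ev hz (𝔤.covRm 0 I) := by
  rw [riemann, Geom.covRm, map_sum]
  simp only [map_mul, h.riemannUp_eq hz, h.g]

theorem ricci_eq (h : Represents 𝔤 G) {z : Coords k} (hz : z ∈ Ω.carrier) (i j : Fin k) :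
    ricci G z i j = Sm.ev hz (𝔤.ric i j) := by
  rw [Geom.ric, map_sum]
  simp only [← h.riemannUp_eq hz]
  rfl

theorem scalarCurv_eq (h : Represents 𝔤 G) {z : Coords k} (hz : z ∈ Ω.carrier) :
    scalarCurv G z = Sm.ev hz 𝔤.scal := by
  simp only [scalarCurv, Geom.scal, map_sum, map_mul, h.ricci_eq hz, h.inv_eq hz]

theorem covDeriv_eq (h : Represents 𝔤 G) {r : ℕ} {T : CoordTensor k r} {t : (Fin r → Fin k) → Sm Ω}
    (hT : ∀ z (hz : z ∈ Ω.carrier) I, T z I = Sm.ev hz (t I)) {z : Coords k} (hz : z ∈ Ω.carrier)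
    (J : Fin (r + 1) → Fin k) :
    covDeriv G T z J
      = Sm.ev hz (𝔤.nabla (fun _ => false) t (J (Fin.last r)) (Fin.init J)) := by
  rw [covDeriv, Geom.nabla, h.partialD_eq (fun z hz => hT z hz _) _ hz]
  simp only [map_add, map_sum, map_mul, map_neg, Geom.conn, Bool.false_eq_true, if_false,
    h.christoffel_eq hz, hT z hz, neg_mul, Finset.sum_neg_distrib]
  rw [sub_eq_add_neg]

theorem iterCovDeriv_eq (h : Represents 𝔤 G) {z : Coords k} (hz : z ∈ Ω.carrier) (n : ℕ) (I : Fin (4 + n) → Fin k) :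
    iterCovDeriv G (riemann G) n z I = Sm.ev hz (𝔤.covRm n I) := by
  induction n generalizing z with
  | zero => exact h.riemann_eq hz I
  | succ n ih => exact h.covDeriv_eq (fun z hz I => ih hz I) hz I

theorem covDeriv_covDeriv_eq (h : Represents 𝔤 G) {T : CoordTensor k 2} {t : Fin k → Fin k → Sm Ω}
    (hT : ∀ z (hz : z ∈ Ω.carrier) I, T z I = Sm.ev hz (t (I 0) (I 1))) {z : Coords k}
    (hz : z ∈ Ω.carrier) (J : Fin 4 → Fin k) :
    covDeriv G (covDeriv G T) z J = Sm.ev hz (𝔤.cov3 (𝔤.cov2 t) (J 0) (J 1) (J 2) (J 3)) := by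
  have h1 : ∀ z (hz : z ∈ Ω.carrier) (I : Fin 3 → Fin k),
      covDeriv G T z I = Sm.ev hz (𝔤.cov2 t (I 0) (I 1) (I 2)) := fun z hz I => by
    rw [h.covDeriv_eq hT hz, 𝔤.nabla_two]
    rfl
  rw [h.covDeriv_eq h1 hz, 𝔤.nabla_three]
  rfl

theorem tensorLaplacian_eq (h : Represents 𝔤 G) {T : CoordTensor k 2} {t : Fin k → Fin k → Sm Ω}
    (hT : ∀ z (hz : z ∈ Ω.carrier) I, T z I = Sm.ev hz (t (I 0) (I 1))) {z : Coords k}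
    (hz : z ∈ Ω.carrier) (I : Fin 2 → Fin k) :
    tensorLaplacian G T z I = Sm.ev hz (𝔤.lap t (I 0) (I 1)) := by
  simp only [tensorLaplacian, Geom.lap, map_sum, map_mul, h.inv_eq hz,
    h.covDeriv_covDeriv_eq hT hz]
  rfl

theorem tensorLaplacian_iterate_eq (h : Represents 𝔤 G) (n : ℕ) {T : CoordTensor k 2} {t : Fin k → Fin k → Sm Ω}
    (hT : ∀ z (hz : z ∈ Ω.carrier) I, T z I = Sm.ev hz (t (I 0) (I 1))) {z : Coords k}
    (hz : z ∈ Ω.carrier) (I : Fin 2 → Fin k) :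
    (tensorLaplacian G)^[n] T z I = Sm.ev hz (𝔤.lap^[n] t (I 0) (I 1)) := by
  induction n generalizing T t z with
  | zero => exact hT z hz I
  | succ n ih =>
    rw [Function.iterate_succ_apply, Function.iterate_succ_apply]
    exact ih (fun z hz I => h.tensorLaplacian_eq hT hz I) hz

end Represents

namespace Represents

variable {n : ℕ} {Ω : Domain (n + 1)} {𝔤 : Geom (Fin (n + 1)) (Sm Ω)} {G : CoordMetric (n + 1)}


theorem schouten_eq (h : Represents 𝔤 G) {z : Coords (n + 1)} (hz : z ∈ Ω.carrier) (I : Fin 2 → Fin (n + 1)) :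
    schouten n G z I = Sm.ev hz (𝔤.schouten (I 0) (I 1)) := by
  have e1 : ((n + 1 : ℕ) : ℝ) - 2 = n - 1 := by push_cast; ring
  have e2 : ((n + 1 : ℕ) : ℝ) - 1 = n := by push_cast; ring
  simp only [schouten, Geom.schouten, map_mul, map_sub, AlgHom.commutes, h.ricci_eq hz,
    h.scalarCurv_eq hz, h.g, e1, e2]
  change _ = 1 / ((n : ℝ) - 1) * (_ - 1 / (2 * (n : ℝ)) * _ * _)
  ring

theorem principalTensor_eq (h : Represents 𝔤 G) {z : Coords (n + 1)} (hz : z ∈ Ω.carrier) (I : Fin 2 → Fin (n + 1)) :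
    principalTensor n G z I = Sm.ev hz (𝔤.bach (I 0) (I 1)) := by
  simp only [principalTensor, Geom.bach, Geom.lap, Geom.hessTr, map_sub, map_sum, map_mul,
    h.inv_eq hz, h.covDeriv_covDeriv_eq (fun z hz I => h.schouten_eq hz I) hz]
  rfl

theorem contraction_eval_eq (h : Represents 𝔤 G) {z : Coords (n + 1)} (hz : z ∈ Ω.carrier) (C : CurvatureContraction n)
    (I : Fin 2 → Fin (n + 1)) : C.eval G z I = Sm.ev hz (C.aeval 𝔤 I) := by
  simp only [CurvatureContraction.eval, CurvatureContraction.aeval, map_sum, map_mul, map_prod,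
    h.iterCovDeriv_eq hz, h.inv_eq hz, h.g]

theorem polynomial_eval_eq (h : Represents 𝔤 G) {z : Coords (n + 1)} (hz : z ∈ Ω.carrier) (Q : CurvaturePolynomial n)
    (I : Fin 2 → Fin (n + 1)) :
    Q.eval G z I = Sm.ev hz (Q.map fun t => t.1 • t.2.aeval 𝔤 I).sum := by
  rw [CurvaturePolynomial.eval, map_list_sum, List.map_map]
  congr 1
  refine List.map_congr_left fun t _ => ?_
  rw [Function.comp, map_smul, h.contraction_eval_eq hz, smul_eq_mul]

theorem traceFree_eq (h : Represents 𝔤 G) {z : Coords (n + 1)} (hz : z ∈ Ω.carrier) {b : Fin (n + 1) → Fin (n + 1) → Sm Ω}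
    {B : Matrix (Fin (n + 1)) (Fin (n + 1)) ℝ} (hB : ∀ i j, B i j = Sm.ev hz (b i j))
    (i j : Fin (n + 1)) : traceFree (G z) B i j = Sm.ev hz (𝔤.tf b i j) := by
  rw [traceFree, Matrix.sub_apply, Matrix.smul_apply, smul_eq_mul, Geom.tf, Geom.tr]
  simp only [map_sub, map_mul, map_sum, AlgHom.commutes, h.inv_eq hz, h.g, hB]
  change _ = _ - 1 / ((n + 1 : ℕ) : ℝ) * _
  ring

end Represents

end rep

end

section

open PowerSeries (coeff)

/-! ### Families of metrics on a collar -/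

/-- A smooth one-parameter family of metrics on `[0, ε) × U`. -/
structure CollarFamily (m : ℕ) where
  U : Set (Coords m)
  ε : ℝ
  h : ℝ → CoordMetric m
  isOpen : IsOpen U
  pos : 0 < ε
  posDef : ∀ x ∈ Ico 0 ε, ∀ y ∈ U, (h x y).PosDef
  smooth : ∀ i j, ContDiffOn ℝ ∞ (fun q : ℝ × Coords m => h q.1 q.2 i j) (Ico 0 ε ×ˢ U)

namespace CollarFamily

variable {m : ℕ} (𝔽 : CollarFamily m)

/-- The collar `[0, ε) × U`. -/
abbrev dom : Domain (m + 1) := collar 𝔽.U 𝔽.isOpen 𝔽.ε 𝔽.pos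

/-- The boundary `U`. -/
abbrev base : Domain m := Domain.ofOpen 𝔽.U 𝔽.isOpen

/-- The components of the metrics. -/
def entry (i j : Fin m) : Sm 𝔽.dom :=
  Sm.of (fun z => 𝔽.h (z 0) (tailCoords z) i j)
    ((𝔽.smooth i j).comp (splitL m).contDiff.contDiffOn fun z hz => hz)

theorem ev_entry (i j : Fin m) {z : Coords (m + 1)} (hz : z ∈ 𝔽.dom.carrier) :
    Sm.ev hz (𝔽.entry i j) = 𝔽.h (z 0) (tailCoords z) i j := rfl

theorem entry_symm (i j : Fin m) : 𝔽.entry i j = 𝔽.entry j i := by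
  refine Sm.eq_of_ev fun z hz => ?_
  rw [ev_entry, ev_entry]
  exact ((𝔽.posDef _ hz.1 _ hz.2).isHermitian.apply i j).symm

theorem isUnit_det : IsUnit (Matrix.of 𝔽.entry).det := by
  refine Sm.isUnit_of_ne_zero fun z hz => ?_
  have h1 : (Sm.ev hz).mapMatrix (Matrix.of 𝔽.entry) = 𝔽.h (z 0) (tailCoords z) := by
    ext i j; rfl
  rw [AlgHom.map_det, h1]
  exact (𝔽.posDef _ hz.1 _ hz.2).det_pos.ne'

/-- The family, as a path of metrics over the algebra of smooth functions on the collar. -/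
def path : GeomPath m (Sm 𝔽.dom) where
  D i := Sm.deriv _ (EuclideanSpace.single i.succ 1)
  comm i j a := Sm.deriv_comm _ _ a
  g := Matrix.of 𝔽.entry
  gi := (Matrix.of 𝔽.entry)⁻¹
  symm := 𝔽.entry_symm
  mul_inv := Matrix.mul_nonsing_inv _ 𝔽.isUnit_det
  D₀ := normalD 𝔽.isOpen 𝔽.pos
  comm₀ i a := Sm.deriv_comm _ _ a
  x := normalX 𝔽.isOpen 𝔽.pos
  D₀_x := normalD_normalX
  D_x i := by
    rw [deriv_normalX]; simp [(Fin.succ_ne_zero _).symm]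

/-- The metric `h_0`. -/
def initial : Geom (Fin m) (Sm 𝔽.base) :=
  smGeom ((bdry 𝔽.isOpen 𝔽.pos).mapMatrix 𝔽.path.g) ((bdry 𝔽.isOpen 𝔽.pos).mapMatrix 𝔽.path.gi)
    (fun i j => congrArg (bdry 𝔽.isOpen 𝔽.pos) (𝔽.entry_symm i j))
    (by rw [← map_mul, 𝔽.path.mul_inv, map_one])

theorem represents_initial {G : CoordMetric m} (hG : ∀ y ∈ 𝔽.U, 𝔽.h 0 y = G y) :
    Represents 𝔽.initial G where
  isOpen := 𝔽.isOpen
  D i := rfl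
  g i j y hy := by
    have hm : joinCoords 0 y ∈ 𝔽.dom.carrier := ⟨⟨le_rfl, 𝔽.pos⟩, hy⟩
    refine (ev_bdry (𝔽.entry i j) hy).trans ?_
    exact (Sm.ev_apply (𝔽.entry i j) hm).symm.trans (congrFun (congrFun (hG y hy) i) j)

/-- The formal Taylor series of the family. -/
def series : SMetric 𝔽.initial where
  h i j := taylorBdry 𝔽.isOpen 𝔽.pos (𝔽.entry i j)
  symm i j := by rw [𝔽.entry_symm]
  coeff_zero i j := coeff_zero_taylor _ _ _

theorem bdry_deriv_succ (i : Fin m) (a : Sm 𝔽.dom) :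
    bdry 𝔽.isOpen 𝔽.pos (Sm.deriv _ (EuclideanSpace.single i.succ 1) a)
      = Sm.deriv _ (EuclideanSpace.single i 1) (bdry 𝔽.isOpen 𝔽.pos a) := by
  rw [bdry, Sm.deriv_pull, zeroL_single]

/-- F is built from the metric, x and the derivations. Taylor expansion takes ∂_x to d/dX,
tangential derivatives to coefficientwise ones, x to X and h to its series. -/
theorem taylorBdry_F (a b : Fin (m + 1)) :
    taylorBdry 𝔽.isOpen 𝔽.pos (𝔽.path.F a b) = 𝔽.series.path.F a b :=
  GeomPath.map_F
    { map_D := fun i a => taylor_comm (fun a => Sm.deriv_comm _ _ a) (𝔽.bdry_deriv_succ i) a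
      map_g := fun i j => rfl }
    (fun a => taylor_D _ _ a) taylorBdry_normalX a b

/-- The open collar `(0, ε) × U`. -/
abbrev inner : Domain (m + 1) := openCollar 𝔽.U 𝔽.isOpen 𝔽.ε

/-- The restriction to the open collar. -/
def res : Sm 𝔽.dom →ₐ[ℝ] Sm 𝔽.inner :=
  Sm.pull (ContinuousLinearMap.id ℝ _) (openCollar_subset (hε := 𝔽.pos))

theorem ev_res (f : Sm 𝔽.dom) {z : Coords (m + 1)} (hz : z ∈ 𝔽.inner.carrier) :
    Sm.ev hz (𝔽.res f) = f.ext z := (Sm.ev_pull _ _ _ hz).trans (Sm.ev_apply _ _)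

theorem deriv_res (v : Coords (m + 1)) (f : Sm 𝔽.dom) :
    Sm.deriv _ v (𝔽.res f) = 𝔽.res (Sm.deriv _ v f) := Sm.deriv_pull _ _ _ _

/-- The metric `dx² + h_x` on the open collar. -/
def cylinder : Geom (Fin (m + 1)) (Sm 𝔽.inner) :=
  smGeom (𝔽.res.mapMatrix 𝔽.path.cyl.g) (𝔽.res.mapMatrix 𝔽.path.cyl.gi)
    (fun i j => congrArg 𝔽.res (𝔽.path.cyl.symm i j))
    (by rw [← map_mul, 𝔽.path.cyl.mul_inv, map_one])

theorem hom_cylinder : Geom.Hom 𝔽.res 𝔽.path.cyl 𝔽.cylinder where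
  map_D i a := by
    refine Fin.cases ?_ (fun i => ?_) i
    · exact (𝔽.deriv_res _ _).symm
    · exact (𝔽.deriv_res _ _).symm
  map_g i j := rfl

/-- The function `1 / x`. -/
def invX : Sm 𝔽.inner :=
  Sm.of (fun z => (z 0)⁻¹) ((headL m).contDiff.contDiffOn.inv fun z hz => hz.1.1.ne')

theorem x_mul_invX : 𝔽.res 𝔽.path.x * 𝔽.invX = 1 := by
  refine Sm.eq_of_ev fun z hz => ?_
  rw [map_mul, map_one, ev_res]
  refine (congrArg (· * _) ((Sm.ev_apply _ (openCollar_subset hz)).symm)).trans ?_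
  exact mul_inv_cancel₀ (a := z 0) hz.1.1.ne'

/-- The metric `x⁻² (dx² + h_x)` on the open collar. -/
def poincare : Geom (Fin (m + 1)) (Sm 𝔽.inner) :=
  smGeom (𝔽.invX ^ 2 • 𝔽.cylinder.g) (𝔽.res 𝔽.path.x ^ 2 • 𝔽.cylinder.gi)
    (fun i j => congrArg (𝔽.invX ^ 2 * ·) (𝔽.cylinder.symm i j))
    (by
      rw [smul_mul_smul_comm, 𝔽.cylinder.mul_inv, ← mul_pow, mul_comm 𝔽.invX, x_mul_invX, one_pow,
        one_smul])

theorem represents_poincare : Represents 𝔽.poincare (poincareMetric 𝔽.h) where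
  isOpen := (isOpen_Ioo.prod 𝔽.isOpen).preimage (splitL m).continuous
  D i := rfl
  g i j z hz := by
    change Sm.ev hz (𝔽.invX ^ 2 * 𝔽.res (𝔽.path.cyl.g i j)) = _
    rw [map_mul, map_pow, ev_res]
    have h1 : Sm.ev hz 𝔽.invX = (z 0)⁻¹ := rfl
    have hz' := openCollar_subset (hε := 𝔽.pos) hz
    rw [h1, inv_pow, ← Sm.ev_apply _ hz']
    refine congrArg ((z 0 ^ 2)⁻¹ * ·) ?_
    refine Fin.cases ?_ (fun i => ?_) i <;> refine Fin.cases ?_ (fun j => ?_) j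
    · exact map_one _
    · exact map_zero _
    · exact map_zero _
    · rfl

/-- The Einstein defect of the metric `x⁻² (dx² + h_x)`, in terms of the metrics `h_x`. -/
theorem mul_einsteinDefect {z : Coords (m + 1)} (hz : z ∈ 𝔽.inner.carrier) (a b : Fin (m + 1)) :
    z 0 * einsteinDefect 𝔽.h z a b = (𝔽.path.F a b).ext z := by
  have h1 := 𝔽.cylinder.conformal_defect (𝔥 := 𝔽.poincare) (o := 0) (x := 𝔽.res 𝔽.path.x)
    (fun b => by
      refine (congrArg 𝔽.res (𝔽.path.cyl_unit b)).trans ?_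
      split_ifs <;> simp)
    (fun c => by
      refine (𝔽.hom_cylinder.map_D c 𝔽.path.x).symm.trans ?_
      rw [𝔽.path.cyl_D_x]
      split_ifs <;> simp)
    𝔽.invX 𝔽.x_mul_invX (fun i a => rfl) (fun i j => rfl) a b
  rw [← 𝔽.hom_cylinder.map_defect, ← GeomPath.F] at h1
  have h2 := congrArg (Sm.ev hz) h1
  rw [ev_res, map_mul, map_add, map_mul, ev_res, Fintype.card_fin, map_sub, map_natCast, map_one,
    ← 𝔽.represents_poincare.ricci_eq hz, 𝔽.represents_poincare.g] at h2
  rw [← h2, einsteinDefect]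
  have h3 : (𝔽.path.x).ext z = z 0 := (Sm.ev_apply _ (openCollar_subset hz)).symm
  rw [h3, Matrix.add_apply, Matrix.smul_apply, smul_eq_mul]
  push_cast
  ring

theorem eventually_inner {y : Coords m} (hy : y ∈ 𝔽.U) :
    ∀ᶠ z in 𝓝[{z : Coords (m + 1) | 0 < z 0}] (joinCoords 0 y), z ∈ 𝔽.inner.carrier :=
  eventually_openCollar 𝔽.isOpen 𝔽.pos hy

/-- The exponent moves from n to n + 1 because F is x times the Einstein defect. -/
theorem einstein_iff (n : ℕ) (a b : Fin (m + 1)) :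
    (∀ y ∈ 𝔽.U, (fun z => einsteinDefect 𝔽.h z a b)
      =O[𝓝[{z : Coords (m + 1) | 0 < z 0}] (joinCoords 0 y)] fun z => z 0 ^ n)
      ↔ PowerSeries.X ^ (n + 1) ∣ 𝔽.series.path.F a b := by
  rw [← taylorBdry_F, ← isBigO_iff_dvd]
  refine forall₂_congr fun y hy => ?_
  have h0 : ∀ᶠ z in 𝓝[{z : Coords (m + 1) | 0 < z 0}] (joinCoords 0 y),
      (𝔽.path.F a b).ext z = z 0 * einsteinDefect 𝔽.h z a b :=
    (𝔽.eventually_inner hy).mono fun z hz => (𝔽.mul_einsteinDefect hz a b).symm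
  have h1 : ∀ᶠ z in 𝓝[{z : Coords (m + 1) | 0 < z 0}] (joinCoords 0 y),
      einsteinDefect 𝔽.h z a b = (z 0)⁻¹ * (𝔽.path.F a b).ext z :=
    (𝔽.eventually_inner hy).mono fun z hz => by
      rw [← 𝔽.mul_einsteinDefect hz a b, inv_mul_cancel_left₀ (show z 0 ≠ 0 from hz.1.1.ne')]
  constructor
  · intro h
    refine ((isBigO_refl (fun z : Coords (m + 1) => z 0) _).mul h).congr' ?_ ?_
    · exact h0.mono fun z hz => hz.symm
    · exact Eventually.of_forall fun z => (pow_succ' _ _).symm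
  · intro h
    refine ((isBigO_refl (fun z : Coords (m + 1) => (z 0)⁻¹) _).mul h).congr' ?_ ?_
    · exact h1.mono fun z hz => hz.symm
    · refine (𝔽.eventually_inner hy).mono fun z hz => ?_
      change (z 0)⁻¹ * z 0 ^ (n + 1) = z 0 ^ n
      rw [pow_succ', inv_mul_cancel_left₀ (show z 0 ≠ 0 from hz.1.1.ne')]

theorem tendsto_einsteinDefect {n : ℕ} {a b : Fin (m + 1)}
    (h : PowerSeries.X ^ (n + 1) ∣ 𝔽.series.path.F a b) {y : Coords m} (hy : y ∈ 𝔽.U) :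
    Tendsto (fun x : ℝ => (x ^ n)⁻¹ * einsteinDefect 𝔽.h (joinCoords x y) a b) (𝓝[>] 0)
      (𝓝 (Sm.ext (coeff (n + 1) (𝔽.series.path.F a b)) y)) := by
  rw [← taylorBdry_F] at h ⊢
  refine (tendsto_of_dvd h hy).congr' ?_
  filter_upwards [(tendsto_joinCoords y).eventually (𝔽.eventually_inner hy), self_mem_nhdsWithin]
    with x h1 (hx : 0 < x)
  rw [← 𝔽.mul_einsteinDefect h1, joinCoords_zero_apply, pow_succ, mul_inv, mul_assoc,
    inv_mul_cancel_left₀ hx.ne']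

end CollarFamily

end

section

/-! ### The components of a Riemannian metric in a chart -/

section chart

variable {m : ℕ} {M : Type*} [TopologicalSpace M] [ChartedSpace (EuclideanSpace ℝ (Fin m)) M]
  [IsManifold (𝓡 m) ∞ M]
  (g : ContMDiffRiemannianMetric (𝓡 m) ∞ (EuclideanSpace ℝ (Fin m))
    (fun p : M => TangentSpace (𝓡 m) p))
  {e : OpenPartialHomeomorph M (EuclideanSpace ℝ (Fin m))}

theorem sum_smul_single (x : Fin m → ℝ) :
    ∑ i, x i • EuclideanSpace.single i (1 : ℝ) = WithLp.toLp 2 x := by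
  ext j
  simp [Finset.sum_apply, Pi.single_apply]

/-- The components are the Gram matrix of the coordinate vectors, which are independent because the
differential of the inverse chart is injective. -/
theorem metricInChart_posDef (he : e ∈ IsManifold.maximalAtlas (𝓡 m) ∞ M)
    {y : EuclideanSpace ℝ (Fin m)} (hy : y ∈ e.target) : (metricInChart g e y).PosDef := by
  have hd : e.MDifferentiable (𝓡 m) (𝓡 m) :=
    ⟨(contMDiffOn_of_mem_maximalAtlas he).mdifferentiableOn (by simp),
      (contMDiffOn_symm_of_mem_maximalAtlas he).mdifferentiableOn (by simp)⟩
  have hinj := hd.symm.mfderiv_injective (x := y) hy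
  refine Matrix.PosDef.of_dotProduct_mulVec_pos ?_ fun x hx => ?_
  · ext i j
    exact g.symm _ _ _
  · set L := mfderiv (𝓡 m) (𝓡 m) e.symm y
    have h1 : star x ⬝ᵥ (metricInChart g e y).mulVec x
        = g.inner (e.symm y) (L (WithLp.toLp 2 x)) (L (WithLp.toLp 2 x)) := by
      have h2 : L (WithLp.toLp 2 x) = ∑ i, x i • L (EuclideanSpace.single i (1 : ℝ)) := by
        rw [← sum_smul_single x]
        exact (map_sum L _ _).trans (Finset.sum_congr rfl fun i _ => map_smul L _ _)
      rw [h2]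
      simp only [map_sum, _root_.sum_apply, map_smul,
        _root_.smul_apply, smul_eq_mul, dotProduct, Matrix.mulVec, Finset.mul_sum,
        star_trivial]
      refine Finset.sum_comm.trans ?_
      refine Finset.sum_congr rfl fun i _ => Finset.sum_congr rfl fun j _ => ?_
      change x j * (g.inner (e.symm y) (L _) (L _) * x i) = _
      ring
    rw [h1]
    refine g.pos _ _ fun h0 => hx ?_
    have h3 := hinj (h0.trans (map_zero L).symm)
    exact congrArg WithLp.ofLp h3

/-- The tangent map of the inverse chart carries constant vector fields to smooth sections along it,
and the metric is a smooth bundle map evaluated on two of them. -/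
theorem metricInChart_contDiffOn (he : e ∈ IsManifold.maximalAtlas (𝓡 m) ∞ M) (i j : Fin m) :
    ContDiffOn ℝ ∞ (fun y => metricInChart g e y i j) e.target := by
  have hs : ContMDiffOn (𝓡 m) (𝓡 m) ∞ e.symm e.target := contMDiffOn_symm_of_mem_maximalAtlas he
  have hT := hs.contMDiffOn_tangentMapWithin (m := ∞) (by simp) e.open_target.uniqueMDiffOn
  have hv : ∀ v : EuclideanSpace ℝ (Fin m), ContMDiffOn (𝓡 m) ((𝓡 m).prod 𝓘(ℝ, EuclideanSpace ℝ (Fin m))) ∞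
      (fun y => TotalSpace.mk' (EuclideanSpace ℝ (Fin m)) (E := fun p : M => TangentSpace (𝓡 m) p)
        (e.symm y) (mfderiv (𝓡 m) (𝓡 m) e.symm y v)) e.target := fun v => by
    have hc : ContMDiff (𝓡 m) ((𝓡 m).prod 𝓘(ℝ, EuclideanSpace ℝ (Fin m))) ∞
        (fun y : EuclideanSpace ℝ (Fin m) => TotalSpace.mk' (EuclideanSpace ℝ (Fin m))
          (E := fun p : EuclideanSpace ℝ (Fin m) => TangentSpace (𝓡 m) p) y v) :=
      contMDiff_vectorSpace_iff_contDiff.mpr contDiff_const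
    refine (hT.comp hc.contMDiffOn fun y hy => hy).congr fun y hy => ?_
    change _ = TotalSpace.mk' (EuclideanSpace ℝ (Fin m)) (E := fun p : M => TangentSpace (𝓡 m) p)
      (e.symm y) (mfderivWithin (𝓡 m) (𝓡 m) e.symm e.target y v)
    rw [mfderivWithin_of_isOpen e.open_target hy]
  have h1 : ContMDiffOn (𝓡 m) ((𝓡 m).prod 𝓘(ℝ)) ∞
      (fun y => TotalSpace.mk' ℝ (E := Bundle.Trivial M ℝ) (e.symm y)
        (g.inner (e.symm y) (mfderiv (𝓡 m) (𝓡 m) e.symm y (EuclideanSpace.single i (1 : ℝ)))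
          (mfderiv (𝓡 m) (𝓡 m) e.symm y (EuclideanSpace.single j (1 : ℝ))))) e.target := by
    refine ContMDiffOn.clm_bundle_apply₂ (F₁ := EuclideanSpace ℝ (Fin m))
      (F₂ := EuclideanSpace ℝ (Fin m)) ?_ (hv _) (hv _)
    exact g.contMDiff.comp_contMDiffOn hs
  intro y hy
  have h2 := h1 y hy
  rw [contMDiffWithinAt_totalSpace] at h2
  exact h2.2.contDiffWithinAt

end chart

end

section

open PowerSeries (coeff)

/-! ### Existence of Poincaré families -/

/-- Positive definiteness is an open condition. -/
theorem eventually_posDef {X : Type*} [TopologicalSpace X] {m : ℕ} {F : X → Matrix (Fin m) (Fin m) ℝ}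
    {p : X} (hF : ∀ i j, ContinuousAt (fun q => F q i j) p) (hs : ∀ q i j, F q i j = F q j i)
    (hp : (F p).PosDef) : ∀ᶠ q in 𝓝 p, (F q).PosDef := by
  have hc : ∀ x : EuclideanSpace ℝ (Fin m), ContinuousAt
      (fun q : X × EuclideanSpace ℝ (Fin m) => ∑ i, q.2 i * ∑ j, F q.1 i j * q.2 j) (p, x) := by
    intro x
    have h1 : ∀ i, ContinuousAt (fun q : X × EuclideanSpace ℝ (Fin m) => q.2 i) (p, x) :=
      fun i => by fun_prop
    have h2 : ∀ i j, ContinuousAt (fun q : X × EuclideanSpace ℝ (Fin m) => F q.1 i j) (p, x) :=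
      fun i j => ContinuousAt.comp (x := (p, x)) (f := Prod.fst) (hF i j) continuousAt_fst
    exact tendsto_finsetSum _ fun i _ => (h1 i).mul (tendsto_finsetSum _ fun j _ => (h2 i j).mul (h1 j))
  have hpos : ∀ x ∈ Metric.sphere (0 : EuclideanSpace ℝ (Fin m)) 1,
      ∀ᶠ q : X × EuclideanSpace ℝ (Fin m) in 𝓝 p ×ˢ 𝓝 x,
        0 < ∑ i, q.2 i * ∑ j, F q.1 i j * q.2 j := by
    intro x hx
    rw [← nhds_prod_eq]
    refine (hc x).eventually_const_lt ?_
    have hx0 : x.ofLp ≠ 0 := fun h => by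
      have : x = 0 := by ext i; exact congrFun h i
      rw [this] at hx
      simp at hx
    exact hp.dotProduct_mulVec_pos hx0
  -- On the compact unit sphere the neighbourhoods can be chosen uniformly in the vector;
  -- homogeneity extends the positivity to all nonzero vectors.
  have h := (isCompact_sphere (0 : EuclideanSpace ℝ (Fin m)) 1).eventually_forall_of_forall_eventually
    (x₀ := p) (P := fun q x => 0 < ∑ i, x i * ∑ j, F q i j * x j) (fun x hx => by
      rw [nhds_prod_eq]; exact hpos x hx)
  filter_upwards [h] with q hq
  refine Matrix.PosDef.of_dotProduct_mulVec_pos ?_ fun x hx => ?_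
  · ext i j; exact hs q j i
  · set v : EuclideanSpace ℝ (Fin m) := WithLp.toLp 2 x
    have hv : 0 < ‖v‖ := norm_pos_iff.mpr fun h => hx (congrArg WithLp.ofLp h)
    have h1 := hq (‖v‖⁻¹ • v) (by
      rw [mem_sphere_zero_iff_norm, norm_smul, norm_inv, norm_norm, inv_mul_cancel₀ hv.ne'])
    have h2 : ∑ i, (‖v‖⁻¹ • v) i * ∑ j, F q i j * (‖v‖⁻¹ • v) j
        = ‖v‖⁻¹ ^ 2 * ∑ i, x i * ∑ j, F q i j * x j := by
      simp only [Finset.mul_sum, PiLp.smul_apply, smul_eq_mul]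
      exact Finset.sum_congr rfl fun i _ => Finset.sum_congr rfl fun j _ => by
        change ‖v‖⁻¹ * x i * (F q i j * (‖v‖⁻¹ * x j)) = _
        ring
    rw [h2] at h1
    exact pos_of_mul_pos_right h1 (by positivity)

variable {m : ℕ} {V : Set (Coords m)} {G : CoordMetric m}

/-- A smooth metric, over the algebra of smooth functions. -/
theorem exists_geom (hV : IsOpen V) (hG : ∀ i j, ContDiffOn ℝ ∞ (fun y => G y i j) V)
    (hp : ∀ y ∈ V, (G y).PosDef) :
    ∃ 𝔤 : Geom (Fin m) (Sm (Domain.ofOpen V hV)), Represents 𝔤 G := by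
  set g : Matrix (Fin m) (Fin m) (Sm (Domain.ofOpen V hV)) :=
    Matrix.of fun i j => Sm.of (fun y => G y i j) (hG i j)
  have hs : ∀ i j, g i j = g j i := fun i j => Sm.eq_of_ev fun y hy =>
    ((hp y hy).isHermitian.apply i j).symm
  have hd : IsUnit g.det := Sm.isUnit_of_ne_zero fun y hy => by
    have h1 : (Sm.ev hy).mapMatrix g = G y := by ext i j; rfl
    rw [AlgHom.map_det, h1]
    exact (hp y hy).det_pos.ne'
  exact ⟨smGeom g g⁻¹ hs (Matrix.mul_nonsing_inv _ hd), hV, fun _ => rfl, fun i j y hy => rfl⟩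

/-- The family `∑ x^s H_s` with the given Taylor coefficients, on a small collar. -/
theorem exists_collarFamily {hV : IsOpen V} {𝔤 : Geom (Fin m) (Sm (Domain.ofOpen V hV))}
    (h𝔤 : Represents 𝔤 G) (H : SMetric 𝔤) (d : ℕ) (hd : ∀ i j k, d < k → coeff k (H.h i j) = 0)
    {y₀ : Coords m} (hy₀ : y₀ ∈ V) (hp : (G y₀).PosDef) :
    ∃ 𝔽 : CollarFamily m, y₀ ∈ 𝔽.U ∧ (∀ y ∈ 𝔽.U, 𝔽.h 0 y = G y) ∧
      ∃ φ : Sm (Domain.ofOpen V hV) →ₐ[ℝ] Sm 𝔽.base, ∀ a b,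
        PowerSeries.mapAlgHom φ (H.path.F a b) = 𝔽.series.path.F a b := by
  set c : ℕ → Fin m → Fin m → Sm (Domain.ofOpen V hV) := fun s i j => coeff s (H.h i j) with hc
  set h : ℝ → CoordMetric m := fun x y => Matrix.of fun i j =>
    ∑ s ∈ Finset.range (d + 1), x ^ s * (c s i j).ext y with hh
  have h0 : ∀ y ∈ V, h 0 y = G y := fun y hy => by
    ext i j
    change ∑ s ∈ Finset.range (d + 1), (0 : ℝ) ^ s * (c s i j).ext y = _
    rw [Finset.sum_eq_single 0 (fun s _ hs => by rw [zero_pow hs, zero_mul]) (by simp),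
      pow_zero, one_mul, hc]
    beta_reduce
    rw [H.coeff_zero, ← h𝔤.g i j y hy]
    exact (Sm.ev_apply _ hy).symm
  -- A polynomial in x makes sense for negative x as well, so (0, y₀) is an interior point and the
  -- openness of positive definiteness applies there.
  have hsm : ∀ i j, ContDiffOn ℝ ∞ (fun q : ℝ × Coords m => h q.1 q.2 i j) (univ ×ˢ V) := by
    intro i j
    change ContDiffOn ℝ ∞ (fun q : ℝ × Coords m =>
      ∑ s ∈ Finset.range (d + 1), q.1 ^ s * (c s i j).ext q.2) (univ ×ˢ V)
    refine ContDiffOn.sum fun s _ => ?_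
    have e1 : ContDiffOn ℝ ∞ (fun q : ℝ × Coords m => q.1 ^ s) (univ ×ˢ V) :=
      (contDiff_fst.pow s).contDiffOn
    have e2 : ContDiffOn ℝ ∞ (fun q : ℝ × Coords m => (c s i j).ext q.2) (univ ×ˢ V) :=
      (c s i j).contDiffOn.comp contDiff_snd.contDiffOn fun q hq => hq.2
    exact e1.mul e2
  have hsymm : ∀ (q : ℝ × Coords m) i j, h q.1 q.2 i j = h q.1 q.2 j i := fun q i j => by
    change ∑ s ∈ Finset.range (d + 1), q.1 ^ s * (coeff s (H.h i j)).ext q.2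
      = ∑ s ∈ Finset.range (d + 1), q.1 ^ s * (coeff s (H.h j i)).ext q.2
    rw [H.symm i j]
  have hev := eventually_posDef (F := fun q : ℝ × Coords m => h q.1 q.2) (p := (0, y₀))
    (fun i j => (hsm i j).continuousOn.continuousAt
      ((isOpen_univ.prod hV).mem_nhds ⟨mem_univ _, hy₀⟩)) hsymm (by
      change (h 0 y₀).PosDef
      rw [h0 y₀ hy₀]; exact hp)
  obtain ⟨u, hu, v, hv, huv⟩ := eventually_prod_iff.mp (nhds_prod_eq (x := (0 : ℝ)) (y := y₀) ▸ hev)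
  obtain ⟨ε, hε, hεu⟩ := Metric.eventually_nhds_iff.mp hu
  obtain ⟨W, hWv, hW, hyW⟩ := eventually_nhds_iff.mp hv
  let 𝔽 : CollarFamily m :=
    { U := W ∩ V
      ε := ε
      h := h
      isOpen := hW.inter hV
      pos := hε
      posDef := fun x hx y hy => huv (hεu (by
        rw [Real.dist_eq, sub_zero, abs_of_nonneg hx.1]; exact hx.2)) (hWv y hy.1)
      smooth := fun i j => (hsm i j).mono fun q hq => ⟨mem_univ _, hq.2.2⟩ }
  -- Restriction to the smaller open set; it takes the formal model over V to the Taylor series of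
  -- the constructed family.
  let φ : Sm (Domain.ofOpen V hV) →ₐ[ℝ] Sm 𝔽.base :=
    Sm.pull (ContinuousLinearMap.id ℝ _) fun y hy => hy.2
  have hcoeff : ∀ n (f : PowerSeries (Sm (Domain.ofOpen V hV))),
      coeff n (PowerSeries.mapAlgHom φ f) = φ (coeff n f) := fun n f => by
    rw [PowerSeries.mapAlgHom_apply]; exact PowerSeries.coeff_map _ _ _
  have hevφ : ∀ f y (hy : y ∈ 𝔽.base.carrier), Sm.ev hy (φ f) = f.ext y := fun f y hy =>
    (Sm.ev_pull (ContinuousLinearMap.id ℝ _) _ f hy).trans (Sm.ev_apply f _)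
  have hentry : ∀ i j, 𝔽.entry i j = ∑ s ∈ Finset.range (d + 1),
      normalX 𝔽.isOpen 𝔽.pos ^ s * lift 𝔽.isOpen 𝔽.pos (φ (c s i j)) := fun i j => by
    refine Sm.eq_of_ev fun z hz => ?_
    rw [CollarFamily.ev_entry, map_sum]
    change ∑ s ∈ Finset.range (d + 1), z 0 ^ s * (c s i j).ext (tailCoords z) = _
    refine Finset.sum_congr rfl fun s _ => ?_
    rw [map_mul, map_pow, lift, Sm.ev_pull]
    refine congrArg (z 0 ^ s * ·) ?_
    exact (hevφ _ _ _).symm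
  have hseries : ∀ i j, PowerSeries.mapAlgHom φ (H.h i j) = 𝔽.series.h i j := fun i j => by
    change _ = taylorBdry 𝔽.isOpen 𝔽.pos (𝔽.entry i j)
    rw [hentry, map_sum]
    simp only [map_mul, map_pow, taylorBdry_normalX, taylorBdry_lift]
    ext n
    rw [hcoeff, map_sum]
    simp only [PowerSeries.X_pow_mul, PowerSeries.coeff_C_mul_X_pow]
    rw [Finset.sum_ite_eq]
    split_ifs with hn
    · rfl
    · rw [hd i j n (by simpa using hn), map_zero]
  refine ⟨𝔽, ⟨hyW, hy₀⟩, fun y hy => h0 y hy.2, φ, fun a b => ?_⟩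
  refine GeomPath.map_F ⟨fun i a => ?_, fun i j => hseries i j⟩ (fun a => ?_) ?_ a b
  · ext n
    rw [hcoeff]
    change φ (coeff n (mapD (𝔤.D i) a)) = coeff n (mapD (𝔽.initial.D i) _)
    rw [coeff_mapD, coeff_mapD, hcoeff, h𝔤.D]
    exact (Sm.deriv_pull _ _ _ _).symm
  · ext n
    rw [hcoeff]
    change φ (coeff n (ddX _ a)) = coeff n (ddX _ _)
    rw [coeff_ddX, coeff_ddX, hcoeff, map_mul, map_add, map_natCast, map_one]
  · rw [PowerSeries.mapAlgHom_apply]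
    exact PowerSeries.map_X _

/-! ### The obstruction tensor -/

/-- The obstruction tensor of a smooth metric in local coordinates. -/
theorem exists_polynomial_isObstructionTensorAt (K : ℕ) : ∃ Q : CurvaturePolynomial (2 * K + 3),
    ∀ {V : Set (Coords (2 * K + 4))} {G : CoordMetric (2 * K + 4)}, IsOpen V →
      (∀ i j, ContDiffOn ℝ ∞ (fun y => G y i j) V) → (∀ y ∈ V, (G y).PosDef) →
      ∀ y₀ ∈ V, ∀ O : Matrix (Fin (2 * K + 4)) (Fin (2 * K + 4)) ℝ,
        IsObstructionTensorAt (2 * K + 3) G y₀ O ↔ ∀ i j, O i j =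
          (tensorLaplacian G)^[K] (principalTensor (2 * K + 3) G) y₀ ![i, j]
            + Q.eval G y₀ ![i, j] := by
  obtain ⟨Q, hQ⟩ := exists_polynomial_of_dvd K
  -- Shared by both directions: only divisibility of the tangential components is used to compute
  -- the obstruction.
  have hkey : ∀ (𝔽 : CollarFamily (2 * K + 4)) (G : CoordMetric (2 * K + 4)),
      (∀ y ∈ 𝔽.U, 𝔽.h 0 y = G y) →
      (∀ i j : Fin (2 * K + 4), PowerSeries.X ^ (2 * K + 3) ∣ 𝔽.series.path.F i.succ j.succ) →
      ∀ y ∈ 𝔽.U, ∀ B : Matrix (Fin (2 * K + 4)) (Fin (2 * K + 4)) ℝ,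
      (∀ i j, B i j = Sm.ext (coeff (2 * K + 3) (𝔽.series.path.F i.succ j.succ)) y) → ∀ i j,
      (obstructionConst (2 * K + 3) • traceFree (G y) B) i j
        = (tensorLaplacian G)^[K] (principalTensor (2 * K + 3) G) y ![i, j]
            + Q.eval G y ![i, j] := by
    intro 𝔽 G hG hd y hy B hB i j
    have hR := 𝔽.represents_initial hG
    have hy' : y ∈ 𝔽.base.carrier := hy
    have h1 := congrArg (Sm.ev hy') (hQ _ 𝔽.initial 𝔽.series hd i j)
    rw [map_mul, AlgHom.commutes, map_add, ← hR.polynomial_eval_eq hy' Q] at h1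
    rw [Matrix.smul_apply, smul_eq_mul, hR.traceFree_eq hy'
      (fun i j => (hB i j).trans (Sm.ev_apply _ hy').symm),
      hR.tensorLaplacian_iterate_eq K (fun z hz I => hR.principalTensor_eq hz I) hy']
    exact h1
  refine ⟨Q, fun {V G} hV hG hp y₀ hy₀ O => ⟨?_, fun hO => ?_⟩⟩
  · rintro ⟨U, ε, h, B, hyU, hF, hB, rfl⟩ i j
    let 𝔽 : CollarFamily (2 * K + 4) := ⟨U, ε, h, hF.isOpen, hF.pos, hF.posDef, hF.smooth⟩
    have hd : ∀ a b, PowerSeries.X ^ (2 * K + 3) ∣ 𝔽.series.path.F a b := fun a b =>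
      (𝔽.einstein_iff (2 * K + 2) a b).mp (hF.einstein a b)
    refine hkey 𝔽 G hF.initial (fun i j => hd _ _) y₀ hyU B (fun i j => ?_) i j
    exact tendsto_nhds_unique (hB i j) (𝔽.tendsto_einsteinDefect (n := 2 * K + 2) (hd _ _) hyU)
  -- Existence: the polynomial model is realized on a small collar around y₀, and its obstruction is
  -- computed by `hkey`.
  · obtain ⟨𝔤, h𝔤⟩ := exists_geom hV hG hp
    obtain ⟨H, -, hH⟩ := exists_model (2 * K + 4) (2 * K + 3) le_rfl
    obtain ⟨𝔽, hyU, h0, φ, hφ⟩ := exists_collarFamily h𝔤 (H _ 𝔤) (2 * K + 3)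
      (fun i j => (hH _ 𝔤 i j).2) hy₀ (hp y₀ hy₀)
    have hd : ∀ i j : Fin (2 * K + 4),
        PowerSeries.X ^ (2 * K + 3) ∣ 𝔽.series.path.F i.succ j.succ := fun i j => by
      have := map_dvd (PowerSeries.mapAlgHom φ) (hH _ 𝔤 i j).1
      rwa [hφ, map_pow, PowerSeries.mapAlgHom_apply, PowerSeries.map_X] at this
    -- The model solves only the tangential equations; the components with a normal index follow
    -- from the Bianchi identity.
    have hd' : ∀ a b, PowerSeries.X ^ (2 * K + 3) ∣ 𝔽.series.path.F a b := fun a b => by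
      have hz := 𝔽.series.path.dvd_F_zero hd
      refine Fin.cases (hz b) (fun i => ?_) a
      refine Fin.cases ?_ (fun j => hd i j) b
      rw [GeomPath.F_symm]
      exact hz _
    refine ⟨𝔽.U, 𝔽.ε, 𝔽.h, Matrix.of fun i j =>
      Sm.ext (coeff (2 * K + 3) (𝔽.series.path.F i.succ j.succ)) y₀, hyU,
      ⟨𝔽.isOpen, 𝔽.pos, h0, 𝔽.posDef, 𝔽.smooth, fun a b => ?_⟩, fun i j => ?_, ?_⟩
    · exact (𝔽.einstein_iff (2 * K + 2) a b).mpr (hd' a b)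
    · exact 𝔽.tendsto_einsteinDefect (n := 2 * K + 2) (hd i j) hyU
    · ext i j
      rw [hO i j]
      exact (hkey 𝔽 G h0 hd y₀ hyU _ (fun i j => rfl) i j).symm

/-- A single order is at most the sum n + 1 - 2l, and l ≥ 2. -/
theorem CurvatureContraction.order_le {n : ℕ} (C : CurvatureContraction n) (j : Fin C.numFactors) :
    C.order j ≤ n - 3 := by
  have h1 := C.two_le
  have h2 := Finset.single_le_sum (f := C.order) (fun _ _ => Nat.zero_le _) (Finset.mem_univ j)
  have h3 := C.sum_order
  omega

end

end

end AmbientObstruction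

theorem proposition4p1 (n : ℕ) (hn : 3 ≤ n) (heven : Even (n + 1)) :
    ∃ Q : CurvaturePolynomial n,
      (∀ t ∈ Q, ∀ j, t.2.order j ≤ n - 3) ∧
      ∀ (M : Type*) [TopologicalSpace M] [ChartedSpace (EuclideanSpace ℝ (Fin (n + 1))) M]
        [IsManifold (𝓡 (n + 1)) ∞ M]
        (g : ContMDiffRiemannianMetric (𝓡 (n + 1)) ∞ (EuclideanSpace ℝ (Fin (n + 1)))
          (fun p : M => TangentSpace (𝓡 (n + 1)) p))
        (e : OpenPartialHomeomorph M (EuclideanSpace ℝ (Fin (n + 1))))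
        (_he : e ∈ IsManifold.maximalAtlas (𝓡 (n + 1)) ∞ M)
        (p : M) (_hp : p ∈ e.source)
        (O : Matrix (Fin (n + 1)) (Fin (n + 1)) ℝ),
        IsObstructionTensorAt n (metricInChart g e) (e p) O ↔
          ∀ i j, O i j =
            (tensorLaplacian (metricInChart g e))^[(n + 1) / 2 - 2]
                (principalTensor n (metricInChart g e)) (e p) ![i, j]
              + Q.eval (metricInChart g e) (e p) ![i, j] := by
  -- K is the power of the Laplacian; n ≥ 3 makes it a natural number.
  obtain ⟨K, rfl⟩ : ∃ K, n = 2 * K + 3 := by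
    obtain ⟨r, hr⟩ := heven
    exact ⟨r - 2, by omega⟩
  obtain ⟨Q, hQ⟩ := exists_polynomial_isObstructionTensorAt K
  refine ⟨Q, fun t _ j => t.2.order_le j, fun M _ _ _ g e he p hp O => ?_⟩
  rw [show (2 * K + 3 + 1) / 2 - 2 = K by omega]
  exact hQ e.open_target (metricInChart_contDiffOn g he) (fun y hy => metricInChart_posDef g he hy)
    (e p) (e.map_source hp) O
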